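/- **Lengths and minimal pairs.** For $u\in\mathbb C$ let $E(u)$ be a root $y$ of $y+y^{-1}=2u$ with $|y|\ge 1$. For $g,h\in \mathrm{PSL}_2(\mathbb C)$ the (exponentiated) translation length is $L(g)=E(\tfrac12(\operatorname{tr} g)^2-1)$, the square of the larger eigenvalue, and the (exponentiated) ortholength $L_h(g)=E(\cosh d)$, where $d$ is the complex distance from the axis of $h$ to its image under $g$; for $h$ diagonal and $g=\begin{pmatrix}a&b\\c&d\end{pmatrix}$ the argument of $E$ is $ad+bc$. A pair $(f,w)$ is *minimal* if $|L(f)|\le|L(g)|$ for all $g\in\langle f,w\rangle$, $g\ne 1$, and $|L_f(w)|\le|L_f(g)|$ for all $g\in\langle f,w\rangle$ that are not powers of $f$. Put $$s(z)=\pm\begin{pmatrix}\sqrt z&0\\0&1/\sqrt z\end{pmatrix},\qquad c(x,z)=\pm\begin{pmatrix}\mathrm{ch}\,\sqrt z&\mathrm{sh}/\sqrt z\\ \mathrm{sh}\,\sqrt z&\mathrm{ch}/\sqrt z\end{pmatrix},\quad \mathrm{ch},\mathrm{sh}=\tfrac12(\sqrt x\pm 1/\sqrt x).$$ **Boxes.**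 Let $\sigma_0,\dots,\sigma_5$ be the floating-point values of $2^{(5-i)/6}$. Use the six real coordinates $(\Re x_0,\Re x_1,\Re x_2,\Im x_0,\Im x_1,\Im x_2)$ of $x\in\mathbb C^3$. $Z(\lambda)=\prod_i[-4\sigma_i,4\sigma_i)$, and for a binary word $p$ of length $n$ the sets $Z(p0)$, $Z(p1)$ are the lower and the upper half (half-open) of $Z(p)$ along coordinate $n \bmod 6$. **Domain.** The holes are the following words with angles $\vartheta$: - $h_{1}=\texttt{001000110001110110011101000110111110100010110000100011101101001101001000110101011000000100000}$ ($\vartheta=2\pi/3$) - $h_{2}=\texttt{001000110101010010101010110001100101110111100001101010111100100000010001111100}$ ($\vartheta=2\pi/3$) - $h_{3}=\texttt{1110000000010001100110111011010110001111010111100011001111111001101100000000100010100010}$ ($\vartheta=2\pi/3$) - $h_{4}=\texttt{11100000000100011001100100111110101001111011011011110110001111111011011010000111101}$ ($\vartheta=2\pi/3$) - $h_{5}=\texttt{11100000000100011001100100111110101011111001011001110100001101111001011000000101101}$ ($\vartheta=2\pi/3$) - $h_{6}=\texttt{0010001101111100011010010101010110010110110101111011011000011011010001110100011101011001011101110111110100}$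 ($\vartheta=\arg(-0.3933+0.91942\,i)$, a ``vol3'' hole) - $h_{7}=\texttt{0010011101101100001010000101000110000110100101101011001000001011000001100100001101001001001101100111100100}$ ($\vartheta=\arg(-0.3933+0.91942\,i)$, a ``vol3'' hole) - $h_{8}=\texttt{0010001100011101110011110001011111111011111001110011110000011110111101111}$ ($\vartheta=2\pi/3$) - $h_{9}=\texttt{0010011100001101100011100001001111101011101001100011100000001110101101101}$ ($\vartheta=2\pi/3$) - $h_{10}=\texttt{1110000000010001111111111101010011110111110101111111111100010010110001110}$ ($\vartheta=2\pi/3$) - $h_{11}=\texttt{1110010000000001101111101101000011100111100101101111101100000010100001100}$ ($\vartheta=2\pi/3$) The visual angle $v(x)$ of $x\in\mathbb C$ is $|\arg\frac{y^2-6y+1+4(1-y)\sqrt{-y}}{(y+1)^2}|$ with $y=\pm x$, $\Re y\ge0$. The domain $D$ is the set of $x\in\mathbb C^3$ with $1.10274\le|x_0|\le3.63201$, $1\le|x_2|$, $|x_2|^2\le|x_0|$, lying in no $Z(h)$ for a vol3 hole $h$, such that for some hole $h$ with angle $\vartheta$ there is $y\in Z(h)$ with $y_0=x_0$, $|y_1|\le|x_1|$,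 and $v(x_1)\ge\vartheta$. A set $R\subset\mathbb C^3$ is *MNG-free* if $(s(x_0),c(x_1,x_2))$ is not minimal for any $x\in R\cap D$. **Program.** All arithmetic is IEEE double precision (round to nearest, with infinities and NaN); an underflow, a failed assertion, an invalid code or the end of the input stops the program without success. The library function hypot is only assumed to return a double such that no double lies strictly between it and the true value, and likewise for the $\sigma_i$ (as powers of 2 with rounded exponent). A *jet* $(f,f_0,f_1,f_2,e)$ represents the functions on $\{|z_k|\le1\}$ that differ from $f+\sum f_kz_k$ by at most $e$. The program has routines for negation, sum, difference, product, quotient and square root of jets, for an upper bound absUB and a lower bound absLB of the modulus, and for products and inverses of $2\times2$ matrices of jets, which compute first-order Taylor coefficients in floating point and an error term enlarged by explicit multiples of $\mathrm{EPS}=2^{-52}$. (The formulas are those of the published source, and are reproduced one by one in the formal definitions.) For a word $p$ the jets $X_0,X_1,X_2$ are discs around the (rounded) centre of $Z(p)$ that cover the three coordinates of $Z(p)$. The program is given a binary word $p$, a finite sequence of integers as input, and a file *conditionlist*, whose $k$-th line is the condition of code $k\ge 1$. It calls $\mathrm{verify}(p,0)$. The procedure $\mathrm{verify}(q,a)$ stops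 without success if $q$ has length at least $200$; otherwise it takes as code $k$ the number $a$, or the next input integer if $a=0$. If $k<0$ it prints $q$. If $k>0$ and condition $k$ holds for $q$, it returns. In all other cases it calls $\mathrm{verify}(q0,k)$ and then $\mathrm{verify}(q1,k)$. If the whole run finishes, and $m_0,\dots,m_k$ are the words printed in this way, the program has printed ``verified $p-\{m_0\,m_1\dots m_k\}$''. A condition holds for $q$ in the following cases. It holds without any test if $q$ is the word of a vol3 hole, or if no hole $h$ with $\mathrm{minD}(h)\le 3$ agrees with $q$ in all digits at the positions divisible by 3 (counted from 0) within the common length; here $\mathrm{minD}(h)$ is absLB of the jet $X_1$ of $h$. Otherwise let $\mathrm{minD}$ be the least $\mathrm{minD}(h)$ and $\mathrm{maxAngle}$ a largest of the angles $\pi/2,\vartheta$ for the holes that agree with $q$. A line beginning with s, l, n, f, W or w holds if $\mathrm{absUB}(X_0)<1.10274$; $\mathrm{absLB}(X_0)>3.63201$; $\mathrm{absUB}(X_1)<\mathrm{minD}$; the jet of visual angles of $X_1$ is certified to be below $\mathrm{maxAngle}$; $\mathrm{absUB}(X_2)<1$; $(1-\mathrm{EPS})\,\mathrm{absLB}(X_2)^2>\mathrm{absUB}(X_0)$,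 respectively. A line $\mathtt{L(}a\mathtt{)}$ or $\mathtt{2(}a\mathtt{)}$, with $a$ a word in $f,w,F=f^{-1},W=w^{-1}$, is treated by evaluating the matrix jet $g$ of $a$ at $f=s(X_0)$, $w=c(X_1,X_2)$, and the jet $\ell$ of its translation length; it holds if $\mathrm{absUB}(\ell/X_0)<1$, $\mathrm{absLB}(\ell X_0)>1$ and, for $\mathtt L$, some entry of $g$ certifies $g\neq\pm I$, while for $\mathtt 2$, every two consecutive letters of $a$ are one of $ff,FF,ww,WW,fw,fW,Fw,FW$. Any other line stops the program. **Statement.** Assume that *conditionlist* contains no line $\mathtt{2()}$ with the empty word. If the program, run on any such machine with any input sequence, finishes and prints ``verified $p-\{m_0\,m_1\dots m_k\}$'', then $Z(p)\setminus\bigcup_i Z(m_i)$ is MNG-free. -/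

import Mathlib

noncomputable section

namespace Verify

/-! ### Translation length, ortholength and minimal pairs in `PSL₂(ℂ)` -/

/-- The group `SL₂(ℂ)`. -/
abbrev SL2C : Type := Matrix.SpecialLinearGroup (Fin 2) ℂ

/-- The group `PSL₂(ℂ)`. -/
abbrev PSL2C : Type := Matrix.ProjectiveSpecialLinearGroup (Fin 2) ℂ

/-- For `u = cosh ℓ`, the number `exp ℓ` with `|exp ℓ| ≥ 1`: the root `y` of `y + y⁻¹ = 2 u`
of larger modulus. -/
def expArcosh (u : ℂ) : ℂ :=
  if 1 ≤ ‖u + Complex.sqrt (u ^ 2 - 1)‖ then u + Complex.sqrt (u ^ 2 - 1)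
  else u - Complex.sqrt (u ^ 2 - 1)

/-- The exponential of the complex translation length `ℓ` of an isometry,
`cosh ℓ = (tr A)² / 2 - 1`; it is the square of the eigenvalue of larger modulus. -/
def lengthSL (A : SL2C) : ℂ := expArcosh (A.1.trace ^ 2 / 2 - 1)

/-- The trace-free part of a matrix; for a loxodromic matrix it encodes the oriented axis. -/
def traceFree (A : SL2C) : Matrix (Fin 2) (Fin 2) ℂ := A.1 - (A.1.trace / 2) • 1

/-- The hyperbolic cosine of the complex distance from the axis of `A` to its image under `B`.
For diagonal `A` it is `B₀₀ B₁₁ + B₀₁ B₁₀`. -/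
def coshOrtho (A B : SL2C) : ℂ :=
  (traceFree A * B.1 * traceFree A * (B⁻¹).1).trace / (2 * (A.1.trace ^ 2 / 4 - 1))

theorem exists_sign {A B : SL2C} (h : QuotientGroup.leftRel (Subgroup.center SL2C) A B) :
    ∃ r : ℂ, r ^ 2 = 1 ∧ B.1 = r • A.1 ∧ (B⁻¹).1 = r • (A⁻¹).1 := by
  rw [QuotientGroup.leftRel_apply, Matrix.SpecialLinearGroup.mem_center_iff] at h
  obtain ⟨r, hr, h⟩ := h
  have hB : B.1 = r • A.1 := by
    have h2 : A.1 * (A⁻¹ * B).1 = B.1 := by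
      rw [← Matrix.SpecialLinearGroup.coe_mul, mul_inv_cancel_left]
    rw [← h2, ← h, Matrix.scalar_apply, ← Matrix.smul_one_eq_diagonal, Matrix.mul_smul,
      Matrix.mul_one]
  refine ⟨r, by simpa using hr, hB, ?_⟩
  rw [Matrix.SpecialLinearGroup.coe_inv, Matrix.SpecialLinearGroup.coe_inv, hB,
    Matrix.adjugate_smul]
  simp

/-- The (exponential of the complex) translation length `L(g)` of `g ∈ PSL₂(ℂ)`. -/
def tlength : PSL2C → ℂ :=
  Quotient.lift lengthSL (by
    intro A B h
    obtain ⟨r, hr, hB, -⟩ := exists_sign h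
    simp [lengthSL, hB, mul_pow, hr])

/-- The (exponential of the complex) ortholength `L_h(g)` of `g` with respect to `h`, for
`h, g ∈ PSL₂(ℂ)`: the complex distance from the axis of `h` to its image under `g`. -/
def olength : PSL2C → PSL2C → ℂ :=
  Quotient.lift₂ (fun A B => expArcosh (coshOrtho A B)) (by
    intro A B A' B' hA hB
    obtain ⟨r, hr, hA, -⟩ := exists_sign hA
    obtain ⟨s, hs, hB, hB'⟩ := exists_sign hB
    have h1 : traceFree A' = r • traceFree A := by
      simp [traceFree, hA, smul_sub, smul_smul, mul_div_assoc]
    have h2 : coshOrtho A' B' = coshOrtho A B := by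
      have h3 : (r • traceFree A) * (s • B.1) * (r • traceFree A) * (s • (B⁻¹).1)
          = traceFree A * B.1 * traceFree A * (B⁻¹).1 := by
        simp only [smul_mul_assoc, mul_smul_comm, smul_smul]
        rw [show s * (r * (s * r)) = r ^ 2 * s ^ 2 by ring, hr, hs]
        simp
      have h4 : A'.1.trace ^ 2 = A.1.trace ^ 2 := by
        rw [hA, Matrix.trace_smul, smul_eq_mul, mul_pow, hr, one_mul]
      rw [coshOrtho, coshOrtho, h1, hB, hB', h3, h4]
    simp only [h2])

/-- `(f, w)` is minimal: among the nontrivial elements of `⟨f, w⟩` the element `f` has the least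
translation length, and among the elements that are not powers of `f` the element `w` has the
least ortholength with respect to `f`. -/
def IsMinimal (f w : PSL2C) : Prop :=
  (∀ g ∈ Subgroup.closure {f, w}, g ≠ 1 → ‖tlength f‖ ≤ ‖tlength g‖) ∧
  (∀ g ∈ Subgroup.closure {f, w}, g ∉ Subgroup.zpowers f → ‖olength f w‖ ≤ ‖olength f g‖)

/-- The map `s : ℂ → PSL₂(ℂ)` (the value at `0` is irrelevant). -/
def shortGen (z : ℂ) : PSL2C :=
  if hz : z = 0 then 1
  else QuotientGroup.mk (⟨!![Complex.sqrt z, 0; 0, 1 / Complex.sqrt z], by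
    have h : Complex.sqrt z ≠ 0 := by simpa [Complex.sqrt] using hz
    rw [Matrix.det_fin_two_of]
    field_simp
    ring⟩ : SL2C)

/-- The map `c : ℂ² → PSL₂(ℂ)` (the values at `x = 0` and at `z = 0` are irrelevant). -/
def closeGen (x z : ℂ) : PSL2C :=
  if h : x = 0 ∨ z = 0 then 1
  else QuotientGroup.mk (⟨!![
      (Complex.sqrt x + 1 / Complex.sqrt x) / 2 * Complex.sqrt z,
      (Complex.sqrt x - 1 / Complex.sqrt x) / 2 / Complex.sqrt z;
      (Complex.sqrt x - 1 / Complex.sqrt x) / 2 * Complex.sqrt z,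
      (Complex.sqrt x + 1 / Complex.sqrt x) / 2 / Complex.sqrt z], by
    have hx : Complex.sqrt x ≠ 0 := by simpa [Complex.sqrt] using fun h' => h (Or.inl h')
    have hz : Complex.sqrt z ≠ 0 := by simpa [Complex.sqrt] using fun h' => h (Or.inr h')
    rw [Matrix.det_fin_two_of]
    field_simp
    ring⟩ : SL2C)

/-! ### Double precision arithmetic -/

/-- `DBL_EPSILON`. -/
def eps : ℝ := 2 ^ (-52 : ℤ)

/-- IEEE double precision data.  The two zeros are identified; the program never divides by a
negative zero, so this is not visible. -/
inductive Dbl : Type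
  | fin (x : ℝ)
  | inf (negative : Bool)
  | nan

/-- A floating-point computation; `none` means that the program has been stopped (by the
underflow trap, by a failed assertion or by `exit(1)`). -/
abbrev FP : Type := Option Dbl

/-- Rounding to the nearest integer, ties to even. -/
def roundEven (x : ℝ) : ℤ :=
  if Int.fract x = 1 / 2 then (if Even ⌊x⌋ then ⌊x⌋ else ⌊x⌋ + 1) else round x

/-- Rounding to 53 significant bits, to nearest, ties to even, with unbounded exponent. -/
def round53 (x : ℝ) : ℝ :=
  roundEven (x / 2 ^ (Int.log 2 |x| - 52)) * 2 ^ (Int.log 2 |x| - 52)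

/-- The result of an arithmetic operation with exact real value `x`: a nonzero value below the
smallest normal number is an underflow and stops the program, a value that is too large becomes
infinite. -/
def fl (x : ℝ) : FP :=
  if x = 0 then some (Dbl.fin 0)
  else if |x| < 2 ^ (-1022 : ℤ) then none
  else if |round53 x| < 2 ^ 1024 then some (Dbl.fin (round53 x))
  else some (Dbl.inf (decide (x < 0)))

namespace Dbl

/-- A constant that is exactly representable. -/
abbrev const (x : ℝ) : Dbl := fin x

/-- The double nearest to a decimal constant of the source text. -/
def lit (x : ℝ) : Dbl := fin (round53 x)

def neg : Dbl → Dbl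
  | fin x => fin (-x)
  | inf s => inf (!s)
  | nan => nan

def abs : Dbl → Dbl
  | fin x => fin |x|
  | inf _ => inf false
  | nan => nan

def add : Dbl → Dbl → FP
  | fin x, fin y => fl (x + y)
  | inf s, fin _ => some (inf s)
  | fin _, inf s => some (inf s)
  | inf s, inf t => some (if s = t then inf s else nan)
  | nan, _ => some nan
  | _, nan => some nan

def mul : Dbl → Dbl → FP
  | fin x, fin y => fl (x * y)
  | inf s, fin x => some (if x = 0 then nan else inf (xor s (decide (x < 0))))
  | fin x, inf s => some (if x = 0 then nan else inf (xor s (decide (x < 0))))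
  | inf s, inf t => some (inf (xor s t))
  | nan, _ => some nan
  | _, nan => some nan

def div : Dbl → Dbl → FP
  | fin x, fin y =>
    if y = 0 then some (if x = 0 then nan else inf (decide (x < 0))) else fl (x / y)
  | inf s, fin y => some (inf (xor s (decide (y < 0))))
  | fin _, inf _ => some (fin 0)
  | inf _, inf _ => some nan
  | nan, _ => some nan
  | _, nan => some nan

def sqrt : Dbl → FP
  | fin x => if x < 0 then some nan else fl (Real.sqrt x)
  | inf false => some (inf false)
  | inf true => some nan
  | nan => some nan

/-- The comparison `x < y`; it is false as soon as an argument is not a number. -/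
def lt : Dbl → Dbl → Bool
  | fin x, fin y => decide (x < y)
  | inf s, fin _ => s
  | fin _, inf s => !s
  | inf s, inf t => s && !t
  | nan, _ => false
  | _, nan => false

/-- The comparison `x ≤ y`; it is false as soon as an argument is not a number. -/
def le : Dbl → Dbl → Bool
  | fin x, fin y => decide (x ≤ y)
  | inf s, fin _ => s
  | fin _, inf s => !s
  | inf s, inf t => s || !t
  | nan, _ => false
  | _, nan => false

end Dbl

open Dbl (const lit)

def fadd (a b : FP) : FP := do Dbl.add (← a) (← b)
def fsub (a b : FP) : FP := do Dbl.add (← a) (← b).neg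
def fmul (a b : FP) : FP := do Dbl.mul (← a) (← b)
def fdiv (a b : FP) : FP := do Dbl.div (← a) (← b)
def fsqrt (a : FP) : FP := do Dbl.sqrt (← a)
def flt (a b : FP) : Option Bool := do return Dbl.lt (← a) (← b)
def fle (a b : FP) : Option Bool := do return Dbl.le (← a) (← b)

infixl:65 " +ᶠ " => fadd
infixl:65 " -ᶠ " => fsub
infixl:70 " *ᶠ " => fmul
infixl:70 " /ᶠ " => fdiv
infix:50 " <ᶠ " => flt
infix:50 " ≤ᶠ " => fle

/-- Floating-point numbers with 53 bits and exponents bounded below only; the finite doubles are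
those of modulus less than `2 ^ 1024`. -/
def IsRepresentable (x : ℝ) : Prop :=
  ∃ m e : ℤ, |m| < 2 ^ 53 ∧ -1074 ≤ e ∧ x = m * 2 ^ e

/-- `y` is a computed value of the real number `t` such that no representable number lies
between the two. -/
def IsFaithful (y t : ℝ) : Prop :=
  IsRepresentable y ∧ ∀ z, IsRepresentable z → ¬ (min y t < z ∧ z < max y t)

/-- What the machine contributes besides the IEEE operations: the function `hypot`, and the six
values `pow(2, (5 - i) / 6.0)`. -/
structure Machine where
  hypot : ℝ → ℝ → ℝ
  hypot_faithful : ∀ x y, IsFaithful (hypot x y) (Real.sqrt (x ^ 2 + y ^ 2))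
  scale : Fin 6 → ℝ
  scale_faithful : ∀ i, IsFaithful (scale i) ((2 : ℝ) ^ round53 ((5 - (i.val : ℝ)) / 6))

/-- `hypot` on doubles. -/
def Machine.fhypot (M : Machine) : Dbl → Dbl → Dbl
  | .fin x, .fin y =>
    if |M.hypot x y| < 2 ^ 1024 then Dbl.fin (M.hypot x y) else Dbl.inf false
  | .inf _, _ => Dbl.inf false
  | _, .inf _ => Dbl.inf false
  | .nan, _ => Dbl.nan
  | _, .nan => Dbl.nan

def EPS : Dbl := const eps
def HALFEPS : Dbl := const (eps / 2)

/-! ### Complex numbers -/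

/-- Exactly represented complex numbers. -/
structure XComplex where
  re : Dbl
  im : Dbl

/-- Discs of complex numbers: centre and radius. -/
structure AComplex where
  z : XComplex
  e : Dbl

namespace XComplex

def ofDbl (x : Dbl) : XComplex := ⟨x, const 0⟩

def zero : XComplex := ofDbl (const 0)

def neg (x : XComplex) : XComplex := ⟨x.re.neg, x.im.neg⟩

def addD (x : XComplex) (y : Dbl) : Option AComplex := do
  let re ← x.re +ᶠ y
  let e ← HALFEPS *ᶠ re.abs
  return ⟨⟨re, x.im⟩, e⟩

def subD (x : XComplex) (y : Dbl) : Option AComplex := do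
  let re ← x.re -ᶠ y
  let e ← HALFEPS *ᶠ re.abs
  return ⟨⟨re, x.im⟩, e⟩

def add (x y : XComplex) : Option AComplex := do
  let re ← x.re +ᶠ y.re
  let im ← x.im +ᶠ y.im
  let e ← HALFEPS *ᶠ (const (1 + eps) *ᶠ (re.abs +ᶠ im.abs))
  return ⟨⟨re, im⟩, e⟩

def sub (x y : XComplex) : Option AComplex := do
  let re ← x.re -ᶠ y.re
  let im ← x.im -ᶠ y.im
  let e ← HALFEPS *ᶠ (const (1 + eps) *ᶠ (re.abs +ᶠ im.abs))
  return ⟨⟨re, im⟩, e⟩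

def mulD (x : XComplex) (y : Dbl) : Option AComplex := do
  let re ← x.re *ᶠ y
  let im ← x.im *ᶠ y
  let e ← HALFEPS *ᶠ (const (1 + eps) *ᶠ (re.abs +ᶠ im.abs))
  return ⟨⟨re, im⟩, e⟩

def mul (x y : XComplex) : Option AComplex := do
  let re1 ← x.re *ᶠ y.re
  let re2 ← x.im *ᶠ y.im
  let im1 ← x.re *ᶠ y.im
  let im2 ← x.im *ᶠ y.re
  let e ← EPS *ᶠ (const (1 + 2 * eps) *ᶠ ((re1.abs +ᶠ re2.abs) +ᶠ (im1.abs +ᶠ im2.abs)))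
  let re ← re1 -ᶠ re2
  let im ← im1 +ᶠ im2
  return ⟨⟨re, im⟩, e⟩

/-- Quotient of a double by a complex number. -/
def divOfD (x : Dbl) (y : XComplex) : Option AComplex := do
  let nrm ← y.re *ᶠ y.re +ᶠ y.im *ᶠ y.im
  let re ← (x *ᶠ y.re) /ᶠ nrm
  let xi ← x *ᶠ y.im
  let im ← xi.neg /ᶠ nrm
  let e ← const (2 * eps) *ᶠ (const (1 + 2 * eps) *ᶠ (re.abs +ᶠ im.abs))
  return ⟨⟨re, im⟩, e⟩

def div (x y : XComplex) : Option AComplex := do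
  let nrm ← y.re *ᶠ y.re +ᶠ y.im *ᶠ y.im
  let xryr ← x.re *ᶠ y.re
  let xiyi ← x.im *ᶠ y.im
  let xiyr ← x.im *ᶠ y.re
  let xryi ← x.re *ᶠ y.im
  let re ← (xryr +ᶠ xiyi) /ᶠ nrm
  let im ← (xiyr -ᶠ xryi) /ᶠ nrm
  let A ← ((xryr.abs +ᶠ xiyi.abs) +ᶠ (xiyr.abs +ᶠ xryi.abs)) /ᶠ nrm
  let e ← const (5 * (eps / 2)) *ᶠ (const (1 + 3 * eps) *ᶠ A)
  return ⟨⟨re, im⟩, e⟩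

def sqrt (M : Machine) (x : XComplex) : Option AComplex := do
  let s ← fsqrt ((x.re.abs +ᶠ M.fhypot x.re x.im) *ᶠ const (1 / 2))
  let d ← (x.im /ᶠ s) *ᶠ const (1 / 2)
  let e ← EPS *ᶠ (const (1 + 4 * eps) *ᶠ (const (5 / 4) *ᶠ s +ᶠ const (7 / 4) *ᶠ d.abs))
  if ← const 0 <ᶠ x.re then return ⟨⟨s, d⟩, e⟩ else return ⟨⟨d, s⟩, e⟩

def absUB (M : Machine) (x : XComplex) : FP := const (1 + 2 * eps) *ᶠ M.fhypot x.re x.im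

def absLB (M : Machine) (x : XComplex) : FP := const (1 - 2 * eps) *ᶠ M.fhypot x.re x.im

end XComplex

namespace AComplex

def add (x y : AComplex) : Option AComplex := do
  let re ← x.z.re +ᶠ y.z.re
  let im ← x.z.im +ᶠ y.z.im
  let e ← const (1 + 2 * eps) *ᶠ (HALFEPS *ᶠ (re.abs +ᶠ im.abs) +ᶠ (x.e +ᶠ y.e))
  return ⟨⟨re, im⟩, e⟩

def sub (x y : AComplex) : Option AComplex := do
  let re ← x.z.re -ᶠ y.z.re
  let im ← x.z.im -ᶠ y.z.im
  let e ← const (1 + 2 * eps) *ᶠ (HALFEPS *ᶠ (re.abs +ᶠ im.abs) +ᶠ (x.e +ᶠ y.e))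
  return ⟨⟨re, im⟩, e⟩

def div (x y : AComplex) : Option AComplex := do
  let nrm ← y.z.re *ᶠ y.z.re +ᶠ y.z.im *ᶠ y.z.im
  let xryr ← x.z.re *ᶠ y.z.re
  let xiyi ← x.z.im *ᶠ y.z.im
  let xiyr ← x.z.im *ᶠ y.z.re
  let xryi ← x.z.re *ᶠ y.z.im
  guard (← y.e *ᶠ y.e <ᶠ const (10000 * eps * eps) *ᶠ nrm)
  let A ← (xryr.abs +ᶠ xiyi.abs) +ᶠ (xiyr.abs +ᶠ xryi.abs)
  let B ← x.e *ᶠ (y.z.re.abs +ᶠ y.z.im.abs) +ᶠ y.e *ᶠ (x.z.re.abs +ᶠ x.z.im.abs)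
  let e ← const (1 + 4 * eps) *ᶠ
    ((const (5 * (eps / 2)) *ᶠ A +ᶠ const (1 + 103 * eps) *ᶠ B) /ᶠ nrm)
  let re ← (xryr +ᶠ xiyi) /ᶠ nrm
  let im ← (xiyr -ᶠ xryi) /ᶠ nrm
  return ⟨⟨re, im⟩, e⟩

end AComplex

/-! ### Approximate complex 1-jets -/

/-- `(f, f0, f1, f2, e)` stands for the functions on `{z : |z_k| ≤ 1}` that differ from
`f + f0 z_0 + f1 z_1 + f2 z_2` by at most `e`; `size` bounds `|f0| + |f1| + |f2|`. -/
structure ACJ where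
  f : XComplex
  f0 : XComplex
  f1 : XComplex
  f2 : XComplex
  e : Dbl
  size : Dbl

namespace ACJ

variable (M : Machine)

def build (f f0 f1 f2 : XComplex) (e : Dbl) : Option ACJ := do
  let size ← const (1 + 2 * eps) *ᶠ (f0.absUB M +ᶠ (f1.absUB M +ᶠ f2.absUB M))
  return ⟨f, f0, f1, f2, e, size⟩

def ofDbl (x : Dbl) : Option ACJ :=
  build M (.ofDbl x) .zero .zero .zero (const 0)

def neg (x : ACJ) : Option ACJ := build M x.f.neg x.f0.neg x.f1.neg x.f2.neg x.e

def add (x y : ACJ) : Option ACJ := do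
  let r ← x.f.add y.f
  let r0 ← x.f0.add y.f0
  let r1 ← x.f1.add y.f1
  let r2 ← x.f2.add y.f2
  let err ← const (1 + 3 * eps) *ᶠ ((x.e +ᶠ y.e) +ᶠ ((r.e +ᶠ r0.e) +ᶠ (r1.e +ᶠ r2.e)))
  build M r.z r0.z r1.z r2.z err

def sub (x y : ACJ) : Option ACJ := do
  let r ← x.f.sub y.f
  let r0 ← x.f0.sub y.f0
  let r1 ← x.f1.sub y.f1
  let r2 ← x.f2.sub y.f2
  let err ← const (1 + 3 * eps) *ᶠ ((x.e +ᶠ y.e) +ᶠ ((r.e +ᶠ r0.e) +ᶠ (r1.e +ᶠ r2.e)))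
  build M r.z r0.z r1.z r2.z err

def addD (x : ACJ) (y : Dbl) : Option ACJ := do
  let r ← x.f.addD y
  let err ← const (1 + eps) *ᶠ (x.e +ᶠ r.e)
  build M r.z x.f0 x.f1 x.f2 err

def subD (x : ACJ) (y : Dbl) : Option ACJ := do
  let r ← x.f.subD y
  let err ← const (1 + eps) *ᶠ (x.e +ᶠ r.e)
  build M r.z x.f0 x.f1 x.f2 err

def mul (x y : ACJ) : Option ACJ := do
  let xdist := x.size
  let ydist := y.size
  let ax ← x.f.absUB M
  let ay ← y.f.absUB M
  let r ← x.f.mul y.f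
  let r0 ← (← x.f.mul y.f0).add (← x.f0.mul y.f)
  let r1 ← (← x.f.mul y.f1).add (← x.f1.mul y.f)
  let r2 ← (← x.f.mul y.f2).add (← x.f2.mul y.f)
  let A ← (xdist +ᶠ x.e) *ᶠ (ydist +ᶠ y.e)
  let B ← ax *ᶠ y.e +ᶠ ay *ᶠ x.e
  let C ← (r.e +ᶠ r0.e) +ᶠ (r1.e +ᶠ r2.e)
  let err ← const (1 + 3 * eps) *ᶠ (A +ᶠ (B +ᶠ C))
  build M r.z r0.z r1.z r2.z err

def mulD (x : ACJ) (y : Dbl) : Option ACJ := do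
  let r ← x.f.mulD y
  let r0 ← x.f0.mulD y
  let r1 ← x.f1.mulD y
  let r2 ← x.f2.mulD y
  let err ← const (1 + 3 * eps) *ᶠ
    ((x.e *ᶠ y.abs) +ᶠ ((r.e +ᶠ r0.e) +ᶠ (r1.e +ᶠ r2.e)))
  build M r.z r0.z r1.z r2.z err

def div (x y : ACJ) : Option ACJ := do
  let xdist := x.size
  let ydist := y.size
  let ax ← x.f.absUB M
  let ay ← y.f.absLB M
  let D ← ay -ᶠ const (1 + eps) *ᶠ (y.e +ᶠ ydist)
  if ← const 0 <ᶠ D then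
    let den ← y.f.mul y.f
    let r ← x.f.div y.f
    let r0 ← (← (← x.f0.mul y.f).sub (← x.f.mul y.f0)).div den
    let r1 ← (← (← x.f1.mul y.f).sub (← x.f.mul y.f1)).div den
    let r2 ← (← (← x.f2.mul y.f).sub (← x.f.mul y.f2)).div den
    let A ← (ax +ᶠ (xdist +ᶠ x.e)) /ᶠ D
    let B ← (ax /ᶠ ay +ᶠ xdist /ᶠ ay) +ᶠ (ydist *ᶠ ax) /ᶠ (ay *ᶠ ay)
    let C ← (r.e +ᶠ r0.e) +ᶠ (r1.e +ᶠ r2.e)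
    let err ← const (1 + 3 * eps) *ᶠ
      ((const (1 + 3 * eps) *ᶠ A -ᶠ const (1 - 3 * eps) *ᶠ B) +ᶠ C)
    build M r.z r0.z r1.z r2.z err
  else
    build M .zero .zero .zero .zero (.inf false)

/-- Quotient of a double by a jet. -/
def divOfD (x : Dbl) (y : ACJ) : Option ACJ := do
  let ydist := y.size
  let ax := x.abs
  let ay ← y.f.absLB M
  let D ← ay -ᶠ const (1 + eps) *ᶠ (y.e +ᶠ ydist)
  if ← const 0 <ᶠ D then
    let den ← y.f.mul y.f
    let r ← XComplex.divOfD x y.f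
    let r0 ← (← (XComplex.ofDbl x.neg).mul y.f0).div den
    let r1 ← (← (XComplex.ofDbl x.neg).mul y.f1).div den
    let r2 ← (← (XComplex.ofDbl x.neg).mul y.f2).div den
    let B ← ax /ᶠ ay +ᶠ (ydist *ᶠ ax) /ᶠ (ay *ᶠ ay)
    let C ← (r.e +ᶠ r0.e) +ᶠ (r1.e +ᶠ r2.e)
    let err ← const (1 + 3 * eps) *ᶠ
      ((const (1 + 2 * eps) *ᶠ (ax /ᶠ D) -ᶠ const (1 - 3 * eps) *ᶠ B) +ᶠ C)
    build M r.z r0.z r1.z r2.z err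
  else
    build M .zero .zero .zero .zero (.inf false)

def sqrt (x : ACJ) : Option ACJ := do
  let xdist := x.size
  let ax ← x.f.absUB M
  let D ← ax -ᶠ const (1 + eps) *ᶠ (xdist +ᶠ x.e)
  if ← const 0 <ᶠ D then
    let r ← x.f.sqrt M
    let t ← r.add r
    let r0 ← (AComplex.mk x.f0 (const 0)).div t
    let r1 ← (AComplex.mk x.f1 (const 0)).div t
    let r2 ← (AComplex.mk x.f2 (const 0)).div t
    let err ← const (1 + 3 * eps) *ᶠ
      ((const (1 + eps) *ᶠ fsqrt ax -ᶠ
        const (1 - 3 * eps) *ᶠ (xdist /ᶠ (const 2 *ᶠ fsqrt ax) +ᶠ fsqrt D)) +ᶠ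
      ((r.e +ᶠ r0.e) +ᶠ (r1.e +ᶠ r2.e)))
    build M r.z r0.z r1.z r2.z err
  else
    let err ← const (1 + 2 * eps) *ᶠ fsqrt (ax +ᶠ (xdist +ᶠ x.e))
    build M .zero .zero .zero .zero err

def absUB (x : ACJ) : FP := const (1 + 2 * eps) *ᶠ (x.f.absUB M +ᶠ (x.size +ᶠ x.e))

def absLB (x : ACJ) : FP := do
  let v ← const (1 - eps) *ᶠ (x.f.absLB M -ᶠ const (1 + eps) *ᶠ (x.size +ᶠ x.e))
  if ← const 0 <ᶠ v then return v else return const 0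

/-- The test whether all values of the jet have positive imaginary part. -/
def imPos (x : ACJ) : Option Bool := const (1 + eps) *ᶠ (x.size +ᶠ x.e) <ᶠ x.f.im

/-- The test whether all values of the jet have negative imaginary part. -/
def imNeg (x : ACJ) : Option Bool := const (1 + eps) *ᶠ (x.size +ᶠ x.e) <ᶠ x.f.im.neg

end ACJ

/-! ### Matrices of approximate complex 1-jets -/

structure SL2ACJ where
  a : ACJ
  b : ACJ
  c : ACJ
  d : ACJ

section

variable (M : Machine)

def SL2ACJ.mul (x y : SL2ACJ) : Option SL2ACJ := do
  let a ← (← x.a.mul M y.a).add M (← x.b.mul M y.c)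
  let b ← (← x.a.mul M y.b).add M (← x.b.mul M y.d)
  let c ← (← x.c.mul M y.a).add M (← x.d.mul M y.c)
  let d ← (← x.c.mul M y.b).add M (← x.d.mul M y.d)
  return ⟨a, b, c, d⟩

def SL2ACJ.inverse (x : SL2ACJ) : Option SL2ACJ := do
  return ⟨x.d, ← x.b.neg M, ← x.c.neg M, x.a⟩

def SL2ACJ.length (x : SL2ACJ) : Option ACJ := do
  let t ← (← x.a.add M x.d).mulD M (const (1 / 2))
  let r ← (← (← t.mul M t).subD M (const 1)).sqrt M
  let r1 ← t.add M r
  if ← const 1 ≤ᶠ r1.f.re *ᶠ r1.f.re +ᶠ r1.f.im *ᶠ r1.f.im then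
    (← t.add M r).mul M (← t.add M r)
  else
    (← t.sub M r).mul M (← t.sub M r)

/-- The two tests in a disjunct are evaluated from left to right and the second one only if the
first one does not decide, as prescribed for `||` and `&&`. -/
def SL2ACJ.notIdentity (x : SL2ACJ) : Option Bool := do
  if ← const 0 <ᶠ x.b.absLB M then return true
  if ← const 0 <ᶠ x.c.absLB M then return true
  if ← const 0 <ᶠ (← x.a.subD M (const 1)).absLB M then
    if ← const 0 <ᶠ (← x.a.addD M (const 1)).absLB M then return true
  if ← const 0 <ᶠ (← x.d.subD M (const 1)).absLB M then
    if ← const 0 <ᶠ (← x.d.addD M (const 1)).absLB M then return true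
  return false

def shortGenerator (z : ACJ) : Option SL2ACJ := do
  let sz ← z.sqrt M
  let zero ← ACJ.ofDbl M (const 0)
  return ⟨sz, zero, zero, ← ACJ.divOfD M (const 1) sz⟩

def closeGenerator (x z : ACJ) : Option SL2ACJ := do
  let sx ← x.sqrt M
  let sz ← z.sqrt M
  let sh ← (← sx.sub M (← ACJ.divOfD M (const 1) sx)).mulD M (const (1 / 2))
  let ch ← (← sx.add M (← ACJ.divOfD M (const 1) sx)).mulD M (const (1 / 2))
  return ⟨← ch.mul M sz, ← sh.div M sz, ← sh.mul M sz, ← ch.div M sz⟩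

/-! ### Boxes -/

/-- The digits of a position that subdivide the `i`-th of the six real coordinates. -/
def axisBits (p : List Bool) (i : Fin 6) : List Bool :=
  ((List.range p.length).filter (fun d => d % 6 = i.val)).map (fun d => p.getD d false)

/-- Centre and half-length of the interval with the given binary address in `[-4, 4)`. -/
def realAxis (l : List Bool) : ℝ × ℝ :=
  l.foldl (fun a b => (if b then a.1 + a.2 / 2 else a.1 - a.2 / 2, a.2 / 2)) (0, 4)

/-- The six real coordinates of a point of `ℂ³`: the three real parts, then the three imaginary
parts. -/
def coord (x : Fin 3 → ℂ) (i : Fin 6) : ℝ :=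
  ![(x 0).re, (x 1).re, (x 2).re, (x 0).im, (x 1).im, (x 2).im] i

/-- The recursive partition: `Z(λ)` is the box of points whose `i`-th coordinate lies in
`[-4 scale_i, 4 scale_i)`, and the `d`-th digit of the address halves the box along coordinate
`d mod 6`, `0` standing for the lower and `1` for the upper half. -/
def Z (p : List Bool) : Set (Fin 3 → ℂ) :=
  {x | ∀ i : Fin 6,
    M.scale i * ((realAxis (axisBits p i)).1 - (realAxis (axisBits p i)).2) ≤ coord x i ∧
    coord x i < M.scale i * ((realAxis (axisBits p i)).1 + (realAxis (axisBits p i)).2)}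

/-- The program's `pos[i]` and `size[i]` for a position. -/
def posSize (p : List Bool) (i : Fin 6) : Option (Dbl × Dbl) := do
  let (pos, size) ← (axisBits p i).foldlM (init := (const 0, const 4)) fun a b => do
    let size ← a.2 /ᶠ const 2
    let pos ← if b then a.1 +ᶠ size else a.1 -ᶠ size
    return (pos, size)
  let pos ← pos *ᶠ const (M.scale i)
  let size ← const (1 + 2 * eps) *ᶠ (size *ᶠ const (M.scale i) +ᶠ HALFEPS *ᶠ pos.abs)
  return (pos, size)

def alongJet (p : List Bool) : Option ACJ := do
  let (x, sx) ← posSize M p 0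
  let (y, sy) ← posSize M p 3
  ACJ.build M ⟨x, y⟩ ⟨sx, sy⟩ .zero .zero (const 0)

def orthoJet (p : List Bool) : Option ACJ := do
  let (x, sx) ← posSize M p 1
  let (y, sy) ← posSize M p 4
  ACJ.build M ⟨x, y⟩ .zero ⟨sx, sy⟩ .zero (const 0)

def whirleJet (p : List Bool) : Option ACJ := do
  let (x, sx) ← posSize M p 2
  let (y, sy) ← posSize M p 5
  ACJ.build M ⟨x, y⟩ .zero .zero ⟨sx, sy⟩ (const 0)

/-! ### The exceptional boxes and the domain -/

/-- An exceptional box: its address, and whether its angle bound is the one called `vol3`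
(otherwise it is the one called `third`). -/
structure Hole where
  position : List Bool
  isVol3 : Bool

/-- The `len` lowest binary digits of `n`, highest digit first. -/
def bits (len n : ℕ) : List Bool := (List.range len).map fun i => n.testBit (len - 1 - i)

def holes : List Hole := [
  ⟨bits 93 0b001000110001110110011101000110111110100010110000100011101101001101001000110101011000000100000, false⟩,
  ⟨bits 78 0b001000110101010010101010110001100101110111100001101010111100100000010001111100, false⟩,
  ⟨bits 88 0b1110000000010001100110111011010110001111010111100011001111111001101100000000100010100010, false⟩,
  ⟨bits 83 0b11100000000100011001100100111110101001111011011011110110001111111011011010000111101, false⟩,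
  ⟨bits 83 0b11100000000100011001100100111110101011111001011001110100001101111001011000000101101, false⟩,
  ⟨bits 106 0b0010001101111100011010010101010110010110110101111011011000011011010001110100011101011001011101110111110100, true⟩,
  ⟨bits 106 0b0010011101101100001010000101000110000110100101101011001000001011000001100100001101001001001101100111100100, true⟩,
  ⟨bits 73 0b0010001100011101110011110001011111111011111001110011110000011110111101111, false⟩,
  ⟨bits 73 0b0010011100001101100011100001001111101011101001100011100000001110101101101, false⟩,
  ⟨bits 73 0b1110000000010001111111111101010011110111110101111111111100010010110001110, false⟩,
  ⟨bits 73 0b1110010000000001101111101101000011100111100101101111101100000010100001100, false⟩]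

/-- The angle bound of an exceptional box. -/
def Hole.angle (h : Hole) : ℝ :=
  if h.isVol3 then Complex.arg (-0.3933 + 0.91942 * Complex.I) else 2 * Real.pi / 3

/-- The visual angle of a geodesic at complex (exponentiated) distance `x` from the core
geodesic.  The numbers `x` and `-x` describe the same unoriented geodesic; the two choices of the
square root give two mutually inverse numbers, hence the same angle. -/
def visualAngle (x : ℂ) : ℝ :=
  let y := if x.re < 0 then -x else x
  |Complex.arg ((y * (y - 6) + 1 + (-4 * y + 4) * Complex.sqrt (-y)) / ((y + 1) * (y + 1)))|

/-- The domain `D`.  The first line says that `f` is neither short nor long, the second that the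
twist is reduced.  The third says that `x` is a possible alternate image of a group in an
exceptional box: some point of the box has the same `f`, the ortholength of `x` is not smaller,
and the visual angle of `x` is not smaller than the bound for the box.  The boxes marked `vol3`
themselves are left out. -/
def domain : Set (Fin 3 → ℂ) :=
  {x | 1.10274 ≤ ‖x 0‖ ∧ ‖x 0‖ ≤ 3.63201 ∧
    1 ≤ ‖x 2‖ ∧ ‖x 2‖ ^ 2 ≤ ‖x 0‖ ∧
    (∃ h ∈ holes, (∃ y ∈ Z M h.position, y 0 = x 0 ∧ ‖y 1‖ ≤ ‖x 1‖) ∧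
      h.angle ≤ visualAngle (x 1)) ∧
    ∀ h ∈ holes, h.isVol3 = true → x ∉ Z M h.position}

/-- A region is MNG-free if none of its points in the domain gives a minimal pair. -/
def MNGFree (R : Set (Fin 3 → ℂ)) : Prop :=
  ∀ x ∈ R ∩ domain M, ¬ IsMinimal (shortGen (x 0)) (closeGen (x 1) (x 2))

/-! ### The program -/

def largerAngle (x y : ACJ) : Option Bool := do
  let xy ← ACJ.ofDbl M (const 0)
  let xy ← if ← x.imPos then
      let xy ← if ← y.imPos then x.div M y else pure xy
      if ← y.imNeg then x.mul M y else pure xy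
    else pure xy
  let xy ← if ← x.imNeg then
      let xy ← if ← y.imPos then (← x.neg M).mul M y else pure xy
      if ← y.imNeg then (← x.neg M).div M y else pure xy
    else pure xy
  xy.imPos

def horizon (ortho : ACJ) : Option ACJ := do
  let ortho ← if ← ortho.f.re <ᶠ const 0 then ortho.neg M else pure ortho
  let r ← (← ortho.mul M (← ortho.subD M (const 6))).addD M (const 1)
  let d ← (← (← ortho.mulD M (const (-4))).addD M (const 4)).mul M (← (← ortho.neg M).sqrt M)
  let x ← r.f.div d.f
  let h ← if ← const 0 <ᶠ x.z.re then
      (← r.add M d).div M (← (← ortho.addD M (const 1)).mul M (← ortho.addD M (const 1)))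
    else
      (← r.sub M d).div M (← (← ortho.addD M (const 1)).mul M (← ortho.addD M (const 1)))
  if ← ortho.f.re <ᶠ const (1 + eps) *ᶠ (ortho.size +ᶠ ortho.e) then
    let err ← const (1 + eps) *ᶠ (h.size +ᶠ h.e)
    ACJ.build M h.f .zero .zero .zero err
  else
    return h

def quarter : Option ACJ := ACJ.build M ⟨const 0, const 1⟩ .zero .zero .zero (const 0)

def third : Option ACJ := do
  let im ← fsqrt (const (3 / 4))
  ACJ.build M ⟨const (-1 / 2), im⟩ .zero .zero .zero EPS

def vol3 : Option ACJ := do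
  let e ← lit 1.415 *ᶠ EPS
  ACJ.build M ⟨(lit 0.3933).neg, lit 0.91942⟩ .zero .zero .zero e

def Hole.maxAngle (h : Hole) : Option ACJ := if h.isVol3 then vol3 M else third M

/-- The result of `compute_min_d`. -/
def Hole.minD (h : Hole) : FP := do (← orthoJet M h.position).absLB M

/-- The position and the address of the hole agree in every third digit, up to the length of the
shorter one. -/
def Hole.matches (h : Hole) (p : List Bool) : Bool :=
  (List.range (min h.position.length p.length)).all fun j =>
    j % 3 != 0 || p.getD j false == h.position.getD j false

/-- The loop of `covers_hole`; the value `some none` stands for the return value `0`, the value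
`some (some (min_d, max_angle))` for the return value `1`. -/
def coversHoleLoop (p : List Bool) : List Hole → Dbl → ACJ → Option (Option (Dbl × ACJ))
  | [], minD, maxAngle => do
    if ← minD ≤ᶠ const 3 then return some (minD, maxAngle) else return none
  | h :: hs, minD, maxAngle => do
    let hd ← h.minD M
    let ha ← h.maxAngle M
    if h.isVol3 && p == h.position then return none
    if h.matches p then
      let minD' ← if ← hd <ᶠ minD then pure hd else pure minD
      let maxAngle' ← if ← largerAngle M ha maxAngle then pure ha else pure maxAngle
      coversHoleLoop p hs minD' maxAngle'
    else
      coversHoleLoop p hs minD maxAngle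

def coversHole (p : List Bool) : Option (Option (Dbl × ACJ)) := do
  coversHoleLoop M p holes (const 4) (← quarter M)

/-- The loop of `evaluateWord`.  Bytes are ASCII codes: `w` 119, `W` 87, `f` 102, `F` 70, closing
parenthesis 41; any other byte, in particular the zero byte behind the end of the text, violates
an assertion. -/
def wordLoop (f F w W : SL2ACJ) : List ℕ → SL2ACJ → Option SL2ACJ
  | [], _ => none
  | b :: t, g =>
    if b = 41 then some g
    else if b = 119 then do wordLoop f F w W t (← g.mul M w)
    else if b = 87 then do wordLoop f F w W t (← g.mul M W)
    else if b = 102 then do wordLoop f F w W t (← g.mul M f)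
    else if b = 70 then do wordLoop f F w W t (← g.mul M F)
    else none

/-- `evaluateWord`, applied to the text behind the opening parenthesis. -/
def evaluateWord (word : List ℕ) (along ortho whirle : ACJ) : Option SL2ACJ := do
  let one ← ACJ.ofDbl M (const 1)
  let zero ← ACJ.ofDbl M (const 0)
  let f ← shortGenerator M along
  let w ← closeGenerator M ortho whirle
  let F ← f.inverse M
  let W ← w.inverse M
  wordLoop M f F w W word ⟨one, zero, zero, one⟩

end

/-- `wordImpliesCommuting`, applied to the text behind the opening parenthesis. -/
def wordImpliesCommuting : List ℕ → Bool
  | [] => false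
  | [a] => a == 41
  | a :: b :: t =>
    if a = 41 ∨ b = 41 then true
    else if (a = 102 ∧ b = 102) ∨ (a = 70 ∧ b = 70) ∨ (a = 119 ∧ b = 119) ∨
        (a = 87 ∧ b = 87) ∨ (a = 102 ∧ b = 119) ∨ (a = 102 ∧ b = 87) ∨
        (a = 70 ∧ b = 119) ∨ (a = 70 ∧ b = 87) then wordImpliesCommuting (b :: t)
    else false

/-- The test `absUB(l/along) < 1 && absLB(l*along) > 1`. -/
def lengthTest (M : Machine) (l along : ACJ) : Option Bool := do
  if ← (← l.div M along).absUB M <ᶠ const 1 then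
    const 1 <ᶠ (← l.mul M along).absLB M
  else
    return false

/-- `inequalityHolds`; the first byte of the code is `s` 115, `l` 108, `n` 110, `f` 102, `W` 87,
`w` 119, `L` 76 or `2` 50, and any other one violates an assertion. -/
def inequalityHolds (M : Machine) (code : List ℕ) (p : List Bool) : Option Bool := do
  match ← coversHole M p with
  | none => return true
  | some (minD, maxAngle) =>
    let along ← alongJet M p
    let ortho ← orthoJet M p
    let whirle ← whirleJet M p
    match code.getD 0 0 with
    | 115 => along.absUB M <ᶠ lit 1.10274
    | 108 => lit 3.63201 <ᶠ along.absLB M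
    | 110 => ortho.absUB M <ᶠ minD
    | 102 => largerAngle M maxAngle (← horizon M ortho)
    | 87 => whirle.absUB M <ᶠ const 1
    | 119 =>
      let wh ← whirle.absLB M
      along.absUB M <ᶠ const (1 - eps) *ᶠ wh *ᶠ wh
    | c =>
      let g ← evaluateWord M (code.drop 2) along ortho whirle
      let l ← g.length M
      match c with
      | 76 => if ← g.notIdentity M then lengthTest M l along else return false
      | 50 => if wordImpliesCommuting (code.drop 2) then lengthTest M l along else return false
      | _ => none

/-- The texts that start behind the line feeds (byte 10) of a file, except behind a final one. -/
def lineStarts : List ℕ → List (List ℕ)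
  | [] => []
  | b :: t => if b = 10 ∧ t ≠ [] then t :: lineStarts t else lineStarts t

/-- The codes that the program reads from the file `conditionlist` (given by its bytes): the
pointers to the beginnings of its lines.  Only 300000 bytes and 13199 lines are used. -/
def codes (file : List ℕ) : List (List ℕ) :=
  ((file.take 300000) :: lineStarts (file.take 300000)).take 13199

def inequalityFor (file : List ℕ) (code : ℤ) : Option (List ℕ) :=
  if code < 1 then none else (codes file)[code.toNat - 1]?

/-- No condition of the kind `2` has the empty word. -/
def WordsNonempty (file : List ℕ) : Prop :=
  ∀ c ∈ codes file, c.getD 0 0 = 50 → c.getD 2 0 ≠ 41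

/-- `verify(where, depth, autocode)`, where `depth` is the length of `p` and the first argument is
`MAXDEPTH - depth`.  The result is the list of printed positions and the unread input. -/
def verify (M : Machine) (file : List ℕ) :
    ℕ → List Bool → ℤ → List ℤ → Option (List (List Bool) × List ℤ)
  | 0, _, _, _ => none
  | n + 1, p, autocode, input => do
    let (code, input) ← if autocode = 0 then
        match input with
        | [] => none
        | c :: rest => pure (c, rest)
      else pure (autocode, input)
    if code < 0 then return ([p], input)
    else
      let holds ← if code ≠ 0 then do
          inequalityHolds M (← inequalityFor file code) p
        else pure false
      if holds then return ([], input)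
      else
        let (out0, input) ← verify M file n (p ++ [false]) code input
        let (out1, input) ← verify M file n (p ++ [true]) code input
        return (out0 ++ out1, input)

/-- The program, run on the machine `M` with the given condition file, standard input and
command-line argument `p`.  The value is `some [m_0, …, m_k]` if the program finishes and prints
that `p - { m_0 … m_k }` is verified, and `none` in all other cases. -/
def program (M : Machine) (file : List ℕ) (input : List ℤ) (p : List Bool) :
    Option (List (List Bool)) := do
  let (out, _) ← verify M file (200 - p.length) p 0 input
  return out

end Verify

end

noncomputable section

namespace Verify

open Dbl (const lit)

variable {x y : ℝ}

theorem bind_iff {α β : Type} {a : Option α} {f : α → Option β} {b : β} :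
    (a >>= f) = some b ↔ ∃ c, a = some c ∧ f c = some b := Option.bind_eq_some_iff

theorem pure_iff {α : Type} {a b : α} : (pure a : Option α) = some b ↔ a = b := Option.some_inj

/-! ### Rounding -/

/-- The unit roundoff. -/
def ur : ℝ := 2 ^ (-53 : ℤ)

theorem ur_pos : 0 < ur := by unfold ur; positivity

theorem ur_le : ur ≤ 1 / 9007199254740992 := by unfold ur; norm_num

theorem ur_eq : ur = 1 / 9007199254740992 := by unfold ur; norm_num

theorem eps_eq : eps = 2 * ur := by unfold eps ur; norm_num

theorem floor_le_roundEven (x : ℝ) : ⌊x⌋ ≤ roundEven x := by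
  unfold roundEven
  split_ifs with h1 h2
  · exact le_rfl
  · lia
  · rw [round_eq]
    apply Int.floor_mono
    linarith

theorem roundEven_le_floor_add_one (x : ℝ) : roundEven x ≤ ⌊x⌋ + 1 := by
  unfold roundEven
  split_ifs with h1 h2
  · lia
  · exact le_rfl
  · rw [round_eq, ← Int.floor_add_one]
    apply Int.floor_mono
    linarith

theorem roundEven_of_fract_lt (h : Int.fract x < 1 / 2) : roundEven x = ⌊x⌋ := by
  unfold roundEven
  rw [if_neg h.ne, round_eq, Int.floor_eq_iff]
  have := Int.floor_add_fract x
  have := Int.fract_nonneg x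
  constructor <;> linarith

theorem roundEven_of_lt_fract (h : 1 / 2 < Int.fract x) : roundEven x = ⌊x⌋ + 1 := by
  unfold roundEven
  rw [if_neg h.ne', round_eq, Int.floor_eq_iff]
  have := Int.floor_add_fract x
  have := Int.fract_lt_one x
  push_cast
  constructor <;> linarith

theorem abs_roundEven_sub_le (x : ℝ) : |(roundEven x : ℝ) - x| ≤ 1 / 2 := by
  have h1 := Int.floor_add_fract x
  have h2 := Int.fract_nonneg x
  have h3 := Int.fract_lt_one x
  rcases lt_trichotomy (Int.fract x) (1 / 2) with h | h | h
  · rw [roundEven_of_fract_lt h, abs_le]; constructor <;> linarith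
  · rw [abs_le]
    unfold roundEven
    rw [if_pos h]
    split_ifs
    · constructor <;> linarith
    · push_cast; constructor <;> linarith
  · rw [roundEven_of_lt_fract h, abs_le]; push_cast; constructor <;> linarith

theorem roundEven_intCast (n : ℤ) : roundEven (n : ℝ) = n := by
  rw [roundEven_of_fract_lt (by simp)]; simp

theorem roundEven_mono (h : x ≤ y) : roundEven x ≤ roundEven y := by
  rcases (Int.floor_mono h).lt_or_eq with h1 | h1
  · exact (roundEven_le_floor_add_one x).trans (h1.trans_le (floor_le_roundEven y))
  · have hx := Int.floor_add_fract x
    have hy := Int.floor_add_fract y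
    have h1' : (⌊x⌋ : ℝ) = ⌊y⌋ := by exact_mod_cast h1
    have hf : Int.fract x ≤ Int.fract y := by linarith
    rcases lt_trichotomy (Int.fract x) (1 / 2) with h2 | h2 | h2
    · rw [roundEven_of_fract_lt h2, h1]; exact floor_le_roundEven y
    · rcases hf.lt_or_eq with h3 | h3
      · rw [roundEven_of_lt_fract (x := y) (by linarith), ← h1]
        exact roundEven_le_floor_add_one x
      · rw [show x = y by linarith]
    · rw [roundEven_of_lt_fract h2, roundEven_of_lt_fract (x := y) (by linarith), h1]

theorem roundEven_neg (x : ℝ) : roundEven (-x) = -roundEven x := by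
  have hx := Int.floor_add_fract x
  have h0 := Int.fract_nonneg x
  have h1 := Int.fract_lt_one x
  by_cases hz : Int.fract x = 0
  · have : x = (⌊x⌋ : ℤ) := by linarith
    rw [this, ← Int.cast_neg, roundEven_intCast, roundEven_intCast]
  · have hn : Int.fract (-x) = 1 - Int.fract x := Int.fract_neg hz
    have hfl : ⌊-x⌋ = -⌊x⌋ - 1 := by
      rw [Int.floor_eq_iff]
      have : 0 < Int.fract x := lt_of_le_of_ne h0 (Ne.symm hz)
      push_cast
      constructor <;> linarith
    rcases lt_trichotomy (Int.fract x) (1 / 2) with h | h | h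
    · rw [roundEven_of_fract_lt h, roundEven_of_lt_fract (by linarith), hfl]; ring
    · unfold roundEven
      rw [if_pos h, if_pos (by linarith), hfl]
      rcases Int.even_or_odd ⌊x⌋ with he | ho
      · rw [if_pos he, if_neg]
        · ring
        · rw [Int.not_even_iff_odd]; exact (he.neg).sub_odd odd_one
      · rw [if_neg (Int.not_even_iff_odd.2 ho), if_pos]
        · ring
        · exact (ho.neg).sub_odd odd_one
    · rw [roundEven_of_lt_fract h, roundEven_of_fract_lt (by linarith), hfl]; ring

theorem round53_zero : round53 0 = 0 := by
  unfold round53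
  rw [zero_div, show (0 : ℝ) = ((0 : ℤ) : ℝ) by simp, roundEven_intCast]
  simp

theorem round53_neg (x : ℝ) : round53 (-x) = -round53 x := by
  unfold round53
  rw [abs_neg, neg_div, roundEven_neg]
  push_cast
  ring

theorem log_bounds (hx : 0 < x) :
    (2 : ℝ) ^ Int.log 2 x ≤ x ∧ x < 2 ^ (Int.log 2 x + 1) := by
  have h1 := Int.zpow_log_le_self (R := ℝ) (b := 2) (by norm_num) hx
  have h2 := Int.lt_zpow_succ_log_self (R := ℝ) (b := 2) (by norm_num) x
  exact ⟨by exact_mod_cast h1, by exact_mod_cast h2⟩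

theorem log_two_zpow_mul (k : ℤ) (hx : 0 < x) :
    Int.log 2 ((2 : ℝ) ^ k * x) = k + Int.log 2 x := by
  have h1 := log_bounds hx
  have hp : (0 : ℝ) < 2 ^ k := by positivity
  have h2 := log_bounds (mul_pos hp hx)
  set a := Int.log 2 x
  set b := Int.log 2 ((2 : ℝ) ^ k * x)
  have h3 : (2 : ℝ) ^ (k + a) < 2 ^ (b + 1) := by
    rw [zpow_add₀ (by norm_num)]
    exact lt_of_le_of_lt (mul_le_mul_of_nonneg_left h1.1 hp.le) h2.2
  have h4 : (2 : ℝ) ^ b < 2 ^ (k + (a + 1)) := by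
    rw [zpow_add₀ (by norm_num) k]
    exact lt_of_le_of_lt h2.1 (mul_lt_mul_of_pos_left h1.2 hp)
  have h5 := (zpow_lt_zpow_iff_right₀ (by norm_num : (1 : ℝ) < 2)).1 h3
  have h6 := (zpow_lt_zpow_iff_right₀ (by norm_num : (1 : ℝ) < 2)).1 h4
  lia

theorem round53_two_zpow_mul (k : ℤ) (x : ℝ) : round53 (2 ^ k * x) = 2 ^ k * round53 x := by
  rcases eq_or_ne x 0 with rfl | hx
  · simp [round53_zero]
  · have hp : (0 : ℝ) < 2 ^ k := by positivity
    unfold round53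
    rw [abs_mul, abs_of_pos hp, log_two_zpow_mul k (abs_pos.2 hx),
      show k + Int.log 2 |x| - 52 = k + (Int.log 2 |x| - 52) by ring, zpow_add₀ (by norm_num),
      mul_div_mul_left _ _ hp.ne']
    ring

theorem abs_round53_sub_le_zpow (hx : 0 < x) :
    |round53 x - x| ≤ ur * 2 ^ Int.log 2 x := by
  have hp : (0 : ℝ) < 2 ^ (Int.log 2 x - 52) := by positivity
  have h := abs_roundEven_sub_le (x / 2 ^ (Int.log 2 x - 52))
  unfold round53
  rw [abs_of_pos hx]
  have h2 : (roundEven (x / 2 ^ (Int.log 2 x - 52)) : ℝ) * 2 ^ (Int.log 2 x - 52) - x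
      = (roundEven (x / 2 ^ (Int.log 2 x - 52)) - x / 2 ^ (Int.log 2 x - 52))
        * 2 ^ (Int.log 2 x - 52) := by
    field_simp
  rw [h2, abs_mul, abs_of_pos hp]
  calc _ ≤ 1 / 2 * (2 : ℝ) ^ (Int.log 2 x - 52) := by gcongr
    _ = ur * 2 ^ Int.log 2 x := by
      unfold ur
      rw [zpow_sub₀ (by norm_num)]
      norm_num
      ring

theorem zpow_log_le_round53 (hx : 0 < x) : (2 : ℝ) ^ Int.log 2 x ≤ round53 x := by
  have hp : (0 : ℝ) < 2 ^ (Int.log 2 x - 52) := by positivity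
  have h1 := (log_bounds hx).1
  have h2 : ((2 ^ 52 : ℤ) : ℝ) ≤ x / 2 ^ (Int.log 2 x - 52) := by
    rw [le_div_iff₀ hp]
    refine le_trans (le_of_eq ?_) h1
    rw [zpow_sub₀ (by norm_num)]
    norm_num
    ring
  have h3 := roundEven_mono h2
  rw [roundEven_intCast] at h3
  unfold round53
  rw [abs_of_pos hx]
  calc (2 : ℝ) ^ Int.log 2 x = ((2 ^ 52 : ℤ) : ℝ) * 2 ^ (Int.log 2 x - 52) := by
        rw [zpow_sub₀ (by norm_num)]; norm_num; ring
    _ ≤ _ := by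
      apply mul_le_mul_of_nonneg_right _ hp.le
      exact_mod_cast h3

theorem round53_le_zpow_log (hx : 0 < x) : round53 x ≤ (2 : ℝ) ^ (Int.log 2 x + 1) := by
  have hp : (0 : ℝ) < 2 ^ (Int.log 2 x - 52) := by positivity
  have h1 := (log_bounds hx).2
  have h2 : x / 2 ^ (Int.log 2 x - 52) ≤ ((2 ^ 53 : ℤ) : ℝ) := by
    rw [div_le_iff₀ hp]
    refine le_trans h1.le (le_of_eq ?_)
    rw [zpow_sub₀ (by norm_num), zpow_add₀ (by norm_num)]
    norm_num
    ring
  have h3 := roundEven_mono h2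
  rw [roundEven_intCast] at h3
  unfold round53
  rw [abs_of_pos hx]
  calc _ ≤ ((2 ^ 53 : ℤ) : ℝ) * 2 ^ (Int.log 2 x - 52) := by
        apply mul_le_mul_of_nonneg_right _ hp.le
        exact_mod_cast h3
    _ = (2 : ℝ) ^ (Int.log 2 x + 1) := by
      rw [zpow_sub₀ (by norm_num), zpow_add₀ (by norm_num)]; norm_num; ring

theorem round53_pos (hx : 0 < x) : 0 < round53 x :=
  lt_of_lt_of_le (by positivity) (zpow_log_le_round53 hx)

theorem round53_nonneg (hx : 0 ≤ x) : 0 ≤ round53 x := by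
  rcases hx.eq_or_lt with rfl | hx
  · rw [round53_zero]
  · exact (round53_pos hx).le

theorem abs_round53 (x : ℝ) : |round53 x| = round53 |x| := by
  rcases le_total 0 x with h | h
  · rw [abs_of_nonneg h, abs_of_nonneg (round53_nonneg h)]
  · rw [abs_of_nonpos h, round53_neg, abs_of_nonpos]
    have := round53_nonneg (x := -x) (by linarith)
    rw [round53_neg] at this
    linarith

theorem round53_mono (h : x ≤ y) : round53 x ≤ round53 y := by
  have key : ∀ {x y : ℝ}, 0 < x → x ≤ y → round53 x ≤ round53 y := by
    intro x y hx h
    have hy := hx.trans_le h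
    rcases (Int.log_mono_right (b := 2) hx h).lt_or_eq with h1 | h1
    · calc round53 x ≤ 2 ^ (Int.log 2 x + 1) := round53_le_zpow_log hx
        _ ≤ 2 ^ Int.log 2 y := zpow_le_zpow_right₀ (by norm_num) h1
        _ ≤ _ := zpow_log_le_round53 hy
    · unfold round53
      rw [abs_of_pos hx, abs_of_pos hy, h1]
      apply mul_le_mul_of_nonneg_right _ (by positivity)
      exact_mod_cast roundEven_mono (by gcongr)
  rcases lt_or_ge 0 x with hx | hx
  · exact key hx h
  · rcases lt_or_ge y 0 with hy | hy
    · have := key (x := -y) (y := -x) (by linarith) (by linarith)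
      rw [round53_neg, round53_neg] at this
      linarith
    · have h1 := round53_nonneg hy
      have h2 := round53_nonneg (x := -x) (by linarith)
      rw [round53_neg] at h2
      linarith

theorem abs_round53_sub_le (x : ℝ) : |round53 x - x| ≤ ur * |x| := by
  have key : ∀ {x : ℝ}, 0 < x → |round53 x - x| ≤ ur * x := fun hx =>
    (abs_round53_sub_le_zpow hx).trans
      (mul_le_mul_of_nonneg_left (log_bounds hx).1 ur_pos.le)
  rcases lt_trichotomy x 0 with h | rfl | h
  · have := key (x := -x) (by linarith)
    rw [round53_neg] at this
    rw [abs_of_neg h, ← abs_neg]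
    convert this using 2
    ring
  · simp [round53_zero]
  · rw [abs_of_pos h]; exact key h

theorem abs_round53_sub_le' (x : ℝ) : |round53 x - x| ≤ ur * |round53 x| := by
  have key : ∀ {x : ℝ}, 0 < x → |round53 x - x| ≤ ur * round53 x := fun hx =>
    (abs_round53_sub_le_zpow hx).trans
      (mul_le_mul_of_nonneg_left (zpow_log_le_round53 hx) ur_pos.le)
  rcases lt_trichotomy x 0 with h | rfl | h
  · have := key (x := -x) (by linarith)
    rw [abs_round53, abs_of_neg h, ← abs_neg]
    convert this using 2
    rw [round53_neg]; ring
  · simp [round53_zero]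
  · rw [abs_of_pos (round53_pos h)]; exact key h

/-- Rounding loses at most a factor `1 + ur`. -/
theorem le_round53 (hy : 0 ≤ y) : y ≤ (1 + ur) * round53 y := by
  have h := abs_round53_sub_le' y
  rw [abs_of_nonneg (round53_nonneg hy)] at h
  have := (abs_le.1 h).1
  linarith

theorem round53_le (hy : 0 ≤ y) : round53 y ≤ (1 + ur) * y := by
  have h := abs_round53_sub_le y
  rw [abs_of_nonneg hy] at h
  have := (abs_le.1 h).2
  linarith

/-- An integer multiple of a power of two with at most 53 bits is not changed by rounding. -/
theorem round53_intCast_mul {m e : ℤ} (hm : |m| ≤ 2 ^ 53) :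
    round53 (m * 2 ^ e) = m * 2 ^ e := by
  rw [mul_comm, round53_two_zpow_mul]
  congr 1
  have key : ∀ {m : ℤ}, 0 < m → m ≤ 2 ^ 53 → round53 m = m := by
    intro m h0 hm
    have hm0 : (0 : ℝ) < m := by exact_mod_cast h0
    have hb := log_bounds hm0
    rcases hm.lt_or_eq with h | h
    · have h1 : Int.log 2 (m : ℝ) < 53 := by
        have : (2 : ℝ) ^ Int.log 2 (m : ℝ) < 2 ^ (53 : ℤ) := by
          refine lt_of_le_of_lt hb.1 ?_
          exact_mod_cast h
        exact (zpow_lt_zpow_iff_right₀ (by norm_num : (1 : ℝ) < 2)).1 this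
      obtain ⟨n, hn⟩ : ∃ n : ℕ, (n : ℤ) = 52 - Int.log 2 (m : ℝ) :=
        ⟨(52 - Int.log 2 (m : ℝ)).toNat, by lia⟩
      have h2 : (m : ℝ) / 2 ^ (Int.log 2 (m : ℝ) - 52) = ((m * 2 ^ n : ℤ) : ℝ) := by
        rw [show Int.log 2 (m : ℝ) - 52 = -(n : ℤ) by lia, zpow_neg, zpow_natCast]
        push_cast
        field_simp
      unfold round53
      rw [abs_of_pos hm0, h2, roundEven_intCast, ← h2]
      field_simp
    · subst h
      rw [show ((2 ^ 53 : ℤ) : ℝ) = 2 ^ (53 : ℤ) * 1 by norm_num, round53_two_zpow_mul]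
      congr 1
      unfold round53
      rw [abs_one, Int.log_one_right, show (1 : ℝ) / 2 ^ ((0 : ℤ) - 52) = ((2 ^ 52 : ℤ) : ℝ) by
        norm_num, roundEven_intCast]
      norm_num
  rcases lt_trichotomy m 0 with h | rfl | h
  · have := key (m := -m) (by lia) (by rw [abs_of_neg h] at hm; exact hm)
    push_cast at this
    rw [round53_neg] at this
    linarith
  · simp [round53_zero]
  · exact key h (by rw [abs_of_pos h] at hm; exact hm)

theorem exists_round53_eq (hx : 0 < x) :
    ∃ n : ℤ, 2 ^ 52 ≤ n ∧ n ≤ 2 ^ 53 ∧ round53 x = n * 2 ^ (Int.log 2 x - 52) := by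
  refine ⟨roundEven (x / 2 ^ (Int.log 2 x - 52)), ?_, ?_, by unfold round53; rw [abs_of_pos hx]⟩
  · have h := zpow_log_le_round53 hx
    unfold round53 at h
    rw [abs_of_pos hx, ← div_le_iff₀ (by positivity), ← zpow_sub₀ (by norm_num)] at h
    rw [show Int.log 2 x - (Int.log 2 x - 52) = (52 : ℤ) by ring] at h
    exact_mod_cast h
  · have h := round53_le_zpow_log hx
    unfold round53 at h
    rw [abs_of_pos hx, ← le_div_iff₀ (by positivity), ← zpow_sub₀ (by norm_num)] at h
    rw [show Int.log 2 x + 1 - (Int.log 2 x - 52) = (53 : ℤ) by ring] at h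
    exact_mod_cast h

theorem round53_round53 (x : ℝ) : round53 (round53 x) = round53 x := by
  unfold round53
  have key : ∀ {x : ℝ}, 0 < x → round53 (round53 x) = round53 x := by
    intro x hx
    obtain ⟨n, h1, h2, h3⟩ := exists_round53_eq hx
    rw [h3]
    exact round53_intCast_mul (by rw [abs_of_nonneg (by lia)]; exact h2)
  change round53 (round53 x) = round53 x
  rcases lt_trichotomy x 0 with h | rfl | h
  · have := key (x := -x) (by linarith)
    rw [round53_neg, round53_neg] at this
    linarith
  · rw [round53_zero, round53_zero]
  · exact key h

theorem round53_one : round53 1 = 1 := by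
  have := round53_intCast_mul (m := 1) (e := 0) (by norm_num)
  simpa using this

/-- Multiplication by `1 + EPS` makes up for the rounding of its argument and of the product. -/
theorem le_round53_mul_round53 (hy : 0 ≤ y) :
    y ≤ round53 ((1 + 2 * ur) * round53 y) := by
  rcases hy.eq_or_lt with rfl | hy
  · rw [round53_zero, mul_zero, round53_zero]
  obtain ⟨n, h1, h2, h3⟩ := exists_round53_eq hy
  have hp : (0 : ℝ) < 2 ^ (Int.log 2 y - 52) := by positivity
  have hn : (2 : ℝ) ^ 52 ≤ n := by exact_mod_cast h1
  have hr := round53_pos hy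
  have hu := ur_pos
  rcases h2.lt_or_eq with h | h
  · have h4 : ((n + 1 : ℤ) : ℝ) * 2 ^ (Int.log 2 y - 52) ≤ (1 + 2 * ur) * round53 y := by
      rw [h3, ← mul_assoc]
      apply mul_le_mul_of_nonneg_right _ hp.le
      push_cast
      have : 1 ≤ 2 * ur * n := by
        norm_num [ur_eq] at hn ⊢; linarith
      linarith
    have h5 := round53_mono h4
    rw [round53_intCast_mul (by rw [abs_of_nonneg (by lia)]; lia)] at h5
    refine le_trans ?_ h5
    have h6 := (abs_le.1 (abs_round53_sub_le_zpow hy)).1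
    have h7 : ur * 2 ^ Int.log 2 y = 1 / 2 * 2 ^ (Int.log 2 y - 52) := by
      unfold ur; rw [zpow_sub₀ (by norm_num)]; norm_num; ring
    rw [h7, h3] at h6
    push_cast
    linarith
  · have h4 : y ≤ round53 y := by
      have := (log_bounds hy).2
      rw [h3, h]
      refine this.le.trans (le_of_eq ?_)
      push_cast
      rw [zpow_sub₀ (by norm_num), zpow_add₀ (by norm_num)]; norm_num; ring
    have h5 : round53 y ≤ (1 + 2 * ur) * round53 y := by nlinarith
    have h6 := round53_mono h5
    rw [round53_round53] at h6
    exact h4.trans h6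

/-! ### Results of arithmetic operations -/

/-- A real number that is zero or not smaller than the least normal double. -/
def IsNormal (x : ℝ) : Prop := x = 0 ∨ (2 : ℝ) ^ (-1022 : ℤ) ≤ |x|

theorem IsNormal.neg (h : IsNormal x) : IsNormal (-x) := by
  rcases h with h | h
  · left; linarith
  · right; rwa [abs_neg]

theorem isNormal_zero : IsNormal 0 := Or.inl rfl

theorem isNormal_one : IsNormal 1 := Or.inr (by
  rw [abs_one]; exact zpow_le_one_of_nonpos₀ (by norm_num) (by norm_num))

theorem round53_two_zpow (k : ℤ) : round53 (2 ^ k) = 2 ^ k := by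
  have := round53_two_zpow_mul k 1
  rwa [round53_one, mul_one] at this

theorem IsNormal.round53 (h : IsNormal x) : IsNormal (round53 x) := by
  rcases h with rfl | h
  · left; exact round53_zero
  · right
    rw [abs_round53, ← round53_two_zpow]
    exact round53_mono h

/-- The operation with exact value `x` has the finite result `c`. -/
theorem fl_eq_fin {x c : ℝ} (h : fl x = some (.fin c)) :
    c = round53 x ∧ IsNormal x ∧ |c| < 2 ^ 1024 := by
  unfold fl at h
  split_ifs at h with h1 h2 h3
  · simp only [Option.some.injEq, Dbl.fin.injEq] at h
    subst h
    subst h1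
    exact ⟨round53_zero.symm, isNormal_zero, by simp⟩
  · simp only [Option.some.injEq, Dbl.fin.injEq] at h
    subst h
    exact ⟨rfl, Or.inr (not_lt.1 h2), h3⟩
  · simp at h

theorem fl_cases {d : Dbl} (h : fl x = some d) :
    (d = .fin (round53 x) ∧ IsNormal x ∧ |round53 x| < 2 ^ 1024) ∨
    (d = .inf (decide (x < 0)) ∧ 2 ^ 1024 ≤ |round53 x|) := by
  unfold fl at h
  split_ifs at h with h1 h2 h3
  · simp only [Option.some.injEq] at h
    subst h
    subst h1
    left
    rw [round53_zero]
    exact ⟨rfl, isNormal_zero, by simp⟩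
  · simp only [Option.some.injEq] at h
    exact Or.inl ⟨h.symm, Or.inr (not_lt.1 h2), h3⟩
  · simp only [Option.some.injEq] at h
    exact Or.inr ⟨h.symm, not_lt.1 h3⟩

theorem fl_of_intCast_mul {m e : ℤ} (hm : |m| < 2 ^ 53) (hm0 : m ≠ 0) (he : -1022 ≤ e)
    (he' : e ≤ 900) : fl (m * 2 ^ e) = some (.fin (m * 2 ^ e)) := by
  have hr := round53_intCast_mul (m := m) (e := e) hm.le
  have hm1 : (1 : ℝ) ≤ |(m : ℝ)| := by
    rw [← Int.cast_abs]; exact_mod_cast Int.one_le_abs hm0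
  have hm2 : |(m : ℝ)| < 2 ^ 53 := by
    rw [← Int.cast_abs]; exact_mod_cast hm
  have hp : (0 : ℝ) < 2 ^ e := by positivity
  have hp1 : (2 : ℝ) ^ (-1022 : ℤ) ≤ 2 ^ e := zpow_le_zpow_right₀ (by norm_num) he
  have hp2 : (2 : ℝ) ^ e ≤ 2 ^ (900 : ℤ) := zpow_le_zpow_right₀ (by norm_num) he'
  unfold fl
  rw [if_neg (by positivity), if_neg, hr, if_pos]
  · rw [abs_mul, abs_of_pos hp]
    calc |(m : ℝ)| * 2 ^ e ≤ 2 ^ 53 * 2 ^ (900 : ℤ) := by gcongr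
      _ = (2 : ℝ) ^ 953 := by rw [zpow_ofNat, ← pow_add]
      _ < 2 ^ 1024 := pow_lt_pow_right₀ (by norm_num) (by norm_num)
  · rw [abs_mul, abs_of_pos hp, not_lt]
    nlinarith

/-! ### Faithful rounding -/

theorem isRepresentable_intCast_mul {m e : ℤ} (hm : |m| ≤ 2 ^ 53) (he : -1074 ≤ e) :
    IsRepresentable (m * 2 ^ e) := by
  rcases hm.lt_or_eq with h | h
  · exact ⟨m, e, h, he, rfl⟩
  · rcases abs_eq (by norm_num : (0 : ℤ) ≤ 2 ^ 53) |>.1 h with h | h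
    · exact ⟨1, e + 53, by norm_num, by lia, by
        rw [h, zpow_add₀ (by norm_num)]; push_cast; norm_num; ring⟩
    · exact ⟨-1, e + 53, by norm_num, by lia, by
        rw [h, zpow_add₀ (by norm_num)]; push_cast; norm_num; ring⟩

theorem IsFaithful.abs_sub_le {y t : ℝ} (h : IsFaithful y t) (ht : (2 : ℝ) ^ (-1022 : ℤ) ≤ t) :
    |y - t| ≤ 2 * ur * t := by
  have ht0 : 0 < t := lt_of_lt_of_le (by positivity) ht
  obtain ⟨h1, h2⟩ := log_bounds ht0
  set E := Int.log 2 t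
  have hE : -1022 ≤ E := by
    have : (2 : ℝ) ^ (-1022 : ℤ) < 2 ^ (E + 1) := lt_of_le_of_lt ht h2
    have := (zpow_lt_zpow_iff_right₀ (by norm_num : (1 : ℝ) < 2)).1 this
    lia
  have hp : (0 : ℝ) < 2 ^ (E - 52) := by positivity
  set n := ⌊t / 2 ^ (E - 52)⌋
  have hn1 : (n : ℝ) * 2 ^ (E - 52) ≤ t := by
    rw [← le_div_iff₀ hp]; exact Int.floor_le _
  have hn2 : t < (n + 1 : ℝ) * 2 ^ (E - 52) := by
    rw [← div_lt_iff₀ hp]; exact Int.lt_floor_add_one _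
  have hn3 : 2 ^ 52 ≤ n := by
    rw [Int.le_floor, le_div_iff₀ hp]
    refine le_trans (le_of_eq ?_) h1
    push_cast
    rw [zpow_sub₀ (by norm_num)]; norm_num; ring
  have hn4 : n < 2 ^ 53 := by
    rw [Int.floor_lt, div_lt_iff₀ hp]
    refine lt_of_lt_of_le h2 (le_of_eq ?_)
    push_cast
    rw [zpow_sub₀ (by norm_num), zpow_add₀ (by norm_num)]; norm_num; ring
  have hstep : (2 : ℝ) ^ (E - 52) ≤ 2 * ur * t := by
    refine le_trans (le_of_eq ?_) (mul_le_mul_of_nonneg_left h1 (by have := ur_pos; positivity))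
    unfold ur; rw [zpow_sub₀ (by norm_num)]; norm_num; ring
  have hr : ∀ m : ℤ, |m| ≤ 2 ^ 53 → ¬ (min y t < m * 2 ^ (E - 52) ∧ m * 2 ^ (E - 52) < max y t) :=
    fun m hm => h.2 _ (isRepresentable_intCast_mul hm (by lia))
  rw [abs_le]
  constructor
  · by_contra hc
    push Not at hc
    have hyt : y < t := by nlinarith [ur_pos]
    rw [min_eq_left hyt.le, max_eq_right hyt.le] at hr
    rcases hn1.lt_or_eq with h5 | h5
    · exact hr n (by rw [abs_of_nonneg (by lia)]; lia) ⟨by nlinarith, h5⟩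
    · refine hr (n - 1) (by rw [abs_of_nonneg (by lia)]; lia) ⟨?_, ?_⟩ <;> push_cast <;> nlinarith
  · by_contra hc
    push Not at hc
    have hyt : t < y := by nlinarith [ur_pos]
    rw [min_eq_right hyt.le, max_eq_left hyt.le] at hr
    refine hr (n + 1) (by rw [abs_of_nonneg (by lia)]; lia) ⟨?_, ?_⟩ <;> push_cast <;> nlinarith

theorem IsFaithful.abs_le_of_zero (h : IsFaithful y 0) :
    |y| ≤ 2 ^ (-1074 : ℤ) := by
  have h1 : IsRepresentable (2 ^ (-1074 : ℤ)) := by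
    simpa using isRepresentable_intCast_mul (m := 1) (e := -1074) (by norm_num) le_rfl
  have h2 : IsRepresentable (-2 ^ (-1074 : ℤ)) := by
    simpa using isRepresentable_intCast_mul (m := -1) (e := -1074) (by norm_num) le_rfl
  have hp : (0 : ℝ) < 2 ^ (-1074 : ℤ) := by positivity
  by_contra hc
  push Not at hc
  rcases lt_or_ge 0 y with h3 | h3
  · rw [abs_of_pos h3] at hc
    exact h.2 _ h1 (by rw [min_eq_right h3.le, max_eq_left h3.le]; exact ⟨hp, hc⟩)
  · rw [abs_of_nonpos h3] at hc
    refine h.2 _ h2 ?_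
    rw [min_eq_left h3, max_eq_right h3]
    constructor <;> linarith

variable {a b : FP} {d : Dbl} {c r s x y : ℝ}

/-! ### Upper bounds in floating-point arithmetic -/

/-- `d` is an upper bound of `r`; a value that is not a number counts as one. -/
def UB : Dbl → ℝ → Prop
  | .fin x, r => r ≤ x
  | .inf s, _ => s = false
  | .nan, _ => True

/-- The result of a computation, if there is one, is an upper bound of `r`. -/
def UBo (a : FP) (r : ℝ) : Prop := ∀ d, a = some d → UB d r

/-- Positive infinity or not a number. -/
def Bad (d : Dbl) : Prop := d = .nan ∨ d = .inf false

theorem Bad.ub (h : Bad d) (r : ℝ) : UB d r := by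
  rcases h with rfl | rfl <;> simp [UB]

theorem UB.mono (h : UB d r) (hs : s ≤ r) : UB d s := by
  cases d with
  | fin x => exact hs.trans h
  | inf s => exact h
  | nan => trivial

theorem UB.cases (h : UB d r) : Bad d ∨ ∃ x, d = .fin x ∧ r ≤ x := by
  cases d with
  | fin x => exact Or.inr ⟨x, rfl, h⟩
  | inf s => exact Or.inl (Or.inr (by rw [show s = false from h]))
  | nan => exact Or.inl (Or.inl rfl)

theorem UBo.mono (h : UBo a r) (hs : s ≤ r) : UBo a s :=
  fun d hd => (h d hd).mono hs

theorem UB.some (h : UB d r) : UBo (some d) r := by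
  rintro _ ⟨⟩; exact h

theorem ubo_const (h : r ≤ x) : UBo (some (const x)) r := UB.some h

theorem ub_fin : UB (.fin x) r ↔ r ≤ x := Iff.rfl

theorem ub_abs (d : Dbl) : UB d.abs 0 := by
  cases d with
  | fin x => exact abs_nonneg x
  | inf s => rfl
  | nan => trivial

theorem fadd_eq_some {c : Dbl} (h : a +ᶠ b = some c) :
    ∃ x y, a = some x ∧ b = some y ∧ Dbl.add x y = some c := by
  simpa only [fadd, bind_iff, exists_and_left] using h

theorem fsub_eq_some {c : Dbl} (h : a -ᶠ b = some c) :
    ∃ x y, a = some x ∧ b = some y ∧ Dbl.add x y.neg = some c := by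
  simpa only [fsub, bind_iff, exists_and_left] using h

theorem fmul_eq_some {c : Dbl} (h : a *ᶠ b = some c) :
    ∃ x y, a = some x ∧ b = some y ∧ Dbl.mul x y = some c := by
  simpa only [fmul, bind_iff, exists_and_left] using h

theorem fdiv_eq_some {c : Dbl} (h : a /ᶠ b = some c) :
    ∃ x y, a = some x ∧ b = some y ∧ Dbl.div x y = some c := by
  simpa only [fdiv, bind_iff, exists_and_left] using h

theorem fsqrt_eq_some {c : Dbl} (h : fsqrt a = some c) :
    ∃ x, a = some x ∧ Dbl.sqrt x = some c := by
  simpa only [fsqrt, bind_iff] using h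

theorem flt_eq_some {c : Bool} (h : (a <ᶠ b) = some c) :
    ∃ x y, a = some x ∧ b = some y ∧ Dbl.lt x y = c := by
  simpa only [flt, bind_iff, exists_and_left, pure_iff] using h

/-- `1 / (1 + ur)`, the least factor by which rounding changes a nonnegative number. -/
def kap : ℝ := 1 / (1 + ur)

theorem kap_pos : 0 < kap := by unfold kap; have := ur_pos; positivity

theorem kap_mul_le (hy : 0 ≤ y) : kap * y ≤ round53 y := by
  have := le_round53 hy
  have := ur_pos
  unfold kap
  rw [one_div, inv_mul_le_iff₀ (by positivity)]
  linarith

theorem kap_le_one : kap ≤ 1 := by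
  unfold kap; rw [div_le_one (by have := ur_pos; positivity)]; linarith [ur_pos]

theorem ub_of_fl (h : fl x = some d) (hr : 0 ≤ r) (hx : r ≤ x) :
    UB d (kap * r) := by
  rcases fl_cases h with ⟨rfl, -, -⟩ | ⟨rfl, -⟩
  · have := kap_mul_le (hr.trans hx)
    exact (mul_le_mul_of_nonneg_left hx kap_pos.le).trans this
  · simp only [UB, decide_eq_false_iff_not, not_lt]
    linarith

theorem UBo.add (ha : UBo a r) (hb : UBo b s) (h : 0 ≤ r + s) :
    UBo (a +ᶠ b) (kap * (r + s)) := by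
  intro c hc
  obtain ⟨x, y, hx, hy, hc⟩ := fadd_eq_some hc
  rcases (ha x hx).cases with (rfl | rfl) | ⟨x, rfl, hx⟩ <;>
  rcases (hb y hy).cases with (rfl | rfl) | ⟨y, rfl, hy⟩ <;>
  simp only [Dbl.add, Option.some.injEq] at hc <;> try (subst hc; simp [UB])
  exact ub_of_fl hc h (by linarith)

theorem UBo.mul (ha : UBo a r) (hb : UBo b s) (hr : 0 ≤ r) (hs : 0 ≤ s) :
    UBo (a *ᶠ b) (kap * (r * s)) := by
  intro c hc
  obtain ⟨x, y, hx, hy, hc⟩ := fmul_eq_some hc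
  rcases (ha x hx).cases with (rfl | rfl) | ⟨x, rfl, hx⟩ <;>
  rcases (hb y hy).cases with (rfl | rfl) | ⟨y, rfl, hy⟩ <;>
  simp only [Dbl.mul, Option.some.injEq] at hc <;> try (subst hc; simp [UB]; done)
  iterate 2
    · subst hc
      split_ifs with h0
      · trivial
      · simp only [UB, Bool.false_xor, decide_eq_false_iff_not, not_lt]; linarith
  · exact ub_of_fl hc (by positivity) (by gcongr; linarith)

/-- Scaling of a rounded number by a power of two is exact. -/
theorem UBo.two_zpow_mul (k : ℤ) (ha : UBo a r) (hr : 0 ≤ r)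
    (hR : ∀ c, a = some (.fin c) → round53 c = c) :
    UBo (some (const (2 ^ k)) *ᶠ a) (2 ^ k * r) := by
  intro c hc
  have hc' := hc
  obtain ⟨x, y, ⟨⟩, hy, hc⟩ := fmul_eq_some hc
  rcases (ha y hy).cases with (rfl | rfl) | ⟨y, rfl, hy'⟩
  · simp only [Dbl.mul, Option.some.injEq] at hc; subst hc; trivial
  · have hp : ¬ (2 : ℝ) ^ k < 0 := not_lt.2 (by positivity)
    simp only [Dbl.mul, Option.some.injEq] at hc; subst hc
    rw [if_neg (by positivity)]
    simp [UB, hp]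
  · simp only [Dbl.mul] at hc
    rcases fl_cases hc with ⟨rfl, -, -⟩ | ⟨rfl, -⟩
    · rw [round53_two_zpow_mul, hR y hy]
      change _ ≤ _
      gcongr
    · simp only [UB, decide_eq_false_iff_not, not_lt]
      have := hr.trans hy'
      positivity

/-- The constant `1 + EPS` makes up for the rounding in a sum and in the product. -/
theorem UBo.guard_add (ha : UBo a r) (hb : UBo b s) (h : 0 ≤ r + s) :
    UBo (some (const (1 + eps)) *ᶠ (a +ᶠ b)) (r + s) := by
  intro c hc
  obtain ⟨x, y, ⟨⟩, hy, hc⟩ := fmul_eq_some hc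
  have hpos : 0 < 1 + eps := by rw [eps_eq]; have := ur_pos; positivity
  rcases ((ha.add hb h) y hy).cases with (rfl | rfl) | ⟨y, rfl, hy'⟩
  · simp only [Dbl.mul, Option.some.injEq] at hc; subst hc; trivial
  · simp only [Dbl.mul, Option.some.injEq] at hc; subst hc
    rw [if_neg hpos.ne']
    simp [UB, hpos.le]
  · obtain ⟨p, q, hp, hq, hpq⟩ := fadd_eq_some hy
    rcases (ha p hp).cases with (rfl | rfl) | ⟨p, rfl, hp⟩ <;>
    rcases (hb q hq).cases with (rfl | rfl) | ⟨q, rfl, hq⟩ <;>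
    simp only [Dbl.add, Option.some.injEq, reduceCtorEq, ↓reduceIte] at hpq
    obtain ⟨rfl, -, -⟩ := fl_eq_fin hpq
    simp only [Dbl.mul] at hc
    have h3 := le_round53_mul_round53 (y := p + q) (by linarith)
    rcases fl_cases hc with ⟨rfl, -, -⟩ | ⟨rfl, -⟩
    · rw [eps_eq]
      change _ ≤ _
      linarith
    · simp only [UB, decide_eq_false_iff_not, not_lt]
      have := round53_nonneg (x := p + q) (by linarith)
      positivity

theorem bad_add_left {a b c : Dbl} (ha : Bad a) (h : Dbl.add a b = some c) : Bad c := by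
  rcases ha with rfl | rfl <;> rcases b with _ | (_ | _) | _ <;>
    simp only [Dbl.add, Option.some.injEq] at h <;> subst h <;> simp [Bad]

theorem bad_add_right {a b c : Dbl} (ha : Bad b) (h : Dbl.add a b = some c) : Bad c := by
  rcases ha with rfl | rfl <;> rcases a with _ | (_ | _) | _ <;>
    simp only [Dbl.add, Option.some.injEq] at h <;> subst h <;> simp [Bad]

theorem bad_mul {b c : Dbl} (hx : 0 < x) (hb : Bad b) (h : Dbl.mul (.fin x) b = some c) :
    Bad c := by
  rcases hb with rfl | rfl <;> simp only [Dbl.mul, Option.some.injEq] at h <;> subst h <;>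
    simp [Bad, hx.ne', hx.le]

theorem bad_div {b c : Dbl} (hx : 0 < x) (hb : Bad b) (h : Dbl.div b (.fin x) = some c) :
    Bad c := by
  rcases hb with rfl | rfl <;> simp only [Dbl.div, Option.some.injEq] at h <;> subst h <;>
    simp [Bad, hx.le]

/-! ### Finite results -/

/-- `c` is the finite floating-point result of an operation with exact value `x`. -/
structure FlEq (x c : ℝ) : Prop where
  eq : c = round53 x
  normal : IsNormal x
  lt : |c| < 2 ^ 1024

theorem FlEq.isNormal (h : FlEq x c) : IsNormal c := by
  rw [h.eq]; exact h.normal.round53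

theorem FlEq.fixed (h : FlEq x c) : round53 c = c := by
  rw [h.eq, round53_round53]

theorem FlEq.abs_sub_le (h : FlEq x c) : |c - x| ≤ ur * |x| := by
  rw [h.eq]; exact abs_round53_sub_le x

theorem FlEq.abs_sub_le' (h : FlEq x c) : |c - x| ≤ ur * |c| := by
  rw [h.eq]; exact abs_round53_sub_le' x

theorem FlEq.le (h : FlEq x c) (hx : 0 ≤ x) : c ≤ (1 + ur) * x := by
  rw [h.eq]; exact round53_le hx

theorem FlEq.ge (h : FlEq x c) (hx : 0 ≤ x) : x ≤ (1 + ur) * c := by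
  rw [h.eq]; exact le_round53 hx

theorem FlEq.nonneg (h : FlEq x c) (hx : 0 ≤ x) : 0 ≤ c := by
  rw [h.eq]; exact round53_nonneg hx

theorem FlEq.self (h : FlEq x c) : FlEq c c := ⟨h.fixed.symm, h.isNormal, h.lt⟩

theorem FlEq.arg_lt (h : FlEq x c) : x < 2 ^ 1024 := by
  by_contra hx
  have h1 := round53_mono (not_lt.1 hx)
  rw [← zpow_natCast, round53_two_zpow, zpow_natCast, ← h.eq] at h1
  exact absurd ((le_abs_self _).trans_lt h.lt) (not_lt.2 h1)

theorem flEq_of_fl (h : fl x = some (.fin c)) : FlEq x c :=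
  ⟨(fl_eq_fin h).1, (fl_eq_fin h).2.1, (fl_eq_fin h).2.2⟩

theorem fadd_fin (h : a +ᶠ b = some (.fin c)) :
    ∃ x y, a = some (.fin x) ∧ b = some (.fin y) ∧ FlEq (x + y) c := by
  obtain ⟨x, y, hx, hy, hc⟩ := fadd_eq_some h
  rcases x with x | _ | _ <;> rcases y with y | _ | _ <;>
    simp only [Dbl.add, Option.some.injEq, reduceCtorEq] at hc
  · exact ⟨x, y, hx, hy, flEq_of_fl hc⟩
  · split_ifs at hc

theorem Dbl.neg_eq_fin (h : d.neg = .fin x) : d = .fin (-x) := by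
  cases d <;> simp only [Dbl.neg, Dbl.fin.injEq, reduceCtorEq] at h
  subst h; simp

theorem Dbl.abs_eq_fin (h : d.abs = .fin x) : ∃ y, d = .fin y ∧ x = |y| := by
  cases d <;> simp only [Dbl.abs, Dbl.fin.injEq, reduceCtorEq] at h
  exact ⟨_, rfl, h.symm⟩

theorem fsub_fin (h : a -ᶠ b = some (.fin c)) :
    ∃ x y, a = some (.fin x) ∧ b = some (.fin y) ∧ FlEq (x - y) c := by
  obtain ⟨x, y, hx, hy, hc⟩ := fsub_eq_some h
  have : fadd (some x) (some y.neg) = some (.fin c) := hc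
  obtain ⟨x', y', h1, h2, h3⟩ := fadd_fin this
  rw [Option.some.injEq] at h1 h2
  subst h1
  rw [Dbl.neg_eq_fin h2] at hy
  exact ⟨x', -y', hx, hy, by rwa [sub_neg_eq_add]⟩

theorem fmul_fin (h : a *ᶠ b = some (.fin c)) :
    ∃ x y, a = some (.fin x) ∧ b = some (.fin y) ∧ FlEq (x * y) c := by
  obtain ⟨x, y, hx, hy, hc⟩ := fmul_eq_some h
  rcases x with x | _ | _ <;> rcases y with y | _ | _ <;>
    simp only [Dbl.mul, Option.some.injEq, reduceCtorEq] at hc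
  · exact ⟨x, y, hx, hy, flEq_of_fl hc⟩
  all_goals split_ifs at hc

theorem fdiv_fin (h : a /ᶠ b = some (.fin c)) :
    (∃ x y, a = some (.fin x) ∧ b = some (.fin y) ∧ y ≠ 0 ∧ FlEq (x / y) c) ∨
    (∃ x s, a = some (.fin x) ∧ b = some (.inf s) ∧ c = 0) := by
  obtain ⟨x, y, hx, hy, hc⟩ := fdiv_eq_some h
  cases x with
  | fin x => cases y with
    | fin y =>
      simp only [Dbl.div] at hc
      split_ifs at hc with h1 h2
      · simp at hc
      · simp at hc
      · exact Or.inl ⟨x, y, hx, hy, h1, flEq_of_fl hc⟩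
    | inf t =>
      simp only [Dbl.div, Option.some.injEq, Dbl.fin.injEq] at hc
      exact Or.inr ⟨x, t, hx, hy, hc.symm⟩
    | nan => simp [Dbl.div] at hc
  | inf s => cases y <;> simp [Dbl.div] at hc
  | nan => simp [Dbl.div] at hc

theorem fsqrt_fin (h : fsqrt a = some (.fin c)) :
    ∃ x, a = some (.fin x) ∧ 0 ≤ x ∧ FlEq (√x) c := by
  obtain ⟨x, hx, hc⟩ := fsqrt_eq_some h
  cases x with
  | fin x =>
    simp only [Dbl.sqrt] at hc
    split_ifs at hc with h1
    · simp at hc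
    · exact ⟨x, hx, not_lt.1 h1, flEq_of_fl hc⟩
  | inf s => cases s <;> simp [Dbl.sqrt] at hc
  | nan => simp [Dbl.sqrt] at hc

theorem abs_fin (h : some d.abs = some (Dbl.fin x)) :
    ∃ y, d = .fin y ∧ x = |y| := Dbl.abs_eq_fin (by simpa using h)

theorem UBo.div_nonneg (ha : UBo a 0) (hb : UBo b 0) : UBo (a /ᶠ b) 0 := by
  intro c hc
  obtain ⟨x, y, hx, hy, hc⟩ := fdiv_eq_some hc
  rcases (ha x hx).cases with (rfl | rfl) | ⟨x, rfl, hx⟩ <;>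
  rcases (hb y hy).cases with (rfl | rfl) | ⟨y, rfl, hy⟩ <;>
  simp only [Dbl.div, Option.some.injEq] at hc <;> try (subst hc; simp [UB]; done)
  · subst hc; simpa [UB]
  · split_ifs at hc with h1 h2
    · cases hc; trivial
    · cases hc; simpa [UB]
    · have := ub_of_fl hc le_rfl (by positivity)
      simpa using this

theorem UBo.add_nonneg (ha : UBo a 0) (hb : UBo b 0) : UBo (a +ᶠ b) 0 := by
  simpa using ha.add hb (by simp)

theorem UBo.mul_nonneg (ha : UBo a 0) (hb : UBo b 0) : UBo (a *ᶠ b) 0 := by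
  simpa using ha.mul hb le_rfl le_rfl

theorem ubo_sq (d : Dbl) : UBo (some d *ᶠ some d) 0 := by
  intro c hc
  obtain ⟨x, y, ⟨⟩, ⟨⟩, hc⟩ := fmul_eq_some hc
  cases d with
  | fin x =>
    have := ub_of_fl hc le_rfl (mul_self_nonneg x)
    simpa using this
  | inf s => simp only [Dbl.mul, Option.some.injEq] at hc; subst hc; simp [UB]
  | nan => simp only [Dbl.mul, Option.some.injEq] at hc; subst hc; trivial

theorem ubo_sqrt (a : FP) : UBo (fsqrt a) 0 := by
  intro c hc
  obtain ⟨x, hx, hc⟩ := fsqrt_eq_some hc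
  cases x with
  | fin x =>
    simp only [Dbl.sqrt] at hc
    split_ifs at hc with h1
    · cases hc; trivial
    · have := ub_of_fl hc le_rfl (Real.sqrt_nonneg x)
      simpa using this
  | inf s => cases s <;> (simp only [Dbl.sqrt, Option.some.injEq] at hc; subst hc; simp [UB])
  | nan => simp only [Dbl.sqrt, Option.some.injEq] at hc; subst hc; trivial

theorem ubo_abs (d : Dbl) : UBo (some d.abs) 0 := (ub_abs d).some

theorem eps_nonneg : 0 ≤ eps := by rw [eps_eq]; have := ur_pos; positivity

theorem ubo_EPS : UBo (some EPS) 0 := ubo_const eps_nonneg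

theorem ubo_HALFEPS : UBo (some HALFEPS) 0 := ubo_const (by have := eps_nonneg; positivity)

theorem Dbl.lt_true {x : Dbl} {c r : ℝ} (hx : UB x r) (h : Dbl.lt x (.fin c) = true) :
    r < c ∧ ∃ y, x = .fin y ∧ y < c := by
  rcases hx.cases with (rfl | rfl) | ⟨y, rfl, hy⟩ <;>
    simp only [Dbl.lt, decide_eq_true_eq, reduceCtorEq] at h
  exact ⟨lt_of_le_of_lt hy h, y, rfl, h⟩

/-! ### The modulus of an exact complex number -/

/-- `x` is the finite complex number `f`. -/
structure IsC (x : XComplex) (f : ℂ) : Prop where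
  re : x.re = .fin f.re
  im : x.im = .fin f.im
  nre : IsNormal f.re
  nim : IsNormal f.im

theorem IsC.unique {x : XComplex} {f g : ℂ} (hf : IsC x f) (hg : IsC x g) : f = g := by
  apply Complex.ext
  · have := hf.re.symm.trans hg.re; simpa using this
  · have := hf.im.symm.trans hg.im; simpa using this

theorem IsC.neg {x : XComplex} {f : ℂ} (h : IsC x f) : IsC x.neg (-f) :=
  ⟨by simp [XComplex.neg, h.re, Dbl.neg], by simp [XComplex.neg, h.im, Dbl.neg],
    by simpa using h.nre.neg, by simpa using h.nim.neg⟩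

protected theorem XComplex.neg_neg (x : XComplex) : x.neg.neg = x := by
  rcases x with ⟨a, b⟩; cases a <;> cases b <;> simp [XComplex.neg, Dbl.neg]

theorem isC_zero : IsC .zero 0 :=
  ⟨rfl, rfl, isNormal_zero, isNormal_zero⟩

theorem isC_ofDbl {x : ℝ} (hx : IsNormal x) : IsC (.ofDbl (.fin x)) (x : ℂ) :=
  ⟨by simp [XComplex.ofDbl], by simp [XComplex.ofDbl], by simpa using hx,
    by simpa using isNormal_zero⟩

theorem sqrt_re_im (f : ℂ) : √(f.re ^ 2 + f.im ^ 2) = ‖f‖ := by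
  rw [Complex.norm_def, Complex.normSq_apply]; ring_nf

theorem norm_le_re_im (z : ℂ) : ‖z‖ ≤ |z.re| + |z.im| := Complex.norm_le_abs_re_add_abs_im z

theorem two_zpow_le_norm {f : ℂ} (h1 : IsNormal f.re) (h2 : IsNormal f.im) (h : f ≠ 0) :
    (2 : ℝ) ^ (-1022 : ℤ) ≤ ‖f‖ := by
  rcases h1 with h1 | h1
  · rcases h2 with h2 | h2
    · exact absurd (Complex.ext h1 h2) h
    · exact h2.trans (Complex.abs_im_le_norm f)
  · exact h1.trans (Complex.abs_re_le_norm f)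

theorem hypot_spec (M : Machine) {x : XComplex} {f : ℂ} (h : IsC x f) :
    (f = 0 ∧ |M.hypot f.re f.im| ≤ 2 ^ (-1074 : ℤ)) ∨
    (f ≠ 0 ∧ |M.hypot f.re f.im - ‖f‖| ≤ 2 * ur * ‖f‖) := by
  have hf := M.hypot_faithful f.re f.im
  rw [sqrt_re_im] at hf
  rcases eq_or_ne f 0 with h0 | h0
  · refine Or.inl ⟨h0, ?_⟩
    rw [show ‖f‖ = 0 by simp [h0]] at hf
    exact hf.abs_le_of_zero
  · exact Or.inr ⟨h0, hf.abs_sub_le (two_zpow_le_norm h.nre h.nim h0)⟩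

theorem fhypot_fin (M : Machine) {x : XComplex} {f : ℂ} (h : IsC x f) :
    (M.fhypot x.re x.im = .fin (M.hypot f.re f.im)) ∨
    (M.fhypot x.re x.im = .inf false ∧ 2 ^ 1024 ≤ |M.hypot f.re f.im|) := by
  rw [h.re, h.im]
  unfold Machine.fhypot
  by_cases hh : |M.hypot f.re f.im| < 2 ^ 1024
  · left; simp only [if_pos hh]
  · right; simp only [if_neg hh, true_and]; exact not_lt.1 hh

theorem two_zpow_neg_le : (2 : ℝ) ^ (-1074 : ℤ) ≤ 1 / 2 := by
  have : (2 : ℝ) ^ (-1074 : ℤ) ≤ 2 ^ (-1 : ℤ) := zpow_le_zpow_right₀ (by norm_num) (by norm_num)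
  rwa [zpow_neg_one, ← one_div] at this

theorem one_lt_two_pow_1024 : (1 : ℝ) < 2 ^ 1024 := one_lt_pow₀ (by norm_num) (by norm_num)

/-- A number with modulus below the least normal double does not survive a multiplication by
a factor below two. -/
theorem fl_eq_zero_of_tiny {k h c : ℝ} (hk : |k| ≤ 2) (hh : |h| ≤ 2 ^ (-1074 : ℤ))
    (hfl : FlEq (k * h) c) : c = 0 := by
  rcases hfl.normal with h1 | h1
  · rw [hfl.eq, h1, round53_zero]
  · exfalso
    have h2 : |k * h| ≤ 2 * 2 ^ (-1074 : ℤ) := by rw [abs_mul]; gcongr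
    have h3 : (2 : ℝ) * 2 ^ (-1074 : ℤ) < 2 ^ (-1022 : ℤ) := by
      rw [show (-1022 : ℤ) = 52 + -1074 by norm_num, zpow_add₀ (by norm_num)]
      have : (0 : ℝ) < 2 ^ (-1074 : ℤ) := by positivity
      nlinarith
    linarith

theorem neg_le_hypot (M : Machine) (x y : ℝ) : -2 ^ (-1074 : ℤ) ≤ M.hypot x y := by
  by_contra hc
  push Not at hc
  have hp : (0 : ℝ) < 2 ^ (-1074 : ℤ) := by positivity
  have h2 : IsRepresentable (-2 ^ (-1074 : ℤ)) := by
    simpa using isRepresentable_intCast_mul (m := -1) (e := -1074) (by norm_num) le_rfl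
  have hs := Real.sqrt_nonneg (x ^ 2 + y ^ 2)
  refine (M.hypot_faithful x y).2 _ h2 ?_
  rw [min_eq_left (by linarith), max_eq_right (by linarith)]
  constructor <;> linarith

theorem ubo_mul_fhypot (M : Machine) {k : ℝ} (hk : 0 < k) (hk2 : k ≤ 2) (x : XComplex) :
    UBo (some (const k) *ᶠ some (M.fhypot x.re x.im)) 0 := by
  intro d hd
  obtain ⟨_, y, ⟨⟩, ⟨⟩, hd⟩ := fmul_eq_some hd
  have hinf : Dbl.mul (const k) (.inf false) = some d → UB d 0 := by
    intro h
    simp only [Dbl.mul, Option.some.injEq] at h; subst h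
    simp [UB, hk.ne', hk.le]
  have hnan : Dbl.mul (const k) .nan = some d → UB d 0 := by
    intro h
    simp only [Dbl.mul, Option.some.injEq] at h; subst h
    trivial
  cases hx : x.re with
  | fin a => cases hy : x.im with
    | fin b =>
      rw [hx, hy] at hd
      unfold Machine.fhypot at hd
      by_cases hh : |M.hypot a b| < 2 ^ 1024
      · simp only [if_pos hh, Dbl.mul] at hd
        have h1 := neg_le_hypot M a b
        rcases le_or_gt 0 (M.hypot a b) with h2 | h2
        · simpa using ub_of_fl hd le_rfl (by positivity)
        · rcases fl_cases hd with ⟨rfl, h3, h4⟩ | ⟨rfl, h3⟩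
          · have := fl_eq_zero_of_tiny (k := k) (h := M.hypot a b)
              (by rw [abs_of_pos hk]; exact hk2)
              (by rw [abs_of_neg h2]; linarith) ⟨rfl, h3, h4⟩
            rw [this]; exact le_rfl
          · exfalso
            have h5 : |k * M.hypot a b| ≤ 1 := by
              rw [abs_mul, abs_of_pos hk, abs_of_neg h2]
              have := two_zpow_neg_le
              generalize (2 : ℝ) ^ (-1074 : ℤ) = T at *
              nlinarith
            rw [abs_round53] at h3
            have := round53_mono h5
            rw [round53_one] at this
            exact absurd (h3.trans this) (not_le.2 one_lt_two_pow_1024)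
      · simp only [if_neg hh] at hd
        exact hinf hd
    | inf s => rw [hx, hy] at hd; exact hinf hd
    | nan => rw [hx, hy] at hd; exact hnan hd
  | inf s => rw [hx] at hd; exact hinf hd
  | nan => cases hy : x.im with
    | fin b => rw [hx, hy] at hd; exact hnan hd
    | inf s => rw [hx, hy] at hd; exact hinf hd
    | nan => rw [hx, hy] at hd; exact hnan hd

theorem ubo_absUB (M : Machine) (x : XComplex) : UBo (x.absUB M) 0 :=
  ubo_mul_fhypot M (by have := eps_nonneg; positivity)
    (by rw [eps_eq]; linarith [ur_le]) x

theorem absUB_spec {M : Machine} {x : XComplex} {f : ℂ} (h : IsC x f) {d : Dbl}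
    (hd : x.absUB M = some d) :
    UB d ‖f‖ ∧ ∀ a, d = .fin a → 0 ≤ a ∧ a ≤ (1 + 7.01 * ur) * ‖f‖ ∧ ‖f‖ ≤ a ∧
      round53 a = a := by
  have hu := ur_pos
  have hu' := ur_le
  unfold XComplex.absUB at hd
  rcases fhypot_fin M h with h1 | ⟨h1, -⟩
  · rw [h1] at hd
    obtain ⟨_, _, ⟨⟩, ⟨⟩, hd'⟩ := fmul_eq_some hd
    rcases hypot_spec M h with ⟨h0, h2⟩ | ⟨h0, h2⟩
    · have hn : ‖f‖ = 0 := by simp [h0]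
      have hd0 := ubo_absUB M x d (by unfold XComplex.absUB; rw [h1]; exact hd)
      refine ⟨by rwa [hn], ?_⟩
      rintro a rfl
      have := fl_eq_zero_of_tiny (by rw [abs_of_pos (by rw [eps_eq]; positivity), eps_eq]; linarith)
        h2 (flEq_of_fl hd')
      subst this
      rw [hn]
      exact ⟨le_rfl, by simp, le_rfl, round53_zero⟩
    · have hn := norm_nonneg f
      obtain ⟨h3, h4⟩ := abs_le.1 h2
      set H := M.hypot f.re f.im
      have hH : 0 ≤ H := by nlinarith
      have key : ∀ a, FlEq ((1 + 2 * eps) * H) a → 0 ≤ a ∧ a ≤ (1 + 7.01 * ur) * ‖f‖ ∧ ‖f‖ ≤ a ∧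
          round53 a = a := by
        intro a ha
        have h5 : 0 ≤ (1 + 2 * eps) * H := by have := eps_nonneg; positivity
        refine ⟨ha.nonneg h5, ?_, ?_, ha.fixed⟩
        · refine (ha.le h5).trans ?_
          calc (1 + ur) * ((1 + 2 * eps) * H) ≤ (1 + ur) * ((1 + 2 * eps) * ((1 + 2 * ur) * ‖f‖)) := by
                have := eps_nonneg
                gcongr; linarith
            _ = ((1 + ur) * (1 + 2 * eps) * (1 + 2 * ur)) * ‖f‖ := by ring
            _ ≤ _ := by
              gcongr
              norm_num [eps_eq, ur_eq]
        · have h6 := ha.ge h5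
          have h7 : (1 + ur) * ‖f‖ ≤ (1 + 2 * eps) * H := by
            calc (1 + ur) * ‖f‖ ≤ ((1 + 2 * eps) * (1 - 2 * ur)) * ‖f‖ := by
                  gcongr
                  norm_num [eps_eq, ur_eq]
              _ ≤ _ := by
                rw [mul_assoc]
                have := eps_nonneg
                gcongr; linarith
          exact le_of_mul_le_mul_left (h7.trans h6) (by positivity)
      refine ⟨?_, fun a ha => key a (by subst ha; exact flEq_of_fl hd')⟩
      rcases fl_cases hd' with ⟨rfl, h3, h4⟩ | ⟨rfl, h3⟩
      · exact (key _ ⟨rfl, h3, h4⟩).2.2.1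
      · simp only [UB, decide_eq_false_iff_not, not_lt]
        have := eps_nonneg; positivity
  · rw [h1] at hd
    obtain ⟨_, _, ⟨⟩, ⟨⟩, hd⟩ := fmul_eq_some hd
    have hp : (0 : ℝ) < 1 + 2 * eps := by have := eps_nonneg; positivity
    simp only [Dbl.mul, Option.some.injEq] at hd; subst hd
    rw [if_neg hp.ne']
    simp [UB, hp.le]

theorem absLB_spec {M : Machine} {x : XComplex} {f : ℂ} (h : IsC x f) {d : Dbl}
    (hd : x.absLB M = some d) :
    (∃ a, d = .fin a ∧ 0 ≤ a ∧ a ≤ ‖f‖ ∧ (1 - 8 * ur) * ‖f‖ ≤ a) ∨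
      (d = .inf false ∧ 2 ^ 1024 * (1 - 2 * ur) ≤ ‖f‖) := by
  have hu := ur_pos
  have hu' := ur_le
  unfold XComplex.absLB at hd
  have hp : (0 : ℝ) < 1 - 2 * eps := by rw [eps_eq]; linarith
  rcases fhypot_fin M h with h1 | ⟨h1, h2⟩
  · rw [h1] at hd
    obtain ⟨_, _, ⟨⟩, ⟨⟩, hd'⟩ := fmul_eq_some hd
    rcases hypot_spec M h with ⟨h0, h2⟩ | ⟨h0, h2⟩
    · have hn : ‖f‖ = 0 := by simp [h0]
      left
      rcases fl_cases hd' with ⟨rfl, h3, h4⟩ | ⟨rfl, h3⟩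
      · have := fl_eq_zero_of_tiny (by rw [abs_of_pos hp, eps_eq]; linarith) h2 ⟨rfl, h3, h4⟩
        rw [this]
        exact ⟨0, rfl, le_rfl, norm_nonneg f, by rw [hn]; simp⟩
      · exfalso
        have h5 : |(1 - 2 * eps) * M.hypot f.re f.im| ≤ 1 := by
          rw [abs_mul, abs_of_pos hp]
          have := two_zpow_neg_le
          have h6 := eps_nonneg
          have h7 := abs_nonneg (M.hypot f.re f.im)
          generalize (2 : ℝ) ^ (-1074 : ℤ) = T at *
          nlinarith
        rw [abs_round53] at h3
        have := round53_mono h5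
        rw [round53_one] at this
        exact absurd (h3.trans this) (not_le.2 one_lt_two_pow_1024)
    · have hn := norm_nonneg f
      obtain ⟨h3, h4⟩ := abs_le.1 h2
      set H := M.hypot f.re f.im
      have hH : 0 ≤ H := by nlinarith
      have h5 : 0 ≤ (1 - 2 * eps) * H := by positivity
      have hle : round53 ((1 - 2 * eps) * H) ≤ ‖f‖ := by
        refine (round53_le h5).trans ?_
        calc (1 + ur) * ((1 - 2 * eps) * H) ≤ (1 + ur) * ((1 - 2 * eps) * ((1 + 2 * ur) * ‖f‖)) := by
              gcongr; linarith
          _ = ((1 + ur) * (1 - 2 * eps) * (1 + 2 * ur)) * ‖f‖ := by ring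
          _ ≤ 1 * ‖f‖ := by
            gcongr
            norm_num [eps_eq, ur_eq]
          _ = ‖f‖ := one_mul _
      rcases fl_cases hd' with ⟨rfl, -, -⟩ | ⟨rfl, h6⟩
      · left
        refine ⟨_, rfl, round53_nonneg h5, hle, ?_⟩
        refine le_trans ?_ (kap_mul_le h5)
        calc (1 - 8 * ur) * ‖f‖ ≤ (kap * (1 - 2 * eps) * (1 - 2 * ur)) * ‖f‖ := by
              gcongr
              unfold kap; norm_num [eps_eq, ur_eq]
          _ = kap * ((1 - 2 * eps) * ((1 - 2 * ur) * ‖f‖)) := by ring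
          _ ≤ _ := by
            have := kap_pos
            gcongr; linarith
      · right
        refine ⟨by simp only [Dbl.inf.injEq, decide_eq_false_iff_not, not_lt]; exact h5, ?_⟩
        rw [abs_of_nonneg (round53_nonneg h5)] at h6
        have : (0 : ℝ) < 2 ^ 1024 := by positivity
        generalize (2 : ℝ) ^ 1024 = T at *
        nlinarith
  · rw [h1] at hd
    obtain ⟨_, _, ⟨⟩, ⟨⟩, hd⟩ := fmul_eq_some hd
    simp only [Dbl.mul, Option.some.injEq] at hd; subst hd
    right
    refine ⟨by simp [hp.ne', not_lt.2 hp.le, -sub_neg], ?_⟩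
    have h1024 := one_lt_two_pow_1024
    rcases hypot_spec M h with ⟨h0, h3⟩ | ⟨h0, h3⟩
    · have := two_zpow_neg_le
      generalize (2 : ℝ) ^ 1024 = T at *
      generalize (2 : ℝ) ^ (-1074 : ℤ) = T' at *
      linarith
    · have hn := norm_nonneg f
      obtain ⟨h4, h5⟩ := abs_le.1 h3
      have hH : 0 ≤ M.hypot f.re f.im := by nlinarith
      rw [abs_of_nonneg hH] at h2
      generalize (2 : ℝ) ^ 1024 = T at *
      have : T ≤ (1 + 2 * ur) * ‖f‖ := by linarith
      have h6 : (1 - 2 * ur) * T ≤ (1 - 2 * ur) * ((1 + 2 * ur) * ‖f‖) :=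
        mul_le_mul_of_nonneg_left this (by linarith)
      nlinarith

/-! ### Arithmetic of complex numbers -/

theorem HALFEPS_eq : HALFEPS = const (2 ^ (-53 : ℤ)) := by
  unfold HALFEPS eps; norm_num

theorem const_two_eps : const (2 * eps) = const (2 ^ (-51 : ℤ)) := by
  unfold eps; norm_num

theorem fixed_of_fmul {a b : FP} {c : ℝ} (h : a *ᶠ b = some (.fin c)) : round53 c = c := by
  obtain ⟨_, _, _, _, h⟩ := fmul_fin h
  exact h.fixed

theorem ubo_abs_fin (x : ℝ) : UBo (some (Dbl.fin x).abs) |x| := UB.some (le_refl |x|)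

theorem norm_sub_mk_le {v c : ℂ} {k : ℝ} (h1 : |c.re - v.re| ≤ k * |c.re|)
    (h2 : |c.im - v.im| ≤ k * |c.im|) : ‖v - c‖ ≤ k * (|c.re| + |c.im|) := by
  refine (norm_le_re_im _).trans ?_
  rw [Complex.sub_re, Complex.sub_im, abs_sub_comm v.re, abs_sub_comm v.im]
  linarith

theorem norm_le_mul_of_components {v w : ℂ} {k : ℝ} (hk : 0 ≤ k) (h1 : |v.re| ≤ k * |w.re|)
    (h2 : |v.im| ≤ k * |w.im|) : ‖v‖ ≤ k * ‖w‖ := by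
  rw [← sqrt_re_im, ← sqrt_re_im]
  refine Real.sqrt_le_iff.2 ⟨by positivity, ?_⟩
  rw [mul_pow, Real.sq_sqrt (by positivity), ← sq_abs v.re, ← sq_abs v.im, ← sq_abs w.re,
    ← sq_abs w.im]
  have h3 := pow_le_pow_left₀ (abs_nonneg _) h1 2
  have h4 := pow_le_pow_left₀ (abs_nonneg _) h2 2
  rw [mul_pow] at h3 h4
  linarith

theorem ubo_half_sum (p q : ℝ) :
    UBo (some HALFEPS *ᶠ (some (const (1 + eps)) *ᶠ
      (some (Dbl.fin p).abs +ᶠ some (Dbl.fin q).abs))) (ur * (|p| + |q|)) := by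
  rw [HALFEPS_eq]
  exact UBo.two_zpow_mul (-53)
    (UBo.guard_add (ubo_abs_fin p) (ubo_abs_fin q) (by positivity)) (by positivity)
    (fun c hc => fixed_of_fmul hc)

theorem XComplex.finC_of_pair {re im : Dbl} {e : ℝ}
    (h : some HALFEPS *ᶠ (some (const (1 + eps)) *ᶠ (some re.abs +ᶠ some im.abs)) =
      some (.fin e)) : (∃ p, re = .fin p) ∧ ∃ q, im = .fin q := by
  obtain ⟨_, _, -, h1, -⟩ := fmul_fin h
  obtain ⟨_, _, -, h2, -⟩ := fmul_fin h1
  obtain ⟨_, _, h3, h4, -⟩ := fadd_fin h2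
  obtain ⟨p, rfl, -⟩ := abs_fin h3
  obtain ⟨q, rfl, -⟩ := abs_fin h4
  exact ⟨⟨p, rfl⟩, ⟨q, rfl⟩⟩

theorem norm_sub_le_of_flEq {v : ℂ} {p q : ℝ} (hp : FlEq v.re p) (hq : FlEq v.im q) :
    ‖v - ⟨p, q⟩‖ ≤ ur * ‖v‖ := by
  refine norm_le_mul_of_components ur_pos.le ?_ ?_
  · rw [Complex.sub_re, abs_sub_comm]; exact hp.abs_sub_le
  · rw [Complex.sub_im, abs_sub_comm]; exact hq.abs_sub_le

/-- The common part of the sum and the product with a double. -/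
theorem pair_sound {re im d : Dbl} {e : ℝ} {v : ℂ}
    (hre : ∀ p, re = .fin p → FlEq v.re p) (him : ∀ q, im = .fin q → FlEq v.im q)
    (hd : some HALFEPS *ᶠ (some (const (1 + eps)) *ᶠ (some re.abs +ᶠ some im.abs)) = some d)
    (he : d = .fin e) :
    ∃ c, IsC ⟨re, im⟩ c ∧ ‖v - c‖ ≤ e ∧ ‖v - c‖ ≤ ur * ‖v‖ := by
  subst he
  obtain ⟨⟨p, rfl⟩, q, rfl⟩ := XComplex.finC_of_pair hd
  have hp := hre p rfl
  have hq := him q rfl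
  refine ⟨⟨p, q⟩, ⟨rfl, rfl, hp.isNormal, hq.isNormal⟩, ?_, norm_sub_le_of_flEq hp hq⟩
  exact (norm_sub_mk_le hp.abs_sub_le' hq.abs_sub_le').trans (ubo_half_sum p q _ hd)

theorem flEq_of_fadd {x y c : ℝ} (h : some (Dbl.fin x) +ᶠ some (Dbl.fin y) = some (.fin c)) :
    FlEq (x + y) c := by
  obtain ⟨_, _, ⟨⟩, ⟨⟩, h⟩ := fadd_fin h; exact h

theorem flEq_of_fmul {x y c : ℝ} (h : some (Dbl.fin x) *ᶠ some (Dbl.fin y) = some (.fin c)) :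
    FlEq (x * y) c := by
  obtain ⟨_, _, ⟨⟩, ⟨⟩, h⟩ := fmul_fin h; exact h

theorem flEq_of_fdiv {x y c : ℝ} (h : some (Dbl.fin x) /ᶠ some (Dbl.fin y) = some (.fin c)) :
    y ≠ 0 ∧ FlEq (x / y) c := by
  rcases fdiv_fin h with ⟨_, _, ⟨⟩, ⟨⟩, h0, h⟩ | ⟨_, _, _, h, _⟩
  · exact ⟨h0, h⟩
  · cases h

namespace XComplex

variable {x y : XComplex} {r : AComplex} {a b : ℂ} {e : ℝ} {t : Dbl}

theorem add_eq_some (h : x.add y = some r) : ∃ re im d,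
    some x.re +ᶠ some y.re = some re ∧ some x.im +ᶠ some y.im = some im ∧
    some HALFEPS *ᶠ (some (const (1 + eps)) *ᶠ (some re.abs +ᶠ some im.abs)) = some d ∧
    ⟨⟨re, im⟩, d⟩ = r := by
  simpa only [XComplex.add, bind_iff, pure_iff, exists_and_left] using h

theorem mulD_eq_some (h : x.mulD t = some r) : ∃ re im d,
    some x.re *ᶠ some t = some re ∧ some x.im *ᶠ some t = some im ∧
    some HALFEPS *ᶠ (some (const (1 + eps)) *ᶠ (some re.abs +ᶠ some im.abs)) = some d ∧
    ⟨⟨re, im⟩, d⟩ = r := by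
  simpa only [XComplex.mulD, bind_iff, pure_iff, exists_and_left] using h

theorem ubo_half_abs (re im : Dbl) :
    UBo (some HALFEPS *ᶠ (some (const (1 + eps)) *ᶠ (some re.abs +ᶠ some im.abs))) 0 :=
  ubo_HALFEPS.mul_nonneg ((ubo_const (by have := eps_nonneg; positivity)).mul_nonneg
    ((ubo_abs re).add_nonneg (ubo_abs im)))

theorem add_nonneg (h : x.add y = some r) : UB r.e 0 := by
  obtain ⟨re, im, d, -, -, h3, rfl⟩ := add_eq_some h
  exact ubo_half_abs re im d h3

theorem mulD_nonneg (h : x.mulD t = some r) : UB r.e 0 := by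
  obtain ⟨re, im, d, -, -, h3, rfl⟩ := mulD_eq_some h
  exact ubo_half_abs re im d h3

theorem add_sound (h : x.add y = some r) (hx : IsC x a) (hy : IsC y b) (he : r.e = .fin e) :
    ∃ c, IsC r.z c ∧ ‖a + b - c‖ ≤ e ∧ ‖a + b - c‖ ≤ ur * ‖a + b‖ := by
  obtain ⟨re, im, d, h1, h2, h3, rfl⟩ := add_eq_some h
  rw [hx.re, hy.re] at h1
  rw [hx.im, hy.im] at h2
  refine pair_sound (v := a + b) ?_ ?_ h3 he
  · rintro p rfl; exact flEq_of_fadd h1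
  · rintro p rfl; exact flEq_of_fadd h2

theorem mulD_sound {s : ℝ} (h : x.mulD (.fin s) = some r) (hx : IsC x a) (he : r.e = .fin e) :
    ∃ c, IsC r.z c ∧ ‖a * s - c‖ ≤ e ∧ ‖a * s - c‖ ≤ ur * ‖a * s‖ := by
  obtain ⟨re, im, d, h1, h2, h3, rfl⟩ := mulD_eq_some h
  rw [hx.re] at h1
  rw [hx.im] at h2
  refine pair_sound (v := a * s) ?_ ?_ h3 he
  · rintro p rfl
    rw [Complex.re_mul_ofReal]; exact flEq_of_fmul h1
  · rintro p rfl
    rw [Complex.im_mul_ofReal]; exact flEq_of_fmul h2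

theorem addD_eq_some (h : x.addD t = some r) : ∃ re d,
    some x.re +ᶠ some t = some re ∧ some HALFEPS *ᶠ some re.abs = some d ∧
    ⟨⟨re, x.im⟩, d⟩ = r := by
  simpa only [XComplex.addD, bind_iff, pure_iff, exists_and_left] using h

theorem addD_nonneg (h : x.addD t = some r) : UB r.e 0 := by
  obtain ⟨re, d, -, h3, rfl⟩ := addD_eq_some h
  exact ubo_HALFEPS.mul_nonneg (ubo_abs re) d h3

theorem re_sound {p s : ℝ} (hp : FlEq s p) {im : Dbl} {v : ℂ} (hv : v.re = s)
    (him : im = .fin v.im) (hn : IsNormal v.im)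
    (hd : some HALFEPS *ᶠ some (Dbl.fin p).abs = some (.fin e)) :
    ∃ c, IsC ⟨.fin p, im⟩ c ∧ ‖v - c‖ ≤ e ∧ ‖v - c‖ ≤ ur * ‖v‖ := by
  refine ⟨⟨p, v.im⟩, ⟨rfl, him, hp.isNormal, hn⟩, ?_, ?_⟩
  · have h1 : UBo (some HALFEPS *ᶠ some (Dbl.fin p).abs) (ur * |p|) := by
      rw [HALFEPS_eq]
      refine UBo.two_zpow_mul (-53) (ubo_abs_fin p) (by positivity) ?_
      rintro c hc
      simp only [Dbl.abs, Option.some.injEq, Dbl.fin.injEq] at hc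
      rw [← hc, ← abs_round53, hp.fixed]
    refine le_trans ?_ (h1 _ hd)
    refine (norm_le_re_im _).trans ?_
    rw [Complex.sub_re, Complex.sub_im, hv, abs_sub_comm]
    simpa using hp.abs_sub_le'
  · refine norm_le_mul_of_components ur_pos.le ?_ ?_
    · rw [Complex.sub_re, abs_sub_comm, hv]; exact hp.abs_sub_le
    · have := ur_pos
      simp only [Complex.sub_im, sub_self, abs_zero]; positivity

theorem addD_sound {s : ℝ} (h : x.addD (.fin s) = some r) (hx : IsC x a) (he : r.e = .fin e) :
    ∃ c, IsC r.z c ∧ ‖a + s - c‖ ≤ e ∧ ‖a + s - c‖ ≤ ur * ‖a + s‖ := by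
  obtain ⟨re, d, h1, h3, rfl⟩ := addD_eq_some h
  obtain rfl : d = .fin e := he
  obtain ⟨_, _, -, h4, -⟩ := fmul_fin h3
  obtain ⟨p, rfl, -⟩ := abs_fin h4
  rw [hx.re] at h1
  exact re_sound (flEq_of_fadd h1) (by simp) (by simpa using hx.im) (by simpa using hx.nim) h3

theorem mul_eq_some (h : x.mul y = some r) : ∃ re1 re2 im1 im2 d re im,
    some x.re *ᶠ some y.re = some re1 ∧ some x.im *ᶠ some y.im = some re2 ∧
    some x.re *ᶠ some y.im = some im1 ∧ some x.im *ᶠ some y.re = some im2 ∧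
    some EPS *ᶠ (some (const (1 + 2 * eps)) *ᶠ ((some re1.abs +ᶠ some re2.abs) +ᶠ
      (some im1.abs +ᶠ some im2.abs))) = some d ∧
    some re1 -ᶠ some re2 = some re ∧ some im1 +ᶠ some im2 = some im ∧ ⟨⟨re, im⟩, d⟩ = r := by
  simpa only [XComplex.mul, bind_iff, pure_iff, exists_and_left] using h

theorem mul_nonneg (h : x.mul y = some r) : UB r.e 0 := by
  obtain ⟨re1, re2, im1, im2, d, re, im, -, -, -, -, h5, -, -, rfl⟩ := mul_eq_some h
  exact ubo_EPS.mul_nonneg ((ubo_const (by have := eps_nonneg; positivity)).mul_nonneg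
    (((ubo_abs _).add_nonneg (ubo_abs _)).add_nonneg ((ubo_abs _).add_nonneg (ubo_abs _)))) d h5

end XComplex

/-- An operation does not overflow if one with a larger exact value does not. -/
theorem fin_of_fl_of_le {x y c : ℝ} {d : Dbl} (hy : FlEq y c) (hx : |x| ≤ y) (h : fl x = some d) :
    ∃ p, d = .fin p ∧ FlEq x p := by
  rcases fl_cases h with ⟨rfl, h1, h2⟩ | ⟨rfl, h2⟩
  · exact ⟨_, rfl, rfl, h1, h2⟩
  · exfalso
    rw [abs_round53] at h2
    have h3 := round53_mono hx
    rw [← hy.eq] at h3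
    have := (le_abs_self c).trans_lt hy.lt
    exact absurd (h2.trans h3) (not_le.2 this)

theorem sub_of_mul_error {t1 t2 p1 p2 q : ℝ} (h1 : |p1 - t1| ≤ ur * |p1|)
    (h2 : |p2 - t2| ≤ ur * |p2|) (hq : |q - (p1 + p2)| ≤ ur * |p1 + p2|) :
    |q - (t1 + t2)| ≤ 2 * ur * (|p1| + |p2|) := by
  have h3 : q - (t1 + t2) = (q - (p1 + p2)) + (p1 - t1) + (p2 - t2) := by ring
  rw [h3]
  have h4 := abs_add_three (q - (p1 + p2)) (p1 - t1) (p2 - t2)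
  have h5 := abs_add_le p1 p2
  have := ur_pos
  nlinarith

theorem abs_mul_add_le (a b : ℂ) : |a.re * b.re| + |a.im * b.im| ≤ ‖a‖ * ‖b‖ := by
  have h1 : (|a.re| * |b.re| + |a.im| * |b.im|) ^ 2 ≤ (‖a‖ * ‖b‖) ^ 2 := by
    rw [mul_pow, ← sqrt_re_im a, ← sqrt_re_im b, Real.sq_sqrt (by positivity),
      Real.sq_sqrt (by positivity), ← sq_abs a.re, ← sq_abs a.im, ← sq_abs b.re, ← sq_abs b.im]
    nlinarith [sq_nonneg (|a.re| * |b.im| - |a.im| * |b.re|)]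
  rw [abs_mul, abs_mul]
  exact (le_abs_self _).trans (abs_le_of_sq_le_sq h1 (by positivity))

theorem abs_mul_add_le' (a b : ℂ) : |a.re * b.im| + |a.im * b.re| ≤ ‖a‖ * ‖b‖ := by
  have h : ‖(⟨b.im, b.re⟩ : ℂ)‖ = ‖b‖ := by rw [← sqrt_re_im, ← sqrt_re_im, add_comm]
  rw [← h]; exact abs_mul_add_le a ⟨b.im, b.re⟩

theorem abs_le_of_flEq {x p : ℝ} (h : FlEq x p) : |p| ≤ (1 + ur) * |x| := by
  have h1 := h.abs_sub_le
  have h2 := abs_sub_abs_le_abs_sub p x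
  linarith

theorem abs_le_of_flEq' {x p : ℝ} (h : FlEq x p) : |x| ≤ (1 + ur) * |p| := by
  have h1 := h.abs_sub_le'
  have h2 := abs_sub_abs_le_abs_sub x p
  rw [abs_sub_comm] at h2
  linarith

theorem XComplex.mul_sound {x y : XComplex} {r : AComplex} {a b : ℂ} {e : ℝ}
    (h : x.mul y = some r) (hx : IsC x a) (hy : IsC y b) (he : r.e = .fin e) :
    ∃ c, IsC r.z c ∧ ‖a * b - c‖ ≤ e ∧ ‖a * b - c‖ ≤ 5 * ur * (‖a‖ * ‖b‖) := by
  obtain ⟨re1, re2, im1, im2, d, re, im, h1, h2, h3, h4, h5, h6, h7, rfl⟩ :=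
    XComplex.mul_eq_some h
  obtain rfl : d = .fin e := he
  obtain ⟨_, _, -, h8, -⟩ := fmul_fin h5
  obtain ⟨_, _, -, h9, -⟩ := fmul_fin h8
  obtain ⟨_, _, h10, h11, -⟩ := fadd_fin h9
  obtain ⟨_, _, h12, h13, hs⟩ := fadd_fin h10
  obtain ⟨_, _, h14, h15, hs'⟩ := fadd_fin h11
  obtain ⟨p1, rfl, rfl⟩ := abs_fin h12
  obtain ⟨p2, rfl, rfl⟩ := abs_fin h13
  obtain ⟨p3, rfl, rfl⟩ := abs_fin h14
  obtain ⟨p4, rfl, rfl⟩ := abs_fin h15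
  rw [hx.re, hy.re] at h1
  rw [hx.im, hy.im] at h2
  rw [hx.re, hy.im] at h3
  rw [hx.im, hy.re] at h4
  have f1 := flEq_of_fmul h1
  have f2 := flEq_of_fmul h2
  have f3 := flEq_of_fmul h3
  have f4 := flEq_of_fmul h4
  obtain ⟨_, _, ⟨⟩, ⟨⟩, h6⟩ := fsub_eq_some h6
  obtain ⟨_, _, ⟨⟩, ⟨⟩, h7⟩ := fadd_eq_some h7
  obtain ⟨p, rfl, fp⟩ := fin_of_fl_of_le hs
    ((abs_add_le p1 (-p2)).trans (by rw [abs_neg])) h6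
  obtain ⟨q, rfl, fq⟩ := fin_of_fl_of_le hs' (abs_add_le p3 p4) h7
  have g1 := sub_of_mul_error (t2 := -(a.im * b.im)) (p2 := -p2) f1.abs_sub_le'
    (by rw [abs_neg, neg_sub_neg, abs_sub_comm]; exact f2.abs_sub_le') fp.abs_sub_le
  have g2 := sub_of_mul_error f3.abs_sub_le' f4.abs_sub_le' fq.abs_sub_le
  rw [abs_neg] at g1
  have hu := ur_pos
  have key : ‖a * b - (⟨p, q⟩ : ℂ)‖ ≤ 2 * ur * ((|p1| + |p2|) + (|p3| + |p4|)) := by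
    refine (norm_le_re_im _).trans ?_
    rw [Complex.sub_re, Complex.sub_im, Complex.mul_re, Complex.mul_im, abs_sub_comm,
      abs_sub_comm _ q, sub_eq_add_neg (a.re * b.re)]
    linarith
  refine ⟨⟨p, q⟩, ⟨rfl, rfl, fp.isNormal, fq.isNormal⟩, key.trans ?_, key.trans ?_⟩
  · have hpos : 0 ≤ 1 + 2 * eps := by have := eps_nonneg; positivity
    have hk := kap_pos
    have hb := UBo.two_zpow_mul (-52) ((ubo_const (le_refl (1 + 2 * eps))).mul
      ((((ubo_abs_fin p1).add (ubo_abs_fin p2) (by positivity)).add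
      ((ubo_abs_fin p3).add (ubo_abs_fin p4) (by positivity)) (by positivity))) hpos
      (by positivity)) (by positivity) (fun c hc => fixed_of_fmul hc) _ h5
    refine le_trans ?_ hb
    have h1 : (1 : ℝ) ≤ kap * (1 + 2 * eps) * kap * kap := by
      unfold kap; norm_num [eps_eq, ur_eq]
    have h2 : (2 : ℝ) ^ (-52 : ℤ) = 2 * ur := by unfold ur; norm_num
    rw [h2]
    have h3 : 0 ≤ (|p1| + |p2|) + (|p3| + |p4|) := by positivity
    calc 2 * ur * ((|p1| + |p2|) + (|p3| + |p4|))
        ≤ 2 * ur * ((kap * (1 + 2 * eps) * kap * kap) * ((|p1| + |p2|) + (|p3| + |p4|))) := by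
          gcongr
          exact le_mul_of_one_le_left h3 h1
      _ = _ := by ring
  · have k1 := abs_le_of_flEq f1
    have k2 := abs_le_of_flEq f2
    have k3 := abs_le_of_flEq f3
    have k4 := abs_le_of_flEq f4
    have k5 := abs_mul_add_le a b
    have k6 := abs_mul_add_le' a b
    have k7 : (|p1| + |p2|) + (|p3| + |p4|) ≤ (1 + ur) * (2 * (‖a‖ * ‖b‖)) := by nlinarith
    have k8 : 0 ≤ ‖a‖ * ‖b‖ := by positivity
    calc _ ≤ 2 * ur * ((1 + ur) * (2 * (‖a‖ * ‖b‖))) := by gcongr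
      _ = (4 * (1 + ur)) * ur * (‖a‖ * ‖b‖) := by ring
      _ ≤ _ := by gcongr; norm_num [ur_eq]

/-! ### Upper bounds with a count of the roundings -/

/-- The result of a computation is an upper bound of the nonnegative number `r` up to `n`
roundings. -/
structure Kb (n : ℕ) (a : FP) (r : ℝ) : Prop where
  nonneg : 0 ≤ r
  ub : UBo a (kap ^ n * r)

theorem Kb.weaken {n m : ℕ} {a : FP} {r : ℝ} (h : Kb n a r) (hnm : n ≤ m) : Kb m a r :=
  ⟨h.nonneg, h.ub.mono (mul_le_mul_of_nonneg_right
    (pow_le_pow_of_le_one kap_pos.le kap_le_one hnm) h.nonneg)⟩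

theorem UBo.kb {a : FP} {r : ℝ} (h : UBo a r) (hr : 0 ≤ r) : Kb 0 a r := ⟨hr, by simpa⟩

theorem UB.kb {d : Dbl} {r : ℝ} (h : UB d r) (hr : 0 ≤ r) : Kb 0 (Option.some d) r :=
  UBo.kb (UB.some h) hr

theorem kb_const {x : ℝ} (hx : 0 ≤ x) : Kb 0 (some (const x)) x := (ubo_const le_rfl).kb hx

theorem kb_abs (x : ℝ) : Kb 0 (some (Dbl.fin x).abs) |x| := (ubo_abs_fin x).kb (abs_nonneg x)

theorem Kb.add {n m : ℕ} {a b : FP} {r s : ℝ} (ha : Kb n a r) (hb : Kb m b s) :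
    Kb (max n m + 1) (a +ᶠ b) (r + s) := by
  have h1 := (ha.weaken (le_max_left n m)).ub
  have h2 := (hb.weaken (le_max_right n m)).ub
  have hk := kap_pos
  have := ha.nonneg
  have := hb.nonneg
  refine ⟨by positivity, (h1.add h2 (by positivity)).mono (le_of_eq ?_)⟩
  rw [pow_succ]; ring

theorem Kb.mul {n m : ℕ} {a b : FP} {r s : ℝ} (ha : Kb n a r) (hb : Kb m b s) :
    Kb (n + m + 1) (a *ᶠ b) (r * s) := by
  have hk := kap_pos
  have := ha.nonneg
  have := hb.nonneg
  refine ⟨by positivity, (ha.ub.mul hb.ub (by positivity) (by positivity)).mono (le_of_eq ?_)⟩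
  rw [pow_succ, pow_add]; ring

theorem Kb.two_zpow_mul {n : ℕ} {a : FP} {r : ℝ} (k : ℤ) (ha : Kb n a r)
    (hR : ∀ c, a = some (.fin c) → round53 c = c) :
    Kb n (some (const (2 ^ k)) *ᶠ a) (2 ^ k * r) := by
  have hk := kap_pos
  have := ha.nonneg
  refine ⟨by positivity, (ha.ub.two_zpow_mul k (by positivity) hR).mono (le_of_eq ?_)⟩
  ring

theorem UBo.div_pos {a : FP} {r y : ℝ} (ha : UBo a r) (hr : 0 ≤ r) (hy : 0 < y) :
    UBo (a /ᶠ some (.fin y)) (kap * (r / y)) := by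
  intro c hc
  obtain ⟨x, _, hx, ⟨⟩, hc⟩ := fdiv_eq_some hc
  rcases (ha x hx).cases with hb | ⟨x, rfl, hx⟩
  · exact (bad_div hy hb hc).ub _
  · simp only [Dbl.div, if_neg hy.ne'] at hc
    exact ub_of_fl hc (by positivity) (by gcongr)

theorem Kb.div {n : ℕ} {a : FP} {r y : ℝ} (ha : Kb n a r) (hy : 0 < y) :
    Kb (n + 1) (a /ᶠ some (.fin y)) (r / y) := by
  have hk := kap_pos
  have := ha.nonneg
  refine ⟨by positivity, (ha.ub.div_pos (by positivity) hy).mono (le_of_eq ?_)⟩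
  rw [pow_succ]; ring

theorem Kb.le {n : ℕ} {a : FP} {r s x : ℝ} (h : Kb n a r) (ha : a = some (.fin x))
    (hs : s ≤ kap ^ n * r) : s ≤ x := hs.trans (h.ub _ ha)

theorem Kb.le_of {n : ℕ} {a : FP} {r S C K x : ℝ} (h : Kb n a r) (ha : a = some (.fin x))
    (hr : r = K * S) (hS : 0 ≤ S) (hC : C ≤ kap ^ n * K) : C * S ≤ x := by
  refine h.le ha ?_
  rw [hr, ← mul_assoc]
  exact mul_le_mul_of_nonneg_right hC hS

theorem FlEq.left_le {a b c : ℝ} (h : FlEq (a + b) c) (ha : round53 a = a) (hb : 0 ≤ b) :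
    a ≤ c := by
  rw [h.eq]
  calc a = round53 a := ha.symm
    _ ≤ _ := round53_mono (by linarith)

theorem FlEq.right_le {a b c : ℝ} (h : FlEq (a + b) c) (hb : round53 b = b) (ha : 0 ≤ a) :
    b ≤ c := by
  rw [add_comm] at h
  exact h.left_le hb ha

/-- Both parts are finite. -/
def FinC (x : XComplex) : Prop := ∃ p q, x.re = .fin p ∧ x.im = .fin q

theorem IsC.finC {x : XComplex} {f : ℂ} (h : IsC x f) : FinC x := ⟨_, _, h.re, h.im⟩

/-- If the error of `r` is finite, then `r` is a disc that contains `v`, unless the centre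
overflows. -/
def RepA (r : AComplex) (v : ℂ) : Prop :=
  ∀ e, r.e = .fin e → (∃ c, IsC r.z c ∧ ‖v - c‖ ≤ e) ∨ ¬ FinC r.z

theorem nrm_spec {y : XComplex} {b : ℂ} {n : Dbl} (hy : IsC y b) (hb : ‖b‖ ≤ 2 ^ 500)
    (h : some y.re *ᶠ some y.re +ᶠ some y.im *ᶠ some y.im = some n) :
    ∃ N, n = .fin N ∧ 0 ≤ N ∧ |N - ‖b‖ ^ 2| ≤ (2 * ur + ur ^ 2) * ‖b‖ ^ 2 := by
  have hu := ur_pos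
  have hu' := ur_le
  obtain ⟨c, d, hc, hd, h⟩ := fadd_eq_some h
  rw [hy.re] at hc
  rw [hy.im] at hd
  have hT : (2 : ℝ) * (2 * (2 ^ 500) ^ 2) < 2 ^ 1024 := by
    rw [← pow_mul, ← pow_succ', ← pow_succ']
    exact pow_lt_pow_right₀ (by norm_num) (by norm_num)
  have hn : ‖b‖ ^ 2 = b.re * b.re + b.im * b.im := by
    rw [Complex.sq_norm, Complex.normSq_apply]
  have hle : ‖b‖ ^ 2 ≤ (2 ^ 500) ^ 2 := by gcongr
  have h1 := mul_self_nonneg b.re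
  have h2 := mul_self_nonneg b.im
  have key : ∀ {x : ℝ} {d : Dbl}, 0 ≤ x → x ≤ 2 * ‖b‖ ^ 2 → fl x = some d →
      d = .fin (round53 x) := by
    intro x d hx hx' hd
    rcases fl_cases hd with ⟨rfl, -, -⟩ | ⟨-, h3⟩
    · rfl
    · exfalso
      rw [abs_of_nonneg (round53_nonneg hx)] at h3
      have h4 := round53_le hx
      generalize (2 : ℝ) ^ 1024 = T at *
      generalize ((2 : ℝ) ^ 500) ^ 2 = S at *
      nlinarith
  obtain rfl := key h1 (by linarith) hc
  obtain rfl := key h2 (by linarith) hd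
  have h3 := round53_nonneg h1
  have h4 := round53_nonneg h2
  have h5 := round53_le h1
  have h6 := round53_le h2
  have h7 := le_round53 h1
  have h8 := le_round53 h2
  obtain rfl := key (add_nonneg h3 h4) (by nlinarith) h
  refine ⟨_, rfl, round53_nonneg (add_nonneg h3 h4), ?_⟩
  have h9 := abs_round53_sub_le (round53 (b.re * b.re) + round53 (b.im * b.im))
  have h10 := abs_round53_sub_le (b.re * b.re)
  have h11 := abs_round53_sub_le (b.im * b.im)
  rw [abs_of_nonneg (add_nonneg h3 h4)] at h9
  rw [abs_of_nonneg h1] at h10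
  rw [abs_of_nonneg h2] at h11
  rw [hn]
  generalize round53 (round53 (b.re * b.re) + round53 (b.im * b.im)) = N at *
  rw [show N - (b.re * b.re + b.im * b.im) = (N - (round53 (b.re * b.re) + round53 (b.im * b.im)))
    + (round53 (b.re * b.re) - b.re * b.re) + (round53 (b.im * b.im) - b.im * b.im) by ring]
  refine (abs_add_three _ _ _).trans ?_
  nlinarith

/-- The error of a component of a quotient. -/
theorem abs_quotient_sub_le {t1 t2 p1 p2 p N n q : ℝ} (f1 : FlEq t1 p1) (f2 : FlEq t2 p2)
    (fp : FlEq (p1 + p2) p) (hN : 0 < N) (hn : 0 < n) (hNn : |N - n| ≤ (2 * ur + ur ^ 2) * n)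
    (fq : FlEq (p / N) q) :
    |q - (t1 + t2) / n| ≤ (5 * ur + 4.5 * ur ^ 2) * ((|p1| + |p2|) / N) := by
  have hu := ur_pos
  have h1 := f1.abs_sub_le'
  have h2 := f2.abs_sub_le'
  have h3 := sub_of_mul_error h1 h2 fp.abs_sub_le
  have h4 := abs_add_le p1 p2
  have hp : |p| ≤ (1 + ur) * (|p1| + |p2|) :=
    (abs_le_of_flEq fp).trans (by gcongr)
  have ht : |t1 + t2| ≤ (1 + ur) * (|p1| + |p2|) := by
    have h5 := abs_add_le t1 t2
    have h6 := abs_sub_abs_le_abs_sub t1 p1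
    have h7 := abs_sub_abs_le_abs_sub t2 p2
    rw [abs_sub_comm] at h6 h7
    nlinarith
  have h5 : |q - p / N| ≤ ur * ((1 + ur) * (|p1| + |p2|) / N) := by
    refine fq.abs_sub_le.trans ?_
    rw [abs_div, abs_of_pos hN]
    gcongr
  have h6 : |p / N - (t1 + t2) / N| ≤ 2 * ur * ((|p1| + |p2|) / N) := by
    rw [← sub_div, abs_div, abs_of_pos hN, ← mul_div_assoc]
    gcongr
  have h7 : |(t1 + t2) / N - (t1 + t2) / n| ≤ (2 * ur + ur ^ 2) * ((1 + ur) * (|p1| + |p2|) / N) := by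
    rw [show (t1 + t2) / N - (t1 + t2) / n = ((n - N) / n) * ((t1 + t2) / N) by field_simp,
      abs_mul, abs_div, abs_div, abs_of_pos hN, abs_of_pos hn, abs_sub_comm]
    gcongr
    rwa [div_le_iff₀ hn]
  rw [show q - (t1 + t2) / n = (q - p / N) + (p / N - (t1 + t2) / N) +
    ((t1 + t2) / N - (t1 + t2) / n) by ring]
  refine (abs_add_three _ _ _).trans ?_
  refine (add_le_add (add_le_add h5 h6) h7).trans ?_
  have h8 : 0 ≤ (|p1| + |p2|) / N := by positivity
  rw [mul_div_assoc]
  generalize (|p1| + |p2|) / N = S at *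
  have : ur * ((1 + ur) * S) + 2 * ur * S + (2 * ur + ur ^ 2) * ((1 + ur) * S) =
    (ur * (1 + ur) + 2 * ur + (2 * ur + ur ^ 2) * (1 + ur)) * S := by ring
  rw [this]
  refine mul_le_mul_of_nonneg_right ?_ h8
  norm_num [ur_eq]

theorem div_re_im (a b : ℂ) : (a / b).re = (a.re * b.re + a.im * b.im) / ‖b‖ ^ 2 ∧
    (a / b).im = (a.im * b.re + -(a.re * b.im)) / ‖b‖ ^ 2 := by
  rw [Complex.div_re, Complex.div_im, Complex.sq_norm]
  constructor <;> ring

theorem FlEq.neg {x c : ℝ} (h : FlEq x c) : FlEq (-x) (-c) :=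
  ⟨by rw [h.eq, round53_neg], h.normal.neg, by rw [abs_neg]; exact h.lt⟩

/-- The centre of a quotient, whose error is bounded in terms of the products. -/
theorem quotient_sound {x y : XComplex} {a b : ℂ} {p1 p2 p3 p4 N s1 s2 : ℝ} {re im : Dbl}
    (hx : IsC x a) (hy : IsC y b)
    (h1 : some x.re *ᶠ some y.re = some (.fin p1)) (h2 : some x.im *ᶠ some y.im = some (.fin p2))
    (h3 : some x.im *ᶠ some y.re = some (.fin p3)) (h4 : some x.re *ᶠ some y.im = some (.fin p4))
    (hN : 0 < N) (hNn : |N - ‖b‖ ^ 2| ≤ (2 * ur + ur ^ 2) * ‖b‖ ^ 2)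
    (s12 : FlEq (|p1| + |p2|) s1) (s34 : FlEq (|p3| + |p4|) s2)
    (hre : (some (Dbl.fin p1) +ᶠ some (Dbl.fin p2)) /ᶠ some (.fin N) = some re)
    (him : (some (Dbl.fin p3) -ᶠ some (Dbl.fin p4)) /ᶠ some (.fin N) = some im) :
    b ≠ 0 ∧ (((|p1| + |p2|) + (|p3| + |p4|)) ≤ (1 + ur) * (2 * (‖a‖ * ‖b‖))) ∧
    (∀ v, s1 ≤ v → s2 ≤ v → (∃ c, FlEq (v / N) c) → FinC ⟨re, im⟩) ∧
    (FinC ⟨re, im⟩ → ∃ c, IsC ⟨re, im⟩ c ∧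
      ‖a / b - c‖ ≤ (5 * ur + 4.5 * ur ^ 2) * (((|p1| + |p2|) + (|p3| + |p4|)) / N)) := by
  rw [hx.re, hy.re] at h1
  rw [hx.im, hy.im] at h2
  rw [hx.im, hy.re] at h3
  rw [hx.re, hy.im] at h4
  have f1 := flEq_of_fmul h1
  have f2 := flEq_of_fmul h2
  have f3 := flEq_of_fmul h3
  have f4 := flEq_of_fmul h4
  have hb : b ≠ 0 := by
    rintro rfl
    simp only [norm_zero, ne_eq, OfNat.ofNat_ne_zero, not_false_eq_true, zero_pow, sub_zero,
      mul_zero, abs_nonpos_iff] at hNn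
    exact hN.ne' hNn
  have hn : 0 < ‖b‖ ^ 2 := by positivity
  obtain ⟨_, _, hp, ⟨⟩, hre⟩ := fdiv_eq_some hre
  obtain ⟨_, _, hq, ⟨⟩, him⟩ := fdiv_eq_some him
  obtain ⟨_, _, ⟨⟩, ⟨⟩, hp⟩ := fadd_eq_some hp
  obtain ⟨_, _, ⟨⟩, ⟨⟩, hq⟩ := fsub_eq_some hq
  have hq' : |p3 + -p4| ≤ |p3| + |p4| := (abs_add_le p3 (-p4)).trans (by rw [abs_neg])
  obtain ⟨p, rfl, fp⟩ := fin_of_fl_of_le s12 (abs_add_le p1 p2) hp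
  obtain ⟨q, rfl, fq⟩ := fin_of_fl_of_le s34 hq' hq
  simp only [Dbl.div, if_neg hN.ne'] at hre him
  refine ⟨hb, ?_, ?_, ?_⟩
  · have k1 := abs_le_of_flEq f1
    have k2 := abs_le_of_flEq f2
    have k3 := abs_le_of_flEq f3
    have k4 := abs_le_of_flEq f4
    have k5 := abs_mul_add_le a b
    have k6 := abs_mul_add_le' a b
    have := ur_pos
    nlinarith
  · rintro v hv1 hv2 ⟨c, hc⟩
    have g1 : |p / N| ≤ v / N := by
      rw [abs_div, abs_of_pos hN]
      gcongr
      refine le_trans ?_ hv1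
      rw [fp.eq, abs_round53, s12.eq]
      exact round53_mono (abs_add_le _ _)
    have g2 : |q / N| ≤ v / N := by
      rw [abs_div, abs_of_pos hN]
      gcongr
      refine le_trans ?_ hv2
      rw [fq.eq, abs_round53, s34.eq]
      exact round53_mono hq'
    obtain ⟨c1, rfl, -⟩ := fin_of_fl_of_le hc g1 hre
    obtain ⟨c2, rfl, -⟩ := fin_of_fl_of_le hc g2 him
    exact ⟨_, _, rfl, rfl⟩
  · rintro ⟨c1, c2, e1, e2⟩
    change re = _ at e1
    change im = _ at e2
    subst e1 e2
    have fc1 := flEq_of_fl hre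
    have fc2 := flEq_of_fl him
    refine ⟨⟨c1, c2⟩, ⟨rfl, rfl, fc1.isNormal, fc2.isNormal⟩, ?_⟩
    refine (norm_le_re_im _).trans ?_
    rw [Complex.sub_re, Complex.sub_im, (div_re_im a b).1, (div_re_im a b).2, abs_sub_comm,
      abs_sub_comm _ c2]
    have g1 := abs_quotient_sub_le f1 f2 fp hN hn hNn fc1
    have g2 := abs_quotient_sub_le f3 f4.neg fq hN hn hNn fc2
    rw [abs_neg] at g2
    refine (add_le_add g1 g2).trans (le_of_eq ?_)
    ring

theorem Dbl.fin_of_fdiv {a : FP} {N c : ℝ} (h : a /ᶠ some (.fin N) = some (.fin c)) :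
    ∃ x, a = some (.fin x) ∧ N ≠ 0 ∧ FlEq (x / N) c := by
  rcases fdiv_fin h with ⟨x, _, hx, ⟨⟩, h0, h⟩ | ⟨_, _, _, h, _⟩
  · exact ⟨x, hx, h0, h⟩
  · cases h

theorem XComplex.div_eq_some {x y : XComplex} {r : AComplex} (h : x.div y = some r) :
    ∃ n p1 p2 p3 p4 re im A e,
    some y.re *ᶠ some y.re +ᶠ some y.im *ᶠ some y.im = some n ∧
    some x.re *ᶠ some y.re = some p1 ∧ some x.im *ᶠ some y.im = some p2 ∧
    some x.im *ᶠ some y.re = some p3 ∧ some x.re *ᶠ some y.im = some p4 ∧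
    (some p1 +ᶠ some p2) /ᶠ some n = some re ∧ (some p3 -ᶠ some p4) /ᶠ some n = some im ∧
    ((some p1.abs +ᶠ some p2.abs) +ᶠ (some p3.abs +ᶠ some p4.abs)) /ᶠ some n = some A ∧
    some (const (5 * (eps / 2))) *ᶠ (some (const (1 + 3 * eps)) *ᶠ some A) = some e ∧
    ⟨⟨re, im⟩, e⟩ = r := by
  simpa only [XComplex.div, bind_iff, pure_iff, exists_and_left] using h

theorem ubo_nrm (y : XComplex) :
    UBo (some y.re *ᶠ some y.re +ᶠ some y.im *ᶠ some y.im) 0 :=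
  (ubo_sq _).add_nonneg (ubo_sq _)

theorem XComplex.div_nonneg {x y : XComplex} {r : AComplex} (h : x.div y = some r) :
    UB r.e 0 := by
  obtain ⟨n, p1, p2, p3, p4, re, im, A, e, h1, -, -, -, -, -, -, h8, h9, rfl⟩ := div_eq_some h
  have hu := eps_nonneg
  have hn : UBo (some n) 0 := (ubo_nrm y n h1).some
  have hA : UBo (some A) 0 := UB.some ((((ubo_abs _).add_nonneg (ubo_abs _)).add_nonneg
    ((ubo_abs _).add_nonneg (ubo_abs _))).div_nonneg hn A h8)
  exact (ubo_const (by positivity)).mul_nonneg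
    ((ubo_const (by positivity)).mul_nonneg hA) e h9

theorem XComplex.div_sound {x y : XComplex} {r : AComplex} {a b : ℂ} {e : ℝ}
    (h : x.div y = some r) (hx : IsC x a) (hy : IsC y b) (hb : ‖b‖ ≤ 2 ^ 500)
    (he : r.e = .fin e) :
    ∃ c, IsC r.z c ∧ ‖a / b - c‖ ≤ e ∧ ‖a / b - c‖ ≤ 0.01 * (‖a‖ / ‖b‖) ∧ b ≠ 0 := by
  obtain ⟨n, p1, p2, p3, p4, re, im, A, e, h1, h2, h3, h4, h5, h6, h7, h8, h9, rfl⟩ :=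
    div_eq_some h
  cases he
  have hu := ur_pos
  obtain ⟨N, rfl, hN, hNn⟩ := nrm_spec hy hb h1
  have h9' := h9
  obtain ⟨_, _, -, k1, -⟩ := fmul_fin h9
  obtain ⟨_, A, -, ⟨⟩, -⟩ := fmul_fin k1
  obtain ⟨S, k2, hN0, fA⟩ := Dbl.fin_of_fdiv h8
  obtain ⟨s1, s2, k3, k4, fS⟩ := fadd_fin k2
  obtain ⟨_, _, k5, k6, g1⟩ := fadd_fin k3
  obtain ⟨_, _, k7, k8, g2⟩ := fadd_fin k4
  obtain ⟨p1, rfl, rfl⟩ := abs_fin k5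
  obtain ⟨p2, rfl, rfl⟩ := abs_fin k6
  obtain ⟨p3, rfl, rfl⟩ := abs_fin k7
  obtain ⟨p4, rfl, rfl⟩ := abs_fin k8
  have hN' : 0 < N := lt_of_le_of_ne hN hN0.symm
  obtain ⟨hb0, hP, hfin, hq⟩ := quotient_sound hx hy h2 h3 h4 h5 hN' hNn g1 g2 h6 h7
  have hs1 := g1.nonneg (by positivity)
  have hs2 := g2.nonneg (by positivity)
  have hS1 : s1 ≤ S := by
    exact fS.left_le g1.fixed hs2
  have hS2 : s2 ≤ S := by
    exact fS.right_le g2.fixed hs1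
  obtain ⟨c, hc, hc'⟩ := hq (hfin S hS1 hS2 ⟨A, fA⟩)
  have hP0 : 0 ≤ (|p1| + |p2|) + (|p3| + |p4|) := by positivity
  have hbn : 0 < ‖b‖ := norm_pos_iff.2 hb0
  refine ⟨c, hc, hc'.trans ?_, ?_, hb0⟩
  · have hen := eps_nonneg
    have hkb := (kb_const (x := 5 * (eps / 2)) (by positivity)).mul
      ((kb_const (x := 1 + 3 * eps) (by positivity)).mul
      ((((kb_abs p1).add (kb_abs p2)).add ((kb_abs p3).add (kb_abs p4))).div hN'))
    rw [h8] at hkb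
    refine hkb.le_of (K := 5 * (eps / 2) * (1 + 3 * eps)) h9' (by ring) (by positivity) ?_
    norm_num [kap, eps_eq, ur_eq]
  · have h10 : ‖b‖ ^ 2 * 0.99 ≤ N := by
      have := (abs_le.1 hNn).1
      have h11 : (2 * ur + ur ^ 2) ≤ 0.01 := by norm_num [ur_eq]
      nlinarith
    refine hc'.trans ?_
    have h12 : (|p1| + |p2| + (|p3| + |p4|)) / N ≤
        ((1 + ur) * (2 * (‖a‖ * ‖b‖))) / (‖b‖ ^ 2 * 0.99) := by gcongr
    refine (mul_le_mul_of_nonneg_left h12 (by positivity)).trans ?_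
    rw [show (1 + ur) * (2 * (‖a‖ * ‖b‖)) / (‖b‖ ^ 2 * 0.99) =
      ((1 + ur) * 2 / 0.99) * (‖a‖ / ‖b‖) by field_simp, ← mul_assoc]
    gcongr
    norm_num [ur_eq]

/-! ### Arithmetic of discs -/

theorem two_zpow_neg_53 : (2 : ℝ) ^ (-53 : ℤ) = ur := rfl

theorem FinC.neg_iff {x : XComplex} : FinC x.neg ↔ FinC x := by
  constructor
  · rintro ⟨p, q, h1, h2⟩
    exact ⟨_, _, Dbl.neg_eq_fin h1, Dbl.neg_eq_fin h2⟩
  · rintro ⟨p, q, h1, h2⟩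
    exact ⟨-p, -q, by simp [XComplex.neg, h1, Dbl.neg], by simp [XComplex.neg, h2, Dbl.neg]⟩

namespace AComplex

variable {x y r : AComplex} {a b : ℂ} {e : ℝ}

theorem add_eq_some (h : x.add y = some r) : ∃ re im d,
    some x.z.re +ᶠ some y.z.re = some re ∧ some x.z.im +ᶠ some y.z.im = some im ∧
    some (const (1 + 2 * eps)) *ᶠ (some HALFEPS *ᶠ (some re.abs +ᶠ some im.abs) +ᶠ
      (some x.e +ᶠ some y.e)) = some d ∧ ⟨⟨re, im⟩, d⟩ = r := by
  simpa only [AComplex.add, bind_iff, pure_iff, exists_and_left] using h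

theorem ubo_sum_error (re im : Dbl) (hx : UB x.e 0) (hy : UB y.e 0) :
    UBo (some (const (1 + 2 * eps)) *ᶠ (some HALFEPS *ᶠ (some re.abs +ᶠ some im.abs) +ᶠ
      (some x.e +ᶠ some y.e))) 0 :=
  (ubo_const (by have := eps_nonneg; positivity)).mul_nonneg
    ((ubo_HALFEPS.mul_nonneg ((ubo_abs _).add_nonneg (ubo_abs _))).add_nonneg
      ((UB.some hx).add_nonneg (UB.some hy)))

theorem add_nonneg (h : x.add y = some r) (hx : UB x.e 0) (hy : UB y.e 0) : UB r.e 0 := by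
  obtain ⟨re, im, d, -, -, h3, rfl⟩ := add_eq_some h
  exact ubo_sum_error re im hx hy d h3

theorem sub_nonneg (h : x.sub y = some r) (hx : UB x.e 0) (hy : UB y.e 0) : UB r.e 0 :=
  add_nonneg (y := ⟨y.z.neg, y.e⟩) h hx hy

theorem fin_of_fadd {a b : Dbl} {p : ℝ} (h : some a +ᶠ some b = some (.fin p)) :
    ∃ x y, a = .fin x ∧ b = .fin y := by
  obtain ⟨x, y, ⟨⟩, ⟨⟩, -⟩ := fadd_fin h; exact ⟨x, y, rfl, rfl⟩

/-- A sum with finite error has finite arguments. -/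
theorem fin_of_sum_error {re im : Dbl}
    (hd : some (const (1 + 2 * eps)) *ᶠ (some HALFEPS *ᶠ (some re.abs +ᶠ some im.abs) +ᶠ
      (some x.e +ᶠ some y.e)) = some (.fin e)) :
    (∃ p, re = .fin p) ∧ (∃ q, im = .fin q) ∧ (∃ e1, x.e = .fin e1) ∧ ∃ e2, y.e = .fin e2 := by
  obtain ⟨_, _, -, k1, -⟩ := fmul_fin hd
  obtain ⟨_, _, k2, k3, -⟩ := fadd_fin k1
  obtain ⟨_, _, -, k4, -⟩ := fmul_fin k2
  obtain ⟨_, _, k5, k6, -⟩ := fadd_fin k4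
  obtain ⟨p, rfl, -⟩ := abs_fin k5
  obtain ⟨q, rfl, -⟩ := abs_fin k6
  obtain ⟨e1, e2, k7, k8, -⟩ := fadd_fin k3
  exact ⟨⟨p, rfl⟩, ⟨q, rfl⟩, ⟨e1, by simpa using k7⟩, ⟨e2, by simpa using k8⟩⟩

theorem sum_sound {re im : Dbl} {v c : ℂ} (hx : UB x.e 0) (hy : UB y.e 0)
    (hd : some (const (1 + 2 * eps)) *ᶠ (some HALFEPS *ᶠ (some re.abs +ᶠ some im.abs) +ᶠ
      (some x.e +ᶠ some y.e)) = some (.fin e))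
    (hre : ∀ p, re = .fin p → FlEq c.re p) (him : ∀ q, im = .fin q → FlEq c.im q)
    (hv : ∀ e1 e2, x.e = .fin e1 → y.e = .fin e2 → ‖v - c‖ ≤ e1 + e2) :
    ∃ c', IsC ⟨re, im⟩ c' ∧ ‖v - c'‖ ≤ e ∧ ‖c - c'‖ ≤ ur * ‖c‖ := by
  have hu := ur_pos
  have hen := eps_nonneg
  obtain ⟨⟨p, rfl⟩, ⟨q, rfl⟩, ⟨e1, k7⟩, e2, k8⟩ := fin_of_sum_error hd
  rw [k7] at hx; rw [k8] at hy
  have hp := hre p rfl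
  have hq := him q rfl
  refine ⟨⟨p, q⟩, ⟨rfl, rfl, hp.isNormal, hq.isNormal⟩, ?_, norm_sub_le_of_flEq hp hq⟩
  · have h1 := norm_sub_mk_le (v := c) (c := ⟨p, q⟩) (k := ur) hp.abs_sub_le' hq.abs_sub_le'
    have h2 := hv e1 e2 k7 k8
    have h3 : ‖v - ⟨p, q⟩‖ ≤ ur * (|p| + |q|) + (e1 + e2) := by
      have := norm_add_le (v - c) (c - ⟨p, q⟩)
      rw [sub_add_sub_cancel] at this
      linarith
    refine h3.trans ?_
    have hx' : (0 : ℝ) ≤ e1 := hx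
    have hy' : (0 : ℝ) ≤ e2 := hy
    have hkb := (kb_const (x := 1 + 2 * eps) (by positivity)).mul
      ((Kb.two_zpow_mul (-53) ((kb_abs p).add (kb_abs q)) (fun c hc => by
        obtain ⟨_, _, _, _, hc⟩ := fadd_fin hc; exact hc.fixed)).add
        ((UB.kb (d := x.e) (r := e1) (by rw [k7]; exact le_rfl) hx').add
          (UB.kb (d := y.e) (r := e2) (by rw [k8]; exact le_rfl) hy')))
    rw [← HALFEPS_eq, two_zpow_neg_53] at hkb
    have := hkb.le_of (C := 1) (K := 1 + 2 * eps) (S := ur * (|p| + |q|) + (e1 + e2)) hd rfl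
      (by positivity) (by norm_num [kap, eps_eq, ur_eq])
    linarith

theorem add_sound {α β : ℂ} (h : x.add y = some r) (hx : RepA x α) (hy : RepA y β)
    (hx0 : UB x.e 0) (hy0 : UB y.e 0) (he : r.e = .fin e) :
    ∃ c a b, IsC r.z c ∧ IsC x.z a ∧ IsC y.z b ∧ ‖α + β - c‖ ≤ e ∧ ‖a + b - c‖ ≤ ur * ‖a + b‖ := by
  obtain ⟨re, im, d, h1, h2, h3, rfl⟩ := add_eq_some h
  cases he
  obtain ⟨⟨p, rfl⟩, ⟨q, rfl⟩, ⟨e1, k1⟩, ⟨e2, k2⟩⟩ := fin_of_sum_error h3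
  obtain ⟨_, _, l1, l2⟩ := fin_of_fadd h1
  obtain ⟨_, _, l3, l4⟩ := fin_of_fadd h2
  obtain ⟨a, ha, ha'⟩ := (hx e1 k1).resolve_right (not_not.2 ⟨_, _, l1, l3⟩)
  obtain ⟨b, hb, hb'⟩ := (hy e2 k2).resolve_right (not_not.2 ⟨_, _, l2, l4⟩)
  rw [ha.re, hb.re] at h1
  rw [ha.im, hb.im] at h2
  obtain ⟨c, hc, hc1, hc2⟩ := sum_sound (v := α + β) (c := a + b) hx0 hy0 h3
    (by rintro p ⟨⟩; exact flEq_of_fadd h1) (by rintro p ⟨⟩; exact flEq_of_fadd h2) (by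
      intro e1' e2' q1 q2
      rw [k1] at q1; rw [k2] at q2
      cases q1; cases q2
      rw [add_sub_add_comm]
      exact (norm_add_le _ _).trans (add_le_add ha' hb'))
  exact ⟨c, a, b, hc, ha, hb, hc1, hc2⟩

theorem _root_.Verify.RepA.neg {β : ℂ} (hy : RepA y β) : RepA ⟨y.z.neg, y.e⟩ (-β) := fun e he =>
  (hy e he).imp (fun ⟨b, hb, hb'⟩ => ⟨-b, hb.neg, by rwa [neg_sub_neg, norm_sub_rev]⟩) FinC.neg_iff.not.2

theorem sub_sound {α β : ℂ} (h : x.sub y = some r) (hx : RepA x α) (hy : RepA y β)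
    (hx0 : UB x.e 0) (hy0 : UB y.e 0) (he : r.e = .fin e) :
    ∃ c a b, IsC r.z c ∧ IsC x.z a ∧ IsC y.z b ∧ ‖α - β - c‖ ≤ e ∧ ‖a - b - c‖ ≤ ur * ‖a - b‖ := by
  obtain ⟨c, a, b, hc, ha, hb, h1, h2⟩ := add_sound (y := ⟨y.z.neg, y.e⟩) h hx hy.neg hx0 hy0 he
  exact ⟨c, a, -b, hc, ha, y.z.neg_neg ▸ hb.neg, by rwa [sub_eq_add_neg α], by rwa [sub_neg_eq_add]⟩

theorem div_eq_some (h : x.div y = some r) :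
    ∃ n p1 p2 p3 p4 re im A B e,
    some y.z.re *ᶠ some y.z.re +ᶠ some y.z.im *ᶠ some y.z.im = some n ∧
    some x.z.re *ᶠ some y.z.re = some p1 ∧ some x.z.im *ᶠ some y.z.im = some p2 ∧
    some x.z.im *ᶠ some y.z.re = some p3 ∧ some x.z.re *ᶠ some y.z.im = some p4 ∧
    (some p1 +ᶠ some p2) /ᶠ some n = some re ∧ (some p3 -ᶠ some p4) /ᶠ some n = some im ∧
    (some y.e *ᶠ some y.e <ᶠ some (const (10000 * eps * eps)) *ᶠ some n) = some true ∧
    (some p1.abs +ᶠ some p2.abs) +ᶠ (some p3.abs +ᶠ some p4.abs) = some A ∧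
    some x.e *ᶠ (some y.z.re.abs +ᶠ some y.z.im.abs) +ᶠ
      some y.e *ᶠ (some x.z.re.abs +ᶠ some x.z.im.abs) = some B ∧
    some (const (1 + 4 * eps)) *ᶠ ((some (const (5 * (eps / 2))) *ᶠ some A +ᶠ
      some (const (1 + 103 * eps)) *ᶠ some B) /ᶠ some n) = some e ∧
    r = ⟨⟨re, im⟩, e⟩ := by
  simp only [AComplex.div, bind_iff, pure_iff] at h
  obtain ⟨n, h1, p1, h2, p2, h3, p3, h4, p4, h5, g, h6, _, h7, A, h8, B, h9, e, h10, re, h11, im,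
    h12, rfl⟩ := h
  cases g with
  | false => simp [guard] at h7
  | true => exact ⟨n, p1, p2, p3, p4, re, im, A, B, e, h1, h2, h3, h4, h5, h11, h12, h6, h8, h9,
      h10, rfl⟩

theorem div_nonneg (h : x.div y = some r) (hx0 : UB x.e 0) (hy0 : UB y.e 0) : UB r.e 0 := by
  obtain ⟨n, p1, p2, p3, p4, re, im, A, B, e, h1, -, -, -, -, -, -, -, h8, h9, h10, rfl⟩ :=
    div_eq_some h
  have hu := eps_nonneg
  have hn : UBo (some n) 0 := UB.some (ubo_nrm y.z n h1)
  have hA : UBo (some A) 0 := UB.some ((((ubo_abs _).add_nonneg (ubo_abs _)).add_nonneg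
    ((ubo_abs _).add_nonneg (ubo_abs _))) A h8)
  have hB : UBo (some B) 0 := UB.some ((((UB.some hx0).mul_nonneg ((ubo_abs _).add_nonneg
    (ubo_abs _))).add_nonneg ((UB.some hy0).mul_nonneg ((ubo_abs _).add_nonneg
    (ubo_abs _)))) B h9)
  exact (ubo_const (by positivity)).mul_nonneg
    ((((ubo_const (by positivity)).mul_nonneg hA).add_nonneg
    ((ubo_const (by positivity)).mul_nonneg hB)).div_nonneg hn) e h10

theorem norm_div_sub_div_le {α β a b : ℂ} {ε η : ℝ} (hα : ‖α - a‖ ≤ ε) (hβ : ‖β - b‖ ≤ η)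
    (hb : b ≠ 0) (hη : η ≤ 201 * ur * ‖b‖) :
    ‖α / β - a / b‖ ≤ (ε * ‖b‖ + η * ‖a‖) / ((1 - 201 * ur) * ‖b‖ ^ 2) := by
  have hu := ur_pos
  have hu' := ur_le
  have hbn : 0 < ‖b‖ := norm_pos_iff.2 hb
  have h1 : (1 - 201 * ur) * ‖b‖ ≤ ‖β‖ := by
    have := norm_sub_norm_le b β
    rw [norm_sub_rev] at this
    linarith
  have h0 : 0 < (1 - 201 * ur) * ‖b‖ := mul_pos (by linarith) hbn
  have hβ0 : β ≠ 0 := norm_pos_iff.1 (h0.trans_le h1)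
  have h2 : α / β - a / b = ((α - a) * b - (β - b) * a) / (β * b) := by
    field_simp; ring
  rw [h2, norm_div, norm_mul β b]
  refine div_le_div₀ ?_ ?_ (mul_pos (by linarith) (by positivity)) ?_
  · have := norm_nonneg (α - a)
    have := norm_nonneg (β - b)
    have : 0 ≤ ε := by linarith
    have : 0 ≤ η := by linarith
    positivity
  · refine (norm_sub_le _ _).trans ?_
    rw [norm_mul, norm_mul]
    gcongr
  · nlinarith

theorem div_sound {α β : ℂ} (h : x.div y = some r) (hx : RepA x α) (hy : RepA y β)
    (hx0 : UB x.e 0) (hy0 : UB y.e 0) (hfx : FinC x.z) (hfy : FinC y.z)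
    (hb : ∀ b, IsC y.z b → ‖b‖ ≤ 2 ^ 500) : RepA r (α / β) := by
  obtain ⟨n, p1, p2, p3, p4, re, im, A, B, e, h1, h2, h3, h4, h5, h6, h7, h8, h9, h10, h11, rfl⟩ :=
    div_eq_some h
  rintro e ⟨⟩
  by_cases hfin : FinC ⟨re, im⟩
  swap
  · exact Or.inr hfin
  left
  have hu := ur_pos
  have hu' := ur_le
  have hen := eps_nonneg
  have h11' := h11
  obtain ⟨_, _, k1, k2, k3⟩ := flt_eq_some h8
  have hye : ∃ η, y.e = .fin η := by
    rcases hy0.cases with (hb | hb) | ⟨η, hη, -⟩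
    · rw [hb] at k1
      simp only [fmul, Option.bind_eq_bind, Option.bind_some, Dbl.mul, Option.some.injEq] at k1
      subst k1
      simp [Dbl.lt] at k3
    · rw [hb] at k1
      simp only [fmul, Option.bind_eq_bind, Option.bind_some, Dbl.mul, Option.some.injEq] at k1
      subst k1
      rename_i w2
      cases w2 <;> simp [Dbl.lt] at k3
    · exact ⟨η, hη⟩
  obtain ⟨η, hη⟩ := hye
  obtain ⟨b, hb1, hb2⟩ := (hy η hη).resolve_right (not_not.2 hfy)
  obtain ⟨N, rfl, hN, hNn⟩ := nrm_spec hb1 (hb b hb1) h1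
  obtain ⟨_, _, -, k4, -⟩ := fmul_fin h11
  obtain ⟨S, k5, hN0, fS⟩ := Dbl.fin_of_fdiv k4
  obtain ⟨_, _, k6, k7, -⟩ := fadd_fin k5
  obtain ⟨_, A, -, ⟨⟩, -⟩ := fmul_fin k6
  obtain ⟨_, B, -, ⟨⟩, -⟩ := fmul_fin k7
  obtain ⟨s1, s2, k8, k9, -⟩ := fadd_fin h9
  obtain ⟨_, _, l5, l6, g1⟩ := fadd_fin k8
  obtain ⟨_, _, l7, l8, g2⟩ := fadd_fin k9
  obtain ⟨p1, rfl, rfl⟩ := abs_fin l5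
  obtain ⟨p2, rfl, rfl⟩ := abs_fin l6
  obtain ⟨p3, rfl, rfl⟩ := abs_fin l7
  obtain ⟨p4, rfl, rfl⟩ := abs_fin l8
  obtain ⟨_, _, m1, m2, -⟩ := fadd_fin h10
  obtain ⟨ε, _, m3, m4, -⟩ := fmul_fin m1
  rw [Option.some.injEq] at m3
  obtain ⟨a, ha1, ha2⟩ := (hx ε m3).resolve_right (not_not.2 hfx)
  have hN' : 0 < N := lt_of_le_of_ne hN hN0.symm
  obtain ⟨hb0, -, -, hq⟩ := quotient_sound ha1 hb1 h2 h3 h4 h5 hN' hNn g1 g2 h6 h7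
  obtain ⟨c, hc, hc'⟩ := hq hfin
  refine ⟨c, hc, ?_⟩
  rw [m3] at hx0
  rw [hη] at hy0
  have hε0 : (0 : ℝ) ≤ ε := hx0
  have hη0 : (0 : ℝ) ≤ η := hy0
  have hbn : 0 < ‖b‖ := norm_pos_iff.2 hb0
  have hNle : N ≤ (1 + ur) ^ 2 * ‖b‖ ^ 2 := by
    have := (abs_le.1 hNn).2
    nlinarith
  have hηb : η ≤ 201 * ur * ‖b‖ := by
    rw [hη] at k1
    obtain ⟨_, _, ⟨⟩, ⟨⟩, k1⟩ := fmul_eq_some k1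
    obtain ⟨_, _, ⟨⟩, ⟨⟩, k2⟩ := fmul_eq_some k2
    have q1 := ub_of_fl k1 (by positivity) (le_refl (η * η))
    rename_i w1 w2
    have q2 : η * η ≤ (201 * ur * ‖b‖) ^ 2 := by
      have q3 : 10000 * eps * eps * N ≤ (10000 * eps * eps) * ((1 + ur) ^ 2 * ‖b‖ ^ 2) := by gcongr
      rcases fl_cases k2 with ⟨rfl, -, -⟩ | ⟨rfl, q4⟩
      · obtain ⟨q5, -⟩ := Dbl.lt_true q1 k3
        have q6 := round53_le (y := 10000 * eps * eps * N) (by positivity)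
        have q7 : η * η ≤ (1 + ur) * ((1 + ur) * (10000 * eps * eps * ((1 + ur) ^ 2 * ‖b‖ ^ 2))) := by
          have q8 : kap * (η * η) ≤ (1 + ur) * (10000 * eps * eps * ((1 + ur) ^ 2 * ‖b‖ ^ 2)) :=
            q5.le.trans (q6.trans (by gcongr))
          have q9 : η * η = (1 + ur) * (kap * (η * η)) := by
            unfold kap; field_simp
          rw [q9]; gcongr
        refine q7.trans ?_
        rw [show (201 * ur * ‖b‖) ^ 2 = (201 * ur) ^ 2 * ‖b‖ ^ 2 by ring,
          show (1 + ur) * ((1 + ur) * (10000 * eps * eps * ((1 + ur) ^ 2 * ‖b‖ ^ 2))) =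
            ((1 + ur) * ((1 + ur) * (10000 * eps * eps * ((1 + ur) ^ 2)))) * ‖b‖ ^ 2 by ring]
        refine mul_le_mul_of_nonneg_right ?_ (by positivity)
        norm_num [eps_eq, ur_eq]
      · exfalso
        rw [abs_of_nonneg (round53_nonneg (by positivity))] at q4
        have q5 := q4.trans (round53_le (by positivity))
        have q6 : ‖b‖ ^ 2 ≤ (2 ^ 500) ^ 2 := by have := hb b hb1; gcongr
        have q7 : (1 + ur) * (10000 * eps * eps * N) ≤ 1 * (2 ^ 500) ^ 2 := by
          calc (1 + ur) * (10000 * eps * eps * N)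
              ≤ (1 + ur) * ((10000 * eps * eps) * ((1 + ur) ^ 2 * ‖b‖ ^ 2)) := by gcongr
            _ = ((1 + ur) * ((10000 * eps * eps) * ((1 + ur) ^ 2))) * ‖b‖ ^ 2 := by ring
            _ ≤ 1 * (2 ^ 500) ^ 2 := by
              refine mul_le_mul ?_ q6 (by positivity) (by norm_num)
              norm_num [eps_eq, ur_eq]
        have q8 : (1 : ℝ) * (2 ^ 500) ^ 2 < 2 ^ 1024 := by
          rw [one_mul, ← pow_mul]
          exact pow_lt_pow_right₀ (by norm_num) (by norm_num)
        exact absurd (q5.trans q7) (not_le.2 q8)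
    have := abs_le_of_sq_le_sq (a := η) (b := 201 * ur * ‖b‖) (by rw [pow_two]; exact q2)
      (by positivity)
    exact (le_abs_self _).trans this
  have hd := norm_div_sub_div_le ha2 hb2 hb0 hηb
  have hP : 0 ≤ (|p1| + |p2|) + (|p3| + |p4|) := by positivity
  have hAk := (((kb_abs p1).add (kb_abs p2)).add ((kb_abs p3).add (kb_abs p4)))
  have hbk := (kb_abs b.re).add (kb_abs b.im)
  have hak := (kb_abs a.re).add (kb_abs a.im)
  have hxk := UB.kb (d := x.e) (r := ε) (by rw [m3]; exact le_rfl) hε0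
  have hyk := UB.kb (d := y.e) (r := η) (by rw [hη]; exact le_rfl) hη0
  have hBk := (hxk.mul hbk).add (hyk.mul hak)
  rw [← hb1.re, ← hb1.im, ← ha1.re, ← ha1.im, h10] at hBk
  rw [h9] at hAk
  have hkb := (kb_const (x := 1 + 4 * eps) (by positivity)).mul
    ((((kb_const (x := 5 * (eps / 2)) (by positivity)).mul hAk).add
    ((kb_const (x := 1 + 103 * eps) (by positivity)).mul hBk)).div hN')
  refine hkb.le h11' ?_
  have htri : ‖α / β - c‖ ≤ ‖α / β - a / b‖ + ‖a / b - c‖ := by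
    have := norm_add_le (α / β - a / b) (a / b - c)
    rwa [sub_add_sub_cancel] at this
  refine htri.trans ((add_le_add hd hc').trans ?_)
  set P := (|p1| + |p2|) + (|p3| + |p4|)
  set Q := ε * (|b.re| + |b.im|) + η * (|a.re| + |a.im|)
  have hQ : ε * ‖b‖ + η * ‖a‖ ≤ Q := by
    have := norm_le_re_im b
    have := norm_le_re_im a
    show _ ≤ ε * (|b.re| + |b.im|) + η * (|a.re| + |a.im|)
    gcongr
  have hQ0 : 0 ≤ Q := by positivity
  have e1 : (ε * ‖b‖ + η * ‖a‖) / ((1 - 201 * ur) * ‖b‖ ^ 2) ≤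
      ((1 + ur) ^ 2 / (1 - 201 * ur)) * (Q / N) := by
    have h201 : 0 < 1 - 201 * ur := by linarith
    rw [div_mul_div_comm, div_le_div_iff₀ (by positivity) (by positivity)]
    calc (ε * ‖b‖ + η * ‖a‖) * ((1 - 201 * ur) * N) ≤
        Q * ((1 - 201 * ur) * ((1 + ur) ^ 2 * ‖b‖ ^ 2)) := by gcongr
      _ = _ := by ring
  refine (add_le_add e1 le_rfl).trans ?_
  have hPN : 0 ≤ P / N := by positivity
  have hQN : 0 ≤ Q / N := by positivity
  have c1 : (1 + ur) ^ 2 / (1 - 201 * ur) ≤ kap ^ 7 * (1 + 4 * eps) * (1 + 103 * eps) := by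
    norm_num [kap, eps_eq, ur_eq]
  have c2 : 5 * ur + 4.5 * ur ^ 2 ≤ kap ^ 7 * (1 + 4 * eps) * (5 * (eps / 2)) := by
    norm_num [kap, eps_eq, ur_eq]
  change _ ≤ kap ^ 7 * _
  rw [add_comm]
  refine (add_le_add (mul_le_mul_of_nonneg_right c2 hPN)
    (mul_le_mul_of_nonneg_right c1 hQN)).trans (le_of_eq ?_)
  ring

end AComplex

/-! ### Inverse and square root of an exact complex number -/

namespace XComplex

variable {y : XComplex} {r : AComplex} {b : ℂ} {e : ℝ}

theorem divOfD_eq_some {t : Dbl} (h : divOfD t y = some r) : ∃ n re xi im d,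
    some y.re *ᶠ some y.re +ᶠ some y.im *ᶠ some y.im = some n ∧
    (some t *ᶠ some y.re) /ᶠ some n = some re ∧ some t *ᶠ some y.im = some xi ∧
    some xi.neg /ᶠ some n = some im ∧
    some (const (2 * eps)) *ᶠ (some (const (1 + 2 * eps)) *ᶠ (some re.abs +ᶠ some im.abs)) =
      some d ∧ ⟨⟨re, im⟩, d⟩ = r := by
  simpa only [XComplex.divOfD, bind_iff, pure_iff, exists_and_left] using h

theorem divOfD_nonneg {t : Dbl} (h : divOfD t y = some r) : UB r.e 0 := by
  obtain ⟨n, re, xi, im, d, -, -, -, -, h5, rfl⟩ := divOfD_eq_some h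
  have hu := eps_nonneg
  exact (ubo_const (by positivity)).mul_nonneg ((ubo_const (by positivity)).mul_nonneg
    ((ubo_abs _).add_nonneg (ubo_abs _))) d h5

theorem abs_inverse_sub_le {t p N n q : ℝ} (fp : FlEq t p) (hN : 0 < N) (hn : 0 < n)
    (hNn : |N - n| ≤ (2 * ur + ur ^ 2) * n) (fq : FlEq (p / N) q) :
    |q - t / n| ≤ (4 * ur + 7 * ur ^ 2) * |q| := by
  have hu := ur_pos
  have h1 := fq.abs_sub_le'
  have hpN := abs_le_of_flEq' fq
  have h2 : |p / N - t / N| ≤ ur * ((1 + ur) * |q|) := by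
    rw [← sub_div, abs_div, abs_of_pos hN]
    calc |p - t| / N ≤ ur * |p| / N := by gcongr; exact fp.abs_sub_le'
      _ = ur * |p / N| := by rw [abs_div, abs_of_pos hN]; ring
      _ ≤ _ := by gcongr
  have htN : |t / N| ≤ (1 + ur) * ((1 + ur) * |q|) := by
    have := abs_sub_abs_le_abs_sub (t / N) (p / N)
    rw [abs_sub_comm] at this
    linarith
  have h3 : |t / N - t / n| ≤ (2 * ur + ur ^ 2) * ((1 + ur) * ((1 + ur) * |q|)) := by
    rw [show t / N - t / n = ((n - N) / n) * (t / N) by field_simp, abs_mul, abs_div,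
      abs_of_pos hn, abs_sub_comm]
    gcongr
    rwa [div_le_iff₀ hn]
  rw [show q - t / n = (q - p / N) + (p / N - t / N) + (t / N - t / n) by ring]
  refine (abs_add_three _ _ _).trans ((add_le_add (add_le_add h1 h2) h3).trans ?_)
  rw [show ur * |q| + ur * ((1 + ur) * |q|) + (2 * ur + ur ^ 2) * ((1 + ur) * ((1 + ur) * |q|)) =
    (ur + ur * (1 + ur) + (2 * ur + ur ^ 2) * ((1 + ur) * (1 + ur))) * |q| by ring]
  refine mul_le_mul_of_nonneg_right ?_ (abs_nonneg q)
  norm_num [ur_eq]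

theorem divOfD_sound (h : divOfD (const 1) y = some r) (hy : IsC y b) (hb : ‖b‖ ≤ 2 ^ 500)
    (he : r.e = .fin e) : ∃ c, IsC r.z c ∧ ‖1 / b - c‖ ≤ e ∧ b ≠ 0 := by
  obtain ⟨n, re, xi, im, d, h1, h2, h3, h4, h5, rfl⟩ := divOfD_eq_some h
  cases he
  have hu := ur_pos
  have hen := eps_nonneg
  obtain ⟨N, rfl, hN, hNn⟩ := nrm_spec hy hb h1
  have h5' := h5
  obtain ⟨_, _, -, k1, -⟩ := fmul_fin h5
  obtain ⟨_, _, -, k2, -⟩ := fmul_fin k1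
  obtain ⟨_, _, k3, k4, -⟩ := fadd_fin k2
  obtain ⟨p, rfl, -⟩ := abs_fin k3
  obtain ⟨q, rfl, -⟩ := abs_fin k4
  obtain ⟨p', k5, hN0, fp⟩ := Dbl.fin_of_fdiv h2
  obtain ⟨q', k6, -, fq⟩ := Dbl.fin_of_fdiv h4
  rw [Option.some.injEq] at k6
  rw [Dbl.neg_eq_fin k6] at h3
  rw [hy.re] at k5
  rw [hy.im] at h3
  have f1 := flEq_of_fmul k5
  have f2 := (flEq_of_fmul h3).neg
  rw [one_mul] at f1 f2
  rw [neg_neg] at f2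
  have hN' : 0 < N := lt_of_le_of_ne hN hN0.symm
  have hb0 : b ≠ 0 := by
    rintro rfl
    simp only [norm_zero, ne_eq, OfNat.ofNat_ne_zero, not_false_eq_true, zero_pow, sub_zero,
      mul_zero, abs_nonpos_iff] at hNn
    exact hN0 hNn
  have hn : 0 < ‖b‖ ^ 2 := by have := norm_pos_iff.2 hb0; positivity
  have g1 := abs_inverse_sub_le f1 hN' hn hNn fp
  have g2 := abs_inverse_sub_le f2 hN' hn hNn fq
  refine ⟨⟨p, q⟩, ⟨rfl, rfl, fp.isNormal, fq.isNormal⟩, ?_, hb0⟩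
  have hd := div_re_im 1 b
  simp only [Complex.one_re, Complex.one_im, one_mul, zero_mul, add_zero, zero_add] at hd
  rw [← hd.1] at g1
  rw [← hd.2] at g2
  refine (norm_sub_mk_le (v := 1 / b) (c := ⟨p, q⟩) g1 g2).trans ?_
  have hkb := Kb.two_zpow_mul (-51) ((kb_const (x := 1 + 2 * eps) (by positivity)).mul
    ((kb_abs p).add (kb_abs q))) (fun c hc => fixed_of_fmul hc)
  rw [← const_two_eps] at hkb
  refine hkb.le_of (K := 2 ^ (-51 : ℤ) * (1 + 2 * eps)) h5' (by ring) (by positivity) ?_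
  norm_num [kap, eps_eq, ur_eq]

end XComplex

theorem round53_half {y : ℝ} (hy : round53 y = y) : round53 (y * (1 / 2)) = y * (1 / 2) := by
  have := round53_two_zpow_mul (-1) y
  rw [hy] at this
  norm_num at this
  rw [show y * (1 / 2) = 1 / 2 * y by ring]
  exact this

/-- The error of the computed square root of a real number. -/
theorem abs_sqrt_sub_le {S2 y s : ℝ} (hS : 0 ≤ S2) (hy : |y - S2| ≤ (3 * ur + 2 * ur ^ 2) * S2)
    (fs : FlEq (√y) s) : |s - √S2| ≤ (2.5 * ur + 7 * ur ^ 2) * s := by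
  have hu := ur_pos
  have hu' := ur_le
  obtain ⟨hy1, hy2⟩ := abs_le.1 hy
  have hy0 : 0 ≤ y := by
    have h0 : 3 * ur + 2 * ur ^ 2 ≤ 1 := by norm_num [ur_eq]
    nlinarith
  have hs0 := fs.nonneg (Real.sqrt_nonneg y)
  have h1 := fs.abs_sub_le'
  rw [abs_of_nonneg hs0] at h1
  have h2 := fs.ge (Real.sqrt_nonneg y)
  have hl : √S2 ≤ (1 + 1.5 * ur + 5 * ur ^ 2) * √y := by
    refine Real.sqrt_le_iff.2 ⟨by positivity, ?_⟩
    rw [mul_pow, Real.sq_sqrt hy0]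
    have : 1 ≤ (1 + 1.5 * ur + 5 * ur ^ 2) ^ 2 * (1 - (3 * ur + 2 * ur ^ 2)) := by
      norm_num [ur_eq]
    have h3 : S2 * (1 - (3 * ur + 2 * ur ^ 2)) ≤ y := by linarith
    calc S2 ≤ S2 * ((1 + 1.5 * ur + 5 * ur ^ 2) ^ 2 * (1 - (3 * ur + 2 * ur ^ 2))) := by
          exact le_mul_of_one_le_right hS this
      _ = (1 + 1.5 * ur + 5 * ur ^ 2) ^ 2 * (S2 * (1 - (3 * ur + 2 * ur ^ 2))) := by ring
      _ ≤ _ := by gcongr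
  have hr : (1 - 1.5 * ur - 5 * ur ^ 2) * √y ≤ √S2 := by
    refine Real.le_sqrt_of_sq_le ?_
    rw [mul_pow, Real.sq_sqrt hy0]
    have : (1 - 1.5 * ur - 5 * ur ^ 2) ^ 2 * (1 + (3 * ur + 2 * ur ^ 2)) ≤ 1 := by
      norm_num [ur_eq]
    have h3 : y ≤ (1 + (3 * ur + 2 * ur ^ 2)) * S2 := by linarith
    calc _ ≤ (1 - 1.5 * ur - 5 * ur ^ 2) ^ 2 * ((1 + (3 * ur + 2 * ur ^ 2)) * S2) := by gcongr
      _ = ((1 - 1.5 * ur - 5 * ur ^ 2) ^ 2 * (1 + (3 * ur + 2 * ur ^ 2))) * S2 := by ring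
      _ ≤ _ := mul_le_of_le_one_left hS this
  have h4 : |√y - √S2| ≤ (1.5 * ur + 5 * ur ^ 2) * √y := by
    rw [abs_le]; constructor <;> linarith
  have h5 := abs_add_le (s - √y) (√y - √S2)
  rw [sub_add_sub_cancel] at h5
  have h6 : (1.5 * ur + 5 * ur ^ 2) * √y ≤ (1.5 * ur + 5 * ur ^ 2) * ((1 + ur) * s) := by
    gcongr
  have h7 : ur * s + (1.5 * ur + 5 * ur ^ 2) * ((1 + ur) * s) ≤ (2.5 * ur + 7 * ur ^ 2) * s := by
    rw [← mul_assoc, ← add_mul]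
    refine mul_le_mul_of_nonneg_right ?_ hs0
    norm_num [ur_eq]
  linarith

theorem abs_div_sub_le {t s S q : ℝ} (hs : 0 < s) (hS : 0 < S)
    (h : |s - S| ≤ (2.5 * ur + 7 * ur ^ 2) * s) (fq : FlEq (t / s) q) :
    |q - t / S| ≤ (3.5 * ur + 17 * ur ^ 2) * |q| := by
  have hu := ur_pos
  have hu' := ur_le
  have h1 := fq.abs_sub_le'
  have h2 := abs_le_of_flEq' fq
  have h3 : |t / s - t / S| ≤ (2.5 * ur + 14 * ur ^ 2) * |t / s| := by
    rw [show t / s - t / S = ((S - s) / S) * (t / s) by field_simp, abs_mul, abs_div,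
      abs_of_pos hS, abs_sub_comm]
    gcongr
    rw [div_le_iff₀ hS]
    refine h.trans ?_
    have h4 : (1 - (2.5 * ur + 7 * ur ^ 2)) * s ≤ S := by linarith [(abs_le.1 h).2]
    have h5 : (2.5 * ur + 7 * ur ^ 2) ≤ (2.5 * ur + 14 * ur ^ 2) * (1 - (2.5 * ur + 7 * ur ^ 2)) := by
      norm_num [ur_eq]
    calc (2.5 * ur + 7 * ur ^ 2) * s
        ≤ ((2.5 * ur + 14 * ur ^ 2) * (1 - (2.5 * ur + 7 * ur ^ 2))) * s := by gcongr
      _ = (2.5 * ur + 14 * ur ^ 2) * ((1 - (2.5 * ur + 7 * ur ^ 2)) * s) := by ring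
      _ ≤ _ := by gcongr
  have h5 := abs_add_le (q - t / s) (t / s - t / S)
  rw [sub_add_sub_cancel] at h5
  have h6 : (2.5 * ur + 14 * ur ^ 2) * |t / s| ≤ (2.5 * ur + 14 * ur ^ 2) * ((1 + ur) * |q|) := by
    gcongr
  have h7 : ur * |q| + (2.5 * ur + 14 * ur ^ 2) * ((1 + ur) * |q|) ≤
      (3.5 * ur + 17 * ur ^ 2) * |q| := by
    rw [← mul_assoc, ← add_mul]
    refine mul_le_mul_of_nonneg_right ?_ (abs_nonneg q)
    norm_num [ur_eq]
  linarith

theorem le_mul_of_mul_le {x y k l : ℝ} (hx : 0 ≤ x) (hk : 0 ≤ k) (h : l * x ≤ y)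
    (hkl : 1 ≤ k * l) : x ≤ k * y := by
  calc x ≤ (k * l) * x := le_mul_of_one_le_left hx hkl
    _ = k * (l * x) := by ring
    _ ≤ k * y := by gcongr

theorem XComplex.sqrt_eq_some {M : Machine} {x : XComplex} {r : AComplex}
    (h : x.sqrt M = some r) : ∃ s d e p,
    fsqrt ((some x.re.abs +ᶠ some (M.fhypot x.re x.im)) *ᶠ some (const (1 / 2))) = some s ∧
    (some x.im /ᶠ some s) *ᶠ some (const (1 / 2)) = some d ∧
    some EPS *ᶠ (some (const (1 + 4 * eps)) *ᶠ (some (const (5 / 4)) *ᶠ some s +ᶠ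
      some (const (7 / 4)) *ᶠ some d.abs)) = some e ∧ (some (const 0) <ᶠ some x.re) = some p ∧
    r = ⟨if p then ⟨s, d⟩ else ⟨d, s⟩, e⟩ := by
  simp only [XComplex.sqrt, bind_iff, Option.pure_def] at h
  obtain ⟨s, h1, d, h2, e, h3, p, h4, h5⟩ := h
  refine ⟨s, d, e, p, h1, h2, h3, h4, ?_⟩
  cases p <;> simpa using h5.symm

theorem XComplex.sqrt_nonneg {M : Machine} {x : XComplex} {r : AComplex}
    (h : x.sqrt M = some r) : UB r.e 0 := by
  obtain ⟨s, d, e, p, h1, -, h3, -, rfl⟩ := sqrt_eq_some h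
  have hu := eps_nonneg
  have hs : UBo (some s) 0 := UB.some (ubo_sqrt _ s h1)
  exact ubo_EPS.mul_nonneg ((ubo_const (by positivity)).mul_nonneg
    (((ubo_const (by positivity)).mul_nonneg hs).add_nonneg
    ((ubo_const (by positivity)).mul_nonneg (ubo_abs _)))) e h3

set_option maxHeartbeats 400000 in
theorem XComplex.sqrt_sound {M : Machine} {x : XComplex} {r : AComplex} {f : ℂ} {e : ℝ}
    (h : x.sqrt M = some r) (hx : IsC x f) (he : r.e = .fin e) :
    ∃ ρ c, ρ ^ 2 = f ∧ IsC r.z c ∧ ‖ρ - c‖ ≤ e ∧ ‖c‖ ≤ 2 * √‖f‖ ∧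
      ur * √‖f‖ ≤ e ∧ f ≠ 0 := by
  obtain ⟨s, d, e, p, h1, h2, h3, h4, rfl⟩ := sqrt_eq_some h
  cases he
  have hu := ur_pos
  have hu' := ur_le
  have hen := eps_nonneg
  have h3' := h3
  obtain ⟨_, _, -, k1, -⟩ := fmul_fin h3
  obtain ⟨_, _, -, k2, -⟩ := fmul_fin k1
  obtain ⟨_, _, k3, k4, -⟩ := fadd_fin k2
  obtain ⟨_, s, -, ⟨⟩, -⟩ := fmul_fin k3
  obtain ⟨_, _, -, k5, -⟩ := fmul_fin k4
  obtain ⟨d, rfl, rfl⟩ := abs_fin k5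
  obtain ⟨y, k6, hy0, fs⟩ := fsqrt_fin h1
  obtain ⟨t, _, k7, ⟨⟩, fy⟩ := fmul_fin k6
  obtain ⟨_, H, k8, k9, ft⟩ := fadd_fin k7
  rw [hx.re] at k8
  cases k8
  have hH : H = M.hypot f.re f.im := by
    rcases fhypot_fin M hx with l1 | ⟨l1, -⟩
    · rw [l1] at k9; simpa using k9.symm
    · rw [l1] at k9; cases k9
  subst hH
  have hyt : y = t * (1 / 2) := by rw [fy.eq, round53_half ft.fixed]
  obtain ⟨q, _, k10, ⟨⟩, fd⟩ := fmul_fin h2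
  rw [hx.im] at k10
  obtain ⟨hs0, fq⟩ := flEq_of_fdiv k10
  have hdq : d = q * (1 / 2) := by rw [fd.eq, round53_half fq.fixed]
  have hsnn := fs.nonneg (Real.sqrt_nonneg y)
  have hs : 0 < s := lt_of_le_of_ne hsnn hs0.symm
  have hf : f ≠ 0 := by
    rintro rfl
    rcases hypot_spec M hx with ⟨-, l1⟩ | ⟨l1, -⟩
    · have ft' : FlEq (1 * M.hypot (0 : ℂ).re (0 : ℂ).im) t := by simpa using ft
      have := fl_eq_zero_of_tiny (by norm_num) l1 ft'
      rw [this, zero_mul] at hyt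
      rw [hyt, Real.sqrt_zero] at fs
      exact hs0 (by rw [fs.eq, round53_zero])
    · exact l1 rfl
  have hp : 0 < ‖f‖ := norm_pos_iff.2 hf
  obtain ⟨-, hH⟩ := (hypot_spec M hx).resolve_left (fun h => hf h.1)
  set H := M.hypot f.re f.im
  set S2 := (|f.re| + ‖f‖) / 2 with hS2
  have hre := abs_nonneg f.re
  have hH0 : 0 ≤ H := by nlinarith [(abs_le.1 hH).1]
  have hS20 : 0 < S2 := by positivity
  have hy : |y - S2| ≤ (3 * ur + 2 * ur ^ 2) * S2 := by
    have l1 := ft.abs_sub_le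
    rw [abs_of_nonneg (a := |f.re| + H) (by positivity)] at l1
    have l2 := (abs_le.1 hH).2
    rw [show y - S2 = ((t - (|f.re| + H)) + (H - ‖f‖)) * (1 / 2) by rw [hyt, hS2]; ring, abs_mul,
      abs_of_pos (by norm_num : (0 : ℝ) < 1 / 2)]
    have l3 := abs_add_le (t - (|f.re| + H)) (H - ‖f‖)
    have l4 : |f.re| + H ≤ (1 + 2 * ur) * (|f.re| + ‖f‖) := by nlinarith
    have l5 := mul_le_mul_of_nonneg_left l4 hu.le
    rw [hS2]
    nlinarith
  have hSs := abs_sqrt_sub_le hS20.le hy fs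
  set S := √S2 with hS
  have hSpos : 0 < S := Real.sqrt_pos.2 hS20
  have hSsq : S ^ 2 = S2 := Real.sq_sqrt hS20.le
  have hqd := abs_div_sub_le hs hSpos hSs fq
  set Dd := f.im / (2 * S) with hDd
  have hdd : |d - Dd| ≤ (3.5 * ur + 17 * ur ^ 2) * |d| := by
    have : d - Dd = (q - f.im / S) * (1 / 2) := by rw [hdq, hDd]; field_simp
    rw [this, hdq, abs_mul, abs_mul]
    nlinarith [abs_nonneg ((1 : ℝ) / 2)]
  have hkb := Kb.two_zpow_mul (-52) ((kb_const (x := 1 + 4 * eps) (by positivity)).mul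
    (((kb_const (x := 5 / 4) (by norm_num)).mul (UB.kb (d := .fin s) (r := s) le_rfl hs.le)).add
    ((kb_const (x := 7 / 4) (by norm_num)).mul (kb_abs d)))) (fun c hc => fixed_of_fmul hc)
  have hkb2 := hkb.le_of (K := 2 ^ (-52 : ℤ) * (1 + 4 * eps)) (S := 5 / 4 * s + 7 / 4 * |d|)
    (C := 2 * ur * (1 + 4.9 * ur)) h3' (by ring) (by positivity) (by norm_num [kap, eps_eq, ur_eq])
  have hd0 := abs_nonneg d
  have herr : |s - S| + |d - Dd| ≤ e := by
    refine le_trans ?_ hkb2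
    have c1 : 2.5 * ur + 7 * ur ^ 2 ≤ 2 * ur * (1 + 4.9 * ur) * (5 / 4) := by
      norm_num [ur_eq]
    have c2 : 3.5 * ur + 17 * ur ^ 2 ≤ 2 * ur * (1 + 4.9 * ur) * (7 / 4) := by
      norm_num [ur_eq]
    have := mul_le_mul_of_nonneg_right c1 hs.le
    have := mul_le_mul_of_nonneg_right c2 hd0
    linarith
  have him : f.im ^ 2 = (‖f‖ - |f.re|) * (‖f‖ + |f.re|) := by
    have := Complex.sq_norm f
    rw [Complex.normSq_apply] at this
    have h' := sq_abs f.re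
    nlinarith
  have hDS : Dd ^ 2 = (‖f‖ - |f.re|) / 2 := by
    rw [hDd, div_pow, mul_pow, hSsq, him, hS2]
    field_simp
    ring
  have hDS2 : 2 * S * Dd = f.im := by rw [hDd]; field_simp
  have hSle : S ≤ √‖f‖ := by
    apply Real.sqrt_le_sqrt
    have := Complex.abs_re_le_norm f
    rw [hS2]; linarith
  have hDle : |Dd| ≤ √‖f‖ := by
    apply Real.abs_le_sqrt
    rw [hDS]; linarith
  have hSlb : 0.7 * √‖f‖ ≤ S := by
    apply Real.le_sqrt_of_sq_le
    rw [mul_pow, Real.sq_sqrt hp.le, hS2]; linarith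
  have hs2 : s ≤ (1 + 3 * ur) * S :=
    le_mul_of_mul_le (l := 1 - (2.5 * ur + 7 * ur ^ 2)) hs.le (by positivity)
      (by linarith [(abs_le.1 hSs).2]) (by norm_num [ur_eq])
  have hd2 : |d| ≤ (1 + 4 * ur) * |Dd| :=
    le_mul_of_mul_le (l := 1 - (3.5 * ur + 17 * ur ^ 2)) hd0 (by positivity)
      (by linarith [(abs_sub_abs_le_abs_sub d Dd).trans hdd]) (by norm_num [ur_eq])
  have hs3 : S ≤ (1 + 3 * ur) * s :=
    by
      have c1 : 2.5 * ur + 7 * ur ^ 2 ≤ 3 * ur := by norm_num [ur_eq]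
      have := mul_le_mul_of_nonneg_right c1 hs.le
      linarith [(abs_le.1 hSs).1]
  have hsum : s ^ 2 + d ^ 2 ≤ (2 * √‖f‖) ^ 2 := by
    have l1 : s ^ 2 ≤ (1.1 * S) ^ 2 := by gcongr; exact hs2.trans (by gcongr; norm_num [ur_eq])
    have l2 : |d| ^ 2 ≤ (1.1 * |Dd|) ^ 2 := by
      gcongr; exact hd2.trans (by gcongr; norm_num [ur_eq])
    rw [sq_abs, mul_pow, sq_abs, hDS] at l2
    rw [mul_pow, hSsq, hS2] at l1
    rw [mul_pow, Real.sq_sqrt hp.le]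
    linarith
  have hlb : ur * √‖f‖ ≤ e := by
    refine le_trans ?_ hkb2
    have l0 : (1 + 3 * ur) * s ≤ 1.01 * s := by gcongr; norm_num [ur_eq]
    have l1 : √‖f‖ ≤ 2 * (5 / 4 * s + 7 / 4 * |d|) := by linarith
    calc ur * √‖f‖ ≤ ur * (2 * (5 / 4 * s + 7 / 4 * |d|)) := by gcongr
      _ = 2 * ur * 1 * (5 / 4 * s + 7 / 4 * |d|) := by ring
      _ ≤ _ := by gcongr; linarith
  have hnorm : ∀ a b : ℝ, ‖(⟨a, b⟩ : ℂ)‖ = √(a ^ 2 + b ^ 2) := by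
    intro a b; rw [← sqrt_re_im]
  obtain ⟨_, _, ⟨⟩, h5, h6⟩ := flt_eq_some h4
  rw [Option.some.injEq] at h5
  subst h5
  rw [hx.re] at h6
  simp only [Dbl.lt] at h6
  by_cases hpos : 0 < f.re
  · rw [decide_eq_true hpos] at h6
    subst h6
    rw [abs_of_pos hpos] at *
    refine ⟨⟨S, Dd⟩, ⟨s, d⟩, ?_, ⟨rfl, rfl, fs.isNormal, fd.isNormal⟩, ?_, ?_, hlb, hf⟩
    · apply Complex.ext
      · rw [pow_two, Complex.mul_re]
        change S * S - Dd * Dd = f.re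
        rw [← pow_two, ← pow_two, hSsq, hDS, hS2]; ring
      · rw [pow_two, Complex.mul_im]
        change S * Dd + Dd * S = f.im
        rw [← hDS2]; ring
    · refine (norm_le_re_im _).trans ?_
      rw [Complex.sub_re, Complex.sub_im, abs_sub_comm, abs_sub_comm Dd]
      exact herr
    · rw [hnorm]
      exact Real.sqrt_le_iff.2 ⟨by positivity, hsum⟩
  · rw [decide_eq_false hpos] at h6
    subst h6
    rw [abs_of_nonpos (not_lt.1 hpos)] at *
    refine ⟨⟨Dd, S⟩, ⟨d, s⟩, ?_, ⟨rfl, rfl, fd.isNormal, fs.isNormal⟩, ?_, ?_, hlb, hf⟩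
    · apply Complex.ext
      · rw [pow_two, Complex.mul_re]
        change Dd * Dd - S * S = f.re
        rw [← pow_two, ← pow_two, hSsq, hDS, hS2]; ring
      · rw [pow_two, Complex.mul_im]
        change Dd * S + S * Dd = f.im
        rw [← hDS2]; ring
    · refine (norm_le_re_im _).trans ?_
      rw [Complex.sub_re, Complex.sub_im, abs_sub_comm, abs_sub_comm S, add_comm]
      exact herr
    · rw [hnorm]
      exact Real.sqrt_le_iff.2 ⟨by positivity, by linarith⟩

/-! ### Jets -/

variable {M : Machine} {z : Fin 3 → ℂ}

/-- The value of the jet with the coefficients `f`, `a`, `b`, `c` at `z`. -/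
notation "jet(" z "," f "," a "," b "," c ")" => f + a * z 0 + b * z 1 + c * z 2

/-- The jet `J` represents a function with value `v` at the point `z` of the polydisc. -/
structure Rep (M : Machine) (z : Fin 3 → ℂ) (J : ACJ) (v : ℂ) : Prop where
  hz : ∀ k, ‖z k‖ ≤ 1
  built : ACJ.build M J.f J.f0 J.f1 J.f2 J.e = some J
  nonneg : UB J.e 0
  val : ∀ e, J.e = .fin e → FinC J.f0 → FinC J.f1 → FinC J.f2 →
    ∃ f f0 f1 f2, IsC J.f f ∧ IsC J.f0 f0 ∧ IsC J.f1 f1 ∧ IsC J.f2 f2 ∧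
      ‖v - jet(z,f,f0,f1,f2)‖ ≤ e

theorem build_eq_some {f f0 f1 f2 : XComplex} {e : Dbl} {J : ACJ}
    (h : ACJ.build M f f0 f1 f2 e = some J) : ∃ s,
    some (const (1 + 2 * eps)) *ᶠ (f0.absUB M +ᶠ (f1.absUB M +ᶠ f2.absUB M)) = some s ∧
    ⟨f, f0, f1, f2, e, s⟩ = J := by
  simpa only [ACJ.build, bind_iff, pure_iff, exists_and_left] using h

theorem rep_of_build {f f0 f1 f2 : XComplex} {e : Dbl} {J : ACJ} {v : ℂ}
    (h : ACJ.build M f f0 f1 f2 e = some J) (hz : ∀ k, ‖z k‖ ≤ 1) (he : UB e 0)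
    (hv : ∀ x, e = .fin x → FinC f0 → FinC f1 → FinC f2 →
      ∃ c c0 c1 c2, IsC f c ∧ IsC f0 c0 ∧ IsC f1 c1 ∧ IsC f2 c2 ∧
      ‖v - jet(z,c,c0,c1,c2)‖ ≤ x) : Rep M z J v := by
  obtain ⟨s, -, rfl⟩ := build_eq_some h
  exact ⟨hz, h, he, hv⟩

theorem finC_of_absUB {x : XComplex} {a : ℝ} (h : x.absUB M = some (.fin a)) : FinC x := by
  obtain ⟨_, _, -, h, -⟩ := fmul_fin h
  rw [Option.some.injEq] at h
  cases hx : x.re <;> cases hy : x.im <;> rw [hx, hy] at h <;>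
    first
    | exact ⟨_, _, hx, hy⟩
    | simp [Machine.fhypot] at h

theorem size_nonneg {f f0 f1 f2 : XComplex} {e : Dbl} {J : ACJ}
    (h : ACJ.build M f f0 f1 f2 e = some J) : UB J.size 0 := by
  obtain ⟨s, h1, rfl⟩ := build_eq_some h
  exact (ubo_const (by have := eps_nonneg; positivity)).mul_nonneg
    ((ubo_absUB M _).add_nonneg ((ubo_absUB M _).add_nonneg (ubo_absUB M _))) s h1

theorem size_fixed {f f0 f1 f2 : XComplex} {e : Dbl} {J : ACJ} {σ : ℝ}
    (h : ACJ.build M f f0 f1 f2 e = some J) (hs : J.size = .fin σ) : round53 σ = σ := by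
  obtain ⟨s, h1, rfl⟩ := build_eq_some h
  cases hs
  exact fixed_of_fmul h1

theorem finC_of_size {f f0 f1 f2 : XComplex} {e : Dbl} {J : ACJ} {σ : ℝ}
    (h : ACJ.build M f f0 f1 f2 e = some J) (hs : J.size = .fin σ) :
    FinC f0 ∧ FinC f1 ∧ FinC f2 := by
  obtain ⟨s, h1, rfl⟩ := build_eq_some h
  cases hs
  obtain ⟨_, _, -, h2, -⟩ := fmul_fin h1
  obtain ⟨_, _, h3, h4, -⟩ := fadd_fin h2
  obtain ⟨_, _, h5, h6, -⟩ := fadd_fin h4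
  exact ⟨finC_of_absUB h3, finC_of_absUB h5, finC_of_absUB h6⟩

theorem absUB_kb {x : XComplex} {f : ℂ} (h : IsC x f) : Kb 0 (x.absUB M) ‖f‖ :=
  UBo.kb (fun _ hd => (absUB_spec h hd).1) (norm_nonneg f)

theorem size_ub {f f0 f1 f2 : XComplex} {e : Dbl} {J : ACJ} {c0 c1 c2 : ℂ}
    (h : ACJ.build M f f0 f1 f2 e = some J) (h0 : IsC f0 c0) (h1 : IsC f1 c1) (h2 : IsC f2 c2) :
    UB J.size (‖c0‖ + (‖c1‖ + ‖c2‖)) := by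
  obtain ⟨s, hs, rfl⟩ := build_eq_some h
  have hen := eps_nonneg
  have hkb := (kb_const (x := 1 + 2 * eps) (by positivity)).mul
    ((absUB_kb (M := M) h0).add ((absUB_kb (M := M) h1).add (absUB_kb (M := M) h2)))
  refine (hkb.ub s hs).mono ?_
  rw [← mul_assoc]
  refine le_mul_of_one_le_left (by positivity) ?_
  norm_num [kap, eps_eq, ur_eq]

theorem Rep.size_nonneg {J : ACJ} {v : ℂ} (h : Rep M z J v) : UB J.size 0 :=
  Verify.size_nonneg h.built

/-- What a jet with finite error and finite size says about its values. -/
theorem Rep.data {J : ACJ} {v : ℂ} (h : Rep M z J v) {e σ : ℝ} (he : J.e = .fin e)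
    (hs : J.size = .fin σ) : 0 ≤ e ∧ 0 ≤ σ ∧ ∃ f f0 f1 f2, IsC J.f f ∧ IsC J.f0 f0 ∧
      IsC J.f1 f1 ∧ IsC J.f2 f2 ∧ ‖f0‖ + (‖f1‖ + ‖f2‖) ≤ σ ∧
      ‖v - jet(z,f,f0,f1,f2)‖ ≤ e := by
  obtain ⟨k0, k1, k2⟩ := finC_of_size h.built hs
  obtain ⟨f, f0, f1, f2, hf, h0, h1, h2, hv⟩ := h.val e he k0 k1 k2
  have hn := h.nonneg
  have hn' := h.size_nonneg
  have hu := size_ub h.built h0 h1 h2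
  rw [he] at hn
  rw [hs] at hn' hu
  exact ⟨hn, hn', f, f0, f1, f2, hf, h0, h1, h2, hu, hv⟩

theorem norm_jet_le (hz : ∀ k, ‖z k‖ ≤ 1) (d0 d1 d2 : ℂ) :
    ‖d0 * z 0 + d1 * z 1 + d2 * z 2‖ ≤ ‖d0‖ + (‖d1‖ + ‖d2‖) := by
  have h : ∀ (d : ℂ) k, ‖d * z k‖ ≤ ‖d‖ := fun d k => by
    rw [norm_mul]; exact mul_le_of_le_one_right (norm_nonneg d) (hz k)
  refine norm_add₃_le.trans ?_
  linarith [h d0 0, h d1 1, h d2 2]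

theorem norm_add_jet_le (hz : ∀ k, ‖z k‖ ≤ 1) (a d d0 d1 d2 : ℂ) :
    ‖a + (d + (d0 * z 0 + d1 * z 1 + d2 * z 2))‖ ≤ ‖a‖ + ((‖d‖ + ‖d0‖) + (‖d1‖ + ‖d2‖)) := by
  have h1 := norm_add_le a (d + (d0 * z 0 + d1 * z 1 + d2 * z 2))
  have h2 := norm_add_le d (d0 * z 0 + d1 * z 1 + d2 * z 2)
  have h3 := norm_jet_le hz d0 d1 d2
  linarith

theorem norm_sub_jet_assoc {v f f0 f1 f2 : ℂ} {a : ℝ} (h : ‖v - jet(z,f,f0,f1,f2)‖ ≤ a) :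
    ‖v - (f + (f0 * z 0 + f1 * z 1 + f2 * z 2))‖ ≤ a := by
  rwa [← add_assoc, ← add_assoc]

theorem norm_sub_centre_le (hz : ∀ k, ‖z k‖ ≤ 1) {v f f0 f1 f2 : ℂ} {a : ℝ}
    (hv : ‖v - jet(z,f,f0,f1,f2)‖ ≤ a) :
    ‖v - f‖ ≤ ‖f0‖ + (‖f1‖ + ‖f2‖) + a := by
  have h3 := norm_add_le (v - (f + (f0 * z 0 + f1 * z 1 + f2 * z 2))) (f0 * z 0 + f1 * z 1 + f2 * z 2)
  have h4 := norm_jet_le hz f0 f1 f2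
  have h5 := norm_sub_jet_assoc hv
  rw [← sub_sub] at h3 h5
  rw [sub_add_cancel] at h3
  linarith

theorem Rep.norm_sub_le {J : ACJ} {v : ℂ} (h : Rep M z J v) {e σ : ℝ} (he : J.e = .fin e)
    (hs : J.size = .fin σ) : ∃ f, IsC J.f f ∧ ‖v - f‖ ≤ σ + e := by
  obtain ⟨-, -, f, f0, f1, f2, hf, -, -, -, h1, h2⟩ := h.data he hs
  exact ⟨f, hf, (norm_sub_centre_le h.hz h2).trans (by gcongr)⟩

variable {x y r : ACJ} {v w : ℂ}

theorem rep_ofDbl {t : ℝ} (ht : IsNormal t) (hz : ∀ k, ‖z k‖ ≤ 1)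
    (h : ACJ.ofDbl M (const t) = some r) : Rep M z r t := by
  refine rep_of_build h hz (le_refl (0 : ℝ)) ?_
  rintro _ ⟨⟩ - - -
  exact ⟨t, 0, 0, 0, isC_ofDbl ht, isC_zero, isC_zero, isC_zero, by simp⟩

theorem Rep.neg_val (hx : Rep M z x v) {e : ℝ} (he : x.e = .fin e) (k0 : FinC x.f0.neg)
    (k1 : FinC x.f1.neg) (k2 : FinC x.f2.neg) : ∃ f f0 f1 f2, IsC x.f.neg f ∧ IsC x.f0.neg f0 ∧
      IsC x.f1.neg f1 ∧ IsC x.f2.neg f2 ∧ ‖-v - jet(z,f,f0,f1,f2)‖ ≤ e := by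
  rw [FinC.neg_iff] at k0 k1 k2
  obtain ⟨f, f0, f1, f2, hf, h0, h1, h2, hv⟩ := hx.val e he k0 k1 k2
  refine ⟨_, _, _, _, hf.neg, h0.neg, h1.neg, h2.neg, ?_⟩
  rw [show -v - jet(z,-f,-f0,-f1,-f2) =
    -(v - jet(z,f,f0,f1,f2)) by ring, norm_neg]
  exact hv

theorem Rep.neg (hx : Rep M z x v) (h : x.neg M = some r) : Rep M z r (-v) :=
  rep_of_build h hx.hz hx.nonneg fun _ => hx.neg_val

namespace XComplex

variable {x y : XComplex} {r : AComplex} {e : ℝ} {t : Dbl}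

theorem finC_of_add (h : x.add y = some r) (he : r.e = .fin e) : FinC x ∧ FinC y := by
  obtain ⟨re, im, d, h1, h2, h3, rfl⟩ := add_eq_some h
  cases he
  obtain ⟨⟨p, rfl⟩, ⟨q, rfl⟩⟩ := finC_of_pair h3
  obtain ⟨_, _, k1, k2⟩ := AComplex.fin_of_fadd h1
  obtain ⟨_, _, k3, k4⟩ := AComplex.fin_of_fadd h2
  exact ⟨⟨_, _, k1, k3⟩, ⟨_, _, k2, k4⟩⟩

theorem finC_of_mulD (h : x.mulD t = some r) (he : r.e = .fin e) : FinC x := by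
  obtain ⟨re, im, d, h1, h2, h3, rfl⟩ := mulD_eq_some h
  cases he
  obtain ⟨⟨p, rfl⟩, ⟨q, rfl⟩⟩ := finC_of_pair h3
  obtain ⟨_, _, k2, -, -⟩ := fmul_fin h1
  obtain ⟨_, _, k3, -, -⟩ := fmul_fin h2
  exact ⟨_, _, by simpa using k2, by simpa using k3⟩

end XComplex

theorem fin_of_sum4 {a b c d : FP} {s : ℝ} (h : (a +ᶠ b) +ᶠ (c +ᶠ d) = some (.fin s)) :
    ∃ p q u v, a = some (.fin p) ∧ b = some (.fin q) ∧ c = some (.fin u) ∧ d = some (.fin v) := by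
  obtain ⟨_, _, h1, h2, -⟩ := fadd_fin h
  obtain ⟨p, q, h3, h4, -⟩ := fadd_fin h1
  obtain ⟨u, v, h5, h6, -⟩ := fadd_fin h2
  exact ⟨p, q, u, v, h3, h4, h5, h6⟩

theorem ubo_sum4 {a b c d : Dbl} (ha : UB a 0) (hb : UB b 0) (hc : UB c 0) (hd : UB d 0) :
    UBo ((some a +ᶠ some b) +ᶠ (some c +ᶠ some d)) 0 :=
  ((UB.some ha).add_nonneg (UB.some hb)).add_nonneg ((UB.some hc).add_nonneg (UB.some hd))

theorem kb_fin {d : Dbl} {t : ℝ} (h : d = .fin t) (h0 : UB d 0) : Kb 0 (some d) t :=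
  UB.kb (by rw [h]; exact le_rfl) (by rw [h] at h0; exact h0)

theorem kb_sum4 {a b c d : Dbl} {p q u v : ℝ} (ha : UB a 0) (hb : UB b 0) (hc : UB c 0)
    (hd : UB d 0) (ea : a = .fin p) (eb : b = .fin q) (ec : c = .fin u) (ed : d = .fin v) :
    Kb 2 ((some a +ᶠ some b) +ᶠ (some c +ᶠ some d)) ((p + q) + (u + v)) :=
  ((kb_fin ea ha).add (kb_fin eb hb)).add ((kb_fin ec hc).add (kb_fin ed hd))

theorem ACJ.add_eq_some (h : x.add M y = some r) : ∃ s s0 s1 s2 e,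
    x.f.add y.f = some s ∧ x.f0.add y.f0 = some s0 ∧ x.f1.add y.f1 = some s1 ∧
    x.f2.add y.f2 = some s2 ∧
    some (const (1 + 3 * eps)) *ᶠ ((some x.e +ᶠ some y.e) +ᶠ
      ((some s.e +ᶠ some s0.e) +ᶠ (some s1.e +ᶠ some s2.e))) = some e ∧
    ACJ.build M s.z s0.z s1.z s2.z e = some r := by
  simpa only [ACJ.add, bind_iff, exists_and_left] using h

/-- The common bound for the error of a sum. -/
theorem sum_error_le {a b s s0 s1 s2 : Dbl} {e : ℝ} (ha : UB a 0) (hb : UB b 0) (hs : UB s 0)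
    (hs0 : UB s0 0) (hs1 : UB s1 0) (hs2 : UB s2 0)
    (h : some (const (1 + 3 * eps)) *ᶠ ((some a +ᶠ some b) +ᶠ
      ((some s +ᶠ some s0) +ᶠ (some s1 +ᶠ some s2))) = some (.fin e)) :
    ∃ a' b' t t0 t1 t2, a = .fin a' ∧ b = .fin b' ∧ s = .fin t ∧ s0 = .fin t0 ∧ s1 = .fin t1 ∧
      s2 = .fin t2 ∧ a' + b' + ((t + t0) + (t1 + t2)) ≤ e := by
  have hen := eps_nonneg
  have h' := h
  obtain ⟨_, _, -, k1, -⟩ := fmul_fin h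
  obtain ⟨_, _, k2, k3, -⟩ := fadd_fin k1
  obtain ⟨a', b', l1, l2, -⟩ := fadd_fin k2
  obtain ⟨t, t0, t1, t2, l3, l4, l5, l6⟩ := fin_of_sum4 k3
  rw [Option.some.injEq] at l1 l2 l3 l4 l5 l6
  refine ⟨a', b', t, t0, t1, t2, l1, l2, l3, l4, l5, l6, ?_⟩
  have hin := ((kb_fin l1 ha).add (kb_fin l2 hb)).add (kb_sum4 hs hs0 hs1 hs2 l3 l4 l5 l6)
  have hkb := (kb_const (x := 1 + 3 * eps) (by positivity)).mul hin
  simpa using hkb.le_of (C := 1) h' rfl hin.nonneg (by norm_num [kap, eps_eq, ur_eq])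

theorem Rep.add_of (hx : Rep M z x v) (hy : UB y.e 0) (hw : ∀ e, y.e = .fin e → FinC y.f0 →
      FinC y.f1 → FinC y.f2 → ∃ f f0 f1 f2, IsC y.f f ∧ IsC y.f0 f0 ∧ IsC y.f1 f1 ∧ IsC y.f2 f2 ∧
      ‖w - jet(z,f,f0,f1,f2)‖ ≤ e) (h : x.add M y = some r) :
    Rep M z r (v + w) := by
  obtain ⟨s, s0, s1, s2, e, h1, h2, h3, h4, h5, h6⟩ := ACJ.add_eq_some h
  have n := XComplex.add_nonneg h1
  have n0 := XComplex.add_nonneg h2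
  have n1 := XComplex.add_nonneg h3
  have n2 := XComplex.add_nonneg h4
  refine rep_of_build h6 hx.hz ?_ ?_
  · exact (ubo_const (by have := eps_nonneg; positivity)).mul_nonneg (((UB.some hx.nonneg).add_nonneg
      (UB.some hy)).add_nonneg (ubo_sum4 n n0 n1 n2)) e h5
  · rintro e rfl - - -
    obtain ⟨a, b, t, t0, t1, t2, ea, eb, et, e0, e1, e2, hle⟩ :=
      sum_error_le hx.nonneg hy n n0 n1 n2 h5
    obtain ⟨k0, l0⟩ := XComplex.finC_of_add h2 e0
    obtain ⟨k1, l1⟩ := XComplex.finC_of_add h3 e1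
    obtain ⟨k2, l2⟩ := XComplex.finC_of_add h4 e2
    obtain ⟨f, f0, f1, f2, hf, hf0, hf1, hf2, hv⟩ := hx.val a ea k0 k1 k2
    obtain ⟨g, g0, g1, g2, hg, hg0, hg1, hg2, hw⟩ := hw b eb l0 l1 l2
    obtain ⟨c, hc, q, -⟩ := XComplex.add_sound h1 hf hg et
    obtain ⟨c0, hc0, q0, -⟩ := XComplex.add_sound h2 hf0 hg0 e0
    obtain ⟨c1, hc1, q1, -⟩ := XComplex.add_sound h3 hf1 hg1 e1
    obtain ⟨c2, hc2, q2, -⟩ := XComplex.add_sound h4 hf2 hg2 e2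
    refine ⟨c, c0, c1, c2, hc, hc0, hc1, hc2, ?_⟩
    rw [show v + w - jet(z,c,c0,c1,c2) =
      ((v - jet(z,f,f0,f1,f2)) + (w - jet(z,g,g0,g1,g2))) +
      ((f + g - c) + ((f0 + g0 - c0) * z 0 + (f1 + g1 - c1) * z 1 + (f2 + g2 - c2) * z 2)) by ring]
    refine (norm_add_jet_le hx.hz _ _ _ _ _).trans ?_
    linarith [norm_add_le (v - jet(z,f,f0,f1,f2))
      (w - jet(z,g,g0,g1,g2))]

theorem Rep.add (hx : Rep M z x v) (hy : Rep M z y w) (h : x.add M y = some r) :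
    Rep M z r (v + w) := hx.add_of hy.nonneg hy.val h

theorem Rep.sub (hx : Rep M z x v) (hy : Rep M z y w) (h : x.sub M y = some r) :
    Rep M z r (v - w) := by
  rw [sub_eq_add_neg]
  exact hx.add_of (y := ⟨y.f.neg, y.f0.neg, y.f1.neg, y.f2.neg, y.e, y.size⟩) hy.nonneg
    (fun _ => hy.neg_val) h

theorem Rep.addD {t : ℝ} (hx : Rep M z x v) (h : x.addD M (const t) = some r) :
    Rep M z r (v + t) := by
  simp only [ACJ.addD, bind_iff] at h
  obtain ⟨s, h1, e, he, h3⟩ := h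
  have hs0 := XComplex.addD_nonneg h1
  refine rep_of_build h3 hx.hz ?_ ?_
  · exact (ubo_const (by have := eps_nonneg; positivity)).mul_nonneg
      ((UB.some hx.nonneg).add_nonneg (UB.some hs0)) e he
  · rintro e rfl k0 k1 k2
    have he' := he
    obtain ⟨_, _, -, l1, -⟩ := fmul_fin he
    obtain ⟨a, b, l2, l3, -⟩ := fadd_fin l1
    rw [Option.some.injEq] at l2 l3
    obtain ⟨f, f0, f1, f2, hf, h0, h1', h2, hv⟩ := hx.val a l2 k0 k1 k2
    obtain ⟨c, hc, hc', -⟩ := XComplex.addD_sound h1 hf l3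
    refine ⟨c, f0, f1, f2, hc, h0, h1', h2, ?_⟩
    have hn := hx.nonneg
    rw [l2] at hn
    rw [l3] at hs0
    have hle := UBo.guard_add (UB.some (d := x.e) (r := a) (by rw [l2]; exact le_rfl))
      (UB.some (d := s.e) (r := b) (by rw [l3]; exact le_rfl))
      (add_nonneg (show (0 : ℝ) ≤ a from hn) (show (0 : ℝ) ≤ b from hs0)) _ he'
    refine le_trans ?_ hle
    rw [show v + t - jet(z,c,f0,f1,f2) =
      (v - jet(z,f,f0,f1,f2)) + (f + t - c) by ring]
    exact (norm_add_le _ _).trans (add_le_add hv hc')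

theorem Rep.subD {t : ℝ} (hx : Rep M z x v) (h : x.subD M (const t) = some r) :
    Rep M z r (v - t) := by
  rw [sub_eq_add_neg, ← Complex.ofReal_neg]; exact hx.addD h

theorem Rep.mulD {t : ℝ} (hx : Rep M z x v) (h : x.mulD M (const t) = some r) :
    Rep M z r (v * t) := by
  simp only [ACJ.mulD, bind_iff] at h
  obtain ⟨s, h1, s0, h2, s1, h3, s2, h4, e, h5, h6⟩ := h
  have n := XComplex.mulD_nonneg h1
  have n0 := XComplex.mulD_nonneg h2
  have n1 := XComplex.mulD_nonneg h3
  have n2 := XComplex.mulD_nonneg h4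
  have hen := eps_nonneg
  refine rep_of_build h6 hx.hz ?_ ?_
  · exact (ubo_const (by positivity)).mul_nonneg (((UB.some hx.nonneg).mul_nonneg
      (ubo_abs _)).add_nonneg (ubo_sum4 n n0 n1 n2)) e h5
  · rintro e rfl - - -
    have h5' := h5
    obtain ⟨_, _, -, k1, -⟩ := fmul_fin h5
    obtain ⟨_, _, k2, k3, -⟩ := fadd_fin k1
    obtain ⟨a, b, ea, eb, -⟩ := fmul_fin k2
    obtain ⟨t0, t1, t2, t3, l3, l4, l5, l6⟩ := fin_of_sum4 k3
    rw [Option.some.injEq] at ea l3 l4 l5 l6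
    have hin := ((kb_fin ea hx.nonneg).mul (kb_abs t)).add (kb_sum4 n n0 n1 n2 l3 l4 l5 l6)
    have hkb := (kb_const (x := 1 + 3 * eps) (by positivity)).mul hin
    have hle := hkb.le_of (C := 1) h5' rfl hin.nonneg (by norm_num [kap, eps_eq, ur_eq])
    obtain ⟨f, f0, f1, f2, hf, hf0, hf1, hf2, hv⟩ := hx.val a ea (XComplex.finC_of_mulD h2 l4)
      (XComplex.finC_of_mulD h3 l5) (XComplex.finC_of_mulD h4 l6)
    obtain ⟨c, hc, q, -⟩ := XComplex.mulD_sound h1 hf l3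
    obtain ⟨c0, hc0, q0, -⟩ := XComplex.mulD_sound h2 hf0 l4
    obtain ⟨c1, hc1, q1, -⟩ := XComplex.mulD_sound h3 hf1 l5
    obtain ⟨c2, hc2, q2, -⟩ := XComplex.mulD_sound h4 hf2 l6
    refine ⟨c, c0, c1, c2, hc, hc0, hc1, hc2, ?_⟩
    rw [show v * t - jet(z,c,c0,c1,c2) =
      (v - jet(z,f,f0,f1,f2)) * t +
      ((f * t - c) + ((f0 * t - c0) * z 0 + (f1 * t - c1) * z 1 + (f2 * t - c2) * z 2)) by ring]
    refine (norm_add_jet_le hx.hz _ _ _ _ _).trans ?_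
    have h7 : ‖(v - jet(z,f,f0,f1,f2)) * (t : ℂ)‖ ≤ a * |t| := by
      rw [norm_mul, Complex.norm_real, Real.norm_eq_abs]
      gcongr
    linarith

theorem ACJ.mul_eq_some (h : x.mul M y = some r) :
    ∃ ax ay s p0 q0 s0 p1 q1 s1 p2 q2 s2 A B C e,
    x.f.absUB M = some ax ∧ y.f.absUB M = some ay ∧ x.f.mul y.f = some s ∧
    x.f.mul y.f0 = some p0 ∧ x.f0.mul y.f = some q0 ∧ p0.add q0 = some s0 ∧
    x.f.mul y.f1 = some p1 ∧ x.f1.mul y.f = some q1 ∧ p1.add q1 = some s1 ∧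
    x.f.mul y.f2 = some p2 ∧ x.f2.mul y.f = some q2 ∧ p2.add q2 = some s2 ∧
    (some x.size +ᶠ some x.e) *ᶠ (some y.size +ᶠ some y.e) = some A ∧
    some ax *ᶠ some y.e +ᶠ some ay *ᶠ some x.e = some B ∧
    (some s.e +ᶠ some s0.e) +ᶠ (some s1.e +ᶠ some s2.e) = some C ∧
    some (const (1 + 3 * eps)) *ᶠ (some A +ᶠ (some B +ᶠ some C)) = some e ∧
    ACJ.build M s.z s0.z s1.z s2.z e = some r := by
  simpa only [ACJ.mul, bind_iff, exists_and_left] using h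

theorem XComplex.mul_repA {x y : XComplex} {r : AComplex} {a b : ℂ} (h : x.mul y = some r)
    (hx : IsC x a) (hy : IsC y b) : RepA r (a * b) := by
  intro e he
  obtain ⟨c, hc, hc', -⟩ := XComplex.mul_sound h hx hy he
  exact Or.inl ⟨c, hc, hc'⟩

/-- The exact data of a product of jets with finite error. -/
theorem Rep.mul_data (hx : Rep M z x v) (hy : Rep M z y w) (h : x.mul M y = some r) {e : ℝ}
    (he : r.e = .fin e) :
    ∃ a b σ τ f f0 f1 f2 g g0 g1 g2 c c0 c1 c2 : _,
      x.e = .fin a ∧ y.e = .fin b ∧ x.size = .fin σ ∧ y.size = .fin τ ∧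
      0 ≤ a ∧ 0 ≤ b ∧ 0 ≤ σ ∧ 0 ≤ τ ∧
      IsC x.f f ∧ IsC x.f0 f0 ∧ IsC x.f1 f1 ∧ IsC x.f2 f2 ∧
      IsC y.f g ∧ IsC y.f0 g0 ∧ IsC y.f1 g1 ∧ IsC y.f2 g2 ∧
      IsC r.f c ∧ IsC r.f0 c0 ∧ IsC r.f1 c1 ∧ IsC r.f2 c2 ∧
      ‖f0‖ + (‖f1‖ + ‖f2‖) ≤ σ ∧ ‖g0‖ + (‖g1‖ + ‖g2‖) ≤ τ ∧
      ‖v - jet(z,f,f0,f1,f2)‖ ≤ a ∧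
      ‖w - jet(z,g,g0,g1,g2)‖ ≤ b ∧
      ‖f * g - c‖ ≤ 5 * ur * (‖f‖ * ‖g‖) ∧
      (σ + a) * (τ + b) + ((‖f‖ * b + ‖g‖ * a) + ((‖f * g - c‖ + ‖f * g0 + f0 * g - c0‖) +
        (‖f * g1 + f1 * g - c1‖ + ‖f * g2 + f2 * g - c2‖))) ≤ e := by
  obtain ⟨ax, ay, s, p0, q0, s0, p1, q1, s1, p2, q2, s2, A, B, C, e, h1, h2, h3, h4, h5, h6, h7, h8,
    h9, h10, h11, h12, h13, h14, h15, h16, h17⟩ := ACJ.mul_eq_some h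
  have hen := eps_nonneg
  have n := XComplex.mul_nonneg h3
  have n0 := AComplex.add_nonneg h6 (XComplex.mul_nonneg h4) (XComplex.mul_nonneg h5)
  have n1 := AComplex.add_nonneg h9 (XComplex.mul_nonneg h7) (XComplex.mul_nonneg h8)
  have n2 := AComplex.add_nonneg h12 (XComplex.mul_nonneg h10) (XComplex.mul_nonneg h11)
  obtain ⟨_, -, rfl⟩ := build_eq_some h17
  cases he
  have h16' := h16
  obtain ⟨_, _, -, k1, -⟩ := fmul_fin h16
  obtain ⟨A, _, ⟨⟩, k2, -⟩ := fadd_fin k1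
  obtain ⟨B, C, ⟨⟩, ⟨⟩, -⟩ := fadd_fin k2
  obtain ⟨_, _, k3, k4, -⟩ := fmul_fin h13
  obtain ⟨σ, a, k5, k6, -⟩ := fadd_fin k3
  obtain ⟨τ, b, k7, k8, -⟩ := fadd_fin k4
  obtain ⟨t, t0, t1, t2, l3, l4, l5, l6⟩ := fin_of_sum4 h15
  rw [Option.some.injEq] at k5 k6 k7 k8 l3 l4 l5 l6
  obtain ⟨ha, hσ, f, f0, f1, f2, hf, hf0, hf1, hf2, hfs, hv⟩ := hx.data k6 k5
  obtain ⟨hb, hτ, g, g0, g1, g2, hg, hg0, hg1, hg2, hgs, hw⟩ := hy.data k8 k7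
  obtain ⟨c, hc, r1, r2⟩ := XComplex.mul_sound h3 hf hg l3
  obtain ⟨c0, -, -, hc0, -, -, r3, -⟩ := AComplex.add_sound h6 (XComplex.mul_repA h4 hf hg0)
    (XComplex.mul_repA h5 hf0 hg) (XComplex.mul_nonneg h4) (XComplex.mul_nonneg h5) l4
  obtain ⟨c1, -, -, hc1, -, -, r4, -⟩ := AComplex.add_sound h9 (XComplex.mul_repA h7 hf hg1)
    (XComplex.mul_repA h8 hf1 hg) (XComplex.mul_nonneg h7) (XComplex.mul_nonneg h8) l5
  obtain ⟨c2, -, -, hc2, -, -, r5, -⟩ := AComplex.add_sound h12 (XComplex.mul_repA h10 hf hg2)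
    (XComplex.mul_repA h11 hf2 hg) (XComplex.mul_nonneg h10) (XComplex.mul_nonneg h11) l6
  refine ⟨a, b, σ, τ, f, f0, f1, f2, g, g0, g1, g2, c, c0, c1, c2, k6, k8, k5, k7, ha, hb, hσ, hτ,
    hf, hf0, hf1, hf2, hg, hg0, hg1, hg2, hc, hc0, hc1, hc2, hfs, hgs, hv, hw, r2, ?_⟩
  have hA := ((kb_fin k5 hx.size_nonneg).add (kb_fin k6 hx.nonneg)).mul
    ((kb_fin k7 hy.size_nonneg).add (kb_fin k8 hy.nonneg))
  have hax : Kb 0 (some ax) ‖f‖ := UB.kb (absUB_spec hf h1).1 (norm_nonneg f)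
  have hay : Kb 0 (some ay) ‖g‖ := UB.kb (absUB_spec hg h2).1 (norm_nonneg g)
  have hB := (hax.mul (kb_fin k8 hy.nonneg)).add (hay.mul (kb_fin k6 hx.nonneg))
  have hC := kb_sum4 n n0 n1 n2 l3 l4 l5 l6
  rw [h13] at hA
  rw [h14] at hB
  rw [h15] at hC
  have hin := hA.add (hB.add hC)
  have hkb := (kb_const (x := 1 + 3 * eps) (by positivity)).mul hin
  have hle := hkb.le_of (C := 1) h16' rfl hin.nonneg (by norm_num [kap, eps_eq, ur_eq])
  linarith

theorem norm_mul_sub_jet_le (hz : ∀ k, ‖z k‖ ≤ 1) {f f0 f1 f2 g g0 g1 g2 : ℂ} {a b σ τ : ℝ}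
    (hfs : ‖f0‖ + (‖f1‖ + ‖f2‖) ≤ σ) (hgs : ‖g0‖ + (‖g1‖ + ‖g2‖) ≤ τ)
    (hv : ‖v - jet(z,f,f0,f1,f2)‖ ≤ a)
    (hw : ‖w - jet(z,g,g0,g1,g2)‖ ≤ b) (c c0 c1 c2 : ℂ) :
    ‖v * w - jet(z,c,c0,c1,c2)‖ ≤
      (σ + a) * (τ + b) + ((‖f‖ * b + ‖g‖ * a) + ((‖f * g - c‖ + ‖f * g0 + f0 * g - c0‖) +
        (‖f * g1 + f1 * g - c1‖ + ‖f * g2 + f2 * g - c2‖))) := by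
  have hξ : ‖v - f‖ ≤ σ + a := (norm_sub_centre_le hz hv).trans (by gcongr)
  have hη : ‖w - g‖ ≤ τ + b := (norm_sub_centre_le hz hw).trans (by gcongr)
  rw [show v * w - jet(z,c,c0,c1,c2) =
    ((v - f) * (w - g) + (f * (w - jet(z,g,g0,g1,g2)) +
      g * (v - jet(z,f,f0,f1,f2)))) + ((f * g - c) + ((f * g0 + f0 * g - c0) * z 0
      + (f * g1 + f1 * g - c1) * z 1 + (f * g2 + f2 * g - c2) * z 2)) by ring]
  refine (norm_add_jet_le hz _ _ _ _ _).trans ?_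
  have h1 : ‖(v - f) * (w - g)‖ ≤ (σ + a) * (τ + b) := by
    rw [norm_mul]
    exact mul_le_mul hξ hη (norm_nonneg _) ((norm_nonneg _).trans hξ)
  have h2 := norm_add_le ((v - f) * (w - g)) (f * (w - jet(z,g,g0,g1,g2)) +
      g * (v - jet(z,f,f0,f1,f2)))
  have h3 := norm_add_le (f * (w - jet(z,g,g0,g1,g2)))
      (g * (v - jet(z,f,f0,f1,f2)))
  rw [norm_mul f, norm_mul g] at h3
  have h4 := mul_le_mul_of_nonneg_left hw (norm_nonneg f)
  have h5 := mul_le_mul_of_nonneg_left hv (norm_nonneg g)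
  linarith

theorem Rep.mul (hx : Rep M z x v) (hy : Rep M z y w) (h : x.mul M y = some r) :
    Rep M z r (v * w) := by
  have hr : UB r.e 0 ∧ ACJ.build M r.f r.f0 r.f1 r.f2 r.e = some r := by
    obtain ⟨ax, ay, s, p0, q0, s0, p1, q1, s1, p2, q2, s2, A, B, C, e, h1, h2, h3, h4, h5, h6, h7,
      h8, h9, h10, h11, h12, h13, h14, h15, h16, h17⟩ := ACJ.mul_eq_some h
    have n := XComplex.mul_nonneg h3
    have n0 := AComplex.add_nonneg h6 (XComplex.mul_nonneg h4) (XComplex.mul_nonneg h5)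
    have n1 := AComplex.add_nonneg h9 (XComplex.mul_nonneg h7) (XComplex.mul_nonneg h8)
    have n2 := AComplex.add_nonneg h12 (XComplex.mul_nonneg h10) (XComplex.mul_nonneg h11)
    have hA : UB A 0 := ((UB.some hx.size_nonneg).add_nonneg (UB.some hx.nonneg)).mul_nonneg
      ((UB.some hy.size_nonneg).add_nonneg (UB.some hy.nonneg)) A h13
    have hB : UB B 0 := ((UB.some (ubo_absUB M _ _ h1)).mul_nonneg (UB.some hy.nonneg)).add_nonneg
      ((UB.some (ubo_absUB M _ _ h2)).mul_nonneg (UB.some hx.nonneg)) B h14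
    have hC : UB C 0 := ubo_sum4 n n0 n1 n2 C h15
    have he : UB e 0 := (ubo_const (by have := eps_nonneg; positivity)).mul_nonneg
      ((UB.some hA).add_nonneg ((UB.some hB).add_nonneg (UB.some hC))) e h16
    obtain ⟨_, -, rfl⟩ := build_eq_some h17
    exact ⟨he, h17⟩
  refine ⟨hx.hz, hr.2, hr.1, ?_⟩
  intro e he _ _ _
  obtain ⟨a, b, σ, τ, f, f0, f1, f2, g, g0, g1, g2, c, c0, c1, c2, -, -, -, -, -, -, -, -,
    -, -, -, -, -, -, -, -, hc, hc0, hc1, hc2, hfs, hgs, hv, hw, -, hle⟩ := hx.mul_data hy h he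
  exact ⟨c, c0, c1, c2, hc, hc0, hc1, hc2, (norm_mul_sub_jet_le hx.hz hfs hgs hv hw c c0 c1 c2).trans hle⟩

variable {M : Machine} {z : Fin 3 → ℂ} {x y r : ACJ} {v w : ℂ}

/-! ### Bounds of the values of a jet -/

theorem Rep.absUB (hx : Rep M z x v) : UBo (x.absUB M) ‖v‖ := by
  have key : ∃ a s t : ℝ, 0 ≤ a ∧ 0 ≤ s ∧ 0 ≤ t ∧ UBo (x.f.absUB M) a ∧ UB x.size s ∧ UB x.e t ∧
      ‖v‖ ≤ a + (s + t) := by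
    rcases hx.nonneg.cases with hb | ⟨e, he, he0⟩
    · exact ⟨0, 0, ‖v‖, le_rfl, le_rfl, norm_nonneg v, ubo_absUB M _, hx.size_nonneg, hb.ub _,
        by linarith⟩
    · rcases hx.size_nonneg.cases with hb | ⟨σ, hσ, hσ0⟩
      · exact ⟨0, ‖v‖, 0, le_rfl, norm_nonneg v, le_rfl, ubo_absUB M _, hb.ub _, hx.nonneg,
          by linarith⟩
      · obtain ⟨f, hf, h⟩ := hx.norm_sub_le he hσ
        refine ⟨‖f‖, σ, e, norm_nonneg f, hσ0, he0, fun d hd => (absUB_spec hf hd).1,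
          by rw [hσ]; exact le_rfl, by rw [he]; exact le_rfl, ?_⟩
        have := norm_sub_norm_le v f
        linarith
  obtain ⟨a, s, t, ha, hs, ht, h1, h2, h3, h4⟩ := key
  have hen := eps_nonneg
  have hin := (h1.kb ha).add ((UB.kb h2 hs).add (UB.kb h3 ht))
  have hkb := (kb_const (x := 1 + 2 * eps) (by positivity)).mul hin
  refine hkb.ub.mono (h4.trans ?_)
  rw [← mul_assoc]
  exact le_mul_of_one_le_left hin.nonneg (by norm_num [kap, eps_eq, ur_eq])

theorem two_pow_mul_one_sub_ur :
    (2 : ℝ) ^ 1024 * (1 - ur) = ((2 ^ 53 - 1 : ℤ) : ℝ) * 2 ^ (971 : ℤ) := by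
  have h : (2 : ℝ) ^ 1024 = 2 ^ (53 : ℤ) * 2 ^ (971 : ℤ) := by
    rw [← zpow_add₀ (by norm_num), ← zpow_natCast]; norm_num
  rw [h]
  generalize (2 : ℝ) ^ (971 : ℤ) = T
  rw [ur_eq]
  norm_num
  ring

theorem two_pow_mul_le_norm_of_absLB {x : XComplex} {f : ℂ} {s : Bool} (h : IsC x f)
    (hd : x.absLB M = some (.inf s)) : 2 ^ 1024 * (1 - ur) ≤ ‖f‖ := by
  have hu := ur_pos
  have hu' := ur_le
  have hH : 2 ^ 1024 ≤ M.hypot f.re f.im := by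
    have h0 := neg_le_hypot M f.re f.im
    have h2 := two_zpow_neg_le
    have h3 := one_lt_two_pow_1024
    have hlt : 2 ^ 1024 ≤ |M.hypot f.re f.im| := by
      rcases fhypot_fin M h with h1 | ⟨-, h1⟩
      · unfold XComplex.absLB at hd
        rw [h1] at hd
        obtain ⟨_, _, ⟨⟩, ⟨⟩, hd⟩ := fmul_eq_some hd
        rcases fl_cases hd with ⟨h4, -⟩ | ⟨-, h4⟩
        · cases h4
        · refine h4.trans ?_
          rw [abs_round53]
          refine (round53_le (abs_nonneg _)).trans ?_
          rw [abs_mul, ← mul_assoc]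
          refine mul_le_of_le_one_left (abs_nonneg _) ?_
          rw [abs_of_nonneg (by rw [eps_eq]; linarith)]
          norm_num [eps_eq, ur_eq]
      · exact h1
    generalize (2 : ℝ) ^ (-1074 : ℤ) = T at *
    generalize (2 : ℝ) ^ 1024 = T' at *
    rcases abs_cases (M.hypot f.re f.im) with ⟨h5, -⟩ | ⟨h5, -⟩ <;> linarith
  by_contra hlt
  push Not at hlt
  have hrep : IsRepresentable (2 ^ 1024 * (1 - ur)) := by
    exact ⟨2 ^ 53 - 1, 971, by norm_num, by norm_num, two_pow_mul_one_sub_ur⟩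
  have hf := M.hypot_faithful f.re f.im
  rw [sqrt_re_im] at hf
  have hlt2 : (2 : ℝ) ^ 1024 * (1 - ur) < 2 ^ 1024 := by
    have : (0 : ℝ) < 2 ^ 1024 := by positivity
    generalize (2 : ℝ) ^ 1024 = T' at *
    nlinarith
  refine hf.2 _ hrep ?_
  have h4 := (hlt.trans hlt2).trans_le hH
  rw [min_eq_right h4.le, max_eq_left h4.le]
  exact ⟨hlt, hlt2.trans_le hH⟩

theorem round53_max : round53 (2 ^ 1024 * (1 - ur)) = 2 ^ 1024 * (1 - ur) := by
  rw [two_pow_mul_one_sub_ur]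
  exact round53_intCast_mul (by norm_num)

/-- The computed value of `size + e`, enlarged. -/
theorem guard_fin {a b : Dbl} {G : ℝ} (ha : UB a 0) (hb : UB b 0)
    (h : some (const (1 + eps)) *ᶠ (some a +ᶠ some b) = some (.fin G)) :
    ∃ s t, a = .fin s ∧ b = .fin t ∧ 0 ≤ s ∧ 0 ≤ t ∧ s + t ≤ G ∧ s + t < 2 ^ 1024 * (1 - ur) := by
  obtain ⟨_, _, -, h2, -⟩ := fmul_fin h
  obtain ⟨s, t, h3, h4, -⟩ := fadd_fin h2
  rw [Option.some.injEq] at h3 h4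
  subst h3 h4
  have hs : (0 : ℝ) ≤ s := ha
  have ht : (0 : ℝ) ≤ t := hb
  refine ⟨s, t, rfl, rfl, hs, ht, UBo.guard_add (UB.some (d := .fin s) le_rfl)
    (UB.some (d := .fin t) le_rfl) (by positivity) _ h, ?_⟩
  by_contra hc
  push Not at hc
  obtain ⟨_, k, ⟨⟩, h5, h6⟩ := fmul_fin h
  have h7 := flEq_of_fadd h5
  have h8 := round53_mono hc
  rw [round53_max, ← h7.eq] at h8
  have hu := ur_pos
  have h9 : (2 : ℝ) ^ 1024 ≤ (1 + eps) * k := by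
    have hT : (0 : ℝ) < 2 ^ 1024 := by positivity
    have hu' := ur_le
    rw [eps_eq]
    generalize (2 : ℝ) ^ 1024 = T at *
    have : T ≤ (1 + 2 * ur) * (T * (1 - ur)) := by
      have : 0 ≤ T * (ur * (1 - 2 * ur)) := by
        have : 0 ≤ 1 - 2 * ur := by linarith
        positivity
      linarith
    refine this.trans ?_
    gcongr
  exact absurd h9 (not_le.2 h6.arg_lt)

theorem ubo_guard {a b : Dbl} (ha : UB a 0) (hb : UB b 0) :
    UBo (some (const (1 + eps)) *ᶠ (some a +ᶠ some b)) 0 :=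
  (ubo_const (by have := eps_nonneg; positivity)).mul_nonneg
    ((UB.some ha).add_nonneg (UB.some hb))

theorem Bad.not_lt_sub {a G D : Dbl} (hG : Bad G) (h : Dbl.add a G.neg = some D) :
    Dbl.lt (const 0) D = false := by
  rcases hG with rfl | rfl
  all_goals
    rcases a with _ | (_ | _) | _ <;> simp only [Dbl.neg, Dbl.add, Option.some.injEq] at h <;>
      subst h <;> rfl

theorem pos_of_fl_pos {t : ℝ} {D : Dbl} (h : fl t = some D) (hD : Dbl.lt (const 0) D = true) :
    0 < t := by
  by_contra hc
  push Not at hc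
  rcases fl_cases h with ⟨rfl, -, -⟩ | ⟨rfl, h7⟩
  · simp only [Dbl.lt, decide_eq_true_eq] at hD
    have := round53_mono hc
    rw [round53_zero] at this
    linarith
  · simp only [Dbl.lt, Bool.not_eq_eq_eq_not, Bool.not_true, decide_eq_false_iff_not,
      not_lt] at hD
    rw [le_antisymm hc hD, round53_zero, abs_zero] at h7
    exact absurd h7 (not_le.2 (by positivity))

theorem Dbl.mul_inf {t : ℝ} (ht : 0 < t) (s : Bool) : Dbl.mul (const t) (.inf s) = some (.inf s) := by
  simp [Dbl.mul, ht.ne', ht.not_gt]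

theorem Rep.absLB (hx : Rep M z x v) {d : Dbl} (hd : x.absLB M = some d) :
    (∃ a, d = .fin a ∧ 0 ≤ a ∧ a ≤ ‖v‖) ∨
      (d = .inf false ∧ v ≠ 0 ∧ ∃ e c, x.e = .fin e ∧ IsC x.f c ∧ 2 ^ 1024 * (1 - ur) ≤ ‖c‖) := by
  have hu := ur_pos
  have hu' := ur_le
  have hen : 0 < 1 - eps := by rw [eps_eq]; linarith
  simp only [ACJ.absLB, bind_iff] at hd
  obtain ⟨V, h1, b, h2, h3⟩ := hd
  cases b with
  | false =>
    simp only [Bool.false_eq_true, ↓reduceIte, pure_iff] at h3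
    exact Or.inl ⟨0, h3.symm, le_rfl, norm_nonneg v⟩
  | true =>
    simp only [↓reduceIte, pure_iff] at h3
    subst h3
    obtain ⟨_, _, ⟨⟩, h4, h5⟩ := flt_eq_some h2
    rw [Option.some.injEq] at h4
    subst h4
    obtain ⟨_, E, ⟨⟩, h6, h7⟩ := fmul_eq_some h1
    obtain ⟨F, G, h8, h9, h10⟩ := fsub_eq_some h6
    rcases (ubo_guard hx.size_nonneg hx.nonneg G h9).cases with hG | ⟨G, rfl, -⟩
    · have := hG.not_lt_sub h10
      exfalso
      cases E with
      | fin t =>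
        simp only [Dbl.lt, decide_eq_false_iff_not, not_lt] at this
        simp only [Dbl.mul] at h7
        exact (mul_nonpos_of_nonneg_of_nonpos hen.le this).not_gt (pos_of_fl_pos h7 h5)
      | inf s =>
        cases (Dbl.mul_inf hen _).symm.trans h7
        rw [this] at h5
        cases h5
      | nan =>
        simp only [Dbl.mul, Option.some.injEq] at h7
        subst h7
        cases h5
    · obtain ⟨σ, e, hσ, he, hσ0, he0, hle, hlt⟩ := guard_fin hx.size_nonneg hx.nonneg h9
      obtain ⟨f, hf, hv⟩ := hx.norm_sub_le he hσ
      have hnv : ‖f‖ - (σ + e) ≤ ‖v‖ := by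
        have := norm_sub_norm_le f v
        rw [norm_sub_rev] at this
        linarith
      rcases absLB_spec hf h8 with ⟨a, rfl, -, ha, -⟩ | ⟨rfl, -⟩
      · left
        simp only [Dbl.neg, Dbl.add] at h10
        have hVE : ∀ c, round53 (a + -G) = c → round53 ((1 - eps) * c) ≤ ‖v‖ := by
          intro c hc
          rcases le_or_gt 0 (a + -G) with h0 | h0
          · have h11 := round53_le h0
            have h12 := round53_nonneg h0
            rw [hc] at h11 h12
            refine (round53_le (by positivity)).trans ?_
            calc (1 + ur) * ((1 - eps) * c) ≤ (1 + ur) * ((1 - eps) * ((1 + ur) * (a + -G))) := by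
                  gcongr
              _ = ((1 + ur) * (1 - eps) * (1 + ur)) * (a + -G) := by ring
              _ ≤ 1 * (a + -G) := by
                refine mul_le_mul_of_nonneg_right ?_ h0
                norm_num [eps_eq, ur_eq]
              _ ≤ _ := by linarith
          · have h11 := round53_mono h0.le
            rw [round53_zero, hc] at h11
            have h12 := round53_mono (mul_nonpos_of_nonneg_of_nonpos hen.le h11)
            rw [round53_zero] at h12
            exact h12.trans (norm_nonneg v)
        rcases fl_cases h10 with ⟨rfl, -, h14⟩ | ⟨rfl, h11⟩
        · simp only [Dbl.mul] at h7
          have h12 := hVE _ rfl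
          rcases fl_cases h7 with ⟨rfl, -, -⟩ | ⟨rfl, h13⟩
          · simp only [Dbl.lt, decide_eq_true_eq] at h5
            exact ⟨_, rfl, h5.le, h12⟩
          · exfalso
            have h15 : |round53 ((1 - eps) * round53 (a + -G))| ≤ |round53 (a + -G)| := by
              rw [abs_round53]
              have h16 : |(1 - eps) * round53 (a + -G)| ≤ |round53 (a + -G)| := by
                rw [abs_mul]
                refine mul_le_of_le_one_left (abs_nonneg _) ?_
                rw [abs_of_pos hen]; linarith [eps_nonneg]
              refine (round53_mono h16).trans ?_
              rw [abs_round53, round53_round53]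
            exact absurd (h13.trans h15) (not_le.2 h14)
        · exfalso
          cases (Dbl.mul_inf hen _).symm.trans h7
          simp only [Dbl.lt, Bool.not_eq_eq_eq_not, Bool.not_true, decide_eq_false_iff_not,
            not_lt] at h5
          rw [abs_of_nonneg (round53_nonneg h5)] at h11
          have h13 : round53 (a + -G) ≤ round53 a := round53_mono (by linarith)
          have h14 : round53 a = a := fixed_of_fmul h8
          have h15 : a < 2 ^ 1024 := by
            obtain ⟨_, _, _, _, h16⟩ := fmul_fin h8
            exact (le_abs_self a).trans_lt h16.lt
          rw [h14] at h13
          exact absurd (h11.trans h13) (not_le.2 h15)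
      · right
        have h11 := two_pow_mul_le_norm_of_absLB hf h8
        simp only [Dbl.neg, Dbl.add, Option.some.injEq] at h10
        subst h10
        cases (Dbl.mul_inf hen _).symm.trans h7
        refine ⟨rfl, ?_, e, f, he, hf, h11⟩
        rintro rfl
        rw [norm_zero] at hnv
        linarith

theorem im_pos_of_lt (hx : Rep M z x v) {d : Dbl} {ε : ℝ} (hε : ε = 1 ∨ ε = -1)
    (hd : ∀ f : ℂ, IsC x.f f → d = .fin (ε * f.im))
    (h : (some (const (1 + eps)) *ᶠ (some x.size +ᶠ some x.e) <ᶠ some d) = some true) :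
    0 < ε * v.im := by
  obtain ⟨G, _, h1, h2, h3⟩ := flt_eq_some h
  rw [Option.some.injEq] at h2
  subst h2
  rcases (ubo_guard hx.size_nonneg hx.nonneg G h1).cases with (rfl | rfl) | ⟨G, rfl, -⟩
  · cases h3
  · cases d <;> simp [Dbl.lt] at h3
  · obtain ⟨σ, e, hσ, he, hσ0, he0, hle, -⟩ := guard_fin hx.size_nonneg hx.nonneg h1
    obtain ⟨f, hf, hv⟩ := hx.norm_sub_le he hσ
    rw [hd f hf] at h3
    simp only [Dbl.lt, decide_eq_true_eq] at h3
    have h4 := (Complex.abs_im_le_norm (v - f)).trans hv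
    rw [Complex.sub_im] at h4
    obtain ⟨h5, h6⟩ := abs_le.1 h4
    rcases hε with rfl | rfl <;> linarith

theorem Rep.imPos (hx : Rep M z x v) (h : x.imPos = some true) : 0 < v.im := by
  simpa using im_pos_of_lt hx (Or.inl rfl) (fun f hf => by rw [hf.im, one_mul]) h

theorem Rep.imNeg (hx : Rep M z x v) (h : x.imNeg = some true) : v.im < 0 := by
  simpa using im_pos_of_lt hx (Or.inr rfl) (d := x.f.im.neg)
    (fun f hf => by rw [hf.im]; simp [Dbl.neg]) h

/-! ### Division of jets -/

theorem norm_div_sub_jet_le {f g vl wl : ℂ} {P σ a τ b Q : ℝ} (hf : ‖f‖ ≤ P) (hvl : ‖vl‖ ≤ σ)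
    (hv : ‖v - (f + vl)‖ ≤ a) (hwl : ‖wl‖ ≤ τ) (hw : ‖w - (g + wl)‖ ≤ b) (hQ : Q ≤ ‖g‖)
    (hs : τ + b < Q) :
    w ≠ 0 ∧ ‖v / w - (f / g + (vl * g - f * wl) / (g * g))‖ ≤
      (P + σ + a) / (Q - (τ + b)) - (P / Q + σ / Q + τ * P / (Q * Q)) := by
  have hη : ‖w - g‖ ≤ τ + b := by
    rw [show w - g = (w - (g + wl)) + wl by ring]
    linarith [norm_add_le (w - (g + wl)) wl]
  have hτ := (norm_nonneg _).trans hwl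
  have hb := (norm_nonneg _).trans hw
  have hP := (norm_nonneg _).trans hf
  have hσ := (norm_nonneg _).trans hvl
  have ha := (norm_nonneg _).trans hv
  have hQ0 : 0 < Q := by linarith
  have hd : 0 < Q - (τ + b) := by linarith
  have hwn : Q - (τ + b) ≤ ‖w‖ := by
    have := norm_sub_norm_le g w
    rw [norm_sub_rev] at this
    linarith
  have hw0 : w ≠ 0 := norm_pos_iff.1 (hd.trans_le hwn)
  have hg0 : g ≠ 0 := norm_pos_iff.1 (hQ0.trans_le hQ)
  refine ⟨hw0, ?_⟩
  have e1 : v / w - (f / g + (vl * g - f * wl) / (g * g)) =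
      (-(f * (w - (g + wl))) / (g * g) + f * (w - g) * (w - g) / (g * g * w)) +
      ((v - (f + vl)) / w - vl * (w - g) / (g * w)) := by
    field_simp; ring
  have e2 : (P + σ + a) / (Q - (τ + b)) - (P / Q + σ / Q + τ * P / (Q * Q)) =
      (P * b / (Q * Q) + P * (τ + b) * (τ + b) / (Q * Q * (Q - (τ + b)))) +
      (a / (Q - (τ + b)) + σ * (τ + b) / (Q * (Q - (τ + b)))) := by
    field_simp; ring
  rw [e1, e2]
  refine (norm_add_le _ _).trans (add_le_add ((norm_add_le _ _).trans (add_le_add ?_ ?_))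
    ((norm_sub_le _ _).trans (add_le_add ?_ ?_)))
  all_goals simp only [norm_div, norm_mul, norm_neg]; gcongr

theorem AComplex.fin_of_div {x y r : AComplex} {e : ℝ} (h : x.div y = some r)
    (he : r.e = .fin e) : (∃ s, x.e = .fin s) ∧ ∃ t, y.e = .fin t := by
  obtain ⟨n, p1, p2, p3, p4, re, im, A, B, e, -, -, -, -, -, -, -, -, -, h9, h10, rfl⟩ :=
    div_eq_some h
  cases he
  obtain ⟨_, _, -, k1, -⟩ := fmul_fin h10
  have k2 : ∃ s, some (const (5 * (eps / 2))) *ᶠ some A +ᶠ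
      some (const (1 + 103 * eps)) *ᶠ some B = some (.fin s) := by
    rcases fdiv_fin k1 with ⟨s, _, hs, -⟩ | ⟨s, _, hs, -⟩ <;> exact ⟨s, hs⟩
  obtain ⟨s, k2⟩ := k2
  obtain ⟨_, _, -, k3, -⟩ := fadd_fin k2
  obtain ⟨_, B, -, ⟨⟩, -⟩ := fmul_fin k3
  obtain ⟨_, _, k4, k5, -⟩ := fadd_fin h9
  obtain ⟨s, _, k6, -, -⟩ := fmul_fin k4
  obtain ⟨t, _, k7, -, -⟩ := fmul_fin k5
  exact ⟨⟨s, by simpa using k6⟩, ⟨t, by simpa using k7⟩⟩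

theorem AComplex.div_sq_sound {num den q : AComplex} {α g : ℂ} {y : XComplex} {t : ℝ}
    (h : num.div den = some q) (hn : RepA num α) (hn0 : UB num.e 0)
    (hnf : ∀ e, num.e = .fin e → FinC num.z) (hd : y.mul y = some den) (hy : IsC y g)
    (hg : ‖g‖ ≤ 2 ^ 20) (ht : q.e = .fin t) (hq : FinC q.z) :
    ∃ c, IsC q.z c ∧ ‖α / (g * g) - c‖ ≤ t := by
  obtain ⟨⟨s, hs⟩, ⟨d, hd'⟩⟩ := AComplex.fin_of_div h ht
  obtain ⟨c, hc, hc', hc''⟩ := XComplex.mul_sound hd hy hy hd'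
  refine (AComplex.div_sound h hn (XComplex.mul_repA hd hy hy) hn0 (XComplex.mul_nonneg hd)
    (hnf s hs) hc.finC ?_ t ht).resolve_right (not_not.2 hq)
  intro b hb
  obtain rfl := hb.unique hc
  have h1 := norm_sub_norm_le b (g * g)
  rw [norm_sub_rev, norm_mul] at h1
  have h2 : ‖g‖ * ‖g‖ ≤ 2 ^ 20 * 2 ^ 20 := by gcongr
  have hu : 5 * ur ≤ 1 := by norm_num [ur_eq]
  have h3 : 5 * ur * (‖g‖ * ‖g‖) ≤ 1 * (2 ^ 20 * 2 ^ 20) := by gcongr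
  have h4 : ‖b‖ ≤ 2 ^ 41 := by linarith
  exact h4.trans (pow_le_pow_right₀ (by norm_num) (by norm_num))

theorem XComplex.norm_mul_le_of_div {x y : XComplex} {r : AComplex} {a b : ℂ} {e : ℝ}
    (h : x.div y = some r) (hx : IsC x a) (hy : IsC y b) (he : r.e = .fin e) :
    ‖a‖ * ‖b‖ ≤ (1 + ur) ^ 3 * 2 ^ 1024 := by
  obtain ⟨n, p1, p2, p3, p4, re, im, A, e, h1, h2, h3, h4, h5, h6, h7, h8, h9, rfl⟩ :=
    div_eq_some h
  cases he
  have hu := ur_pos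
  obtain ⟨_, _, -, k1, -⟩ := fmul_fin h9
  obtain ⟨_, A, -, ⟨⟩, -⟩ := fmul_fin k1
  have k2 : ∃ s, (some p1.abs +ᶠ some p2.abs) +ᶠ (some p3.abs +ᶠ some p4.abs) =
      some (.fin s) := by
    rcases fdiv_fin h8 with ⟨s, _, hs, -⟩ | ⟨s, _, hs, -⟩ <;> exact ⟨s, hs⟩
  obtain ⟨S, k2⟩ := k2
  obtain ⟨s1, s2, k3, k4, fS⟩ := fadd_fin k2
  obtain ⟨_, _, k5, k6, g1⟩ := fadd_fin k3
  obtain ⟨_, _, k7, k8, g2⟩ := fadd_fin k4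
  obtain ⟨p1, rfl, rfl⟩ := abs_fin k5
  obtain ⟨p2, rfl, rfl⟩ := abs_fin k6
  obtain ⟨p3, rfl, rfl⟩ := abs_fin k7
  obtain ⟨p4, rfl, rfl⟩ := abs_fin k8
  rw [hx.re, hy.re] at h2
  rw [hx.im, hy.im] at h3
  rw [hx.im, hy.re] at h4
  rw [hx.re, hy.im] at h5
  have f1 := abs_le_of_flEq' (flEq_of_fmul h2)
  have f2 := abs_le_of_flEq' (flEq_of_fmul h3)
  have f3 := abs_le_of_flEq' (flEq_of_fmul h4)
  have f4 := abs_le_of_flEq' (flEq_of_fmul h5)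
  have q1 := g1.ge (by positivity)
  have q2 := g2.ge (by positivity)
  have q3 := fS.ge (_root_.add_nonneg (g1.nonneg (by positivity)) (g2.nonneg (by positivity)))
  have q4 := (le_abs_self S).trans_lt fS.lt
  have q5 : ‖a‖ * ‖b‖ ≤ (|a.re| + |a.im|) * (|b.re| + |b.im|) :=
    mul_le_mul (norm_le_re_im a) (norm_le_re_im b) (norm_nonneg b) (by positivity)
  rw [abs_mul] at f1 f2 f3 f4
  calc ‖a‖ * ‖b‖ ≤ (|a.re| + |a.im|) * (|b.re| + |b.im|) := q5
    _ ≤ (1 + ur) * ((|p1| + |p2|) + (|p3| + |p4|)) := by linarith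
    _ ≤ (1 + ur) * ((1 + ur) * ((1 + ur) * S)) := by
        refine mul_le_mul_of_nonneg_left ?_ (by positivity)
        refine le_trans ?_ (mul_le_mul_of_nonneg_left q3 (by positivity))
        linarith
    _ = (1 + ur) ^ 3 * S := by ring
    _ ≤ _ := mul_le_mul_of_nonneg_left q4.le (by positivity)

/-- The last step in the computation of the error of a nonlinear operation. -/
theorem difference_error {X Y s s0 s1 s2 C e : Dbl} (hX : UB X 0) (hs : UB s 0) (hs0 : UB s0 0)
    (hs1 : UB s1 0) (hs2 : UB s2 0)
    (hC : (some s +ᶠ some s0) +ᶠ (some s1 +ᶠ some s2) = some C)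
    (hXY : ∀ p c, X = .fin p → C = .fin c → ∃ q, Y = .fin q ∧ q ≤ p)
    (h : some (const (1 + 3 * eps)) *ᶠ ((some X -ᶠ some Y) +ᶠ some C) = some e) :
    UB e 0 ∧ ∀ e', e = .fin e' → ∃ p q t t0 t1 t2, X = .fin p ∧ Y = .fin q ∧ s = .fin t ∧
      s0 = .fin t0 ∧ s1 = .fin t1 ∧ s2 = .fin t2 ∧ p - q + ((t + t0) + (t1 + t2)) ≤ e' := by
  have hen := eps_nonneg
  have hp : (0 : ℝ) < 1 + 3 * eps := by positivity
  have hC0 : UB C 0 := ubo_sum4 hs hs0 hs1 hs2 C hC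
  constructor
  · obtain ⟨_, S, ⟨⟩, h1, h2⟩ := fmul_eq_some h
    obtain ⟨W, _, h3, ⟨⟩, h4⟩ := fadd_eq_some h1
    rcases hC0.cases with hb | ⟨c, rfl, hc⟩
    · exact (bad_mul hp (bad_add_right hb h4) h2).ub 0
    rcases hX.cases with hb | ⟨p, rfl, hp'⟩
    · obtain ⟨_, _, ⟨⟩, ⟨⟩, h5⟩ := fsub_eq_some h3
      exact (bad_mul hp (bad_add_left (bad_add_left hb h5) h4) h2).ub 0
    obtain ⟨q, rfl, hq⟩ := hXY p c rfl rfl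
    obtain ⟨_, _, ⟨⟩, ⟨⟩, h5⟩ := fsub_eq_some h3
    have hW := ub_of_fl (r := 0) h5 le_rfl (by linarith)
    rw [mul_zero] at hW
    exact (ubo_const hp.le).mul_nonneg ((UB.some hW).add_nonneg (UB.some hC0)) e
      (by rw [← h3]; exact h)
  · rintro e rfl
    have h' := h
    obtain ⟨_, _, -, h1, -⟩ := fmul_fin h
    obtain ⟨W, C, h2, ⟨⟩, -⟩ := fadd_fin h1
    obtain ⟨p, q, ⟨⟩, ⟨⟩, fW⟩ := fsub_fin h2
    obtain ⟨t, t0, t1, t2, l3, l4, l5, l6⟩ := fin_of_sum4 hC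
    rw [Option.some.injEq] at l3 l4 l5 l6
    obtain ⟨_, ⟨⟩, hq⟩ := hXY p C rfl rfl
    refine ⟨p, q, t, t0, t1, t2, rfl, rfl, l3, l4, l5, l6, ?_⟩
    have hW : Kb 1 (some (Dbl.fin W)) (p - q) := by
      refine ⟨by linarith, UB.some ?_⟩
      rw [fW.eq, pow_one]
      exact kap_mul_le (by linarith)
    have hC' := kb_sum4 hs hs0 hs1 hs2 l3 l4 l5 l6
    rw [hC] at hC'
    have hin := hW.add hC'
    have hkb := (kb_const (x := 1 + 3 * eps) hp.le).mul hin
    rw [← h2] at hkb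
    simpa using hkb.le_of (C := 1) h' rfl hin.nonneg (by norm_num [kap, eps_eq, ur_eq])

theorem guard_of_lt {a s t D : Dbl} (hs : UB s 0) (ht : UB t 0)
    (h : some a -ᶠ some (const (1 + eps)) *ᶠ (some s +ᶠ some t) = some D)
    (hD : (some (const 0) <ᶠ some D) = some true) :
    ∃ G s' t', s = .fin s' ∧ t = .fin t' ∧ 0 ≤ s' ∧ 0 ≤ t' ∧ s' + t' ≤ G ∧
      Dbl.add a (.fin (-G)) = some D ∧ Dbl.lt (const 0) D = true := by
  obtain ⟨_, G, ⟨⟩, h4, h5⟩ := fsub_eq_some h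
  obtain ⟨_, _, ⟨⟩, ⟨⟩, h6⟩ := flt_eq_some hD
  rcases (ubo_guard hs ht G h4).cases with hb | ⟨G, rfl, -⟩
  · rw [hb.not_lt_sub h5] at h6; cases h6
  obtain ⟨s', t', hs, ht, h0, h1, hG, -⟩ := guard_fin hs ht h4
  exact ⟨G, s', t', hs, ht, h0, h1, hG, h5, h6⟩

/-- A difference that is found to be positive is positive, and it does not overflow. -/
theorem fin_of_lt_sub {Q G : ℝ} {D : Dbl} (hQ : FlEq Q Q) (hG : 0 ≤ G) (h : fl (Q + -G) = some D)
    (hD : Dbl.lt (const 0) D = true) :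
    ∃ d, D = .fin d ∧ FlEq (Q + -G) d ∧ 0 < Q + -G ∧ 0 < d := by
  have hpos := pos_of_fl_pos h hD
  obtain ⟨d, rfl, fD⟩ := fin_of_fl_of_le hQ (by rw [abs_of_pos hpos]; linarith) h
  simp only [Dbl.lt, decide_eq_true_eq] at hD
  exact ⟨d, rfl, fD, hpos, hD⟩

/-- A bound for the centre of a jet with finite error. -/
def CentreLE (y : ACJ) (B : ℝ) : Prop := ∀ e g, y.e = .fin e → IsC y.f g → ‖g‖ ≤ B

/-- The data of a denominator that is certified not to vanish. -/
theorem Rep.denominator (hy : Rep M z y w) {ay D : Dbl} (h1 : y.f.absLB M = some ay)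
    (h2 : some ay -ᶠ some (const (1 + eps)) *ᶠ (some y.e +ᶠ some y.size) = some D)
    (h3 : (some (const 0) <ᶠ some D) = some true) (hg : CentreLE y (2 ^ 20)) :
    ∃ b τ Q D' g g0 g1 g2, y.e = .fin b ∧ y.size = .fin τ ∧ ay = .fin Q ∧ D = .fin D' ∧
      0 ≤ b ∧ 0 ≤ τ ∧ IsC y.f g ∧ IsC y.f0 g0 ∧ IsC y.f1 g1 ∧ IsC y.f2 g2 ∧
      ‖g0‖ + (‖g1‖ + ‖g2‖) ≤ τ ∧ ‖w - jet(z,g,g0,g1,g2)‖ ≤ b ∧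
      0 < D' ∧ Q ≤ ‖g‖ ∧ D' ≤ (1 + ur) * (Q - (τ + b)) ∧ D' ≤ Q ∧ τ + b < Q ∧
      round53 τ = τ := by
  obtain ⟨G, b, τ, hb, hτ, hb0, hτ0, hG, h5, h6⟩ := guard_of_lt hy.nonneg hy.size_nonneg h2 h3
  obtain ⟨-, -, g, g0, g1, g2, hg', hg0, hg1, hg2, hgs, hw⟩ := hy.data hb hτ
  rcases absLB_spec hg' h1 with ⟨Q, rfl, hQ0, hQ, -⟩ | ⟨-, h7⟩
  swap
  · exfalso
    have h8 := h7.trans (hg b g hb hg')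
    have h9 : (2 : ℝ) ^ 1024 * (1 / 2) ≤ 2 ^ 1024 * (1 - 2 * ur) := by
      refine mul_le_mul_of_nonneg_left ?_ (by positivity)
      norm_num [ur_eq]
    have h10 : (2 : ℝ) ^ 1024 * (1 / 2) = 2 ^ 1023 := by rw [pow_succ]; ring
    rw [h10] at h9
    exact absurd (h9.trans h8) (not_le.2 (pow_lt_pow_right₀ (by norm_num) (by norm_num)))
  have hQf : round53 Q = Q := fixed_of_fmul h1
  have hu := ur_pos
  obtain ⟨_, _, _, _, fQ⟩ := fmul_fin h1
  obtain ⟨D, rfl, fD, hpos, h6⟩ := fin_of_lt_sub fQ.self (by linarith) h5 h6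
  refine ⟨b, τ, Q, D, g, g0, g1, g2, hb, hτ, rfl, rfl, hb0, hτ0, hg', hg0, hg1, hg2, hgs, hw, h6, hQ,
    ?_, ?_, by linarith, size_fixed hy.built hτ⟩
  · refine (fD.le hpos.le).trans (mul_le_mul_of_nonneg_left ?_ (by positivity))
    linarith
  · rw [fD.eq, ← hQf]
    exact round53_mono (by rw [hQf]; linarith)

theorem quotient_terms_le {P σ τ Q A q q3 c k K : ℝ} (hP : 0 ≤ P) (hσ : 0 ≤ σ) (hτ : 0 ≤ τ)
    (hτQ : τ < Q) (hc0 : 0 ≤ c) (hK : 0 ≤ K) (hA : k * ((P + σ) / (Q - τ)) ≤ A)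
    (hq : q ≤ c * ((P + σ) / Q)) (hq3 : q3 ≤ c * ((1 + ur) * (τ * P / (Q * Q))))
    (hc : c * (1 + ur ^ 2) ≤ K * k) : q + q3 ≤ K * A := by
  have hu := ur_pos
  have hQ : 0 < Q := by linarith
  obtain ⟨t, rfl⟩ : ∃ t, τ = t * Q := ⟨τ / Q, by field_simp⟩
  have ht0 : 0 ≤ t := by
    by_contra hc
    push Not at hc
    nlinarith
  have ht1 : 0 < 1 - t := by
    by_contra hc
    push Not at hc
    nlinarith
  obtain ⟨m, hm⟩ : ∃ m, m = (P + σ) / Q := ⟨_, rfl⟩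
  have hm0 : 0 ≤ m := by rw [hm]; positivity
  have h1 : t * Q * P / (Q * Q) ≤ t * m := by
    rw [hm, mul_div_mul_comm, mul_div_assoc]
    rw [div_self hQ.ne', mul_one]
    gcongr
    linarith
  have h2 : q + q3 ≤ c * (m * (1 + (1 + ur) * t)) := by
    rw [← hm] at hq
    have := mul_le_mul_of_nonneg_left h1 (show 0 ≤ c * (1 + ur) by positivity)
    linarith
  have h3 : (P + σ) / (Q - t * Q) = m / (1 - t) := by
    rw [hm, show Q - t * Q = Q * (1 - t) by ring, div_div]
  have h4 : (1 + (1 + ur) * t) * (1 - t) ≤ 1 + ur ^ 2 := by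
    nlinarith [sq_nonneg (t - ur / 2), mul_nonneg hu.le (sq_nonneg t), sq_nonneg ur]
  rw [h3] at hA
  refine h2.trans ?_
  refine le_trans ?_ (mul_le_mul_of_nonneg_left hA hK)
  rw [← mul_assoc K, mul_div_assoc', le_div_iff₀ ht1]
  calc c * (m * (1 + (1 + ur) * t)) * (1 - t) =
        (c * ((1 + (1 + ur) * t) * (1 - t))) * m := by ring
    _ ≤ (c * (1 + ur ^ 2)) * m := by gcongr
    _ ≤ _ := mul_le_mul_of_nonneg_right hc hm0

theorem fl_of_fdiv {a b : ℝ} {d : Dbl} (hb : b ≠ 0)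
    (h : some (Dbl.fin a) /ᶠ some (Dbl.fin b) = some d) : fl (a / b) = some d := by
  obtain ⟨_, _, ⟨⟩, ⟨⟩, h⟩ := fdiv_eq_some h
  simpa only [Dbl.div, if_neg hb] using h

theorem FlEq.kap_le {x c : ℝ} (h : FlEq x c) (hx : 0 ≤ x) : kap * x ≤ c := by
  rw [h.eq]; exact kap_mul_le hx

theorem no_overflow_of_quotient {p g P Q τ D : ℝ} (hg : 0 ≤ g) (hpg : p * g ≤ (1 + ur) ^ 3 * 2 ^ 1024)
    (hP0 : 0 ≤ P) (hP : P ≤ (1 + 7.01 * ur) * p) (hQg : Q ≤ g) (hQ : Q ≤ 2 ^ 20) (hτ : 0 ≤ τ)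
    (hτQ : τ < Q) (hD : D ≤ (1 + ur) * (Q - τ)) (hPD : P < 2 ^ 1024 * D) :
    |round53 (τ * P)| < 2 ^ 1024 := by
  by_contra hc
  push Not at hc
  rw [abs_of_nonneg (round53_nonneg (by positivity))] at hc
  have h1 := hc.trans (round53_le (by positivity))
  have hu := ur_pos
  have hT : (0 : ℝ) < 2 ^ 1024 := by positivity
  generalize (2 : ℝ) ^ 1024 = T at *
  have hτ0 : 0 < τ := by
    rcases hτ.lt_or_eq with h | h
    · exact h
    · rw [← h] at h1; simp at h1; linarith
  have h2 : T < T * ((1 + ur) ^ 2 * (τ * (Q - τ))) := by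
    calc T ≤ (1 + ur) * (τ * P) := h1
      _ < (1 + ur) * (τ * (T * D)) := by gcongr
      _ ≤ (1 + ur) * (τ * (T * ((1 + ur) * (Q - τ)))) := by gcongr
      _ = _ := by ring
  have h3 : 1 < (1 + ur) ^ 2 * (τ * (Q - τ)) := by
    by_contra hc'
    push Not at hc'
    nlinarith
  have h4 : 2 ^ (-21 : ℤ) ≤ Q - τ := by
    by_contra hc'
    push Not at hc'
    have : (1 + ur) ^ 2 * (τ * (Q - τ)) ≤ (1 + ur) ^ 2 * (2 ^ 20 * 2 ^ (-21 : ℤ)) := by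
      have : 0 ≤ Q - τ := by linarith
      gcongr
      linarith
    have h6 : (1 + ur) ^ 2 * (2 ^ 20 * 2 ^ (-21 : ℤ)) ≤ 1 := by norm_num [ur_eq]
    linarith
  have h5 : τ * (1 + 2 ^ (-41 : ℤ)) ≤ Q := by
    have : τ * 2 ^ (-41 : ℤ) ≤ 2 ^ 20 * 2 ^ (-41 : ℤ) := by gcongr; linarith
    have h7 : (2 : ℝ) ^ 20 * 2 ^ (-41 : ℤ) = 2 ^ (-21 : ℤ) := by norm_num
    linarith
  have h6 : T * (1 + 2 ^ (-41 : ℤ)) ≤ (1 + ur) * ((1 + 7.01 * ur) * ((1 + ur) ^ 3 * T)) := by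
    calc T * (1 + 2 ^ (-41 : ℤ)) ≤ ((1 + ur) * (τ * P)) * (1 + 2 ^ (-41 : ℤ)) := by gcongr
      _ = (1 + ur) * (P * (τ * (1 + 2 ^ (-41 : ℤ)))) := by ring
      _ ≤ (1 + ur) * (P * g) := by gcongr; linarith
      _ ≤ (1 + ur) * (((1 + 7.01 * ur) * p) * g) := by gcongr
      _ = (1 + ur) * ((1 + 7.01 * ur) * (p * g)) := by ring
      _ ≤ _ := by gcongr
  have h7 : (1 + ur) * ((1 + 7.01 * ur) * (1 + ur) ^ 3) < 1 + 2 ^ (-41 : ℤ) := by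
    norm_num [ur_eq]
  nlinarith

theorem ACJ.div_eq_some (h : x.div M y = some r) : ∃ ax ay D p,
    x.f.absUB M = some ax ∧ y.f.absLB M = some ay ∧
    some ay -ᶠ some (const (1 + eps)) *ᶠ (some y.e +ᶠ some y.size) = some D ∧
    (some (const 0) <ᶠ some D) = some p ∧
    ((p = false ∧ ACJ.build M .zero .zero .zero .zero (.inf false) = some r) ∨
    (p = true ∧ ∃ den s a0 b0 n0 s0 a1 b1 n1 s1 a2 b2 n2 s2 A B C e, y.f.mul y.f = some den ∧
      x.f.div y.f = some s ∧
      x.f0.mul y.f = some a0 ∧ x.f.mul y.f0 = some b0 ∧ a0.sub b0 = some n0 ∧ n0.div den = some s0 ∧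
      x.f1.mul y.f = some a1 ∧ x.f.mul y.f1 = some b1 ∧ a1.sub b1 = some n1 ∧ n1.div den = some s1 ∧
      x.f2.mul y.f = some a2 ∧ x.f.mul y.f2 = some b2 ∧ a2.sub b2 = some n2 ∧ n2.div den = some s2 ∧
      (some ax +ᶠ (some x.size +ᶠ some x.e)) /ᶠ some D = some A ∧
      (some ax /ᶠ some ay +ᶠ some x.size /ᶠ some ay) +ᶠ
        (some y.size *ᶠ some ax) /ᶠ (some ay *ᶠ some ay) = some B ∧
      (some s.e +ᶠ some s0.e) +ᶠ (some s1.e +ᶠ some s2.e) = some C ∧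
      some (const (1 + 3 * eps)) *ᶠ ((some (const (1 + 3 * eps)) *ᶠ some A -ᶠ
        some (const (1 - 3 * eps)) *ᶠ some B) +ᶠ some C) = some e ∧
      ACJ.build M s.z s0.z s1.z s2.z e = some r)) := by
  unfold ACJ.div at h
  obtain ⟨ax, h1, h⟩ := bind_iff.1 h
  obtain ⟨ay, h2, h⟩ := bind_iff.1 h
  obtain ⟨D, h3, h⟩ := bind_iff.1 h
  obtain ⟨p, h4, h⟩ := bind_iff.1 h
  refine ⟨ax, ay, D, p, h1, h2, h3, h4, ?_⟩
  cases p
  · exact Or.inl ⟨rfl, by simpa using h⟩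
  · exact Or.inr ⟨rfl, by simpa only [↓reduceIte, bind_iff, exists_and_left] using h⟩

theorem rep_of_infinite_error (hz : ∀ k, ‖z k‖ ≤ 1)
    (h : ACJ.build M .zero .zero .zero .zero (.inf false) = some r) : Rep M z r v :=
  rep_of_build h hz rfl (by rintro _ ⟨⟩)

theorem AComplex.finC_of_sub {x y r : AComplex} {e : ℝ} (h : x.sub y = some r)
    (he : r.e = .fin e) : FinC r.z := by
  obtain ⟨re, im, d, h1, h2, h3, rfl⟩ := AComplex.add_eq_some (y := ⟨y.z.neg, y.e⟩) h
  cases he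
  obtain ⟨⟨p, rfl⟩, ⟨q, rfl⟩, -, -⟩ := AComplex.fin_of_sum_error h3
  exact ⟨p, q, rfl, rfl⟩

theorem AComplex.sub_repA {x y r : AComplex} {α β : ℂ} (h : x.sub y = some r) (hx : RepA x α)
    (hy : RepA y β) (hx0 : UB x.e 0) (hy0 : UB y.e 0) : RepA r (α - β) := by
  intro e he
  obtain ⟨c, -, -, hc, -, -, hc', -⟩ := AComplex.sub_sound h hx hy hx0 hy0 he
  exact Or.inl ⟨c, hc, hc'⟩

theorem fl_fin_of_le {x : ℝ} {d : Dbl} (h0 : 0 ≤ x) (hx : x ≤ 2 ^ 1000) (h : fl x = some d) :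
    ∃ p, d = .fin p ∧ FlEq x p := by
  have h1 : |round53 x| < 2 ^ 1024 := by
    rw [abs_of_nonneg (round53_nonneg h0)]
    refine (round53_le h0).trans_lt ?_
    have h2 : (1 + ur) * x ≤ 2 * 2 ^ 1000 := by
      gcongr
      norm_num [ur_eq]
    refine h2.trans_lt ?_
    rw [← pow_succ']
    exact pow_lt_pow_right₀ (by norm_num) (by norm_num)
  obtain ⟨rfl, h2, -⟩ := (fl_cases h).resolve_right (fun h => absurd h.2 (not_le.2 h1))
  exact ⟨_, rfl, rfl, h2, h1⟩

theorem fl_sq_of_le {Q : ℝ} {s : Dbl} (hQ : Q ≤ 2 ^ 20) (hQ0 : 0 < Q) (h : fl (Q * Q) = some s) :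
    ∃ p, s = .fin p ∧ FlEq (Q * Q) p := by
  refine fl_fin_of_le (by positivity) ?_ h
  calc Q * Q ≤ 2 ^ 500 * 2 ^ 500 := by
        have := hQ.trans (pow_le_pow_right₀ (by norm_num) (by norm_num : 20 ≤ 500))
        gcongr
    _ = _ := by rw [← pow_add]

/-- The two terms of the error of a quotient, when the first one does not overflow. -/
theorem error_difference {K A X q T k L S V : ℝ} {q3 B Y : Dbl} (fX : FlEq (K * A) X)
    (hA : 0 ≤ A) (hK : 0 ≤ K) (hq : 0 ≤ q) (hT : 0 ≤ T) (h3 : fl T = some q3)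
    (hB : fadd (some (.fin q)) (some q3) = some B)
    (hY : some (const (1 - 3 * eps)) *ᶠ some B = some Y) (hmain : q + round53 T ≤ K * A)
    (hV : k * V ≤ A) (hV0 : 0 ≤ V) (hk : 1 ≤ kap * K * k) (hS : q + round53 T ≤ L * S)
    (hS0 : 0 ≤ S) (hL : (1 + ur) * ((1 - 3 * eps) * ((1 + ur) * L)) ≤ 1) :
    ∃ y, Y = .fin y ∧ V ≤ X ∧ y ≤ S := by
  have hu := ur_pos
  have hkap := kap_pos
  have hen := eps_nonneg
  have hT' := round53_nonneg hT
  obtain ⟨rfl, -, -⟩ := (fl_cases h3).resolve_right (fun h => by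
    have h2 := round53_mono (show round53 T ≤ K * A by linarith)
    rw [← fX.eq, round53_round53] at h2
    rw [abs_of_nonneg hT'] at h
    exact absurd (h.2.trans h2) (not_le.2 ((le_abs_self X).trans_lt fX.lt)))
  obtain ⟨_, _, ⟨⟩, ⟨⟩, hB⟩ := fadd_eq_some hB
  obtain ⟨B, rfl, fB⟩ := fin_of_fl_of_le fX (by rwa [abs_of_nonneg (by positivity)]) hB
  obtain ⟨_, _, ⟨⟩, ⟨⟩, hY⟩ := fmul_eq_some hY
  have hB0 := fB.nonneg (by positivity)
  have h13 : (0 : ℝ) ≤ 1 - 3 * eps := by norm_num [eps_eq, ur_eq]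
  obtain ⟨y, rfl, fy⟩ := fin_of_fl_of_le fB.self (by
    rw [abs_of_nonneg (by positivity)]
    exact mul_le_of_le_one_left hB0 (by linarith)) hY
  refine ⟨y, rfl, ?_, ?_⟩
  · calc V ≤ kap * K * k * V := le_mul_of_one_le_left hV0 hk
      _ = kap * (K * (k * V)) := by ring
      _ ≤ kap * (K * A) := by gcongr
      _ ≤ X := fX.kap_le (by positivity)
  · calc y ≤ (1 + ur) * ((1 - 3 * eps) * B) := fy.le (by positivity)
      _ ≤ (1 + ur) * ((1 - 3 * eps) * ((1 + ur) * (L * S))) := by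
        gcongr
        exact (fB.le (by positivity)).trans (mul_le_mul_of_nonneg_left hS (by positivity))
      _ = (1 + ur) * ((1 - 3 * eps) * ((1 + ur) * L)) * S := by ring
      _ ≤ S := mul_le_of_le_one_left hS0 hL

/-- The subtracted term in the error of a quotient does not overflow, and it is small. -/
theorem quotient_error_terms {P σ a τ b Q D p g X : ℝ} {A B Y : Dbl} (hP0 : 0 ≤ P)
    (hPf : round53 P = P) (hσ0 : 0 ≤ σ) (hσf : round53 σ = σ) (ha0 : 0 ≤ a) (hτ0 : 0 ≤ τ)
    (hb0 : 0 ≤ b) (hD0 : 0 < D) (hDQ' : D ≤ Q) (hDQ : D ≤ (1 + ur) * (Q - (τ + b)))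
    (hτQ : τ + b < Q) (hQ : Q ≤ 2 ^ 20) (hQg : Q ≤ g) (hP : P ≤ (1 + 7.01 * ur) * p)
    (hpg : p * g ≤ (1 + ur) ^ 3 * 2 ^ 1024)
    (hA : (some (.fin P) +ᶠ (some (.fin σ) +ᶠ some (.fin a))) /ᶠ some (.fin D) = some A)
    (hX : some (const (1 + 3 * eps)) *ᶠ some A = some (.fin X))
    (hB : (some (.fin P) /ᶠ some (.fin Q) +ᶠ some (.fin σ) /ᶠ some (.fin Q)) +ᶠ
        (some (.fin τ) *ᶠ some (.fin P)) /ᶠ (some (.fin Q) *ᶠ some (.fin Q)) = some B)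
    (hY : some (const (1 - 3 * eps)) *ᶠ some B = some Y) :
    ∃ q, Y = .fin q ∧ (P + σ + a) / (Q - (τ + b)) ≤ X ∧
      q ≤ P / Q + σ / Q + τ * P / (Q * Q) := by
  have hu := ur_pos
  have hk := kap_pos
  have hen := eps_nonneg
  have hQ0 : 0 < Q := by linarith
  obtain ⟨_, A, ⟨⟩, ⟨⟩, fX⟩ := fmul_fin hX
  obtain ⟨N, hN, -, fA⟩ := Dbl.fin_of_fdiv hA
  obtain ⟨_, K, ⟨⟩, hK, fN⟩ := fadd_fin hN
  have fK := flEq_of_fadd hK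
  have hσK : σ ≤ K := fK.left_le hσf ha0
  have hK0 := hσ0.trans hσK
  have hPN : P ≤ N := fN.left_le hPf hK0
  have hN0 := hP0.trans hPN
  have hA0 : 0 ≤ A := fA.nonneg (by positivity)
  have hNk := fN.kap_le (by positivity)
  have hAk := fA.kap_le (by positivity)
  have hDτ : D ≤ (1 + ur) * (Q - τ) :=
    hDQ.trans (mul_le_mul_of_nonneg_left (by linarith) (by positivity))
  have hd : 0 < Q - (τ + b) := by linarith
  have hd' : 0 < Q - τ := by linarith
  have ek : kap = 1 / (1 + ur) := rfl
  have hA3 : kap ^ 3 * ((P + σ) / (Q - τ)) ≤ A := by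
    refine le_trans ?_ hAk
    calc kap ^ 3 * ((P + σ) / (Q - τ)) = kap * (kap * (P + σ) / ((1 + ur) * (Q - τ))) := by
          rw [ek]; field_simp
      _ ≤ kap * (N / D) := by
          have : kap * (P + σ) ≤ N := le_trans (by gcongr) hNk
          gcongr
  have hA4 : kap ^ 4 * ((P + σ + a) / (Q - (τ + b))) ≤ A := by
    refine le_trans ?_ hAk
    have h1 : kap ^ 2 * (P + σ + a) ≤ N := by
      refine le_trans ?_ hNk
      have h2 := fK.kap_le (by positivity)
      have h3 : kap * P ≤ P := mul_le_of_le_one_left hP0 kap_le_one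
      calc kap ^ 2 * (P + σ + a) = kap * (kap * P + kap * (σ + a)) := by ring
        _ ≤ _ := by gcongr
    calc kap ^ 4 * ((P + σ + a) / (Q - (τ + b))) =
          kap * (kap ^ 2 * (P + σ + a) / ((1 + ur) * (Q - (τ + b)))) := by
          rw [ek]; field_simp
      _ ≤ kap * (N / D) := by gcongr
  have hAle : A ≤ (1 + 3 * eps) * A := le_mul_of_one_le_left hA0 (by linarith)
  have hND : ∀ {t : ℝ}, 0 ≤ t → t ≤ N → |t / Q| ≤ N / D := by
    intro t h0 h1
    rw [abs_of_nonneg (by positivity)]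
    gcongr
  obtain ⟨c, q3, hc, hq3, hB⟩ := fadd_eq_some hB
  obtain ⟨q1, q2, hq1, hq2, hc⟩ := fadd_eq_some hc
  obtain ⟨q1, rfl, f1⟩ := fin_of_fl_of_le fA (hND hP0 hPN) (fl_of_fdiv hQ0.ne' hq1)
  obtain ⟨q2, rfl, f2⟩ := fin_of_fl_of_le fA
    (hND hσ0 (fN.right_le fK.fixed hP0 |> hσK.trans)) (fl_of_fdiv hQ0.ne' hq2)
  obtain ⟨t, s, ht, hs, hq3⟩ := fdiv_eq_some hq3
  obtain ⟨_, _, ⟨⟩, ⟨⟩, ht⟩ := fmul_eq_some ht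
  obtain ⟨_, _, ⟨⟩, ⟨⟩, hs⟩ := fmul_eq_some hs
  simp only [Dbl.mul] at ht hs
  simp only [Dbl.add] at hc
  have hPD : P < 2 ^ 1024 * D := hPN.trans_lt ((div_lt_iff₀ hD0).1 fA.arg_lt)
  have hov := no_overflow_of_quotient (hQ0.le.trans hQg) hpg hP0 hP hQg hQ hτ0 (by linarith) hDτ hPD
  obtain ⟨rfl, nt, -⟩ := (fl_cases ht).resolve_right (fun h => absurd h.2 (not_le.2 hov))
  have ft : FlEq (τ * P) (round53 (τ * P)) := ⟨rfl, nt, hov⟩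
  obtain ⟨s, rfl, fs⟩ := fl_sq_of_le hQ hQ0 hs
  set t := round53 (τ * P)
  have hs1 := fs.kap_le (by positivity)
  have hs0 : 0 < s := lt_of_lt_of_le (by positivity) hs1
  have ht1 := ft.le (by positivity)
  have ht0 := ft.nonneg (by positivity)
  simp only [Dbl.div, if_neg hs0.ne'] at hq3
  have hts : t / s ≤ (1 + ur) ^ 2 * (τ * P / (Q * Q)) := by
    calc t / s ≤ ((1 + ur) * (τ * P)) / (kap * (Q * Q)) := by gcongr
      _ = _ := by rw [ek]; field_simp
  have hP1 := f1.le (by positivity)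
  have hP2 := f2.le (by positivity)
  have h10 := f1.nonneg (by positivity)
  have h20 := f2.nonneg (by positivity)
  have h12 : q1 + q2 ≤ (1 + ur) * ((P + σ) / Q) := by rw [add_div]; linarith
  have hrt := round53_le (y := t / s) (by positivity)
  have hr12 := round53_le (y := q1 + q2) (by positivity)
  have hr12' : round53 (q1 + q2) ≤ (1 + ur) ^ 2 * ((P + σ) / Q) := by
    refine hr12.trans ((mul_le_mul_of_nonneg_left h12 (by positivity)).trans (le_of_eq ?_))
    ring
  have hrt' : round53 (t / s) ≤ (1 + ur) ^ 2 * ((1 + ur) * (τ * P / (Q * Q))) := by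
    refine hrt.trans ((mul_le_mul_of_nonneg_left hts (by positivity)).trans (le_of_eq ?_))
    ring
  have hmain : round53 (q1 + q2) + round53 (t / s) ≤ (1 + 3 * eps) * A :=
    quotient_terms_le (k := kap ^ 3) hP0 hσ0 hτ0 (by linarith) (by positivity) (by positivity) hA3
      hr12' hrt' (by norm_num [kap, eps_eq, ur_eq])
  have hm1 := round53_nonneg (x := q1 + q2) (by positivity)
  have hm2 := round53_nonneg (x := t / s) (by positivity)
  obtain ⟨rfl, -, -⟩ := (fl_cases hc).resolve_right (fun h => by
    have h2 := round53_mono (show round53 (q1 + q2) ≤ (1 + 3 * eps) * A by linarith)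
    rw [← fX.eq, round53_round53] at h2
    rw [abs_of_nonneg hm1] at h
    exact absurd (h.2.trans h2) (not_le.2 ((le_abs_self X).trans_lt fX.lt)))
  refine error_difference fX hA0 (by positivity) hm1 (by positivity) hq3 hB hY hmain hA4
    (by positivity) (by norm_num [kap, eps_eq, ur_eq]) (L := (1 + ur) ^ 3) ?_ (by positivity)
    (by norm_num [eps_eq, ur_eq])
  have h17 : (1 + ur) ^ 2 * ((P + σ) / Q) ≤ (1 + ur) ^ 3 * ((P + σ) / Q) := by
    gcongr <;> linarith
  rw [add_div] at h17 hr12'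
  linarith

theorem Rep.div (hx : Rep M z x v) (hy : Rep M z y w) (hg : CentreLE y (2 ^ 20))
    (h : x.div M y = some r) : Rep M z r (v / w) := by
  obtain ⟨ax, ay, D, p, h1, h2, h3, h4, ⟨rfl, h⟩ | ⟨rfl, den, s, a0, b0, n0, s0, a1, b1, n1, s1, a2,
    b2, n2, s2, A, B, C, e, h5, h6, i1, i2, i3, i4, j1, j2, j3, j4, k1, k2, k3, k4, h7, h8, h9, h10,
    h⟩⟩ := ACJ.div_eq_some h
  · exact rep_of_infinite_error hx.hz h
  obtain ⟨b, τ, Q, D, g, g0, g1, g2, hb, hτ, rfl, rfl, hb0, hτ0, hgC, hg0, hg1, hg2, hgs, hw, hD0,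
    hQg, hDQ, hDQ', hτQ, hτf⟩ := hy.denominator h2 h3 h4 hg
  have hgn := hg b g hb hgC
  have hen := eps_nonneg
  have u0 := AComplex.sub_nonneg i3 (XComplex.mul_nonneg i1) (XComplex.mul_nonneg i2)
  have u1 := AComplex.sub_nonneg j3 (XComplex.mul_nonneg j1) (XComplex.mul_nonneg j2)
  have u2 := AComplex.sub_nonneg k3 (XComplex.mul_nonneg k1) (XComplex.mul_nonneg k2)
  have ud := XComplex.mul_nonneg h5
  have t0 := AComplex.div_nonneg i4 u0 ud
  have t1 := AComplex.div_nonneg j4 u1 ud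
  have t2 := AComplex.div_nonneg k4 u2 ud
  have t := XComplex.div_nonneg h6
  obtain ⟨_, h10', ⟨⟩, hsum, -⟩ := fmul_eq_some h10
  obtain ⟨W, _, hW, ⟨⟩, -⟩ := fadd_eq_some hsum
  obtain ⟨X, Y, hX, hY, -⟩ := fsub_eq_some hW
  rw [hX, hY] at h10
  have hX0 : UB X 0 := by
    refine (ubo_const (by positivity)).mul_nonneg (UB.some ?_) X hX
    exact (((UB.some (ubo_absUB M _ _ h1)).add_nonneg ((UB.some hx.size_nonneg).add_nonneg
      (UB.some hx.nonneg))).div_nonneg (ubo_const hD0.le)) A h7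
  have key : ∀ p c, X = .fin p → C = .fin c → ∃ q a σ P f f0 f1 f2, Y = .fin q ∧ x.e = .fin a ∧
      x.size = .fin σ ∧ IsC x.f f ∧ IsC x.f0 f0 ∧ IsC x.f1 f1 ∧ IsC x.f2 f2 ∧
      ‖f0‖ + (‖f1‖ + ‖f2‖) ≤ σ ∧ ‖v - jet(z,f,f0,f1,f2)‖ ≤ a ∧ ‖f‖ ≤ P ∧
      (P + σ + a) / (Q - (τ + b)) - (P / Q + σ / Q + τ * P / (Q * Q)) ≤ p - q := by
    rintro p c rfl rfl
    obtain ⟨_, A, ⟨⟩, ⟨⟩, -⟩ := fmul_fin hX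
    obtain ⟨_, l1, -, -⟩ := Dbl.fin_of_fdiv h7
    obtain ⟨P, _, ⟨⟩, l2, -⟩ := fadd_fin l1
    obtain ⟨σ, a, l3, l4, -⟩ := fadd_fin l2
    rw [Option.some.injEq] at l3 l4
    obtain ⟨ha, hσ, f, f0, f1, f2, hf, hf0, hf1, hf2, hfs, hv⟩ := hx.data l4 l3
    obtain ⟨-, hP⟩ := absUB_spec hf h1
    obtain ⟨hP0, hP1, hP2, hP3⟩ := hP P rfl
    obtain ⟨t', -, -, -, l5, -⟩ := fin_of_sum4 h9
    rw [Option.some.injEq] at l5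
    rw [l3, l4] at h7
    rw [l3, hτ] at h8
    obtain ⟨q, rfl, m1, m2⟩ := quotient_error_terms hP0 hP3 hσ (size_fixed hx.built l3) ha hτ0 hb0
      hD0 hDQ' hDQ hτQ (hQg.trans hgn) hQg hP1 (XComplex.norm_mul_le_of_div h6 hf hgC l5) h7 hX h8 hY
    exact ⟨q, a, σ, P, f, f0, f1, f2, rfl, l4, l3, hf, hf0, hf1, hf2, hfs, hv, hP2, by linarith⟩
  have hjet := norm_jet_le hx.hz
  have hw' := norm_sub_jet_assoc hw
  obtain ⟨he0, he⟩ := difference_error hX0 t t0 t1 t2 h9 (by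
    intro p c hp hc
    obtain ⟨q, a, σ, P, f, f0, f1, f2, hq, -, -, -, -, -, -, hfs, hv, hP, hle⟩ := key p c hp hc
    refine ⟨q, hq, ?_⟩
    have := (norm_nonneg _).trans (norm_div_sub_jet_le hP ((hjet f0 f1 f2).trans hfs) (norm_sub_jet_assoc hv)
      ((hjet g0 g1 g2).trans hgs) hw' hQg hτQ).2
    linarith) h10
  refine rep_of_build h hx.hz he0 ?_
  rintro e rfl q0 q1 q2
  obtain ⟨p, q, ε, ε0, ε1, ε2, rfl, rfl, hε, hε0, hε1, hε2, hle⟩ := he e rfl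
  obtain ⟨c', hc'⟩ : ∃ c, C = .fin c := by
    obtain ⟨_, _, -, m1, -⟩ := fmul_fin h10
    obtain ⟨_, c, -, m2, -⟩ := fadd_fin m1
    exact ⟨c, by simpa using m2⟩
  obtain ⟨_, a, σ, P, f, f0, f1, f2, ⟨⟩, -, -, hf, hf0, hf1, hf2, hfs, hv, hP, hpq⟩ :=
    key p c' rfl hc'
  obtain ⟨hw0, hmain⟩ := norm_div_sub_jet_le hP ((hjet f0 f1 f2).trans hfs) (norm_sub_jet_assoc hv)
    ((hjet g0 g1 g2).trans hgs) hw' hQg hτQ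
  obtain ⟨c, hc, m, -, hgne⟩ := XComplex.div_sound h6 hf hgC
    (hgn.trans (pow_le_pow_right₀ (by norm_num) (by norm_num))) hε
  obtain ⟨c0, hc0, m0⟩ := AComplex.div_sq_sound i4 (AComplex.sub_repA i3 (XComplex.mul_repA i1 hf0 hgC)
    (XComplex.mul_repA i2 hf hg0) (XComplex.mul_nonneg i1) (XComplex.mul_nonneg i2)) u0
    (fun _ he => AComplex.finC_of_sub i3 he) h5 hgC hgn hε0 q0
  obtain ⟨c1, hc1, m1⟩ := AComplex.div_sq_sound j4 (AComplex.sub_repA j3 (XComplex.mul_repA j1 hf1 hgC)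
    (XComplex.mul_repA j2 hf hg1) (XComplex.mul_nonneg j1) (XComplex.mul_nonneg j2)) u1
    (fun _ he => AComplex.finC_of_sub j3 he) h5 hgC hgn hε1 q1
  obtain ⟨c2, hc2, m2⟩ := AComplex.div_sq_sound k4 (AComplex.sub_repA k3 (XComplex.mul_repA k1 hf2 hgC)
    (XComplex.mul_repA k2 hf hg2) (XComplex.mul_nonneg k1) (XComplex.mul_nonneg k2)) u2
    (fun _ he => AComplex.finC_of_sub k3 he) h5 hgC hgn hε2 q2
  refine ⟨c, c0, c1, c2, hc, hc0, hc1, hc2, ?_⟩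
  rw [show v / w - jet(z,c,c0,c1,c2) =
    (v / w - (f / g + ((f0 * z 0 + f1 * z 1 + f2 * z 2) * g -
      f * (g0 * z 0 + g1 * z 1 + g2 * z 2)) / (g * g))) + ((f / g - c) +
      (((f0 * g - f * g0) / (g * g) - c0) * z 0 + ((f1 * g - f * g1) / (g * g) - c1) * z 1 +
      ((f2 * g - f * g2) / (g * g) - c2) * z 2)) by field_simp; ring]
  refine (norm_add_jet_le hx.hz _ _ _ _ _).trans ?_
  linarith

theorem ACJ.divOfD_eq_some (h : ACJ.divOfD M (const 1) y = some r) : ∃ ay D p,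
    y.f.absLB M = some ay ∧
    some ay -ᶠ some (const (1 + eps)) *ᶠ (some y.e +ᶠ some y.size) = some D ∧
    (some (const 0) <ᶠ some D) = some p ∧
    ((p = false ∧ ACJ.build M .zero .zero .zero .zero (.inf false) = some r) ∨
    (p = true ∧ ∃ den s n0 s0 n1 s1 n2 s2 B C e, y.f.mul y.f = some den ∧
      XComplex.divOfD (const 1) y.f = some s ∧
      (XComplex.ofDbl (const 1).neg).mul y.f0 = some n0 ∧ n0.div den = some s0 ∧
      (XComplex.ofDbl (const 1).neg).mul y.f1 = some n1 ∧ n1.div den = some s1 ∧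
      (XComplex.ofDbl (const 1).neg).mul y.f2 = some n2 ∧ n2.div den = some s2 ∧
      some (const 1).abs /ᶠ some ay +ᶠ
        (some y.size *ᶠ some (const 1).abs) /ᶠ (some ay *ᶠ some ay) = some B ∧
      (some s.e +ᶠ some s0.e) +ᶠ (some s1.e +ᶠ some s2.e) = some C ∧
      some (const (1 + 3 * eps)) *ᶠ ((some (const (1 + 2 * eps)) *ᶠ (some (const 1).abs /ᶠ some D) -ᶠ
        some (const (1 - 3 * eps)) *ᶠ some B) +ᶠ some C) = some e ∧
      ACJ.build M s.z s0.z s1.z s2.z e = some r)) := by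
  unfold ACJ.divOfD at h
  obtain ⟨ay, h2, h⟩ := bind_iff.1 h
  obtain ⟨D, h3, h⟩ := bind_iff.1 h
  obtain ⟨p, h4, h⟩ := bind_iff.1 h
  refine ⟨ay, D, p, h2, h3, h4, ?_⟩
  cases p
  · exact Or.inl ⟨rfl, by simpa using h⟩
  · exact Or.inr ⟨rfl, by simpa only [↓reduceIte, bind_iff, exists_and_left] using h⟩

/-- The subtracted term in the error of an inverse does not overflow, and it is small. -/
theorem inverse_error_terms {τ b Q D X : ℝ} {B Y : Dbl} (hτ0 : 0 ≤ τ) (hτf : round53 τ = τ)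
    (hb0 : 0 ≤ b) (hD0 : 0 < D) (hDQ' : D ≤ Q) (hDQ : D ≤ (1 + ur) * (Q - (τ + b)))
    (hτQ : τ + b < Q) (hQ : Q ≤ 2 ^ 20)
    (hX : some (const (1 + 2 * eps)) *ᶠ (some (.fin 1) /ᶠ some (.fin D)) = some (.fin X))
    (hB : some (.fin 1) /ᶠ some (.fin Q) +ᶠ
        (some (.fin τ) *ᶠ some (.fin 1)) /ᶠ (some (.fin Q) *ᶠ some (.fin Q)) = some B)
    (hY : some (const (1 - 3 * eps)) *ᶠ some B = some Y) :
    ∃ q, Y = .fin q ∧ (1 + 0 + 0) / (Q - (τ + b)) ≤ X ∧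
      q ≤ 1 / Q + 0 / Q + τ * 1 / (Q * Q) := by
  have hu := ur_pos
  have hk := kap_pos
  have hen := eps_nonneg
  have hQ0 : 0 < Q := by linarith
  obtain ⟨_, A, ⟨⟩, hA, fX⟩ := fmul_fin hX
  obtain ⟨_, ⟨⟩, -, fA⟩ := Dbl.fin_of_fdiv hA
  have hA0 : 0 ≤ A := fA.nonneg (by positivity)
  have hAk := fA.kap_le (by positivity)
  have hDτ : D ≤ (1 + ur) * (Q - τ) :=
    hDQ.trans (mul_le_mul_of_nonneg_left (by linarith) (by positivity))
  have hd : 0 < Q - (τ + b) := by linarith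
  have hd' : 0 < Q - τ := by linarith
  have ek : kap = 1 / (1 + ur) := rfl
  have hA3 : kap ^ 2 * ((1 + 0) / (Q - τ)) ≤ A := by
    refine le_trans ?_ hAk
    calc kap ^ 2 * ((1 + 0) / (Q - τ)) = kap * (1 / ((1 + ur) * (Q - τ))) := by
          rw [ek]; field_simp; ring
      _ ≤ kap * (1 / D) := by gcongr
  have hA4 : kap ^ 2 * ((1 + 0 + 0) / (Q - (τ + b))) ≤ A := by
    refine le_trans ?_ hAk
    calc kap ^ 2 * ((1 + 0 + 0) / (Q - (τ + b))) = kap * (1 / ((1 + ur) * (Q - (τ + b)))) := by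
          rw [ek]; field_simp; ring
      _ ≤ kap * (1 / D) := by gcongr
  obtain ⟨q1, q3, hq1, hq3, hB⟩ := fadd_eq_some hB
  obtain ⟨q1, rfl, f1⟩ := fin_of_fl_of_le fA (by
    rw [abs_of_nonneg (by positivity)]; gcongr) (fl_of_fdiv hQ0.ne' hq1)
  obtain ⟨t, s, ht, hs, hq3⟩ := fdiv_eq_some hq3
  obtain ⟨_, _, ⟨⟩, ⟨⟩, ht⟩ := fmul_eq_some ht
  obtain ⟨_, _, ⟨⟩, ⟨⟩, hs⟩ := fmul_eq_some hs
  simp only [Dbl.mul] at ht hs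
  obtain ⟨t, rfl, ft⟩ := fl_fin_of_le (by positivity) (by
    have := hQ.trans (pow_le_pow_right₀ (by norm_num) (by norm_num : 20 ≤ 1000))
    rw [mul_one]; exact (by linarith : τ ≤ Q).trans this) ht
  obtain rfl : τ = t := by rw [ft.eq, mul_one, hτf]
  obtain ⟨s, rfl, fs⟩ := fl_sq_of_le hQ hQ0 hs
  have hs1 := fs.kap_le (by positivity)
  have hs0 : 0 < s := lt_of_lt_of_le (by positivity) hs1
  simp only [Dbl.div, if_neg hs0.ne'] at hq3
  have hts : τ / s ≤ (1 + ur) * (τ * 1 / (Q * Q)) := by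
    calc τ / s ≤ τ / (kap * (Q * Q)) := by gcongr
      _ = _ := by rw [ek]; field_simp
  have hP1 := f1.le (by positivity)
  have h10 := f1.nonneg (by positivity)
  have hrt := round53_le (y := τ / s) (by positivity)
  have hrt' : round53 (τ / s) ≤ (1 + ur) * ((1 + ur) * (τ * 1 / (Q * Q))) :=
    hrt.trans (mul_le_mul_of_nonneg_left hts (by positivity))
  have hm2 := round53_nonneg (x := τ / s) (by positivity)
  have hmain : q1 + round53 (τ / s) ≤ (1 + 2 * eps) * A :=
    quotient_terms_le (σ := 0) (P := 1) (k := kap ^ 2) (by norm_num) le_rfl hτ0 (by linarith)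
      (by positivity) (by positivity) hA3 (by simpa using hP1) hrt'
      (by norm_num [kap, eps_eq, ur_eq])
  refine error_difference fX hA0 (by positivity) h10 (by positivity) hq3 hB hY hmain hA4
    (by positivity) (by norm_num [kap, eps_eq, ur_eq]) (L := (1 + ur) ^ 2) ?_ (by positivity)
    (by norm_num [eps_eq, ur_eq])
  have h17 : (1 + ur) * (1 / Q) ≤ (1 + ur) ^ 2 * (1 / Q) := by
    rw [pow_two]; gcongr; nlinarith
  rw [zero_div]
  linarith

theorem Rep.divOfD (hy : Rep M z y w) (hg : CentreLE y (2 ^ 20))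
    (h : ACJ.divOfD M (const 1) y = some r) : Rep M z r (1 / w) := by
  obtain ⟨ay, D, p, h2, h3, h4, ⟨rfl, h⟩ | ⟨rfl, den, s, n0, s0, n1, s1, n2, s2, B, C, e, h5, h6,
    i3, i4, j3, j4, k3, k4, h8, h9, h10, h⟩⟩ := ACJ.divOfD_eq_some h
  · exact rep_of_infinite_error hy.hz h
  obtain ⟨b, τ, Q, D, g, g0, g1, g2, hb, hτ, rfl, rfl, hb0, hτ0, hgC, hg0, hg1, hg2, hgs, hw, hD0,
    hQg, hDQ, hDQ', hτQ, hτf⟩ := hy.denominator h2 h3 h4 hg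
  have hgn := hg b g hb hgC
  have hen := eps_nonneg
  have u0 := XComplex.mul_nonneg i3
  have u1 := XComplex.mul_nonneg j3
  have u2 := XComplex.mul_nonneg k3
  have ud := XComplex.mul_nonneg h5
  have t0 := AComplex.div_nonneg i4 u0 ud
  have t1 := AComplex.div_nonneg j4 u1 ud
  have t2 := AComplex.div_nonneg k4 u2 ud
  have t := XComplex.divOfD_nonneg h6
  have hone : (const 1).abs = Dbl.fin 1 := by simp [Dbl.abs]
  rw [hone] at h8 h10
  rw [hτ] at h8
  obtain ⟨_, h10', ⟨⟩, hsum, -⟩ := fmul_eq_some h10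
  obtain ⟨W, _, hW, ⟨⟩, -⟩ := fadd_eq_some hsum
  obtain ⟨X, Y, hX, hY, -⟩ := fsub_eq_some hW
  rw [hX, hY] at h10
  have hX0 : UB X 0 :=
    (ubo_const (by positivity)).mul_nonneg ((ubo_const (by norm_num)).div_nonneg
      (ubo_const hD0.le)) X hX
  have hjet := norm_jet_le hy.hz
  obtain ⟨hw0, hmain⟩ := norm_div_sub_jet_le (v := 1) (f := 1) (vl := 0) (P := 1) (σ := 0) (a := 0)
    (by simp) (by simp) (by simp) ((hjet g0 g1 g2).trans hgs)
    (norm_sub_jet_assoc hw) hQg hτQ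
  obtain ⟨he0, he⟩ := difference_error hX0 t t0 t1 t2 h9 (by
    rintro p c rfl -
    obtain ⟨q, rfl, m1, m2⟩ := inverse_error_terms hτ0 hτf hb0 hD0 hDQ' hDQ hτQ (hQg.trans hgn) hX
      h8 hY
    have := (norm_nonneg _).trans hmain
    exact ⟨q, rfl, by linarith⟩) h10
  refine rep_of_build h hy.hz he0 ?_
  rintro e rfl q0 q1 q2
  obtain ⟨p, q, ε, ε0, ε1, ε2, rfl, rfl, hε, hε0, hε1, hε2, hle⟩ := he e rfl
  obtain ⟨_, ⟨⟩, m1, m2⟩ := inverse_error_terms hτ0 hτf hb0 hD0 hDQ' hDQ hτQ (hQg.trans hgn) hX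
      h8 hY
  have hneg : IsC (XComplex.ofDbl (const 1).neg) ((-1 : ℝ) : ℂ) := isC_ofDbl isNormal_one.neg
  obtain ⟨c, hc, m, hgne⟩ := XComplex.divOfD_sound h6 hgC
    (hgn.trans (pow_le_pow_right₀ (by norm_num) (by norm_num))) hε
  have fin : ∀ {a : XComplex} {d : AComplex} {t : ℂ},
      (XComplex.ofDbl (const 1).neg).mul a = some d → IsC a t → ∀ e, d.e = .fin e → FinC d.z := by
    intro a d t h ha e he
    obtain ⟨c, hc, -⟩ := XComplex.mul_sound h hneg ha he
    exact hc.finC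
  obtain ⟨c0, hc0, l0⟩ := AComplex.div_sq_sound i4 (XComplex.mul_repA i3 hneg hg0) u0 (fin i3 hg0) h5
    hgC hgn hε0 q0
  obtain ⟨c1, hc1, l1⟩ := AComplex.div_sq_sound j4 (XComplex.mul_repA j3 hneg hg1) u1 (fin j3 hg1) h5
    hgC hgn hε1 q1
  obtain ⟨c2, hc2, l2⟩ := AComplex.div_sq_sound k4 (XComplex.mul_repA k3 hneg hg2) u2 (fin k3 hg2) h5
    hgC hgn hε2 q2
  refine ⟨c, c0, c1, c2, hc, hc0, hc1, hc2, ?_⟩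
  rw [show 1 / w - jet(z,c,c0,c1,c2) =
    (1 / w - (1 / g + (0 * g - 1 * (g0 * z 0 + g1 * z 1 + g2 * z 2)) / (g * g))) + ((1 / g - c) +
      (((((-1 : ℝ) : ℂ) * g0) / (g * g) - c0) * z 0 + ((((-1 : ℝ) : ℂ) * g1) / (g * g) - c1) * z 1 +
      ((((-1 : ℝ) : ℂ) * g2) / (g * g) - c2) * z 2)) by push_cast; field_simp; ring]
  refine (norm_add_jet_le hy.hz _ _ _ _ _).trans ?_
  linarith

/-! ### The geometry of square roots -/

theorem norm_one_sub_sq (w : ℂ) : ‖1 - w‖ ^ 2 = 1 - 2 * w.re + ‖w‖ ^ 2 := by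
  rw [Complex.sq_norm, Complex.sq_norm, Complex.normSq_apply, Complex.normSq_apply]
  simp; ring

theorem norm_sq_sub_one_sq (w : ℂ) : ‖w ^ 2 - 1‖ ^ 2 = (‖w‖ ^ 2 + 1) ^ 2 - 4 * w.re ^ 2 := by
  rw [Complex.sq_norm, Complex.sq_norm, Complex.normSq_apply, Complex.normSq_apply, pow_two w]
  simp; ring

theorem exists_sqrt_eq {x : ℝ} (hx : 0 ≤ x) : ∃ p, p = √x ∧ 0 ≤ p ∧ p ^ 2 = x :=
  ⟨_, rfl, Real.sqrt_nonneg x, Real.sq_sqrt hx⟩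

theorem norm_one_sub_le {w : ℂ} {k : ℝ} (hw : 0 ≤ w.re) (hk : ‖w ^ 2 - 1‖ ≤ k) (hk1 : k ≤ 1) :
    ‖1 - w‖ ^ 2 ≤ (1 - √(1 - k)) ^ 2 := by
  obtain ⟨β, hβ, hβ0, hβ2⟩ := exists_sqrt_eq (x := 1 - k) (by linarith)
  have hk0 := (norm_nonneg _).trans hk
  rw [← hβ, norm_one_sub_sq]
  have h1 := pow_le_pow_left₀ (norm_nonneg _) hk 2
  rw [norm_sq_sub_one_sq, sub_le_iff_le_add] at h1
  have h2 : β ≤ w.re := by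
    have h3 := (Complex.abs_re_le_norm (w ^ 2 - 1)).trans hk
    have h4 := (abs_le.1 h3).1
    have h5 : (w ^ 2 - 1).re = w.re ^ 2 - w.im ^ 2 - 1 := by rw [pow_two w]; simp; ring
    rw [h5] at h4
    refine abs_le_of_sq_le_sq' ?_ hw |>.2
    nlinarith [sq_nonneg w.im]
  have h3 : (‖w‖ ^ 2 + 1) ^ 2 ≤ ((1 - β) ^ 2 + 2 * w.re) ^ 2 := by
    refine h1.trans ?_
    obtain ⟨δ, hδ⟩ : ∃ δ, w.re = β + δ := ⟨w.re - β, by ring⟩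
    have hδ0 : 0 ≤ δ := by linarith
    rw [hδ, show k = 1 - β ^ 2 by linarith]
    nlinarith [mul_nonneg hδ0 (sq_nonneg (1 - β))]
  have h4 := abs_le_of_sq_le_sq' h3 (by positivity)
  linarith [h4.2]

/-- If the distance of `w` from `1` is larger than expected from `‖w ^ 2 - 1‖`, then `w ^ 2` is
close to `1 - k`. -/
theorem norm_sq_sub_one_add_le {w : ℂ} {k β : ℝ} (hw : 0 ≤ w.re) (hk : ‖w ^ 2 - 1‖ ≤ k)
    (hk0 : 0.525 ≤ k) (hβ2 : β ^ 2 = 1 - k + 7.01 * ur)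
    (h : (1 - β) ^ 2 - 8 * ur < ‖1 - w‖ ^ 2) : ‖w ^ 2 - 1 + k‖ ≤ 1e-6 := by
  have hu := ur_pos
  have hu' : ur ≤ 2e-16 := by norm_num [ur_eq]
  have hβ1 : β ≤ 0.6893 := by
    refine (abs_le_of_sq_le_sq' (b := 0.6893) ?_ (by norm_num)).2
    rw [hβ2]; linarith
  have hk1 : k ≤ 1.1 := by nlinarith [sq_nonneg β]
  have h1 := pow_le_pow_left₀ (norm_nonneg _) hk 2
  rw [norm_sq_sub_one_sq, sub_le_iff_le_add] at h1
  rw [norm_one_sub_sq] at h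
  have h2 : w.re ≤ β + 1000 * ur := by
    by_contra hc
    push Not at hc
    obtain ⟨δ, hδ⟩ : ∃ δ, w.re = β + δ := ⟨w.re - β, by ring⟩
    rw [hδ] at hc h h1
    have hδ0 : 1000 * ur < δ := by linarith
    have hδ1 : 0 ≤ δ := by linarith
    have h3 : 1 + β ^ 2 + 2 * δ - 8 * ur < ‖w‖ ^ 2 + 1 := by nlinarith
    have h4 : (1 + β ^ 2 + 2 * δ - 8 * ur) ^ 2 < (‖w‖ ^ 2 + 1) ^ 2 := by
      refine pow_lt_pow_left₀ h3 ?_ (by norm_num)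
      nlinarith [sq_nonneg β]
    have h5 : k = 1 - β ^ 2 + 7.01 * ur := by linarith
    rw [h5] at h1
    have h6 : 0.0965 ≤ (1 - β) ^ 2 := by nlinarith
    have h7 : δ * 0.0965 ≤ δ * (1 - β) ^ 2 := by gcongr
    have hβ3 : β ^ 2 ≤ 0.48 := by nlinarith
    have hβ4 := sq_nonneg β
    have h8 : ur * β ^ 2 ≤ ur * 0.48 := by gcongr
    have h9 : 0 ≤ ur * β ^ 2 := by positivity
    have h10 : δ * ur ≤ δ * 2e-16 := by gcongr
    nlinarith [sq_nonneg ur]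
  have h3 : ‖w ^ 2 - 1 + k‖ ^ 2 ≤ 2 * k * (k - 1 + w.re ^ 2) := by
    have e1 : ‖w ^ 2 - 1 + k‖ ^ 2 = ‖w ^ 2 - 1‖ ^ 2 + 2 * k * (w ^ 2 - 1).re + k ^ 2 := by
      rw [Complex.sq_norm, Complex.sq_norm, Complex.normSq_apply, Complex.normSq_apply]
      simp; ring
    have e2 : (w ^ 2 - 1).re = w.re ^ 2 - w.im ^ 2 - 1 := by rw [pow_two w]; simp; ring
    have e3 := pow_le_pow_left₀ (norm_nonneg _) hk 2
    rw [e1, e2]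
    have : 0 ≤ k * w.im ^ 2 := by positivity
    linarith
  have h4 : k - 1 + w.re ^ 2 ≤ 1e-13 * 4 := by
    have e1 : w.re ^ 2 ≤ (β + 1000 * ur) ^ 2 := by gcongr
    have e2 : ur * β ≤ ur * 0.6893 := by gcongr
    have e3 : ur * ur ≤ ur * 2e-16 := by gcongr
    have e4 : (β + 1000 * ur) ^ 2 = β ^ 2 + 2000 * (ur * β) + 1000000 * (ur * ur) := by ring
    rw [e4, hβ2] at e1
    linarith
  refine (abs_le_of_sq_le_sq' (b := 1e-6) (h3.trans ?_) (by norm_num)).2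
  calc 2 * k * (k - 1 + w.re ^ 2) ≤ 2 * k * (1e-13 * 4) := by gcongr
    _ ≤ _ := by linarith

theorem sqrt_jet_residual {ρ w f fl v : ℂ} (hρ : ρ ^ 2 = f) (hw : w ^ 2 = v) (h0 : ρ ≠ 0) :
    w - (ρ + fl / (2 * ρ)) = -(ρ * (1 - w / ρ) ^ 2) / 2 + (v - (f + fl)) / (2 * ρ) := by
  subst hρ hw
  field_simp; ring

theorem sqrt_error_ge {p P s : ℝ} (hp : 0 < p) (hpP : p ≤ P) (hP : P ^ 2 ≤ (1 + 7.01 * ur) * p ^ 2)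
    (hs : s ≤ 0.525 * p ^ 2) :
    p - √(p ^ 2 - s) ≤ (1 - ur ^ 2) * P - (1 - 2.49 * ur) * √(P ^ 2 - s) := by
  have hu := ur_pos
  have hu' : ur ≤ 2e-16 := by norm_num [ur_eq]
  have hpP2 : p ^ 2 ≤ P ^ 2 := by gcongr
  obtain ⟨Q, hQ, hQ0, hQ2⟩ := exists_sqrt_eq (x := P ^ 2 - s) (by nlinarith)
  obtain ⟨q, hq, hq0, hq2⟩ := exists_sqrt_eq (x := p ^ 2 - s) (by nlinarith)
  rw [← hQ, ← hq]
  obtain ⟨d, rfl⟩ : ∃ d, P = p + d := ⟨P - p, by ring⟩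
  have hd : 0 ≤ d := by linarith
  have hd1 : d ≤ 3.505 * ur * p := by
    by_contra hc
    push Not at hc
    nlinarith [mul_lt_mul_of_pos_right hc hp, sq_nonneg d]
  have hqp : 0.689 * p ≤ q := by
    refine (abs_le_of_sq_le_sq' (a := 0.689 * p) ?_ hq0).2
    nlinarith
  have hqQ : q ≤ Q := by
    refine (abs_le_of_sq_le_sq' ?_ hQ0).2
    nlinarith
  have h1 : (Q - q) * (Q + q) = d * (2 * p + d) := by nlinarith
  have h2 : d ≤ 1e-12 * p := by nlinarith
  have h3 : Q - q ≤ 1.452 * d := by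
    have h4 : (Q - q) * (1.378 * p) ≤ d * (2 * p + 1e-12 * p) := by
      calc (Q - q) * (1.378 * p) ≤ (Q - q) * (Q + q) := by
            refine mul_le_mul_of_nonneg_left ?_ (by linarith)
            linarith
        _ = d * (2 * p + d) := h1
        _ ≤ _ := by gcongr
    by_contra hc
    push Not at hc
    nlinarith [mul_lt_mul_of_pos_right hc hp, mul_nonneg hd hp.le]
  have h4 : ur * (0.689 * p) ≤ ur * Q := by gcongr; linarith
  have h5 : ur ^ 2 * (p + d) ≤ 2e-16 * ur * (2 * p) := by
    rw [pow_two]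
    gcongr
    · linarith
  nlinarith [mul_pos hu hp]

/-! ### Square roots of jets -/

theorem half_add_le {P Q σ : ℝ} (hP : 0 < P) (h : σ ≤ P ^ 2 - Q ^ 2) : σ / (2 * P) + Q ≤ P := by
  have h4 : σ / (2 * P) ≤ P - Q := by
    rw [div_le_iff₀ (by positivity)]
    nlinarith [sq_nonneg (P - Q)]
  linarith

theorem sqrt_error_terms {A σ e D : ℝ} {X Y : Dbl} (hA : A < 2 ^ 1024) (hσ : 0 ≤ σ) (he : 0 ≤ e)
    (hs : σ + e < A) (hD0 : 0 < D) (hD : D ≤ (1 + ur) * (A - (σ + e)))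
    (hX : some (const (1 + eps)) *ᶠ fsqrt (some (.fin A)) = some X)
    (hY : some (const (1 - 3 * eps)) *ᶠ (some (.fin σ) /ᶠ (some (const 2) *ᶠ fsqrt (some (.fin A))) +ᶠ
      fsqrt (some (.fin D))) = some Y) :
    ∃ p q, X = .fin p ∧ Y = .fin q ∧ (1 - ur ^ 2) * √A ≤ p ∧
      q ≤ (1 - 0.9 * ur) * (σ / (2 * √A)) + (1 - 2.49 * ur) * √(A - (σ + e)) := by
  have hu := ur_pos
  have hu' := ur_le
  have hk := kap_pos
  have hen := eps_nonneg
  have hA0 : 0 < A := by linarith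
  have ek : kap = 1 / (1 + ur) := rfl
  obtain ⟨P, hP, -, hP2⟩ := exists_sqrt_eq hA0.le
  have hP0 : 0 < P := by rw [hP]; positivity
  obtain ⟨Q, hQ, hQ0, hQ2⟩ := exists_sqrt_eq (x := A - (σ + e)) (by linarith)
  have hPle : P ≤ 2 ^ 512 := by
    refine (abs_le_of_sq_le_sq' (b := 2 ^ 512) ?_ (by positivity)).2
    rw [hP2, ← pow_mul]
    exact hA.le
  have hbig : ∀ {m : ℝ}, m ≤ 4 * P → m ≤ 2 ^ 1000 := by
    intro m hm
    refine (hm.trans (mul_le_mul_of_nonneg_left hPle (by norm_num))).trans ?_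
    rw [show (4 : ℝ) * 2 ^ 512 = 2 ^ 514 by rw [show (514 : ℕ) = 512 + 2 by norm_num, pow_add]; ring]
    exact pow_le_pow_right₀ (by norm_num) (by norm_num)
  rw [← hP, ← hQ]
  obtain ⟨_, S, ⟨⟩, hS, hX⟩ := fmul_eq_some hX
  have hS' := hS
  obtain ⟨_, ⟨⟩, hS⟩ := fsqrt_eq_some hS
  simp only [Dbl.sqrt, if_neg (not_lt.2 hA0.le), ← hP] at hS
  obtain ⟨S, rfl, fS⟩ := fl_fin_of_le hP0.le (hbig (by linarith)) hS
  have hS1 := fS.kap_le hP0.le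
  have hS2 := fS.le hP0.le
  have hS0 : 0 < S := lt_of_lt_of_le (by positivity) hS1
  have hS3 : S ≤ 2 * P := by
    refine hS2.trans (mul_le_mul_of_nonneg_right ?_ hP0.le)
    linarith
  obtain ⟨p, rfl, fp⟩ := fl_fin_of_le (by positivity) (hbig (by
    have : (1 + eps) * S ≤ (1 + eps) * ((1 + ur) * P) := by gcongr
    have h1 : (1 + eps) * (1 + ur) ≤ 4 := by norm_num [eps_eq, ur_eq]
    have h2 := mul_le_mul_of_nonneg_right h1 hP0.le
    linarith)) hX
  obtain ⟨_, B, ⟨⟩, hB, hY⟩ := fmul_eq_some hY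
  obtain ⟨q1, q2, hq1, hq2, hB⟩ := fadd_eq_some hB
  rw [hS'] at hq1
  obtain ⟨_, E, ⟨⟩, hE, hq1⟩ := fdiv_eq_some hq1
  obtain ⟨_, _, ⟨⟩, ⟨⟩, hE⟩ := fmul_eq_some hE
  obtain ⟨E, rfl, fE⟩ := fl_fin_of_le (by positivity) (hbig (by linarith)) hE
  have hE1 := fE.kap_le (by positivity)
  have hE0 : 0 < E := lt_of_lt_of_le (by positivity) hE1
  simp only [Dbl.div, if_neg hE0.ne'] at hq1
  have hσP : σ / (2 * P) ≤ P / 2 := by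
    rw [div_le_div_iff₀ (by positivity) (by norm_num)]
    nlinarith
  have hσ1 : σ / E ≤ (1 + ur) ^ 2 * (σ / (2 * P)) := by
    calc σ / E ≤ σ / (kap * (2 * (kap * P))) := by
          gcongr
          exact le_trans (by gcongr) hE1
      _ = _ := by rw [ek]; field_simp
  have hσ0 : 0 ≤ σ / (2 * P) := by positivity
  have hc2 : (1 + ur) ^ 2 ≤ 1.01 := by norm_num [ur_eq]
  have hσ2 : σ / E ≤ 1.01 * (σ / (2 * P)) := hσ1.trans (mul_le_mul_of_nonneg_right hc2 hσ0)
  obtain ⟨q1, rfl, f1⟩ := fl_fin_of_le (by positivity) (hbig (by linarith)) hq1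
  obtain ⟨_, ⟨⟩, hq2⟩ := fsqrt_eq_some hq2
  simp only [Dbl.sqrt, if_neg (not_lt.2 hD0.le)] at hq2
  have hDQ : √D ≤ (1 + ur / 2) * Q := by
    rw [Real.sqrt_le_left (by positivity), mul_pow, hQ2]
    refine hD.trans (mul_le_mul_of_nonneg_right ?_ (by linarith))
    nlinarith [sq_nonneg ur]
  have hQP : Q ≤ P := by
    refine (abs_le_of_sq_le_sq' ?_ hP0.le).2
    linarith
  have hc3 : (1 + ur / 2) ≤ 1.01 := by linarith
  have hD2 : √D ≤ 1.01 * Q := hDQ.trans (mul_le_mul_of_nonneg_right hc3 hQ0)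
  obtain ⟨q2, rfl, f2⟩ := fl_fin_of_le (by positivity) (hbig (by linarith)) hq2
  have h10 := f1.nonneg (by positivity)
  have h20 := f2.nonneg (by positivity)
  have h11 := f1.le (by positivity)
  have h21 := f2.le (by positivity)
  have hc4 : 1 + ur ≤ 1.01 := by linarith
  have h12 : q1 ≤ 1.01 * (1.01 * (P / 2)) := h11.trans (mul_le_mul hc4 (hσ2.trans (by linarith))
    (by positivity) (by norm_num))
  have h22 : q2 ≤ 1.01 * (1.01 * P) := h21.trans (mul_le_mul hc4 (hD2.trans (by linarith))
    (by positivity) (by norm_num))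
  obtain ⟨B, rfl, fB⟩ := fl_fin_of_le (by positivity) (hbig (by linarith)) hB
  have hB1 := fB.le (by positivity)
  have hB0 := fB.nonneg (by positivity)
  have hBP : B ≤ 1.01 * (2 * P) := hB1.trans (mul_le_mul hc4 (by linarith) (by positivity)
    (by norm_num))
  have h13 : (0 : ℝ) ≤ 1 - 3 * eps := by norm_num [eps_eq, ur_eq]
  obtain ⟨q, rfl, fq⟩ := fl_fin_of_le (by positivity) (hbig (by
    have : (1 - 3 * eps) * B ≤ 1 * B := by gcongr; linarith
    linarith)) hY
  refine ⟨p, q, rfl, rfl, ?_, ?_⟩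
  · have h3 := fp.kap_le (by positivity)
    have h4 := mul_le_mul_of_nonneg_left hS1 (show 0 ≤ kap * (1 + eps) by positivity)
    have h5 : 1 - ur ^ 2 ≤ kap * (1 + eps) * kap := by norm_num [kap, eps_eq, ur_eq]
    have := mul_le_mul_of_nonneg_right h5 hP0.le
    linarith
  · have h3 := fq.le (by positivity)
    have h4 : q1 + q2 ≤ (1 + ur) ^ 3 * (σ / (2 * P)) + (1 + ur) * (1 + ur / 2) * Q := by
      have h5 := mul_le_mul_of_nonneg_left hσ1 (show 0 ≤ 1 + ur by positivity)
      have h6 := mul_le_mul_of_nonneg_left hDQ (show 0 ≤ 1 + ur by positivity)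
      linarith
    have h5 : q ≤ (1 + ur) * ((1 - 3 * eps) * ((1 + ur) * ((1 + ur) ^ 3 * (σ / (2 * P)) +
        (1 + ur) * (1 + ur / 2) * Q))) := by
      refine h3.trans ?_
      gcongr
      exact hB1.trans (by gcongr)
    have c1 : (1 + ur) * ((1 - 3 * eps) * ((1 + ur) * (1 + ur) ^ 3)) ≤ 1 - 0.9 * ur := by
      norm_num [eps_eq, ur_eq]
    have c2 : (1 + ur) * ((1 - 3 * eps) * ((1 + ur) * ((1 + ur) * (1 + ur / 2)))) ≤ 1 - 2.49 * ur := by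
      norm_num [eps_eq, ur_eq]
    have := mul_le_mul_of_nonneg_right c1 hσ0
    have := mul_le_mul_of_nonneg_right c2 hQ0
    linarith

theorem sqrt_error_nonneg {A σ e q : ℝ} (hσ : 0 ≤ σ) (he : 0 ≤ e) (hs : σ + e < A)
    (hq : q ≤ (1 - 0.9 * ur) * (σ / (2 * √A)) + (1 - 2.49 * ur) * √(A - (σ + e))) :
    q ≤ σ / (2 * √A) + (1 - 2.49 * ur) * √(A - (σ + e)) ∧ q ≤ (1 - ur ^ 2) * √A := by
  have hu := ur_pos
  have hu' := ur_le
  have hA0 : 0 < A := by linarith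
  obtain ⟨P, hP, -, hP2⟩ := exists_sqrt_eq hA0.le
  have hP0 : 0 < P := by rw [hP]; positivity
  obtain ⟨Q, hQ, hQ0, hQ2⟩ := exists_sqrt_eq (x := A - (σ + e)) (by linarith)
  rw [← hP, ← hQ] at hq ⊢
  have hu2 : ur ^ 2 ≤ 0.5 * ur := by nlinarith
  have h1 : 0 ≤ ur * (σ / (2 * P)) := by positivity
  have hmain := half_add_le (σ := σ) (Q := Q) hP0 (by linarith)
  refine ⟨by linarith, ?_⟩
  have h5 : (1 - 2.49 * ur) * Q ≤ (1 - 0.9 * ur) * Q := by gcongr; linarith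
  have h6 := mul_le_mul_of_nonneg_left hmain (show 0 ≤ 1 - 0.9 * ur by linarith)
  have h7 : (1 - 0.9 * ur) * P ≤ (1 - ur ^ 2) * P := by gcongr; linarith
  linarith

theorem ACJ.sqrt_eq_some (h : x.sqrt M = some r) : ∃ ax D p,
    x.f.absUB M = some ax ∧
    some ax -ᶠ some (const (1 + eps)) *ᶠ (some x.size +ᶠ some x.e) = some D ∧
    (some (const 0) <ᶠ some D) = some p ∧
    ((p = false ∧ ∃ e, some (const (1 + 2 * eps)) *ᶠ fsqrt (some ax +ᶠ (some x.size +ᶠ some x.e)) =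
        some e ∧ ACJ.build M .zero .zero .zero .zero e = some r) ∨
    (p = true ∧ ∃ s t s0 s1 s2 e, x.f.sqrt M = some s ∧ s.add s = some t ∧
      (AComplex.mk x.f0 (const 0)).div t = some s0 ∧ (AComplex.mk x.f1 (const 0)).div t = some s1 ∧
      (AComplex.mk x.f2 (const 0)).div t = some s2 ∧
      some (const (1 + 3 * eps)) *ᶠ ((some (const (1 + eps)) *ᶠ fsqrt (some ax) -ᶠ
        some (const (1 - 3 * eps)) *ᶠ (some x.size /ᶠ (some (const 2) *ᶠ fsqrt (some ax)) +ᶠ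
          fsqrt (some D))) +ᶠ ((some s.e +ᶠ some s0.e) +ᶠ (some s1.e +ᶠ some s2.e))) = some e ∧
      ACJ.build M s.z s0.z s1.z s2.z e = some r)) := by
  unfold ACJ.sqrt at h
  obtain ⟨ax, h1, h⟩ := bind_iff.1 h
  obtain ⟨D, h2, h⟩ := bind_iff.1 h
  obtain ⟨p, h3, h⟩ := bind_iff.1 h
  refine ⟨ax, D, p, h1, h2, h3, ?_⟩
  cases p
  · exact Or.inl ⟨rfl, by simpa only [Bool.false_eq_true, ↓reduceIte, bind_iff] using h⟩
  · exact Or.inr ⟨rfl, by simpa only [↓reduceIte, bind_iff, exists_and_left] using h⟩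

/-- The jet `r` does not restrict its values essentially. -/
def Loose (M : Machine) (z : Fin 3 → ℂ) (r : ACJ) : Prop :=
  ∀ τ : ℂ, ∃ w, Rep M z r w ∧ 2 ^ 100 ≤ ‖τ + w‖ ∧ 2 ^ 100 ≤ ‖τ - w‖

theorem exists_far (τ c : ℂ) {K T : ℝ} (hT : 2 * K ≤ T) (hK : 0 < K) :
    ∃ δ : ℝ, 0 ≤ δ ∧ δ ≤ 2 * T ∧ K ≤ ‖τ + (c + δ)‖ ∧ K ≤ ‖τ - (c + δ)‖ := by
  by_contra hc
  push Not at hc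
  have key : ∀ δ δ' : ℝ, T ≤ δ' - δ → (‖τ + (c + δ)‖ < K → ‖τ + (c + δ')‖ < K → False) ∧
      (‖τ - (c + δ)‖ < K → ‖τ - (c + δ')‖ < K → False) := by
    intro δ δ' h
    have hn : T ≤ ‖((δ' - δ : ℝ) : ℂ)‖ := by
      rw [Complex.norm_real]; exact h.trans (le_abs_self _)
    constructor <;> intro h1 h2
    · have := norm_sub_le (τ + (c + δ')) (τ + (c + δ))
      rw [show τ + (c + δ') - (τ + (c + δ)) = ((δ' - δ : ℝ) : ℂ) by push_cast; ring] at this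
      linarith
    · have := norm_sub_le (τ - (c + δ)) (τ - (c + δ'))
      rw [show τ - (c + δ) - (τ - (c + δ')) = ((δ' - δ : ℝ) : ℂ) by push_cast; ring] at this
      linarith
  have h0 := hc 0 le_rfl (by linarith)
  have h1 := hc T (by linarith) (by linarith)
  have h2 := hc (2 * T) (by linarith) le_rfl
  have k1 := key 0 T (by linarith)
  have k2 := key 0 (2 * T) (by linarith)
  have k3 := key T (2 * T) (by linarith)
  rcases le_or_gt K ‖τ + (c + (0 : ℝ))‖ with a0 | a0 <;>
  rcases le_or_gt K ‖τ + (c + (T : ℝ))‖ with a1 | a1 <;>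
  rcases le_or_gt K ‖τ + (c + ((2 * T : ℝ) : ℂ))‖ with a2 | a2
  · exact k1.2 (h0 a0) (h1 a1)
  · exact k1.2 (h0 a0) (h1 a1)
  · exact k2.2 (h0 a0) (h2 a2)
  · exact k3.1 a1 a2
  · exact k3.2 (h1 a1) (h2 a2)
  · exact k2.1 a0 a2
  · exact k1.1 a0 a1
  · exact k1.1 a0 a1

theorem loose_of_build {f f0 f1 f2 : XComplex} {e : Dbl}
    (h : ACJ.build M f f0 f1 f2 e = some r) (hz : ∀ k, ‖z k‖ ≤ 1) (he : UB e 0)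
    (hv : ∀ x, e = .fin x → FinC f0 → FinC f1 → FinC f2 → 2 ^ 302 ≤ x ∧
      ∃ c c0 c1 c2, IsC f c ∧ IsC f0 c0 ∧ IsC f1 c1 ∧ IsC f2 c2) : Loose M z r := by
  intro τ
  have hKT : (2 : ℝ) * 2 ^ 100 ≤ 2 ^ 300 := by
    rw [← pow_succ']; exact pow_le_pow_right₀ (by norm_num) (by norm_num)
  by_cases hc : ∃ x, e = .fin x ∧ FinC f0 ∧ FinC f1 ∧ FinC f2
  · obtain ⟨x, hx, q0, q1, q2⟩ := hc
    obtain ⟨hx', c, c0, c1, c2, hc, hc0, hc1, hc2⟩ := hv x hx q0 q1 q2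
    obtain ⟨δ, hδ0, hδ, h1, h2⟩ := exists_far τ jet(z,c,c0,c1,c2) hKT
      (by positivity)
    refine ⟨_, rep_of_build h hz he ?_, h1, h2⟩
    intro x' hx1 _ _ _
    obtain rfl : x = x' := by rw [hx1] at hx; simpa using hx.symm
    refine ⟨c, c0, c1, c2, hc, hc0, hc1, hc2, ?_⟩
    rw [add_sub_cancel_left, Complex.norm_real, Real.norm_of_nonneg hδ0]
    refine hδ.trans (le_trans ?_ hx')
    rw [← pow_succ']; exact pow_le_pow_right₀ (by norm_num) (by norm_num)
  · obtain ⟨δ, -, -, h1, h2⟩ := exists_far τ 0 hKT (by positivity)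
    exact ⟨_, rep_of_build h hz he (fun x hx q0 q1 q2 => (hc ⟨x, hx, q0, q1, q2⟩).elim), h1, h2⟩

theorem AComplex.div_isC {x y r : AComplex} (h : x.div y = some r) (hr : FinC r.z) :
    ∃ c, IsC r.z c := by
  obtain ⟨n, p1, p2, p3, p4, re, im, A, B, e, -, -, -, -, -, h6, h7, -, -, -, -, rfl⟩ :=
    div_eq_some h
  obtain ⟨p, q, hp, hq⟩ := hr
  dsimp only at hp hq
  subst hp hq
  have key : ∀ {a b : FP} {t : ℝ}, a /ᶠ b = some (.fin t) → IsNormal t := by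
    intro a b t h
    rcases fdiv_fin h with ⟨_, _, _, _, _, h⟩ | ⟨_, _, _, _, rfl⟩
    · exact h.isNormal
    · exact isNormal_zero
  exact ⟨⟨p, q⟩, rfl, rfl, key h6, key h7⟩

theorem exists_sq_eq_of_re_nonneg (v ρ : ℂ) : ∃ w : ℂ, w ^ 2 = v ∧ 0 ≤ (w / ρ).re := by
  obtain ⟨w, hw⟩ : ∃ w : ℂ, w ^ 2 = v := IsAlgClosed.exists_pow_nat_eq v (by norm_num)
  rcases le_total 0 (w / ρ).re with h | h
  · exact ⟨w, hw, h⟩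
  · exact ⟨-w, by rw [neg_sq, hw], by rw [neg_div, Complex.neg_re]; linarith⟩

/-- Either the computed error of a square root is sound, or the value is close to `1 - k` times the
centre, where `k` is the relative radius. -/
theorem sqrt_error_dichotomy {ρ w f fl v : ℂ} {A σ e X Y : ℝ} (hρ : ρ ^ 2 = f) (hρ0 : ρ ≠ 0)
    (hw : w ^ 2 = v) (hre : 0 ≤ (w / ρ).re) (hσ : ‖fl‖ ≤ σ) (he : ‖v - (f + fl)‖ ≤ e)
    (hA : ‖f‖ ≤ A) (hA' : A ≤ (1 + 7.01 * ur) * ‖f‖) (hs : σ + e < A)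
    (hX : (1 - ur ^ 2) * √A ≤ X) (hY : Y ≤ σ / (2 * √A) + (1 - 2.49 * ur) * √(A - (σ + e))) :
    ‖w - (ρ + fl / (2 * ρ))‖ ≤ X - Y ∨ (0.525 * ‖f‖ ≤ σ + e ∧ σ + e ≤ (1 + 1e-9) * ‖f‖ ∧
      ‖v - f + ((σ + e) / ‖f‖ : ℝ) * f‖ ≤ 1e-6 * ‖f‖) := by
  have hu := ur_pos
  have hu' : ur ≤ 2e-16 := by norm_num [ur_eq]
  have hσ0 := (norm_nonneg _).trans hσ
  have he0 := (norm_nonneg _).trans he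
  obtain ⟨p, hp⟩ : ∃ p, p = ‖ρ‖ := ⟨_, rfl⟩
  have hp0 : 0 < p := by rw [hp]; exact norm_pos_iff.2 hρ0
  have hpf : ‖f‖ = p ^ 2 := by rw [hp, ← hρ, norm_pow]
  rw [hpf] at hA hA' ⊢
  have hA0 : 0 < A := by nlinarith
  obtain ⟨P, hP, -, hP2⟩ := exists_sqrt_eq hA0.le
  have hP0 : 0 < P := by rw [hP]; positivity
  have hpP : p ≤ P := by
    refine (abs_le_of_sq_le_sq' ?_ hP0.le).2
    linarith
  obtain ⟨k, hk⟩ : ∃ k, k = (σ + e) / p ^ 2 := ⟨_, rfl⟩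
  have hkp : σ + e = k * p ^ 2 := by rw [hk]; field_simp
  have hf0 : f ≠ 0 := by rw [← hρ]; exact pow_ne_zero 2 hρ0
  have hw2 : (w / ρ) ^ 2 - 1 = (v - f) / f := by
    rw [div_pow, hw, hρ]; field_simp
  have hκ : ‖(w / ρ) ^ 2 - 1‖ ≤ k := by
    rw [hw2, norm_div, hpf, hk]
    gcongr
    have := norm_add_le (v - (f + fl)) fl
    rw [show v - (f + fl) + fl = v - f by ring] at this
    linarith
  have hres : ‖w - (ρ + fl / (2 * ρ))‖ ≤ p / 2 * ‖1 - w / ρ‖ ^ 2 + e / (2 * p) := by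
    rw [sqrt_jet_residual hρ hw hρ0]
    refine (norm_add_le _ _).trans (add_le_add ?_ ?_)
    · rw [norm_div, norm_neg, norm_mul, norm_pow, ← hp]
      simp; linarith
    · rw [norm_div, norm_mul, ← hp]
      simp only [Complex.norm_ofNat]
      gcongr
  have hσP : σ / (2 * P) ≤ σ / (2 * p) := by gcongr
  rw [← hP] at hX hY
  rcases le_or_gt k 0.525 with hk1 | hk1
  · left
    have h1 := norm_one_sub_le hre hκ (by linarith)
    have h2 := sqrt_error_ge (s := σ + e) hp0 hpP (by rw [hP2]; exact hA')
      (by rw [hkp]; gcongr)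
    rw [hP2] at h2
    have h3 : √(p ^ 2 - (σ + e)) = p * √(1 - k) := by
      rw [hkp, show p ^ 2 - k * p ^ 2 = p ^ 2 * (1 - k) by ring, Real.sqrt_mul (by positivity),
        Real.sqrt_sq hp0.le]
    have h4 : (√(1 - k)) ^ 2 = 1 - k := Real.sq_sqrt (by linarith)
    have h5 : p / 2 * ‖1 - w / ρ‖ ^ 2 + e / (2 * p) ≤ p - √(p ^ 2 - (σ + e)) - σ / (2 * p) := by
      have h6 := mul_le_mul_of_nonneg_left h1 (show 0 ≤ p / 2 by positivity)
      have h7 : p / 2 * (1 - √(1 - k)) ^ 2 = p - p * √(1 - k) - (σ + e) / (2 * p) := by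
        rw [hkp, show k * p ^ 2 / (2 * p) = k * p / 2 by field_simp]
        linear_combination (p / 2) * h4
      rw [h3]
      rw [h7, add_div] at h6
      linarith
    linarith
  · by_cases hle : ‖w - (ρ + fl / (2 * ρ))‖ ≤ X - Y
    · exact Or.inl hle
    right
    push Not at hle
    have hs1 : k * p ^ 2 < (1 + 7.01 * ur) * p ^ 2 := by rw [← hkp]; linarith
    have hs2 : k < 1 + 7.01 * ur := lt_of_mul_lt_mul_right hs1 (by positivity)
    obtain ⟨β, hβ, hβ0, hβ2⟩ := exists_sqrt_eq (x := 1 - k + 7.01 * ur) (by linarith)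
    have hQ : √(A - (σ + e)) ≤ p * β := by
      rw [Real.sqrt_le_left (by positivity), mul_pow, hβ2, hkp]
      linarith
    have hQ0 : 0 ≤ √(A - (σ + e)) := by positivity
    have h1 : (1 - ur ^ 2) * p ≤ (1 - ur ^ 2) * P := by
      refine mul_le_mul_of_nonneg_left hpP ?_
      nlinarith
    have h2 : (1 - 2.49 * ur) * √(A - (σ + e)) ≤ p * β := by
      refine le_trans (mul_le_of_le_one_left hQ0 (by linarith)) hQ
    have h3 : (1 - ur ^ 2) * p - σ / (2 * p) - p * β < p / 2 * ‖1 - w / ρ‖ ^ 2 + e / (2 * p) := by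
      linarith
    have h4 : σ / (2 * p) + e / (2 * p) = k * p / 2 := by
      rw [← add_div, hkp]; field_simp
    have h5 : (1 - β) ^ 2 - 8 * ur < ‖1 - w / ρ‖ ^ 2 := by
      have h6 : p * (2 * (1 - ur ^ 2) - k - 2 * β) < p * ‖1 - w / ρ‖ ^ 2 := by linarith
      have h7 := lt_of_mul_lt_mul_left h6 hp0.le
      nlinarith
    have h6 := norm_sq_sub_one_add_le hre hκ hk1.le hβ2 h5
    refine ⟨by rw [hkp]; gcongr, ?_, ?_⟩
    · rw [hkp]
      gcongr
      linarith
    · rw [← hk]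
      have h7 : v - f + (k : ℂ) * f = ((w / ρ) ^ 2 - 1 + k) * f := by
        rw [hw2]; field_simp
      rw [h7, norm_mul, hpf]
      gcongr

theorem Rep.sqrt (hx : Rep M z x v) (h : x.sqrt M = some r) :
    (∃ w, w ^ 2 = v ∧ Rep M z r w) ∨
    (∃ f σ e, IsC x.f f ∧ x.size = .fin σ ∧ x.e = .fin e ∧ f ≠ 0 ∧ 0.525 * ‖f‖ ≤ σ + e ∧
      σ + e ≤ (1 + 1e-9) * ‖f‖ ∧ ‖v - f + ((σ + e) / ‖f‖ : ℝ) * f‖ ≤ 1e-6 * ‖f‖) ∨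
    ((∃ f, IsC x.f f ∧ 2 ^ 900 < ‖f‖) ∧ Loose M z r) := by
  obtain ⟨w0, hw0⟩ : ∃ w : ℂ, w ^ 2 = v := IsAlgClosed.exists_pow_nat_eq v (by norm_num)
  have hen := eps_nonneg
  have hu := ur_pos
  obtain ⟨ax, D, p, h1, h2, h3, ⟨rfl, e, h4, h⟩ | ⟨rfl, s, t, s0, s1, s2, e, h4, h5, h6, h7, h8, h9,
    h⟩⟩ := ACJ.sqrt_eq_some h
  · refine Or.inl ⟨w0, hw0, rep_of_build h hx.hz ?_ ?_⟩
    · exact (ubo_const (by positivity)).mul_nonneg (ubo_sqrt _) e h4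
    · rintro e rfl - - -
      refine ⟨0, 0, 0, 0, isC_zero, isC_zero, isC_zero, isC_zero, ?_⟩
      obtain ⟨_, S, ⟨⟩, k1, fe⟩ := fmul_fin h4
      obtain ⟨N, k2, hN, fS⟩ := fsqrt_fin k1
      have k2' := k2
      obtain ⟨P, _, ⟨⟩, k3, -⟩ := fadd_fin k2
      obtain ⟨σ, a, k4, k5, -⟩ := fadd_fin k3
      rw [Option.some.injEq] at k4 k5
      obtain ⟨f, hf, hv⟩ := hx.norm_sub_le k5 k4
      have hP : Kb 0 (some (Dbl.fin P)) ‖f‖ := UB.kb (absUB_spec hf h1).1 (norm_nonneg f)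
      have hkb := hP.add ((kb_fin k4 hx.size_nonneg).add (kb_fin k5 hx.nonneg))
      have hN' := hkb.le k2' le_rfl
      have hk := kap_pos
      have hv' : ‖v‖ ≤ ‖f‖ + (σ + a) := by
        have := norm_sub_norm_le v f
        linarith
      have hwN : (kap * ‖w0‖) ^ 2 ≤ N := by
        refine le_trans ?_ hN'
        rw [mul_pow, ← norm_pow, hw0]
        change kap ^ 2 * _ ≤ kap ^ 2 * _
        gcongr
      have hS1 : kap * ‖w0‖ ≤ √N := Real.le_sqrt_of_sq_le hwN
      have hS2 := fS.kap_le (by positivity)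
      have hS0 := fS.nonneg (by positivity)
      have he := fe.kap_le (by positivity)
      have h5 : 1 ≤ kap * ((1 + 2 * eps) * (kap * kap)) := by norm_num [kap, eps_eq, ur_eq]
      have h6 : kap * ((1 + 2 * eps) * (kap * (kap * ‖w0‖))) ≤ kap * ((1 + 2 * eps) * S) := by
        gcongr
        exact le_trans (by gcongr) hS2
      have h7 := mul_le_mul_of_nonneg_right h5 (norm_nonneg w0)
      simp only [zero_mul, add_zero, sub_zero]
      linarith
  obtain ⟨G, σ, a, hσ, ha, hσ0, ha0, hG, i2, i3⟩ := guard_of_lt hx.size_nonneg hx.nonneg h2 h3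
  obtain ⟨-, -, f, f0, f1, f2, hf, hf0, hf1, hf2, hfs, hv⟩ := hx.data ha hσ
  obtain ⟨_, _, ⟨⟩, hsum, hmul⟩ := fmul_eq_some h9
  obtain ⟨W, C, hW, hC, hadd⟩ := fadd_eq_some hsum
  obtain ⟨X, Y, hX, hY, hsub⟩ := fsub_eq_some hW
  obtain ⟨ha1, ha2⟩ := absUB_spec hf h1
  rcases ha1.cases with hb | ⟨A, rfl, -⟩
  · -- the modulus of the centre overflows
    have hX' : Bad X := by
      obtain ⟨_, S, ⟨⟩, hS, hX⟩ := fmul_eq_some hX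
      obtain ⟨_, ⟨⟩, hS⟩ := fsqrt_eq_some hS
      refine bad_mul (by positivity) ?_ hX
      rcases hb with rfl | rfl <;> (simp only [Dbl.sqrt, Option.some.injEq] at hS; subst hS)
      · exact Or.inl rfl
      · exact Or.inr rfl
    have he : Bad e := bad_mul (by positivity) (bad_add_left (bad_add_left hX' hsub) hadd) hmul
    refine Or.inl ⟨w0, hw0, rep_of_build h hx.hz (he.ub 0) ?_⟩
    rintro _ rfl
    rcases he with he | he <;> cases he
  obtain ⟨hA0, hA1, hA2, hA3⟩ := ha2 A rfl
  obtain ⟨_, _, _, _, fA⟩ := fmul_fin h1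
  obtain ⟨D, rfl, fD, hpos, hD0⟩ := fin_of_lt_sub fA.self (by linarith) i2 i3
  have hDA : D ≤ (1 + ur) * (A - (σ + a)) := by
    refine (fD.le hpos.le).trans (mul_le_mul_of_nonneg_left ?_ (by positivity))
    linarith
  have hsA : σ + a < A := by linarith
  rw [hσ] at hY
  obtain ⟨p, q, rfl, rfl, hp, hq⟩ := sqrt_error_terms ((le_abs_self A).trans_lt fA.lt) hσ0 ha0 hsA hD0
    hDA hX hY
  obtain ⟨hq1, hq2⟩ := sqrt_error_nonneg hσ0 ha0 hsA hq
  rw [← hσ] at hY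
  rw [hX, hY, hC] at h9
  have hsn := XComplex.sqrt_nonneg h4
  have htn := AComplex.add_nonneg h5 hsn hsn
  have h00 : UB (const 0) 0 := le_refl (0 : ℝ)
  obtain ⟨he0, he⟩ := difference_error (show UB (.fin p) 0 from by
      have : 0 ≤ (1 - ur ^ 2) * √A := by
        have : ur ^ 2 ≤ 1 := by norm_num [ur_eq]
        have : 0 ≤ 1 - ur ^ 2 := by linarith
        positivity
      exact this.trans hp) hsn (AComplex.div_nonneg h6 h00 htn) (AComplex.div_nonneg h7 h00 htn)
    (AComplex.div_nonneg h8 h00 htn) hC (by rintro _ c ⟨⟩ -; exact ⟨q, rfl, hq2.trans hp⟩) h9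
  by_cases hall : ∃ e', e = .fin e' ∧ FinC s0.z ∧ FinC s1.z ∧ FinC s2.z
  swap
  · exact Or.inl ⟨w0, hw0, rep_of_build h hx.hz he0
      (fun e' he' q0 q1 q2 => (hall ⟨e', he', q0, q1, q2⟩).elim)⟩
  obtain ⟨e, rfl, q0, q1, q2⟩ := hall
  obtain ⟨_, _, ε, ε0, ε1, ε2, ⟨⟩, ⟨⟩, hε, hε0, hε1, hε2, hle⟩ := he e rfl
  obtain ⟨ρ, c, hρ, hc, hρc, hcn, hεf, hf0'⟩ := XComplex.sqrt_sound h4 hf hε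
  rcases le_or_gt ‖f‖ (2 ^ 900) with hsmall | hhuge
  swap
  · refine Or.inr (Or.inr ⟨⟨f, hf, hhuge⟩, loose_of_build h hx.hz he0 ?_⟩)
    rintro _ ⟨⟩ q0 q1 q2
    obtain ⟨c0, hc0⟩ := AComplex.div_isC h6 q0
    obtain ⟨c1, hc1⟩ := AComplex.div_isC h7 q1
    obtain ⟨c2, hc2⟩ := AComplex.div_isC h8 q2
    refine ⟨?_, c, c0, c1, c2, hc, hc0, hc1, hc2⟩
    have n0 := AComplex.div_nonneg h6 h00 htn
    have n1 := AComplex.div_nonneg h7 h00 htn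
    have n2 := AComplex.div_nonneg h8 h00 htn
    rw [hε0] at n0
    rw [hε1] at n1
    rw [hε2] at n2
    have m0 : (0 : ℝ) ≤ ε0 := n0
    have m1 : (0 : ℝ) ≤ ε1 := n1
    have m2 : (0 : ℝ) ≤ ε2 := n2
    have h450 : 2 ^ 450 ≤ √‖f‖ := by
      refine Real.le_sqrt_of_sq_le ?_
      rw [← pow_mul]
      exact hhuge.le
    have hε' : (2 : ℝ) ^ 302 ≤ ε := by
      refine le_trans ?_ hεf
      refine le_trans ?_ (mul_le_mul_of_nonneg_left h450 hu.le)
      have : (2 : ℝ) ^ 302 ≤ 2 ^ (-53 : ℤ) * 2 ^ 450 := by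
        rw [← zpow_natCast, ← zpow_natCast, ← zpow_add₀ (by norm_num)]
        exact zpow_le_zpow_right₀ (by norm_num) (by norm_num)
      exact this
    linarith
  have hρ0 : ρ ≠ 0 := by rintro rfl; exact hf0' (by rw [← hρ]; simp)
  obtain ⟨w, hw, hre⟩ := exists_sq_eq_of_re_nonneg v ρ
  rcases sqrt_error_dichotomy hρ hρ0 hw hre ((norm_jet_le hx.hz f0 f1 f2).trans hfs)
    (norm_sub_jet_assoc hv)
    hA2 hA1 hsA hp hq1 with hgood | ⟨b1, b2, b3⟩
  swap
  · exact Or.inr (Or.inl ⟨f, σ, a, hf, hσ, ha, hf0', b1, b2, b3⟩)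
  refine Or.inl ⟨w, hw, rep_of_build h hx.hz he0 ?_⟩
  rintro _ ⟨⟩ - - -
  have hsR : RepA s ρ := by
    intro e' he'
    rw [hε] at he'
    cases he'
    exact Or.inl ⟨c, hc, hρc⟩
  obtain ⟨-, τ, hτ⟩ := AComplex.fin_of_div h6 hε0
  have htR : RepA t (ρ + ρ) := by
    intro e' he'
    obtain ⟨c, -, -, hc, -, -, hc', -⟩ := AComplex.add_sound h5 hsR hsR hsn hsn he'
    exact Or.inl ⟨c, hc, hc'⟩
  obtain ⟨c', a', b', hc', ha', hb', -, hcb⟩ := AComplex.add_sound h5 hsR hsR hsn hsn hτ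
  have htb : ∀ b, IsC t.z b → ‖b‖ ≤ 2 ^ 500 := by
    intro b hb
    obtain rfl := hb.unique hc'
    obtain rfl := ha'.unique hc
    obtain rfl := hb'.unique hc
    have h1 := norm_sub_norm_le b (b' + b')
    rw [norm_sub_rev] at h1
    have h2 := norm_add_le b' b'
    have h3 : √‖f‖ ≤ 2 ^ 450 := by
      rw [Real.sqrt_le_left (by positivity), ← pow_mul]
      exact hsmall
    have h4 : ur ≤ 1 := by norm_num [ur_eq]
    have h5 : ur * ‖b' + b'‖ ≤ 1 * ‖b' + b'‖ := by gcongr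
    have h6 : ‖b‖ ≤ 8 * 2 ^ 450 := by linarith
    refine h6.trans ?_
    rw [show (8 : ℝ) = 2 ^ 3 by norm_num, ← pow_add]
    exact pow_le_pow_right₀ (by norm_num) (by norm_num)
  have coef : ∀ {g : XComplex} {d : ℂ} {s : AComplex} {ε : ℝ}, (AComplex.mk g (const 0)).div t = some s →
      IsC g d → s.e = .fin ε → FinC s.z → ∃ c, IsC s.z c ∧ ‖d / (ρ + ρ) - c‖ ≤ ε := by
    intro g d s ε hs hg hε hfin
    have hR : RepA ⟨g, const 0⟩ d := by
      rintro _ ⟨⟩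
      exact Or.inl ⟨d, hg, by simp⟩
    exact (AComplex.div_sound hs hR htR h00 htn hg.finC hc'.finC htb ε hε).resolve_right
      (not_not.2 hfin)
  obtain ⟨c0, hc0, m0⟩ := coef h6 hf0 hε0 q0
  obtain ⟨c1, hc1, m1⟩ := coef h7 hf1 hε1 q1
  obtain ⟨c2, hc2, m2⟩ := coef h8 hf2 hε2 q2
  refine ⟨c, c0, c1, c2, hc, hc0, hc1, hc2, ?_⟩
  have hρ2 : ρ + ρ ≠ 0 := by rw [← two_mul]; exact mul_ne_zero two_ne_zero hρ0
  rw [show w - jet(z,c,c0,c1,c2) =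
    (w - (ρ + (f0 * z 0 + f1 * z 1 + f2 * z 2) / (2 * ρ))) + ((ρ - c) +
      ((f0 / (ρ + ρ) - c0) * z 0 + (f1 / (ρ + ρ) - c1) * z 1 + (f2 / (ρ + ρ) - c2) * z 2)) by
    rw [two_mul]; field_simp; ring]
  refine (norm_add_jet_le hx.hz _ _ _ _ _).trans ?_
  linarith

/-! ### Bounds for centres -/

theorem norm_le_of_norm_sub_le {a c : ℂ} {ε B : ℝ} (h : ‖a - c‖ ≤ ε * B) (ha : ‖a‖ ≤ B)
    (hε : ε ≤ 0.01) : ‖c‖ ≤ 1.01 * B := by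
  have h1 := norm_sub_norm_le c a
  rw [norm_sub_rev] at h1
  have h2 := mul_le_mul_of_nonneg_right hε ((norm_nonneg a).trans ha)
  linarith

theorem CentreLE.mul {B C : ℝ} (hx : Rep M z x v) (hy : Rep M z y w) (h : x.mul M y = some r)
    (hB : CentreLE x B) (hC : CentreLE y C) : CentreLE r (1.01 * (B * C)) := by
  intro e c he hc
  obtain ⟨a, b, σ, τ, f, f0, f1, f2, g, g0, g1, g2, c', c0, c1, c2, ha, hb, -, -, -, -, -, -,
    hf, -, -, -, hg, -, -, -, hc', -, -, -, -, -, -, -, h5, -⟩ := hx.mul_data hy h he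
  obtain rfl := hc.unique hc'
  have h1 := hB a f ha hf
  have h2 := hC b g hb hg
  have h3 : ‖f‖ * ‖g‖ ≤ B * C := mul_le_mul h1 h2 (norm_nonneg g) ((norm_nonneg f).trans h1)
  have hu : 5 * ur ≤ 0.01 := by norm_num [ur_eq]
  have hu0 := ur_pos
  exact norm_le_of_norm_sub_le (ε := 5 * ur) (h5.trans (by gcongr)) (by rwa [norm_mul]) hu

theorem ur_le_hundredth : ur ≤ 0.01 := by norm_num [ur_eq]

theorem CentreLE.of_norm_sub_le {a : ℂ} {c : ℂ} {B : ℝ} (h : ‖a - c‖ ≤ ur * ‖a‖) (ha : ‖a‖ ≤ B) :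
    ‖c‖ ≤ 1.01 * B :=
  norm_le_of_norm_sub_le (h.trans (mul_le_mul_of_nonneg_left ha ur_pos.le)) ha ur_le_hundredth

theorem CentreLE.add_of {B C : ℝ} (hx : Rep M z x v) (hy : UB y.e 0) (h : x.add M y = some r)
    (hB : CentreLE x B) (hC : ∀ e, y.e = .fin e → FinC y.f0 → FinC y.f1 → FinC y.f2 →
      ∃ g, IsC y.f g ∧ ‖g‖ ≤ C) : CentreLE r (1.01 * (B + C)) := by
  intro e c he hc
  obtain ⟨s, s0, s1, s2, e, h1, h2, h3, h4, h5, h6⟩ := ACJ.add_eq_some h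
  obtain ⟨_, -, rfl⟩ := build_eq_some h6
  cases he
  obtain ⟨a, b, t, t0, t1, t2, ea, eb, et, e0, e1, e2, hle⟩ := sum_error_le hx.nonneg hy
    (XComplex.add_nonneg h1) (XComplex.add_nonneg h2) (XComplex.add_nonneg h3)
    (XComplex.add_nonneg h4) h5
  obtain ⟨k0, l0⟩ := XComplex.finC_of_add h2 e0
  obtain ⟨k1, l1⟩ := XComplex.finC_of_add h3 e1
  obtain ⟨k2, l2⟩ := XComplex.finC_of_add h4 e2
  obtain ⟨f, -, -, -, hf, -⟩ := hx.val a ea k0 k1 k2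
  obtain ⟨g, hg, hgC⟩ := hC b eb l0 l1 l2
  obtain ⟨c', hc', -, q⟩ := XComplex.add_sound h1 hf hg et
  obtain rfl := hc.unique hc'
  exact CentreLE.of_norm_sub_le q ((norm_add_le _ _).trans (add_le_add (hB a f ea hf) hgC))

theorem CentreLE.add {B C : ℝ} (hx : Rep M z x v) (hy : Rep M z y w) (h : x.add M y = some r)
    (hB : CentreLE x B) (hC : CentreLE y C) : CentreLE r (1.01 * (B + C)) :=
  CentreLE.add_of hx hy.nonneg h hB fun e he k0 k1 k2 =>
    let ⟨g, _, _, _, hg, _⟩ := hy.val e he k0 k1 k2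
    ⟨g, hg, hC e g he hg⟩

theorem CentreLE.sub {B C : ℝ} (hx : Rep M z x v) (hy : Rep M z y w) (h : x.sub M y = some r)
    (hB : CentreLE x B) (hC : CentreLE y C) : CentreLE r (1.01 * (B + C)) :=
  CentreLE.add_of (y := ⟨y.f.neg, y.f0.neg, y.f1.neg, y.f2.neg, y.e, y.size⟩) hx hy.nonneg h hB
    fun e he k0 k1 k2 =>
    let ⟨g, _, _, _, hg, _⟩ := hy.neg_val he k0 k1 k2
    ⟨g, hg, by simpa using hC e (-g) he (y.f.neg_neg ▸ hg.neg)⟩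

/-- The centre of a quotient with finite error. -/
theorem Rep.div_centre (hx : Rep M z x v) (hy : Rep M z y w) (hg : CentreLE y (2 ^ 20))
    (h : x.div M y = some r) {e : ℝ} (he : r.e = .fin e) : ∃ a b f g c, x.e = .fin a ∧ y.e = .fin b ∧
      IsC x.f f ∧ IsC y.f g ∧ IsC r.f c ∧ g ≠ 0 ∧ ‖f / g - c‖ ≤ 0.01 * (‖f‖ / ‖g‖) := by
  obtain ⟨ax, ay, D, p, h1, h2, h3, h4, ⟨rfl, h⟩ | ⟨rfl, den, s, a0, b0, n0, s0, a1, b1, n1, s1, a2,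
    b2, n2, s2, A, B, C, e, h5, h6, i1, i2, i3, i4, j1, j2, j3, j4, k1, k2, k3, k4, h7, h8, h9, h10,
    h⟩⟩ := ACJ.div_eq_some h
  · obtain ⟨_, -, rfl⟩ := build_eq_some h
    cases he
  obtain ⟨_, -, rfl⟩ := build_eq_some h
  cases he
  obtain ⟨b, τ, Q, D, g, g0, g1, g2, hb, hτ, rfl, rfl, hb0, hτ0, hgC, -⟩ := hy.denominator h2 h3 h4 hg
  obtain ⟨_, _, -, l1, -⟩ := fmul_fin h10
  obtain ⟨_, C, l2, ⟨⟩, -⟩ := fadd_fin l1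
  obtain ⟨_, _, l3, -, -⟩ := fsub_fin l2
  obtain ⟨_, A, -, ⟨⟩, -⟩ := fmul_fin l3
  obtain ⟨_, l4, -, -⟩ := Dbl.fin_of_fdiv h7
  obtain ⟨P, _, -, l5, -⟩ := fadd_fin l4
  obtain ⟨σ, a, l6, l7, -⟩ := fadd_fin l5
  rw [Option.some.injEq] at l6 l7
  obtain ⟨-, -, f, -, -, -, hf, -⟩ := hx.data l7 l6
  obtain ⟨t', -, -, -, l8, -⟩ := fin_of_sum4 h9
  rw [Option.some.injEq] at l8
  obtain ⟨c, hc, -, m, hg0⟩ := XComplex.div_sound h6 hf hgC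
    ((hg b g hb hgC).trans (pow_le_pow_right₀ (by norm_num) (by norm_num))) l8
  exact ⟨a, b, f, g, c, l7, hb, hf, hgC, hc, hg0, m⟩

theorem CentreLE.sqrt {B : ℝ} (hx : Rep M z x v) (h : x.sqrt M = some r) (hB : CentreLE x (B ^ 2))
    (hB0 : 0 ≤ B) : CentreLE r (2 * B) := by
  intro e c he hc
  obtain ⟨ax, D, p, h1, h2, h3, ⟨rfl, e, h4, h⟩ | ⟨rfl, s, t, s0, s1, s2, e, h4, h5, h6, h7, h8, h9,
    h⟩⟩ := ACJ.sqrt_eq_some h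
  · obtain ⟨_, -, rfl⟩ := build_eq_some h
    obtain rfl := hc.unique isC_zero
    simpa using hB0
  · obtain ⟨_, -, rfl⟩ := build_eq_some h
    cases he
    obtain ⟨_, _, -, l1, -⟩ := fmul_fin h9
    obtain ⟨_, _, -, l2, -⟩ := fadd_fin l1
    obtain ⟨ε, -, -, -, l3, -⟩ := fin_of_sum4 l2
    rw [Option.some.injEq] at l3
    obtain ⟨_, σ, a, hσ, ha, -⟩ := guard_of_lt hx.size_nonneg hx.nonneg h2 h3
    obtain ⟨-, -, f, -, -, -, hf, -⟩ := hx.data ha hσ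
    obtain ⟨ρ, c', -, hc', -, hcn, -⟩ := XComplex.sqrt_sound h4 hf l3
    obtain rfl := hc.unique hc'
    have h10 := hB a f ha hf
    have h11 : √‖f‖ ≤ B := by rw [Real.sqrt_le_left hB0]; exact h10
    linarith

/-! ### Translation lengths -/

theorem norm_add_le_of_aligned {A h m B a n F k V : ℝ} (hA : 0 ≤ A) (hh : 0 ≤ h) (ha : 0 < a)
    (hF : 0 ≤ F) (hk : 0.525 ≤ k) (hk1 : k ≤ 1 + 1e-9)
    (h1 : (k - 1e-6) * a - n ≤ h * m) (h2 : 2 * A * h + h ^ 2 - 1e-6 * a ≤ h * m)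
    (h3 : m ≤ 2 * A + h) (h4 : m - A ≤ B) (h5 : F - n ≤ A ^ 2) (h6 : A ^ 2 ≤ F + n)
    (h7 : B ^ 2 ≤ |1 - k| * F + k + 1e-6 * a) (h8 : V ≤ (|1 - k| + 1e-6) * a)
    (h9 : n ≤ 1e-15 * (A ^ 2 + 1)) (h11 : F ≤ 1 + a) : B ^ 2 + V ≤ 1.0047 := by
  have hkk : |1 - k| ≤ 1 - k + 2e-9 := by
    rw [abs_le]; constructor <;> linarith
  have hk0 := abs_nonneg (1 - k)
  have hn1 : n ≤ 1e-14 * (1 + a) := by linarith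
  have hk2 : |1 - k| ≤ 0.5 := by linarith
  generalize |1 - k| = κ at *
  rcases lt_or_ge (0.1 * a) n with hc | hc
  · have ha1 : a ≤ 1e-12 := by linarith
    have e1 : κ * F ≤ κ * (1 + 1e-12) := by gcongr; linarith
    have e2 : κ * a ≤ κ * 1e-12 := by gcongr
    linarith
  have hd0 : 0 ≤ 2 * A + h - m := by linarith
  obtain ⟨d, hd⟩ : ∃ d, d = 2 * A + h - m := ⟨_, rfl⟩
  rw [← hd] at hd0
  have hhd' : h * d = 2 * A * h + h ^ 2 - h * m := by rw [hd]; ring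
  have hhd : h * d ≤ 1e-6 * a := by linarith
  have hhd0 : 0 ≤ h * d := by positivity
  have hkm : (0.525 - 1e-6) * a ≤ (k - 1e-6) * a := by gcongr
  have hAh : 0.42 * a ≤ 2 * A * h + h ^ 2 := by linarith
  have hA2 := sq_nonneg A
  have hdA : d * A ≤ 7.2e-6 * A ^ 2 + 1e-6 * a := by
    rcases le_total h A with hle | hle
    · have e1 : h ^ 2 ≤ A * h := by rw [pow_two]; gcongr
      have e2 : 0.14 * a ≤ A * h := by linarith
      have e3 : d * A * (0.14 * a) ≤ 1e-6 * a * A ^ 2 := by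
        calc d * A * (0.14 * a) ≤ d * A * (A * h) := by gcongr
          _ = (h * d) * A ^ 2 := by ring
          _ ≤ _ := by gcongr
      have e4 : d * A * 0.14 ≤ 1e-6 * A ^ 2 := by
        refine le_of_mul_le_mul_right ?_ ha
        linarith
      linarith
    · have : d * A ≤ d * h := by gcongr
      linarith
  have hB2 : (A + h) ^ 2 - 2 * (d * A + h * d) ≤ B ^ 2 := by
    rcases le_total 0 (A + h - d) with h0 | h0
    · have : (A + h - d) ^ 2 ≤ B ^ 2 := by gcongr; linarith
      linarith [sq_nonneg d]
    · have := mul_nonneg (add_nonneg hA hh) (sub_nonneg.2 h0)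
      linarith [sq_nonneg B, mul_nonneg hd0 (add_nonneg hA hh)]
  have hkF : κ * F ≤ (1 - k + 2e-9) * F := by gcongr
  have e1 : k * (F + a - 1) ≤ 3e-5 * (1 + a) := by linarith
  have e2 : F + a - 1 ≤ 6e-5 * (1 + a) := by
    by_contra hc'
    push Not at hc'
    have := mul_le_mul hk hc'.le (by positivity) (by linarith)
    linarith
  have e3 : a ≤ 1.0002 := by linarith
  have e5 : κ * (F + a) ≤ κ * 1.00013 := by gcongr; linarith
  linarith

theorem norm_sq_add_norm_le_of_aligned {g θ ν f v τ : ℂ} {s : ℝ} (hτ : τ = g + θ)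
    (hf : f = g ^ 2 - 1 + ν) (hf0 : f ≠ 0) (hv : v = τ ^ 2 - 1)
    (hs : 2 * ‖g‖ * ‖θ‖ + ‖θ‖ ^ 2 + ‖ν‖ ≤ s) (hk : 0.525 * ‖f‖ ≤ s) (hk1 : s ≤ (1 + 1e-9) * ‖f‖)
    (hb : ‖v - f + (s / ‖f‖ : ℝ) * f‖ ≤ 1e-6 * ‖f‖) (hν : ‖ν‖ ≤ 1e-15 * (‖g‖ ^ 2 + 1)) :
    ‖τ ^ 2‖ + ‖v‖ ≤ 1.0047 := by
  have ha : 0 < ‖f‖ := norm_pos_iff.2 hf0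
  obtain ⟨k, rfl⟩ : ∃ k, s = k * ‖f‖ := ⟨s / ‖f‖, by field_simp⟩
  rw [mul_div_cancel_right₀ _ ha.ne'] at hb
  have hk0 : 0.525 ≤ k := le_of_mul_le_mul_right hk ha
  have hk1' : k ≤ 1 + 1e-9 := le_of_mul_le_mul_right hk1 ha
  have ek : ‖(k : ℂ)‖ = k := by rw [Complex.norm_real, Real.norm_of_nonneg (by linarith)]
  have ek1 : ‖(1 - k : ℂ)‖ = |1 - k| := by
    rw [← Complex.ofReal_one, ← Complex.ofReal_sub, Complex.norm_real, Real.norm_eq_abs]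
  have e1 : ‖v - f‖ ≤ ‖θ‖ * ‖2 * g + θ‖ + ‖ν‖ := by
    rw [← norm_mul, show v - f = θ * (2 * g + θ) - ν by rw [hv, hτ, hf]; ring]
    exact norm_sub_le _ _
  have e2 : k * ‖f‖ - 1e-6 * ‖f‖ ≤ ‖v - f‖ := by
    have := norm_sub_le (v - f + k * f) (v - f)
    rw [add_sub_cancel_left, norm_mul, ek] at this
    linarith
  rw [norm_pow]
  refine norm_add_le_of_aligned (A := ‖g‖) (h := ‖θ‖) (m := ‖2 * g + θ‖) (n := ‖ν‖) (F := ‖1 + f‖)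
    (norm_nonneg _) (norm_nonneg _) ha (norm_nonneg _) hk0 hk1' (by linarith) (by linarith) ?_ ?_ ?_
    ?_ ?_ ?_ hν ?_
  · refine (norm_add_le _ _).trans (by rw [norm_mul]; norm_num)
  · have := norm_sub_le (2 * g + θ) g
    have h2 := norm_add_le τ g
    rw [show 2 * g + θ = τ + g by rw [hτ]; ring] at *
    linarith
  · rw [← norm_pow]
    have := norm_add_le (g ^ 2) ν
    rw [show g ^ 2 + ν = 1 + f by rw [hf]; ring] at this
    linarith
  · rw [← norm_pow, show g ^ 2 = 1 + f - ν by rw [hf]; ring]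
    exact norm_sub_le _ _
  · rw [← norm_pow, show τ ^ 2 = (1 - k) * (1 + f) + k + (v - f + k * f) by rw [hv]; ring]
    refine norm_add₃_le.trans ?_
    rw [norm_mul, ek, ek1]
    linarith
  · rw [show v = (1 - k) * f + (v - f + k * f) by ring]
    refine (norm_add_le _ _).trans ?_
    rw [norm_mul, ek1]
    linarith
  · simpa using norm_add_le 1 f

/-- If the square root in the computation of a length leaves its range of validity, then the
length is small. -/
theorem norm_sq_add_norm_le_of_length {q t : ACJ} {τ : ℂ} (ht : Rep M z t τ) (hq : t.mul M t = some q)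
    (hx : q.subD M (const 1) = some x) {f : ℂ} {σ e : ℝ} (hf : IsC x.f f) (hσ : x.size = .fin σ)
    (he : x.e = .fin e) (hf0 : f ≠ 0) (hk : 0.525 * ‖f‖ ≤ σ + e) (hk1 : σ + e ≤ (1 + 1e-9) * ‖f‖)
    (hb : ‖τ ^ 2 - 1 - f + ((σ + e) / ‖f‖ : ℝ) * f‖ ≤ 1e-6 * ‖f‖) :
    ‖τ ^ 2‖ + ‖τ ^ 2 - 1‖ ≤ 1.0047 := by
  have hu := ur_pos
  simp only [ACJ.subD, bind_iff] at hx
  obtain ⟨s, h1, e', h2, h3⟩ := hx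
  obtain ⟨_, h4, rfl⟩ := build_eq_some h3
  simp only at hf hσ he
  subst e'
  have hqr := ht.mul ht hq
  obtain ⟨eq, es, h5, h6, n1, n2, n3, -⟩ := guard_fin hqr.nonneg (XComplex.addD_nonneg (t := const (-1)) h1) h2
  have n3 : eq + es ≤ e := n3
  obtain ⟨a, _, τ', _, g, g0, g1, g2, _, _, _, _, c, c0, c1, c2, ha, hb', hτ, hτ', a0, -, τ0, -,
    hg, hg0, hg1, hg2, i, i0, i1, i2, hc, hc0, hc1, hc2, m1, -, m3, -, m4, m5⟩ := ht.mul_data ht hq h5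
  obtain rfl := hg.unique i
  obtain rfl := hg0.unique i0
  obtain rfl := hg1.unique i1
  obtain rfl := hg2.unique i2
  rw [ha] at hb'; cases hb'
  rw [hτ] at hτ'; cases hτ'
  have hsz := size_ub h3 hc0 hc1 hc2
  rw [show (ACJ.mk s.z q.f0 q.f1 q.f2 (.fin e) _).size = .fin σ from hσ] at hsz
  have hsz : ‖c0‖ + (‖c1‖ + ‖c2‖) ≤ σ := hsz
  obtain ⟨f', hf', k1, k2⟩ := XComplex.addD_sound (s := -1) h1 hc h6
  rw [Complex.ofReal_neg, ← sub_eq_add_neg] at k1 k2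
  obtain rfl := hf.unique hf'
  have j0 := norm_sub_norm_le (g * g0 + g0 * g) (g * g0 + g0 * g - c0)
  have j1 := norm_sub_norm_le (g * g1 + g1 * g) (g * g1 + g1 * g - c1)
  have j2 := norm_sub_norm_le (g * g2 + g2 * g) (g * g2 + g2 * g - c2)
  have dbl : ∀ b : ℂ, ‖g * b + b * g‖ = 2 * ‖g‖ * ‖b‖ := fun b => by
    rw [show g * b + b * g = 2 * (g * b) by ring, norm_mul, norm_mul, Complex.norm_two]; ring
  rw [sub_sub_cancel, dbl] at j0 j1 j2
  have hθ := norm_sub_centre_le ht.hz m3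
  have hν : ‖f - (g ^ 2 - 1)‖ ≤ ‖g * g - c‖ + ‖c - (1 : ℝ) - f‖ := by
    rw [← norm_neg, show -(f - (g ^ 2 - 1)) = (g * g - c) + (c - (1 : ℝ) - f) by push_cast; ring]
    exact norm_add_le _ _
  refine norm_sq_add_norm_le_of_aligned (g := g) (θ := τ - g) (ν := f - (g ^ 2 - 1)) (by ring) (by ring)
    hf0 rfl ?_ hk hk1 hb ?_
  · have h7 : 2 * ‖g‖ * ‖τ - g‖ ≤ 2 * ‖g‖ * (‖g0‖ + (‖g1‖ + ‖g2‖) + a) := by gcongr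
    have h8 : ‖τ - g‖ ^ 2 ≤ (τ' + a) * (τ' + a) := by
      rw [pow_two]; gcongr <;> linarith
    linarith
  · have h7 : ‖c - (1 : ℝ)‖ ≤ ‖g‖ ^ 2 + 5 * ur * (‖g‖ * ‖g‖) + 1 := by
      have h8 := norm_sub_le (g ^ 2) (g * g - c)
      have h9 := norm_sub_le c ((1 : ℝ) : ℂ)
      rw [show g ^ 2 - (g * g - c) = c by ring, norm_pow] at h8
      simp only [Complex.ofReal_one, norm_one] at h9 ⊢
      linarith
    have h10 : ur * ‖c - (1 : ℝ)‖ ≤ ur * (‖g‖ ^ 2 + 5 * ur * (‖g‖ * ‖g‖) + 1) := by gcongr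
    have h11 : 0 ≤ ‖g‖ ^ 2 := by positivity
    have h12 : ur ≤ 1.2e-16 := by norm_num [ur_eq]
    have h13 : 6 * ur + 5 * ur ^ 2 ≤ 1e-15 := by norm_num [ur_eq]
    have h14 := mul_le_mul_of_nonneg_right h13 h11
    linarith

theorem length_eq_some {A : SL2ACJ} {l : ACJ} (h : A.length M = some l) : ∃ b t q x r r1,
    A.a.add M A.d = some b ∧ b.mulD M (const (1 / 2)) = some t ∧ t.mul M t = some q ∧
    q.subD M (const 1) = some x ∧ x.sqrt M = some r ∧
    (t.add M r = some r1 ∨ t.sub M r = some r1) ∧ r1.mul M r1 = some l := by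
  simp only [SL2ACJ.length, bind_iff] at h
  obtain ⟨b, h1, t, h2, q, h3, x, h4, r, h5, r1, h6, p, h7, h⟩ := h
  split at h <;> simp only [bind_iff] at h
  · obtain ⟨r2, h8, r3, h9, h10⟩ := h
    cases h8.symm.trans h9
    exact ⟨b, t, q, x, r, r2, h1, h2, h3, h4, h5, Or.inl h8, h10⟩
  · obtain ⟨r2, h8, r3, h9, h10⟩ := h
    cases h8.symm.trans h9
    exact ⟨b, t, q, x, r, r2, h1, h2, h3, h4, h5, Or.inr h8, h10⟩

theorem rep_length {A : SL2ACJ} {l : ACJ} {α δ τ : ℂ} (ha : Rep M z A.a α) (hd : Rep M z A.d δ)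
    (hτ : 2 * τ = α + δ) (h : A.length M = some l) :
    (∃ y, y ^ 2 - 2 * τ * y + 1 = 0 ∧ Rep M z l (y ^ 2)) ∨
    (∃ ℓ, Rep M z l ℓ ∧ 2 ^ 200 ≤ ‖ℓ‖) ∨ ‖τ ^ 2‖ + ‖τ ^ 2 - 1‖ ≤ 1.0047 := by
  obtain ⟨b, t, q, x, r, r1, h1, h2, h3, h4, h5, h6, h7⟩ := length_eq_some h
  have ht : Rep M z t τ := by
    convert (ha.add hd h1).mulD h2 using 1
    rw [← hτ]; push_cast; ring
  have hx : Rep M z x (τ ^ 2 - 1) := by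
    convert (ht.mul ht h3).subD h4 using 1
    push_cast; ring
  have key : ∀ w, Rep M z r w → Rep M z l ((τ + w) ^ 2) ∨ Rep M z l ((τ - w) ^ 2) := fun w hw => by
    simp only [pow_two]
    rcases h6 with h6 | h6
    · exact Or.inl (((ht.add hw h6).mul (ht.add hw h6)) h7)
    · exact Or.inr (((ht.sub hw h6).mul (ht.sub hw h6)) h7)
  rcases hx.sqrt h5 with ⟨w, hw, hr⟩ | ⟨f, σ, e, hf, hσ, he, hf0, hk, hk1, hb⟩ | ⟨-, hl⟩
  · left
    rcases key w hr with hl | hl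
    · exact ⟨_, by linear_combination hw, hl⟩
    · exact ⟨_, by linear_combination hw, hl⟩
  · exact Or.inr (Or.inr (norm_sq_add_norm_le_of_length ht h3 h4 hf hσ he hf0 hk hk1 hb))
  · right; left
    obtain ⟨w, hr, g1, g2⟩ := hl τ
    have hp : ∀ c : ℂ, 2 ^ 100 ≤ ‖c‖ → 2 ^ 200 ≤ ‖c ^ 2‖ := fun c hc => by
      rw [norm_pow, show (2 : ℝ) ^ 200 = (2 ^ 100) ^ 2 by rw [← pow_mul]]
      gcongr
    rcases key w hr with hl | hl
    · exact ⟨_, hl, hp _ g1⟩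
    · exact ⟨_, hl, hp _ g2⟩

theorem Rep.centre (hx : Rep M z x v) {f : ℂ} (hf : IsC x.f f) : Rep M 0 x f := by
  refine ⟨by simp, hx.built, hx.nonneg, fun e he k0 k1 k2 => ?_⟩
  obtain ⟨f', f0, f1, f2, hf', h0, h1, h2, -⟩ := hx.val e he k0 k1 k2
  obtain rfl := hf.unique hf'
  have := hx.nonneg
  rw [he, ub_fin] at this
  exact ⟨f, f0, f1, f2, hf, h0, h1, h2, by simpa using this⟩

theorem CentreLE.mono {B C : ℝ} (h : CentreLE x B) (hBC : B ≤ C) : CentreLE x C :=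
  fun e g he hg => (h e g he hg).trans hBC

theorem UBo.lt {a : FP} {s B : ℝ} (ha : UBo a s) (h : (a <ᶠ some (const B)) = some true) :
    ∃ t, a = some (.fin t) ∧ s ≤ t ∧ t < B := by
  obtain ⟨d, _, hd, ⟨⟩, hlt⟩ := flt_eq_some h
  rcases (ha d hd).cases with (rfl | rfl) | ⟨t, rfl, ht⟩
  · cases hlt
  · cases hlt
  · exact ⟨t, hd, ht, by simpa [Dbl.lt] using hlt⟩

theorem ACJ.fin_of_absUB {t : ℝ} (h : x.absUB M = some (.fin t)) : ∃ e, x.e = .fin e := by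
  obtain ⟨_, _, -, h, -⟩ := fmul_fin h
  obtain ⟨_, _, -, h, -⟩ := fadd_fin h
  obtain ⟨_, e, -, h, -⟩ := fadd_fin h
  exact ⟨e, by simpa using h⟩

theorem Rep.absLB_fin (hx : Rep M z x v) (hc : CentreLE x (2 ^ 43)) {d : Dbl}
    (hd : x.absLB M = some d) : ∃ a, d = .fin a ∧ 0 ≤ a ∧ a ≤ ‖v‖ := by
  rcases hx.absLB hd with h | ⟨-, -, e', c', h8, h9, h10⟩
  · exact h
  · have h11 := hc e' c' h8 h9
    have h12 : (1 : ℝ) / 2 ≤ 1 - ur := by norm_num [ur_eq]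
    have h13 : (2 : ℝ) ^ 1024 * (1 / 2) ≤ 2 ^ 1024 * (1 - ur) := by gcongr
    have h14 : (2 : ℝ) ^ 44 * 2 ≤ 2 ^ 1024 := by
      rw [← pow_succ]; exact pow_le_pow_right₀ (by norm_num) (by norm_num)
    generalize (2 : ℝ) ^ 1024 = K at *
    norm_num at h11 h14
    linarith

theorem lt_norm_of_absLB {B : ℝ} (hx : Rep M z x v) (hc : CentreLE x (2 ^ 43))
    (h : (some (const B) <ᶠ x.absLB M) = some true) : B < ‖v‖ := by
  obtain ⟨_, d, ⟨⟩, hd, hlt⟩ := flt_eq_some h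
  obtain ⟨a, rfl, -, h7⟩ := hx.absLB_fin hc hd
  exact (show B < a by simpa [Dbl.lt] using hlt).trans_le h7

theorem norm_lt_of_lengthTest {l along : ACJ} {ℓ x0 : ℂ} (hl : Rep M z l ℓ) (hx : Rep M z along x0)
    (hc : CentreLE along (2 ^ 20)) (h : lengthTest M l along = some true) :
    ‖ℓ / x0‖ < 1 ∧ 1 < ‖ℓ * x0‖ := by
  simp only [lengthTest, bind_iff] at h
  obtain ⟨q, h1, p, h2, h⟩ := h
  split at h
  case isFalse => simp at h
  case isTrue hp =>
  subst hp
  have hq := hl.div hx hc h1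
  obtain ⟨t, h3, h4, h5⟩ := hq.absUB.lt h2
  obtain ⟨m, h6, h⟩ := bind_iff.1 h
  refine ⟨h4.trans_lt h5, ?_⟩
  obtain ⟨e, he⟩ := ACJ.fin_of_absUB h3
  obtain ⟨a, b, f, g, c, ha, hb, hf, hg, hcq, hg0, hfg⟩ := hl.div_centre hx hc h1 he
  have hc1 : ‖c‖ ≤ t := ((hq.centre hcq).absUB _ h3)
  have hgn : 0 < ‖g‖ := norm_pos_iff.2 hg0
  have hl1 : CentreLE l (2 ^ 21) := by
    intro _ f' _ hf'
    obtain rfl := hf.unique hf'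
    have h7 := norm_sub_norm_le (f / g) (f / g - c)
    rw [sub_sub_cancel, norm_div] at h7
    have h8 : ‖f‖ / ‖g‖ ≤ 2 := by linarith
    rw [div_le_iff₀ hgn] at h8
    have h9 := hc b g hb hg
    norm_num at h9 ⊢
    linarith
  exact lt_norm_of_absLB (hl.mul hx h6)
    ((CentreLE.mul hl hx h6 hl1 hc).mono (by norm_num)) h

/-! ### Lengths -/

theorem Complex.sqrt_sq (a : ℂ) : Complex.sqrt a ^ 2 = a := by
  rw [Complex.sqrt, ← Complex.cpow_nat_mul]
  simp

theorem norm_expArcosh {u y : ℂ} (hy : y ^ 2 - 2 * u * y + 1 = 0) :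
    ‖expArcosh u‖ = max ‖y‖ ‖y‖⁻¹ := by
  have hs := Complex.sqrt_sq (u ^ 2 - 1)
  rw [expArcosh]
  generalize Complex.sqrt (u ^ 2 - 1) = s at *
  have hp : ‖u + s‖ * ‖u - s‖ = 1 := by
    rw [← norm_mul, show (u + s) * (u - s) = 1 by linear_combination -hs, norm_one]
  have h0 : 0 < ‖u + s‖ := by
    rcases (norm_nonneg (u + s)).eq_or_lt with h | h
    · rw [← h, zero_mul] at hp; cases zero_ne_one hp
    · exact h
  have h1 : ‖u - s‖ = ‖u + s‖⁻¹ := eq_inv_of_mul_eq_one_right hp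
  have h2 : max ‖y‖ ‖y‖⁻¹ = max ‖u + s‖ ‖u + s‖⁻¹ := by
    have h3 : (y - (u + s)) * (y - (u - s)) = 0 := by linear_combination hy - hs
    rcases mul_eq_zero.1 h3 with h | h <;> rw [sub_eq_zero.1 h]
    rw [h1, inv_inv, max_comm]
  rw [h2]
  split_ifs with h
  · rw [max_eq_left]
    exact (inv_le_one_of_one_le₀ h).trans h
  · rw [h1, max_eq_right]
    push Not at h
    exact h.le.trans ((one_le_inv₀ h0).2 h.le)

theorem norm_lengthSL {A : SL2C} {y : ℂ} (hy : y ^ 2 - A.1.trace * y + 1 = 0) :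
    ‖lengthSL A‖ = max (‖y‖ ^ 2) (‖y‖ ^ 2)⁻¹ := by
  rw [lengthSL, norm_expArcosh (y := y ^ 2), norm_pow]
  linear_combination (y ^ 2 + A.1.trace * y + 1) * hy

theorem exists_eigenvalue (t : ℂ) : ∃ y : ℂ, y ^ 2 - t * y + 1 = 0 ∧ y ≠ 0 := by
  obtain ⟨s, hs⟩ : ∃ s : ℂ, s ^ 2 = t ^ 2 / 4 - 1 := IsAlgClosed.exists_pow_nat_eq _ (by norm_num)
  have h : (t / 2 + s) ^ 2 - t * (t / 2 + s) + 1 = 0 := by linear_combination hs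
  exact ⟨_, h, fun h0 => by rw [h0] at h; norm_num at h⟩

theorem norm_tlength_mk (A : SL2C) : tlength (QuotientGroup.mk A) = lengthSL A := rfl

theorem lengthSL_lt_of_norm_le {A : SL2C} {τ : ℂ} (hτ : A.1.trace = 2 * τ)
    (h : ‖τ ^ 2‖ + ‖τ ^ 2 - 1‖ ≤ 1.0047) : ‖lengthSL A‖ < 1.10274 := by
  obtain ⟨y, hy, hy0⟩ := exists_eigenvalue A.1.trace
  rw [norm_lengthSL hy]
  have h1 : τ = (y + y⁻¹) / 2 := by
    field_simp; linear_combination -hy - y * hτ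
  have h2 : τ ^ 2 - 1 = ((y - y⁻¹) / 2) ^ 2 := by rw [h1]; field_simp; ring
  have h3 := parallelogram_law_with_norm ℝ y y⁻¹
  rw [h2, h1, norm_pow, norm_pow, norm_div, norm_div] at h
  rw [norm_inv] at h3
  have h0 : 0 < ‖y‖ := norm_pos_iff.2 hy0
  have h4 : ‖y‖ ^ 2 + (‖y‖ ^ 2)⁻¹ ≤ 2.0094 := by
    rw [← inv_pow]
    simp only [Complex.norm_ofNat] at h
    linarith
  have hq : 0 < ‖y‖ ^ 2 := by positivity
  generalize ‖y‖ ^ 2 = q at *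
  have key : ∀ a : ℝ, 0 < a → a + a⁻¹ ≤ 2.0094 → a < 1.10274 := fun a ha h => by
    by_contra hc
    push Not at hc
    have : a⁻¹ * a = 1 := inv_mul_cancel₀ ha.ne'
    nlinarith
  exact max_lt (key q hq h4) (key q⁻¹ (inv_pos.2 hq) (by rw [inv_inv]; linarith))

/-! ### Matrices -/

/-- The entries of the jet matrix `X` represent the entries of `A`. -/
structure RepM (M : Machine) (z : Fin 3 → ℂ) (X : SL2ACJ) (A : SL2C) : Prop where
  a : Rep M z X.a (A 0 0)
  b : Rep M z X.b (A 0 1)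
  c : Rep M z X.c (A 1 0)
  d : Rep M z X.d (A 1 1)

variable {X Y R : SL2ACJ} {A B : SL2C}

theorem RepM.mul (hX : RepM M z X A) (hY : RepM M z Y B) (h : X.mul M Y = some R) :
    RepM M z R (A * B) := by
  simp only [SL2ACJ.mul, bind_iff, pure_iff] at h
  obtain ⟨p1, h1, p2, h2, a, h3, p4, h4, p5, h5, b, h6, p7, h7, p8, h8, c, h9, p10, h10, p11, h11, d,
    h12, rfl⟩ := h
  have e : ∀ i j, (A * B : SL2C) i j = A i 0 * B 0 j + A i 1 * B 1 j := fun i j => by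
    simp [Matrix.SpecialLinearGroup.coe_mul, Matrix.mul_apply, Fin.sum_univ_two]
  constructor <;> rw [e]
  · exact (hX.a.mul hY.a h1).add (hX.b.mul hY.c h2) h3
  · exact (hX.a.mul hY.b h4).add (hX.b.mul hY.d h5) h6
  · exact (hX.c.mul hY.a h7).add (hX.d.mul hY.c h8) h9
  · exact (hX.c.mul hY.b h10).add (hX.d.mul hY.d h11) h12

theorem RepM.inverse (hX : RepM M z X A) (h : X.inverse M = some R) : RepM M z R A⁻¹ := by
  simp only [SL2ACJ.inverse, bind_iff, pure_iff] at h
  obtain ⟨b, h1, c, h2, rfl⟩ := h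
  have e : A⁻¹.1 = !![A 1 1, -A 0 1; -A 1 0, A 0 0] := by
    rw [Matrix.SpecialLinearGroup.SL2_inv_expl]; rfl
  have e' : ∀ i j, A⁻¹ i j = !![A 1 1, -A 0 1; -A 1 0, A 0 0] i j := fun i j => by rw [← e]
  constructor <;> rw [e']
  · exact hX.d
  · exact hX.b.neg h1
  · exact hX.c.neg h2
  · exact hX.a

theorem Rep.ne_zero_of_absLB (hx : Rep M z x v) (h : (some (const 0) <ᶠ x.absLB M) = some true) :
    v ≠ 0 := by
  obtain ⟨_, d, ⟨⟩, hd, hlt⟩ := flt_eq_some h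
  rcases hx.absLB hd with ⟨a, rfl, -, h7⟩ | ⟨-, h8, -⟩
  · rw [← norm_pos_iff]
    exact (show (0 : ℝ) < a by simpa [Dbl.lt] using hlt).trans_le h7
  · exact h8

theorem exists_smul_of_mk_eq {A B : SL2C} (h : (QuotientGroup.mk A : PSL2C) = QuotientGroup.mk B) :
    ∃ r : ℂ, r ^ 2 = 1 ∧ ∀ i j, B i j = r * A i j := by
  obtain ⟨r, hr, h, -⟩ := exists_sign (QuotientGroup.leftRel_apply.2 (QuotientGroup.eq.1 h))
  exact ⟨r, hr, fun i j => by
    rw [h]; rfl⟩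

theorem mk_eq_of_smul {A B : SL2C} {r : ℂ} (hr : r ^ 2 = 1) (h : ∀ i j, B i j = r * A i j) :
    (QuotientGroup.mk A : PSL2C) = QuotientGroup.mk B := by
  rw [QuotientGroup.eq, Matrix.SpecialLinearGroup.mem_center_iff]
  refine ⟨r, by simpa using hr, ?_⟩
  have hB : B.1 = r • A.1 := by ext i j; exact h i j
  rw [Matrix.SpecialLinearGroup.coe_mul, hB, Matrix.mul_smul, ← Matrix.SpecialLinearGroup.coe_mul,
    inv_mul_cancel, Matrix.scalar_apply, ← Matrix.smul_one_eq_diagonal]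
  rfl

theorem mk_ne_one_of_notIdentity (hX : RepM M z X A) (h : X.notIdentity M = some true) :
    (QuotientGroup.mk A : PSL2C) ≠ 1 := by
  intro h1
  obtain ⟨r, hr, h1⟩ := exists_smul_of_mk_eq (A := 1) (B := A) (by rw [h1]; rfl)
  have e00 : A 0 0 = r := by simp [h1]
  have e11 : A 1 1 = r := by simp [h1]
  have e01 : A 0 1 = 0 := by simp [h1]
  have e10 : A 1 0 = 0 := by simp [h1]
  have hr' : r - (1 : ℝ) = 0 ∨ r + (1 : ℝ) = 0 := by
    rw [← mul_eq_zero]; push_cast; linear_combination hr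
  unfold SL2ACJ.notIdentity at h
  obtain ⟨p, hp, h⟩ := bind_iff.1 h
  cases p
  case true => exact hX.b.ne_zero_of_absLB hp e01
  simp only [Bool.false_eq_true, if_false] at h
  obtain ⟨p, hp, h⟩ := bind_iff.1 h
  cases p
  case true => exact hX.c.ne_zero_of_absLB hp e10
  simp only [Bool.false_eq_true, if_false] at h
  have key : ∀ {x s t : ACJ}, Rep M z x r → x.subD M (const 1) = some s → x.addD M (const 1) = some t →
      (some (const 0) <ᶠ s.absLB M) = some true → (some (const 0) <ᶠ t.absLB M) = some true → False :=
    fun hx hs ht h1 h2 => hr'.elim ((hx.subD hs).ne_zero_of_absLB h1) ((hx.addD ht).ne_zero_of_absLB h2)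
  have ha := hX.a
  have hd := hX.d
  rw [e00] at ha
  rw [e11] at hd
  have hlast : ∀ {k : Option Bool}, (X.d.subD M (const 1) >>= fun s => (some (const 0) <ᶠ s.absLB M) >>=
      fun p => if p = true then (X.d.addD M (const 1) >>= fun s => (some (const 0) <ᶠ s.absLB M) >>=
        fun p => if p = true then pure true else pure false) else pure false) = some true → False := by
    intro _ h
    obtain ⟨s, hs, h⟩ := bind_iff.1 h
    obtain ⟨p, hp, h⟩ := bind_iff.1 h
    cases p
    · simp at h
    · simp only [if_true] at h
      obtain ⟨t, ht, h⟩ := bind_iff.1 h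
      obtain ⟨p, hp', h⟩ := bind_iff.1 h
      cases p
      · simp at h
      · exact key hd hs ht hp hp'
  obtain ⟨s, hs, h⟩ := bind_iff.1 h
  obtain ⟨p, hp, h⟩ := bind_iff.1 h
  cases p
  · simp only [Bool.false_eq_true, if_false] at h
    exact hlast h (k := none)
  · simp only [if_true] at h
    obtain ⟨t, ht, h⟩ := bind_iff.1 h
    obtain ⟨p, hp', h⟩ := bind_iff.1 h
    cases p
    · simp only [Bool.false_eq_true, if_false] at h
      exact hlast h (k := none)
    · exact key ha hs ht hp hp'

theorem norm_tlength_lt {l along : ACJ} {x0 : ℂ} (hX : RepM M z X A) (hl : X.length M = some l)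
    (hx : Rep M z along x0) (hc : CentreLE along (2 ^ 20)) (h0 : 1.10274 ≤ ‖x0‖)
    (h1 : ‖x0‖ ≤ 4) (h : lengthTest M l along = some true) : ‖lengthSL A‖ < ‖x0‖ := by
  have ht : A.1.trace = A 0 0 + A 1 1 := Matrix.trace_fin_two _
  have hpos : 0 < ‖x0‖ := by linarith
  have key : ∀ ℓ, Rep M z l ℓ → ‖ℓ‖ < ‖x0‖ ∧ ‖ℓ‖⁻¹ < ‖x0‖ := fun ℓ hℓ => by
    obtain ⟨h1, h2⟩ := norm_lt_of_lengthTest hℓ hx hc h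
    rw [norm_div, div_lt_one hpos] at h1
    rw [norm_mul] at h2
    have h3 : 0 < ‖ℓ‖ := by
      by_contra h3
      have : ‖ℓ‖ = 0 := le_antisymm (not_lt.1 h3) (norm_nonneg _)
      rw [this, zero_mul] at h2
      linarith
    exact ⟨h1, by rw [inv_lt_iff_one_lt_mul₀' h3]; exact h2⟩
  rcases rep_length hX.a hX.d (τ := A.1.trace / 2) (by rw [ht]; ring) hl with ⟨y, hy, hr⟩ |
    ⟨ℓ, hr, hℓ⟩ | hb
  · obtain ⟨h1, h2⟩ := key _ hr
    rw [norm_pow] at h1 h2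
    rw [norm_lengthSL (y := y) (by linear_combination hy)]
    exact max_lt h1 h2
  · have h2 : (4 : ℝ) ≤ 2 ^ 200 := by norm_num
    linarith [(key ℓ hr).1]
  · exact (lengthSL_lt_of_norm_le (by ring) hb).trans_le h0

variable {X Y R : SL2ACJ} {A B : SL2C}

/-! ### The generators -/

/-- The computed square root of the jet `x` at the value `v` is a square root of `v`. -/
def HasSqrt (M : Machine) (z : Fin 3 → ℂ) (x : ACJ) (v : ℂ) : Prop :=
  ∀ r, x.sqrt M = some r → ∃ w, w ^ 2 = v ∧ Rep M z r w

/-- The diagonal matrices. -/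
def diagHom : ℂˣ →* SL2C where
  toFun t := ⟨!![(t : ℂ), 0; 0, ((t⁻¹ : ℂˣ) : ℂ)], by simp [Matrix.det_fin_two_of]⟩
  map_one' := by
    ext i j; fin_cases i <;> fin_cases j <;> simp
  map_mul' s t := by
    apply Subtype.ext
    change !![((s * t : ℂˣ) : ℂ), 0; 0, (((s * t)⁻¹ : ℂˣ) : ℂ)] =
      !![(s : ℂ), 0; 0, ((s⁻¹ : ℂˣ) : ℂ)] * !![(t : ℂ), 0; 0, ((t⁻¹ : ℂˣ) : ℂ)]
    ext i j; fin_cases i <;> fin_cases j <;> simp [mul_comm]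

theorem diagHom_apply (t : ℂˣ) (i j : Fin 2) :
    diagHom t i j = !![(t : ℂ), 0; 0, ((t⁻¹ : ℂˣ) : ℂ)] i j := rfl

theorem exists_sign_of_sq_eq {a b : ℂ} (h : a ^ 2 = b ^ 2) : ∃ r : ℂ, r ^ 2 = 1 ∧ a = r * b := by
  rcases sq_eq_sq_iff_eq_or_eq_neg.1 h with h | h
  · exact ⟨1, by norm_num, by rw [h, one_mul]⟩
  · exact ⟨-1, by norm_num, by rw [h, neg_one_mul]⟩

theorem inv_of_sq_eq_one {r : ℂ} (h : r ^ 2 = 1) : r⁻¹ = r := by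
  rw [inv_eq_of_mul_eq_one_left]
  rw [← pow_two, h]

theorem mk_diagHom {t : ℂˣ} {x0 : ℂ} (h : (t : ℂ) ^ 2 = x0) :
    (QuotientGroup.mk (diagHom t) : PSL2C) = shortGen x0 := by
  have h0 : x0 ≠ 0 := by rw [← h]; exact pow_ne_zero _ t.ne_zero
  rw [shortGen, dif_neg h0]
  obtain ⟨r, hr, h1⟩ := exists_sign_of_sq_eq ((Complex.sqrt_sq x0).trans h.symm)
  refine mk_eq_of_smul hr fun i j => ?_
  fin_cases i <;> fin_cases j <;> simp [diagHom_apply, h1, inv_of_sq_eq_one hr, mul_comm]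

theorem norm_tlength_shortGen {x0 : ℂ} (h : 1 ≤ ‖x0‖) : ‖tlength (shortGen x0)‖ = ‖x0‖ := by
  have h0 : x0 ≠ 0 := by rintro rfl; simp at h; linarith
  have h1 := Complex.sqrt_sq x0
  have hs : Complex.sqrt x0 ≠ 0 := by intro h2; rw [h2] at h1; simp at h1; exact h0 h1.symm
  rw [← mk_diagHom (t := Units.mk0 _ hs) h1, norm_tlength_mk, norm_lengthSL (y := Complex.sqrt x0),
    ← norm_pow, h1, max_eq_left ((inv_le_one_of_one_le₀ h).trans h)]
  rw [Matrix.trace_fin_two]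
  simp [diagHom_apply]
  field_simp
  ring

theorem repM_shortGenerator {x0 : ℂ} (h0 : x0 ≠ 0) (hx : Rep M z x x0) (hs : HasSqrt M z x x0)
    (hc : CentreLE x (4 ^ 2)) (h : shortGenerator M x = some X) :
    ∃ A : SL2C, RepM M z X A ∧ QuotientGroup.mk A = shortGen x0 := by
  simp only [shortGenerator, bind_iff, pure_iff] at h
  obtain ⟨s, h1, o, h2, d, h3, rfl⟩ := h
  obtain ⟨w, hw, hr⟩ := hs s h1
  have hw0 : w ≠ 0 := by rintro rfl; exact h0 (by rw [← hw]; simp)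
  have ho : Rep M z o (0 : ℝ) := rep_ofDbl (by simp [IsNormal]) hx.hz h2
  have hd := hr.divOfD ((CentreLE.sqrt hx h1 hc (by norm_num)).mono (by norm_num)) h3
  refine ⟨diagHom (Units.mk0 w hw0), ⟨hr, ?_, ?_, ?_⟩, mk_diagHom hw⟩
  · simpa [diagHom_apply] using ho
  · simpa [diagHom_apply] using ho
  · simpa [diagHom_apply] using hd

/-- The matrix that defines `closeGen`, with arbitrary square roots. -/
def closeMat (s t : ℂ) (hs : s ≠ 0) (ht : t ≠ 0) : SL2C :=
  ⟨!![(s + 1 / s) / 2 * t, (s - 1 / s) / 2 / t; (s - 1 / s) / 2 * t, (s + 1 / s) / 2 / t], by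
    rw [Matrix.det_fin_two_of]
    field_simp
    ring⟩

theorem mk_closeMat {s t x1 x2 : ℂ} (hs : s ≠ 0) (ht : t ≠ 0) (h1 : s ^ 2 = x1) (h2 : t ^ 2 = x2) :
    (QuotientGroup.mk (closeMat s t hs ht) : PSL2C) = closeGen x1 x2 := by
  have h0 : ¬ (x1 = 0 ∨ x2 = 0) := by
    rw [← h1, ← h2]; simp [hs, ht]
  rw [closeGen, dif_neg h0]
  obtain ⟨r, hr, h3⟩ := exists_sign_of_sq_eq ((Complex.sqrt_sq x1).trans h1.symm)
  obtain ⟨q, hq, h4⟩ := exists_sign_of_sq_eq ((Complex.sqrt_sq x2).trans h2.symm)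
  refine mk_eq_of_smul (r := r * q) (by rw [mul_pow, hr, hq, one_mul]) fun i j => ?_
  have hr' := inv_of_sq_eq_one hr
  have hq' := inv_of_sq_eq_one hq
  fin_cases i <;> fin_cases j <;>
    simp [closeMat, h3, h4, hr', hq', div_eq_mul_inv] <;> ring

theorem repM_closeGenerator {x1 x2 : ℂ} (h1 : x1 ≠ 0) (h2 : x2 ≠ 0) (hx : Rep M z x x1)
    (hy : Rep M z y x2) (hsx : HasSqrt M z x x1) (hsy : HasSqrt M z y x2) (hcx : CentreLE x (4 ^ 2))
    (hcy : CentreLE y (4 ^ 2)) (h : closeGenerator M x y = some X) :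
    ∃ s t : ℂ, ∃ hs ht, RepM M z X (closeMat s t hs ht) ∧ s ^ 2 = x1 ∧ t ^ 2 = x2 := by
  simp only [closeGenerator, bind_iff, pure_iff] at h
  obtain ⟨sx, i1, sz, i2, p, i3, b, i4, sh, i5, p', i6, b', i7, ch, i8, a11, i9, a12, i10, a21, i11, a22,
    i12, rfl⟩ := h
  obtain ⟨s, hs, hrs⟩ := hsx sx i1
  obtain ⟨t, ht, hrt⟩ := hsy sz i2
  have hs0 : s ≠ 0 := by rintro rfl; exact h1 (by rw [← hs]; simp)
  have ht0 : t ≠ 0 := by rintro rfl; exact h2 (by rw [← ht]; simp)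
  have c1 := (CentreLE.sqrt hx i1 hcx (by norm_num)).mono (C := 2 ^ 20) (by norm_num)
  have c2 := (CentreLE.sqrt hy i2 hcy (by norm_num)).mono (C := 2 ^ 20) (by norm_num)
  have hsh : Rep M z sh ((s - 1 / s) / 2) := by
    convert (hrs.sub (hrs.divOfD c1 i3) i4).mulD i5 using 1
    push_cast; ring
  have hch : Rep M z ch ((s + 1 / s) / 2) := by
    convert (hrs.add (hrs.divOfD c1 i6) i7).mulD i8 using 1
    push_cast; ring
  refine ⟨s, t, hs0, ht0, ⟨?_, ?_, ?_, ?_⟩, hs, ht⟩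
  · exact hch.mul hrt i9
  · exact hsh.div hrt c2 i10
  · exact hsh.mul hrt i11
  · exact hch.div hrt c2 i12

/-! ### Words -/

section Words

variable {G H : Type*} [Group G] [Group H]

/-- The value of a word. -/
def wordVal (f w : G) : List ℕ → G
  | [] => 1
  | b :: t =>
    if b = 41 then 1
    else if b = 119 then w * wordVal f w t
    else if b = 87 then w⁻¹ * wordVal f w t
    else if b = 102 then f * wordVal f w t
    else if b = 70 then f⁻¹ * wordVal f w t
    else 1

theorem map_wordVal (φ : G →* H) (f w : G) (l : List ℕ) :
    φ (wordVal f w l) = wordVal (φ f) (φ w) l := by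
  induction l with
  | nil => simp [wordVal]
  | cons b t ih =>
    simp only [wordVal]
    split_ifs <;> simp [ih]

theorem wordVal_mem (f w : G) (l : List ℕ) : wordVal f w l ∈ Subgroup.closure {f, w} := by
  have hf : f ∈ Subgroup.closure {f, w} := Subgroup.subset_closure (by simp)
  have hw : w ∈ Subgroup.closure {f, w} := Subgroup.subset_closure (by simp)
  induction l with
  | nil => exact one_mem _
  | cons b t ih =>
    simp only [wordVal]
    split_ifs
    exacts [one_mem _, mul_mem hw ih, mul_mem (inv_mem hw) ih, mul_mem hf ih, mul_mem (inv_mem hf) ih,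
      one_mem _]

theorem wordVal_of_commuting (f w : G) (l : List ℕ) (hl : wordImpliesCommuting l = true) :
    (l.getD 0 0 = 102 → ∃ a b : ℤ, 0 < a ∧ wordVal f w l = f ^ a * w ^ b) ∧
    (l.getD 0 0 = 70 → ∃ a b : ℤ, a < 0 ∧ wordVal f w l = f ^ a * w ^ b) ∧
    (l.getD 0 0 = 119 → ∃ b : ℤ, 0 < b ∧ wordVal f w l = w ^ b) ∧
    (l.getD 0 0 = 87 → ∃ b : ℤ, b < 0 ∧ wordVal f w l = w ^ b) := by
  induction l with
  | nil => simp [wordImpliesCommuting] at hl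
  | cons a t ih =>
    cases t with
    | nil =>
      obtain rfl : a = 41 := by simpa [wordImpliesCommuting] using hl
      simp
    | cons b t =>
      rw [wordImpliesCommuting] at hl
      by_cases hb : b = 41
      · subst hb
        simp only [List.getD_cons_zero]
        refine ⟨?_, ?_, ?_, ?_⟩ <;> rintro rfl
        · exact ⟨1, 0, by norm_num, by simp [wordVal]⟩
        · exact ⟨-1, 0, by norm_num, by simp [wordVal]⟩
        · exact ⟨1, by norm_num, by simp [wordVal]⟩
        · exact ⟨-1, by norm_num, by simp [wordVal]⟩
      · simp only [List.getD_cons_zero] at ih ⊢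
        have e1 : wordVal f w (102 :: b :: t) = f * wordVal f w (b :: t) := by
          simp [wordVal]
        have e2 : wordVal f w (70 :: b :: t) = f⁻¹ * wordVal f w (b :: t) := by
          simp [wordVal]
        have e3 : wordVal f w (119 :: b :: t) = w * wordVal f w (b :: t) := by
          simp [wordVal]
        have e4 : wordVal f w (87 :: b :: t) = w⁻¹ * wordVal f w (b :: t) := by
          simp [wordVal]
        refine ⟨?_, ?_, ?_, ?_⟩ <;> rintro rfl <;> simp [hb] at hl <;> obtain ⟨hb', hl⟩ := hl <;>
          obtain ⟨i1, i2, i3, i4⟩ := ih hl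
        · rw [e1]
          rcases hb' with rfl | rfl | rfl
          · obtain ⟨a, c, ha, h⟩ := i1 rfl
            exact ⟨1 + a, c, by omega, by rw [h, zpow_add, zpow_one, mul_assoc]⟩
          · obtain ⟨c, hc, h⟩ := i3 rfl
            exact ⟨1, c, by omega, by rw [h, zpow_one]⟩
          · obtain ⟨c, hc, h⟩ := i4 rfl
            exact ⟨1, c, by omega, by rw [h, zpow_one]⟩
        · rw [e2]
          rcases hb' with rfl | rfl | rfl
          · obtain ⟨a, c, ha, h⟩ := i2 rfl
            exact ⟨-1 + a, c, by omega, by rw [h, zpow_add, zpow_neg_one, mul_assoc]⟩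
          · obtain ⟨c, hc, h⟩ := i3 rfl
            exact ⟨-1, c, by omega, by rw [h, zpow_neg_one]⟩
          · obtain ⟨c, hc, h⟩ := i4 rfl
            exact ⟨-1, c, by omega, by rw [h, zpow_neg_one]⟩
        · rw [e3]
          obtain ⟨c, hc, h⟩ := i3 hb'
          exact ⟨1 + c, by omega, by rw [h, zpow_add, zpow_one]⟩
        · rw [e4]
          obtain ⟨c, hc, h⟩ := i4 hb'
          exact ⟨-1 + c, by omega, by rw [h, zpow_add, zpow_neg_one]⟩

end Words

theorem repM_wordLoop {f F w W g : SL2ACJ} {Af Aw : SL2C} (hf : RepM M z f Af) (hF : RepM M z F Af⁻¹)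
    (hw : RepM M z w Aw) (hW : RepM M z W Aw⁻¹) (l : List ℕ) {Ag : SL2C} (hg : RepM M z g Ag)
    (h : wordLoop M f F w W l g = some R) : RepM M z R (Ag * wordVal Af Aw l) := by
  induction l generalizing g Ag with
  | nil => cases h
  | cons b t ih =>
    rw [wordLoop] at h
    rw [wordVal]
    split_ifs at h ⊢
    · cases h; simpa using hg
    all_goals
      obtain ⟨g', h1, h⟩ := bind_iff.1 h
      rw [← mul_assoc]
      first
      | exact ih (hg.mul hf h1) h
      | exact ih (hg.mul hF h1) h
      | exact ih (hg.mul hw h1) h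
      | exact ih (hg.mul hW h1) h

theorem wordLoop_head {f F w W g : SL2ACJ} {l : List ℕ} (h : wordLoop M f F w W l g = some R) :
    l.getD 0 0 = 41 ∨ l.getD 0 0 = 102 ∨ l.getD 0 0 = 70 ∨ l.getD 0 0 = 119 ∨ l.getD 0 0 = 87 := by
  cases l with
  | nil => cases h
  | cons b t =>
    rw [wordLoop] at h
    rw [List.getD_cons_zero]
    split_ifs at h <;> simp_all

/-! ### Trivial words -/

theorem norm_lengthSL_of_zpow_eq_one {b : ℤ} (hb : b ≠ 0)
    (h : (QuotientGroup.mk A : PSL2C) ^ b = 1) : ‖lengthSL A‖ = 1 := by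
  obtain ⟨y, hy, -⟩ := exists_eigenvalue A.1.trace
  have hy1 : y ∈ spectrum ℂ A.1 := by
    rw [spectrum.mem_iff, Matrix.isUnit_iff_isUnit_det, isUnit_iff_ne_zero, not_not,
      Matrix.algebraMap_eq_diagonal, Matrix.det_fin_two]
    have hd := A.2
    rw [Matrix.det_fin_two] at hd
    rw [Matrix.trace_fin_two] at hy
    simp
    linear_combination hy + hd
  have hn : b.natAbs ≠ 0 := by simpa using hb
  have h1 : (QuotientGroup.mk (A ^ b.natAbs) : PSL2C) = 1 := by
    rw [QuotientGroup.mk_pow]; exact pow_natAbs_eq_one.2 h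
  obtain ⟨r, hr, h2⟩ := exists_smul_of_mk_eq (A := 1) (B := A ^ b.natAbs) (by rw [h1]; rfl)
  have h3 : A.1 ^ b.natAbs = algebraMap ℂ _ r := by
    ext i j
    rw [← Matrix.SpecialLinearGroup.coe_pow]
    refine (h2 i j).trans ?_
    simp [Matrix.algebraMap_eq_diagonal, Matrix.one_apply, Matrix.diagonal_apply]
  have h4 := spectrum.pow_mem_pow A.1 b.natAbs hy1
  rw [h3, spectrum.scalar_eq, Set.mem_singleton_iff] at h4
  have h5 : ‖r‖ = 1 := by
    have : ‖r‖ ^ 2 = 1 := by rw [← norm_pow, hr, norm_one]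
    exact (pow_eq_one_iff_of_nonneg (norm_nonneg _) (by norm_num)).1 this
  have h6 : ‖y‖ = 1 := by
    refine (pow_eq_one_iff_of_nonneg (norm_nonneg _) hn).1 ?_
    rw [← norm_pow, h4, h5]
  rw [norm_lengthSL hy, h6]; simp

theorem eq_one_of_commute {s t x0 : ℂ} (hs : s ≠ 0) (ht : t ≠ 0) (h0 : 1 < ‖x0‖) {a : ℤ} (ha : a ≠ 0)
    (h : Commute (shortGen x0 ^ a) (QuotientGroup.mk (closeMat s t hs ht))) : s ^ 2 = 1 := by
  obtain ⟨q, hq⟩ : ∃ q : ℂˣ, (q : ℂ) ^ 2 = x0 := by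
    refine ⟨Units.mk0 (Complex.sqrt x0) fun h1 => ?_, Complex.sqrt_sq x0⟩
    have := Complex.sqrt_sq x0
    rw [h1] at this
    rw [← this] at h0
    norm_num at h0
  rw [← mk_diagHom hq, ← QuotientGroup.mk_zpow, ← map_zpow] at h
  obtain ⟨r, hr, h1⟩ := exists_smul_of_mk_eq h.eq
  have h2 := h1 0 1
  have hp : ((q ^ a : ℂˣ) : ℂ) ^ 2 = x0 ^ a := by
    rw [← hq]; push_cast; rw [← zpow_natCast, ← zpow_natCast, ← zpow_mul, ← zpow_mul, mul_comm]
  generalize q ^ a = k at *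
  have h3 : (closeMat s t hs ht) 0 1 = 0 := by
    have h4 : (closeMat s t hs ht) 0 1 * (r * (k : ℂ) ^ 2 - 1) = 0 := by
      simp [diagHom_apply, Matrix.SpecialLinearGroup.coe_mul, Matrix.mul_apply, Fin.sum_univ_two] at h2
      have hk : (k : ℂ) ≠ 0 := k.ne_zero
      field_simp at h2
      linear_combination -h2
    rcases mul_eq_zero.1 h4 with h4 | h4
    · exact h4
    · exfalso
      have h5 : ‖r‖ = 1 := by
        have : ‖r‖ ^ 2 = 1 := by rw [← norm_pow, hr, norm_one]
        exact (pow_eq_one_iff_of_nonneg (norm_nonneg _) (by norm_num)).1 this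
      have h6 : ‖x0‖ ^ a = 1 := by
        rw [← norm_zpow, ← hp, ← one_mul ‖(k : ℂ) ^ 2‖]
        nth_rw 1 [← h5]
        rw [← norm_mul, sub_eq_zero.1 h4, norm_one]
      rw [zpow_eq_one_iff_right₀ (norm_nonneg _) h0.ne'] at h6
      exact ha h6
  have h4 : (s - 1 / s) / 2 / t = 0 := h3
  have h5 : s - 1 / s = 0 := by
    rcases div_eq_zero_iff.1 h4 with h4 | h4
    · exact (div_eq_zero_iff.1 h4).resolve_right (by norm_num)
    · exact absurd h4 ht
  field_simp at h5
  linear_combination h5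

variable {M : Machine} {z : Fin 3 → ℂ} {X : SL2ACJ}

theorem not_isMinimal_of_word {along ortho whirle l : ACJ} {x0 x1 x2 : ℂ} {word : List ℕ}
    (hx0 : Rep M z along x0) (hx1 : Rep M z ortho x1) (hx2 : Rep M z whirle x2)
    (hs0 : HasSqrt M z along x0) (hs1 : HasSqrt M z ortho x1) (hs2 : HasSqrt M z whirle x2)
    (hc0 : CentreLE along (4 ^ 2)) (hc1 : CentreLE ortho (4 ^ 2)) (hc2 : CentreLE whirle (4 ^ 2))
    (n0 : 1.10274 ≤ ‖x0‖) (n0' : ‖x0‖ ≤ 4) (n1 : 1 < ‖x1‖) (n2 : x2 ≠ 0)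
    (hX : evaluateWord M word along ortho whirle = some X) (hl : X.length M = some l)
    (ht : lengthTest M l along = some true)
    (hne : X.notIdentity M = some true ∨ wordImpliesCommuting word = true ∧ word.getD 0 0 ≠ 41) :
    ¬ IsMinimal (shortGen x0) (closeGen x1 x2) := by
  intro hmin
  have h0 : x0 ≠ 0 := by rintro rfl; norm_num at n0
  have h1 : x1 ≠ 0 := by rintro rfl; norm_num at n1
  simp only [evaluateWord, bind_iff] at hX
  obtain ⟨one, i1, zero, i2, f, i3, w, i4, F, i5, W, i6, hX⟩ := hX
  obtain ⟨Af, hf, ef⟩ := repM_shortGenerator h0 hx0 hs0 hc0 i3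
  obtain ⟨s, t, hs, ht', hw, es, et⟩ := repM_closeGenerator h1 n2 hx1 hx2 hs1 hs2 hc1 hc2 i4
  have ew := mk_closeMat hs ht' es et
  have hone : Rep M z one (1 : ℝ) := rep_ofDbl isNormal_one hx0.hz i1
  have hzero : Rep M z zero (0 : ℝ) := rep_ofDbl isNormal_zero hx0.hz i2
  have hI : RepM M z ⟨one, zero, zero, one⟩ 1 := by
    constructor <;> simpa using by first | exact hone | exact hzero
  have hg := repM_wordLoop hf (hf.inverse i5) hw (hw.inverse i6) word hI hX
  rw [one_mul] at hg
  have hlt := norm_tlength_lt hg hl hx0 (hc0.mono (by norm_num)) n0 n0' ht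
  have hmk : (QuotientGroup.mk (wordVal Af (closeMat s t hs ht') word) : PSL2C) =
      wordVal (shortGen x0) (closeGen x1 x2) word := by
    rw [← ef, ← ew]
    exact map_wordVal (QuotientGroup.mk' (Subgroup.center SL2C)) _ _ _
  have hmem := wordVal_mem (shortGen x0) (closeGen x1 x2) word
  have hlen := norm_tlength_shortGen (x0 := x0) (by linarith)
  suffices hne1 : wordVal (shortGen x0) (closeGen x1 x2) word ≠ 1 by
    have := hmin.1 _ hmem hne1
    rw [← hmk, norm_tlength_mk, hlen] at this
    linarith
  rcases hne with hne | ⟨hcomm, hhead⟩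
  · rw [← hmk]; exact mk_ne_one_of_notIdentity hg hne
  intro hg1
  have key : ∀ a : ℤ, a ≠ 0 → Commute (shortGen x0 ^ a) (closeGen x1 x2) → False := fun a ha hc => by
    rw [← ew] at hc
    have h3 := eq_one_of_commute hs ht' (by linarith) ha hc
    rw [← es, h3] at n1
    norm_num at n1
  have keyf : ∀ a b : ℤ, a ≠ 0 → shortGen x0 ^ a * closeGen x1 x2 ^ b = 1 → False := fun a b ha h => by
    refine key a ha ?_
    rw [eq_inv_of_mul_eq_one_left h]
    exact ((Commute.refl _).zpow_left b).inv_left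
  have keyw : ∀ b : ℤ, b ≠ 0 → closeGen x1 x2 ^ b = 1 → False := fun b hb h => by
    have h3 : ‖tlength (closeGen x1 x2)‖ = 1 := by
      rw [← ew] at h ⊢
      exact norm_lengthSL_of_zpow_eq_one hb h
    by_cases h4 : closeGen x1 x2 = 1
    · exact key 1 one_ne_zero (by rw [h4]; exact Commute.one_right _)
    · have := hmin.1 _ (Subgroup.subset_closure (by simp)) h4
      rw [hlen, h3] at this
      linarith
  obtain ⟨j1, j2, j3, j4⟩ := wordVal_of_commuting (shortGen x0) (closeGen x1 x2) word hcomm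
  rcases wordLoop_head hX with hh | hh | hh | hh | hh
  · exact hhead hh
  · obtain ⟨a, b, ha, h⟩ := j1 hh
    exact keyf a b (by omega) (by rw [← h, hg1])
  · obtain ⟨a, b, ha, h⟩ := j2 hh
    exact keyf a b (by omega) (by rw [← h, hg1])
  · obtain ⟨b, hb, h⟩ := j3 hh
    exact keyw b (by omega) (by rw [← h, hg1])
  · obtain ⟨b, hb, h⟩ := j4 hh
    exact keyw b (by omega) (by rw [← h, hg1])

/-! ### Addresses of boxes -/

theorem filter_range_mod_six (i : Fin 6) (n : ℕ) : (List.range n).filter (fun d => d % 6 = i.val) =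
    (List.range ((n + 5 - i.val) / 6)).map (fun k => 6 * k + i.val) := by
  have hi := i.2
  induction n with
  | zero =>
    rw [show (0 + 5 - i.val) / 6 = 0 by omega]; rfl
  | succ n ih =>
    rw [List.range_succ, List.filter_append, ih]
    by_cases h : n % 6 = i.val
    · rw [show (n + 1 + 5 - i.val) / 6 = (n + 5 - i.val) / 6 + 1 by omega, List.range_succ,
        List.map_append]
      simp only [h, List.filter_cons, decide_true, if_true, List.filter_nil, List.map_cons,
        List.map_nil, List.append_cancel_left_eq, List.cons.injEq, and_true]
      omega
    · rw [show (n + 1 + 5 - i.val) / 6 = (n + 5 - i.val) / 6 by omega]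
      simp [h]

theorem axisBits_eq (p : List Bool) (i : Fin 6) : axisBits p i =
    (List.range ((p.length + 5 - i.val) / 6)).map (fun k => p.getD (6 * k + i.val) false) := by
  rw [axisBits, filter_range_mod_six, List.map_map]; rfl

theorem length_axisBits (p : List Bool) (i : Fin 6) :
    (axisBits p i).length = (p.length + 5 - i.val) / 6 := by
  rw [axisBits_eq]; simp

theorem getD_axisBits {p : List Bool} {i : Fin 6} {k : ℕ} (h : 6 * k + i.val < p.length) :
    (axisBits p i).getD k false = p.getD (6 * k + i.val) false := by
  have hi := i.2
  rw [axisBits_eq, List.getD_eq_getElem _ _ (by simp; omega)]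
  simp

theorem axisBits_append (p : List Bool) (b : Bool) (i : Fin 6) : axisBits (p ++ [b]) i =
    if p.length % 6 = i.val then axisBits p i ++ [b] else axisBits p i := by
  have h1 : ∀ d ∈ (List.range p.length).filter (fun d => d % 6 = i.val),
      (p ++ [b]).getD d false = p.getD d false := fun d hd => by
    have hd : d < p.length := List.mem_range.1 (List.mem_of_mem_filter hd)
    rw [List.getD_eq_getElem _ _ (by simp; omega), List.getD_eq_getElem _ _ hd,
      List.getElem_append_left hd]
  simp only [axisBits, List.length_append, List.length_cons, List.length_nil, List.range_succ, zero_add,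
    List.filter_append, List.map_append, List.map_congr_left h1]
  split_ifs with h <;> simp [h]

theorem realAxis_append (l : List Bool) (b : Bool) : realAxis (l ++ [b]) =
    (if b then (realAxis l).1 + (realAxis l).2 / 2 else (realAxis l).1 - (realAxis l).2 / 2,
      (realAxis l).2 / 2) := by
  simp [realAxis]

/-- The binary address of a real number with `n` digits. -/
def address (t : ℝ) : ℕ → List Bool
  | 0 => []
  | n + 1 => address t n ++ [decide ((realAxis (address t n)).1 ≤ t)]

theorem length_address (t : ℝ) (n : ℕ) : (address t n).length = n := by
  induction n with
  | zero => rfl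
  | succ n ih => simp [address, ih]

theorem getD_address (t : ℝ) {k n : ℕ} (h : k < n) :
    (address t n).getD k false = decide ((realAxis (address t k)).1 ≤ t) := by
  induction n with
  | zero => omega
  | succ n ih =>
    have hl := length_address t n
    rw [address]
    rcases Nat.lt_succ_iff_lt_or_eq.1 h with h | rfl
    · rw [← ih h, List.getD_eq_getElem _ _ (by simp; omega), List.getD_eq_getElem _ _ (by omega),
        List.getElem_append_left]
    · rw [List.getD_eq_getElem _ _ (by simp; omega), List.getElem_append_right (by omega)]
      simp [hl]

theorem realAxis_pos (l : List Bool) : 0 < (realAxis l).2 := by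
  induction l using List.reverseRecOn with
  | nil => simp [realAxis]
  | append_singleton l b ih => rw [realAxis_append]; simpa using ih

/-- The number `t` lies in the interval with the address `l`. -/
def InAxis (l : List Bool) (t : ℝ) : Prop :=
  (realAxis l).1 - (realAxis l).2 ≤ t ∧ t < (realAxis l).1 + (realAxis l).2

theorem inAxis_append {l : List Bool} {b : Bool} {t : ℝ} :
    InAxis (l ++ [b]) t ↔ InAxis l t ∧ b = decide ((realAxis l).1 ≤ t) := by
  have h := realAxis_pos l
  simp only [InAxis, realAxis_append]
  cases b
  · have e : false = decide ((realAxis l).1 ≤ t) ↔ t < (realAxis l).1 := by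
      rw [eq_comm, decide_eq_false_iff_not, not_le]
    rw [e]
    simp only [Bool.false_eq_true, if_false]
    constructor
    · rintro ⟨h1, h2⟩; refine ⟨⟨?_, ?_⟩, ?_⟩ <;> linarith
    · rintro ⟨⟨h1, h2⟩, h3⟩; constructor <;> linarith
  · simp only [if_true, Eq.comm (a := true), decide_eq_true_iff]
    constructor
    · rintro ⟨h1, h2⟩; refine ⟨⟨?_, ?_⟩, ?_⟩ <;> linarith
    · rintro ⟨⟨h1, h2⟩, h3⟩; constructor <;> linarith

theorem InAxis.eq_address {l : List Bool} {t : ℝ} (h : InAxis l t) : l = address t l.length := by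
  induction l using List.reverseRecOn with
  | nil => rfl
  | append_singleton l b ih =>
    rw [inAxis_append] at h
    have h1 := ih h.1
    rw [List.length_append, List.length_cons, List.length_nil, zero_add, address, ← h1, ← h.2]

theorem InAxis.of_append {l s : List Bool} {t : ℝ} (h : InAxis (l ++ s) t) : InAxis l t := by
  induction s using List.reverseRecOn with
  | nil => simpa using h
  | append_singleton s b ih => rw [← List.append_assoc, inAxis_append] at h; exact ih h.1

/-- The coordinates of the points of a box, with the scaling removed. -/
theorem mem_Z_iff (hM : ∀ i, 0 < M.scale i) {p : List Bool} {x : Fin 3 → ℂ} :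
    x ∈ Z M p ↔ ∀ i, InAxis (axisBits p i) (coord x i / M.scale i) := by
  simp only [Z, Set.mem_ofPred_eq, InAxis, le_div_iff₀ (hM _), div_lt_iff₀ (hM _), mul_comm]

theorem Z_subset_union (hM : ∀ i, 0 < M.scale i) (p : List Bool) :
    Z M p ⊆ Z M (p ++ [false]) ∪ Z M (p ++ [true]) := by
  intro x hx
  rw [mem_Z_iff hM] at hx
  have key : ∃ c, ∀ b, b = c → x ∈ Z M (p ++ [b]) := by
    refine ⟨decide ((realAxis (axisBits p ⟨p.length % 6, Nat.mod_lt _ (by norm_num)⟩)).1 ≤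
      coord x ⟨p.length % 6, Nat.mod_lt _ (by norm_num)⟩ /
        M.scale ⟨p.length % 6, Nat.mod_lt _ (by norm_num)⟩), fun b hb => ?_⟩
    rw [mem_Z_iff hM]
    intro i
    rw [axisBits_append]
    split_ifs with h
    · obtain rfl : i = ⟨p.length % 6, Nat.mod_lt _ (by norm_num)⟩ := Fin.ext h.symm
      rw [inAxis_append]
      exact ⟨hx _, hb⟩
    · exact hx i
  obtain ⟨c, key⟩ := key
  cases c
  · exact Or.inl (key false rfl)
  · exact Or.inr (key true rfl)

theorem matches_of_mem (hM : ∀ i, 0 < M.scale i) {h : Hole} {p : List Bool} {x y : Fin 3 → ℂ}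
    (hx : x ∈ Z M p) (hy : y ∈ Z M h.position) (hxy : y 0 = x 0) : h.matches p = true := by
  rw [mem_Z_iff hM] at hx hy
  have key : ∀ (i : Fin 6) (k : ℕ), coord x i = coord y i → 6 * k + i.val < p.length →
      6 * k + i.val < h.position.length →
      p.getD (6 * k + i.val) false = h.position.getD (6 * k + i.val) false := by
    intro i k hc h1 h2
    have hi := i.2
    rw [← getD_axisBits h1, ← getD_axisBits h2, (hx i).eq_address, (hy i).eq_address, hc,
      getD_address _ (by rw [length_axisBits]; omega), getD_address _ (by rw [length_axisBits]; omega)]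
  rw [Hole.matches, List.all_eq_true]
  intro j hj
  rw [List.mem_range, lt_min_iff] at hj
  by_cases h3 : j % 3 = 0
  · have h0 : coord x 0 = coord y 0 := by simp [coord, hxy]
    have h03 : coord x 3 = coord y 3 := by simp [coord, hxy]
    have hd : p.getD j false = h.position.getD j false := by
      rcases Nat.mod_two_eq_zero_or_one (j / 3) with h4 | h4
      · have := key 0 (j / 6) h0
        rw [show 6 * (j / 6) + (0 : Fin 6).val = j by simp; omega] at this
        exact this hj.2 hj.1
      · have := key 3 (j / 6) h03
        rw [show 6 * (j / 6) + (3 : Fin 6).val = j by simp; omega] at this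
        exact this hj.2 hj.1
    rw [hd]; simp
  · simp [h3]

/-! ### The scaling factors -/

theorem abs_two_rpow_sub_one_le {δ : ℝ} (h : |δ| ≤ 1) : |(2 : ℝ) ^ δ - 1| ≤ 2 * |δ| := by
  rw [Real.rpow_def_of_pos (by norm_num)]
  have h1 : |Real.log 2 * δ| ≤ |δ| := by
    rw [abs_mul, abs_of_pos (Real.log_pos (by norm_num))]
    have := Real.log_two_lt_d9
    nlinarith [abs_nonneg δ]
  exact (Real.abs_exp_sub_one_le (h1.trans h)).trans (by linarith)

theorem abs_scale_pow_sub_le (M : Machine) (i : Fin 6) : 0 < M.scale i ∧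
    2 ^ (5 - i.val) * (1 - 1e-12) ≤ M.scale i ^ 6 ∧ M.scale i ^ 6 ≤ 2 ^ (5 - i.val) * (1 + 1e-12) := by
  have hi : (i.val : ℝ) ≤ 5 := by exact_mod_cast Nat.lt_succ_iff.1 i.2
  have hi0 : (0 : ℝ) ≤ i.val := by positivity
  have hf := M.scale_faithful i
  have hu := ur_pos
  have hq0 : (0 : ℝ) ≤ (5 - (i.val : ℝ)) / 6 := by linarith
  have h1 := abs_round53_sub_le ((5 - (i.val : ℝ)) / 6)
  rw [abs_of_nonneg hq0] at h1
  have hr0 := round53_nonneg hq0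
  generalize round53 ((5 - (i.val : ℝ)) / 6) = r at *
  have hT : (1 : ℝ) ≤ 2 ^ r := Real.one_le_rpow (by norm_num) hr0
  have h2 := hf.abs_sub_le ((zpow_le_one_of_nonpos₀ (by norm_num) (by norm_num)).trans hT)
  have h3 : ((2 : ℝ) ^ r) ^ 6 = 2 ^ (5 - i.val) * 2 ^ (6 * r - (5 - i.val)) := by
    rw [← Real.rpow_natCast, ← Real.rpow_mul (by norm_num), ← Real.rpow_natCast,
      ← Real.rpow_add (by norm_num), Nat.cast_sub (Nat.lt_succ_iff.1 i.2)]
    congr 1; push_cast; ring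
  have h4 : |6 * r - (5 - i.val)| ≤ 6 * ur := by
    rw [show 6 * r - (5 - i.val) = 6 * (r - (5 - i.val) / 6) by ring, abs_mul, abs_of_pos (by norm_num)]
    nlinarith
  have hu1 : ur ≤ 1.2e-16 := by norm_num [ur_eq]
  have h5 := abs_two_rpow_sub_one_le (h4.trans (by linarith))
  rw [abs_le] at h2 h5
  generalize (2 : ℝ) ^ r = T at *
  generalize (2 : ℝ) ^ (6 * r - (5 - i.val)) = D at *
  have hlo : (1 - 2.4e-16) * T ≤ M.scale i := by nlinarith
  have hhi : M.scale i ≤ (1 + 2.4e-16) * T := by nlinarith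
  have hT0 : 0 < T := by linarith
  refine ⟨lt_of_lt_of_le (by positivity) hlo, ?_, ?_⟩
  · refine le_trans ?_ (pow_le_pow_left₀ (by positivity) hlo 6)
    rw [mul_pow, h3, mul_left_comm]
    gcongr
    linarith
  · refine (pow_le_pow_left₀ (lt_of_lt_of_le (by positivity) hlo).le hhi 6).trans ?_
    rw [mul_pow, h3, mul_left_comm]
    gcongr
    linarith

theorem scale_pos (M : Machine) (i : Fin 6) : 0 < M.scale i := (abs_scale_pow_sub_le M i).1

/-- Decimal bounds for the scaling factors. -/
theorem scale_bounds (M : Machine) (i : Fin 6) :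
    ![1.7817, 1.5873, 1.4141, 1.2598, 1.1224, 0.9999] i < M.scale i ∧
    M.scale i < ![1.7819, 1.5875, 1.4143, 1.26, 1.1226, 1.0001] i := by
  obtain ⟨h0, h1, h2⟩ := abs_scale_pow_sub_le M i
  constructor
  · refine lt_of_pow_lt_pow_left₀ 6 h0.le (lt_of_lt_of_le ?_ h1)
    fin_cases i <;> norm_num
  · refine lt_of_pow_lt_pow_left₀ 6 ?_ (h2.trans_lt ?_)
    · fin_cases i <;> norm_num
    · fin_cases i <;> norm_num

theorem scale_lt (M : Machine) (i : Fin 6) : M.scale i < 1.79 := by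
  have := (scale_bounds M i).2
  fin_cases i <;> exact this.trans (by norm_num)

/-! ### Centres and sizes of boxes -/

theorem realAxis_snd (l : List Bool) : (realAxis l).2 = 2 ^ (2 - (l.length : ℤ)) := by
  induction l using List.reverseRecOn with
  | nil => norm_num [realAxis]
  | append_singleton l b ih =>
    rw [realAxis_append]
    simp only [ih, List.length_append, List.length_cons, List.length_nil]
    rw [show (2 : ℤ) - ((l.length + (0 + 1) : ℕ) : ℤ) = 2 - l.length - 1 by push_cast; ring,
      zpow_sub_one₀ (by norm_num)]
    ring

theorem realAxis_fst (l : List Bool) : ∃ m : ℤ, (realAxis l).1 = m * (realAxis l).2 ∧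
    |m| < 2 ^ l.length ∧ (l = [] ∨ Odd m) := by
  induction l using List.reverseRecOn with
  | nil => exact ⟨0, by simp [realAxis], by simp, Or.inl rfl⟩
  | append_singleton l b ih =>
    obtain ⟨m, h1, h2, -⟩ := ih
    rw [realAxis_append, List.length_append, List.length_cons, List.length_nil, zero_add, pow_succ]
    rw [abs_lt] at h2
    cases b
    · refine ⟨2 * m - 1, ?_, by rw [abs_lt]; constructor <;> linarith, Or.inr ⟨m - 1, by ring⟩⟩
      simp only [Bool.false_eq_true, if_false, h1]; push_cast; ring
    · refine ⟨2 * m + 1, ?_, by rw [abs_lt]; constructor <;> linarith, Or.inr ⟨m, rfl⟩⟩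
      simp only [if_true, h1]; push_cast; ring

/-- One step of the computation of a box. -/
def axisStep (a : Dbl × Dbl) (b : Bool) : Option (Dbl × Dbl) := do
  let size ← a.2 /ᶠ const 2
  let pos ← if b then a.1 +ᶠ size else a.1 -ᶠ size
  return (pos, size)

theorem foldlM_axisStep (l : List Bool) (hl : l.length ≤ 50) :
    l.foldlM axisStep (const 0, const 4) = some (.fin (realAxis l).1, .fin (realAxis l).2) := by
  induction l using List.reverseRecOn with
  | nil => simp [realAxis]
  | append_singleton l b ih =>
    rw [List.length_append, List.length_cons, List.length_nil] at hl
    obtain ⟨m, h1, h2, -⟩ := realAxis_fst l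
    have h3 : (realAxis l).2 / 2 = 2 ^ (1 - (l.length : ℤ)) := by
      rw [realAxis_snd, show (2 : ℤ) - l.length = 1 - l.length + 1 by ring, zpow_add_one₀ (by norm_num)]
      ring
    have hp : (2 : ℤ) ^ l.length ≤ 2 ^ 50 := pow_le_pow_right₀ (by norm_num) (by omega)
    rw [abs_lt] at h2
    have e1 : fl ((realAxis l).2 / 2) = some (.fin ((realAxis l).2 / 2)) := by
      have := fl_of_intCast_mul (m := 1) (e := 1 - l.length) (by norm_num) (by norm_num) (by omega)
        (by omega)
      rwa [Int.cast_one, one_mul, ← h3] at this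
    have e2 : ∀ k : ℤ, Odd k → |k| ≤ 1 → fl ((realAxis l).1 + k * ((realAxis l).2 / 2)) =
        some (.fin ((realAxis l).1 + k * ((realAxis l).2 / 2))) := fun k hk hk1 => by
      have := fl_of_intCast_mul (m := 2 * m + k) (e := 1 - l.length)
        (by rw [abs_le] at hk1; rw [abs_lt]; constructor <;> linarith)
        (by obtain ⟨j, rfl⟩ := hk; omega) (by omega) (by omega)
      rw [← h3] at this
      rw [show (realAxis l).1 + k * ((realAxis l).2 / 2) =
        ((2 * m + k : ℤ) : ℝ) * ((realAxis l).2 / 2) by rw [h1]; push_cast; ring]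
      exact this
    rw [List.foldlM_append, ih (by omega), realAxis_append]
    simp only [List.foldlM_cons, List.foldlM_nil, axisStep, fdiv, fadd, fsub, Dbl.div, Dbl.add, Dbl.neg,
      Option.bind_eq_bind, Option.bind_some, Option.pure_def]
    rw [if_neg (by norm_num), e1]
    cases b
    · have := e2 (-1) (by decide) (by norm_num)
      rw [Int.cast_neg, Int.cast_one, neg_one_mul] at this
      simp [this, sub_eq_add_neg]
    · have := e2 1 (by decide) (by norm_num)
      rw [Int.cast_one, one_mul] at this
      simp [this]

theorem flEq_of_abs_le {x : ℝ} {d : Dbl} (hx : |x| ≤ 2 ^ 20) (h : fl x = some d) :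
    ∃ p, d = .fin p ∧ FlEq x p := by
  have hu : ur ≤ 1 := ur_le.trans (by norm_num)
  have h0 := abs_nonneg x
  have h1 : |round53 x| < 2 ^ 1024 := by
    rw [abs_round53]
    calc round53 |x| ≤ (1 + ur) * |x| := round53_le h0
      _ ≤ 2 * 2 ^ 20 := by gcongr; linarith
      _ = (2 : ℝ) ^ 21 := by norm_num
      _ < 2 ^ 1024 := pow_lt_pow_right₀ (by norm_num) (by norm_num)
  rcases fl_cases h with ⟨rfl, h2, h3⟩ | ⟨-, h2⟩
  · exact ⟨_, rfl, rfl, h2, h1⟩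
  · exact absurd h1 (not_lt.2 h2)

set_option maxHeartbeats 400000 in
theorem posSize_spec {p : List Bool} {i : Fin 6} (hp : p.length ≤ 200) {d : Dbl × Dbl}
    (h : posSize M p i = some d) : ∃ P S c h : ℝ, d = (.fin P, .fin S) ∧ IsNormal P ∧ IsNormal S ∧
      c = (realAxis (axisBits p i)).1 ∧ h = (realAxis (axisBits p i)).2 ∧
      |P - c * M.scale i| ≤ ur * |c * M.scale i| ∧ h * M.scale i + |P - c * M.scale i| ≤ S ∧
      S ≤ (1 + 3e-6) * (h * M.scale i) := by
  have hl : (axisBits p i).length ≤ 34 := by rw [length_axisBits]; omega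
  have hfold := foldlM_axisStep (axisBits p i) (by omega)
  rw [posSize] at h
  obtain ⟨⟨d1, d2⟩, h1, h⟩ := bind_iff.1 h
  cases h1.symm.trans hfold
  obtain ⟨m, hm1, hm2, -⟩ := realAxis_fst (axisBits p i)
  have hh := realAxis_pos (axisBits p i)
  have hh4 : (realAxis (axisBits p i)).2 ≤ 4 := by
    rw [realAxis_snd]
    calc (2 : ℝ) ^ (2 - ((axisBits p i).length : ℤ)) ≤ 2 ^ (2 : ℤ) :=
          zpow_le_zpow_right₀ (by norm_num) (by omega)
      _ = 4 := by norm_num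
  have hmh : (2 : ℝ) ^ (axisBits p i).length * (realAxis (axisBits p i)).2 = 4 := by
    rw [realAxis_snd, ← zpow_natCast, ← zpow_add₀ (by norm_num)]; norm_num
  generalize (realAxis (axisBits p i)).1 = c at *
  generalize (realAxis (axisBits p i)).2 = η at *
  have hs := scale_pos M i
  have hs2 := scale_lt M i
  have hmr : |(m : ℝ)| ≤ 2 ^ (axisBits p i).length := by exact_mod_cast hm2.le
  have hc4 : |c| ≤ 4 := by
    rw [hm1, abs_mul, abs_of_pos hh, ← hmh]; gcongr
  have hcη : |c| ≤ 2 ^ 34 * η := by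
    rw [hm1, abs_mul, abs_of_pos hh]; gcongr
    exact hmr.trans (pow_le_pow_right₀ (by norm_num) hl)
  generalize M.scale i = σ at *
  obtain ⟨Pd, h2, h⟩ := bind_iff.1 h
  obtain ⟨Sd, h3, h⟩ := bind_iff.1 h
  cases h
  have hu := ur_pos
  have hu1 : ur ≤ 1.2e-16 := by norm_num [ur_eq]
  have b1 : |c * σ| ≤ 8 := by rw [abs_mul, abs_of_pos hs]; nlinarith [abs_nonneg c]
  obtain ⟨P, rfl, hP⟩ := flEq_of_abs_le (b1.trans (by norm_num)) h2
  have hPd := hP.abs_sub_le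
  have hPd' := hP.abs_sub_le'
  have hP9 : |P| ≤ (1 + 1.2e-16) * |c * σ| := by
    have := abs_sub_abs_le_abs_sub P (c * σ)
    nlinarith [abs_nonneg (c * σ)]
  have hP0 := abs_nonneg P
  have hησ : 0 < η * σ := by positivity
  have hησ8 : η * σ ≤ 8 := by nlinarith
  obtain ⟨_, C', ⟨⟩, h4, h5⟩ := fmul_eq_some h3
  obtain ⟨A', B', h6, h7, h8⟩ := fadd_eq_some h4
  obtain ⟨A, rfl, hA⟩ := flEq_of_abs_le (x := η * σ) (by rw [abs_of_pos hησ]; linarith) h6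
  have hB1 : eps / 2 = ur := by rw [eps_eq]; ring
  obtain ⟨B, rfl, hB⟩ := flEq_of_abs_le (x := eps / 2 * |P|) (by
    rw [hB1, abs_of_nonneg (by positivity)]; nlinarith) h7
  rw [hB1] at hB
  have hA1 := hA.le hησ.le
  have hA2 := hA.ge hησ.le
  have hA0 := hA.nonneg hησ.le
  have huP : 0 ≤ ur * |P| := by positivity
  have hB2 := hB.le huP
  have hB3 := hB.ge huP
  have hB0 := hB.nonneg huP
  have huP1 : ur * |P| ≤ 1.95e-6 * (η * σ) := by
    have e1 : |c * σ| ≤ 2 ^ 34 * (η * σ) := by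
      rw [abs_mul, abs_of_pos hs, ← mul_assoc]; gcongr
    calc ur * |P| ≤ 1.11023e-16 * ((1 + 1.2e-16) * (2 ^ 34 * (η * σ))) := by
          gcongr
          · norm_num [ur_eq]
          · exact hP9.trans (by gcongr)
      _ ≤ _ := by norm_num; linarith
  have hA9 : A ≤ (1 + 1.2e-16) * (η * σ) := hA1.trans (by gcongr)
  have hB9 : B ≤ 1.96e-6 * (η * σ) := by
    have : (1 + ur) * (ur * |P|) ≤ (1 + 1.2e-16) * (1.95e-6 * (η * σ)) := by gcongr
    linarith
  have hAB : 0 ≤ A + B := add_nonneg hA0 hB0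
  obtain ⟨C, rfl, hC⟩ := flEq_of_abs_le (x := A + B) (by rw [abs_of_nonneg hAB]; linarith) h8
  have hC1 := hC.le hAB
  have hC2 := hC.ge hAB
  have hC0 := hC.nonneg hAB
  have hC9 : C ≤ (1 + 1.97e-6) * (η * σ) := by
    have : (1 + ur) * (A + B) ≤ (1 + 1.2e-16) * ((1 + 1.961e-6) * (η * σ)) := by gcongr; linarith
    linarith
  have h1e : 1 + 2 * eps = 1 + 4 * ur := by rw [eps_eq]; ring
  have hx : 0 ≤ (1 + 2 * eps) * C := by rw [h1e]; positivity
  obtain ⟨S, rfl, hS⟩ := flEq_of_abs_le (x := (1 + 2 * eps) * C) (by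
    rw [abs_of_nonneg hx, h1e]
    exact (mul_le_mul (by linarith : 1 + 4 * ur ≤ 2) (by linarith : C ≤ 9) hC0 (by norm_num)).trans
      (by norm_num)) h5
  have hS1 := hS.le hx
  have hS2 := hS.ge hx
  rw [h1e] at hS1 hS2
  refine ⟨P, S, c, η, rfl, hP.isNormal, hS.isNormal, rfl, rfl, hPd, ?_, ?_⟩
  · have e1 : η * σ + ur * |P| ≤ (1 + ur) * ((1 + ur) * C) :=
      calc η * σ + ur * |P| ≤ (1 + ur) * A + (1 + ur) * B := add_le_add hA2 hB3
        _ = (1 + ur) * (A + B) := by ring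
        _ ≤ _ := by gcongr
    have e2 : (1 + ur) * ((1 + ur) * ((1 + ur) * C)) ≤ (1 + 4 * ur) * C := by
      have : (1 + ur) * ((1 + ur) * (1 + ur)) ≤ 1 + 4 * ur := by norm_num [ur_eq]
      calc _ = ((1 + ur) * ((1 + ur) * (1 + ur))) * C := by ring
        _ ≤ _ := by gcongr
    have e3 : (1 + ur) * (η * σ + ur * |P|) ≤ (1 + ur) * S :=
      (mul_le_mul_of_nonneg_left e1 (by positivity)).trans (e2.trans hS2)
    have := le_of_mul_le_mul_left e3 (by positivity)
    linarith
  · have : (1 + ur) * ((1 + 4 * ur) * C) ≤ (1 + 1.2e-16) * ((1 + 5e-16) * ((1 + 1.97e-6) * (η * σ))) := by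
      gcongr; linarith
    linarith

theorem size_le {f f0 f1 f2 : XComplex} {e : Dbl} {J : ACJ} {c0 c1 c2 : ℂ} {σ : ℝ}
    (h : ACJ.build M f f0 f1 f2 e = some J) (h0 : IsC f0 c0) (h1 : IsC f1 c1) (h2 : IsC f2 c2)
    (hσ : J.size = .fin σ) : σ ≤ (1 + 1e-14) * (‖c0‖ + (‖c1‖ + ‖c2‖)) := by
  obtain ⟨s, hs, rfl⟩ := build_eq_some h
  cases hσ
  have hu := ur_pos
  obtain ⟨_, t, ⟨⟩, i1, k1⟩ := fmul_fin hs
  obtain ⟨a0, t', j0, i2, k2⟩ := fadd_fin i1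
  obtain ⟨a1, a2, j1, j2, k3⟩ := fadd_fin i2
  obtain ⟨p0, q0, -⟩ := (absUB_spec h0 j0).2 _ rfl
  obtain ⟨p1, q1, -⟩ := (absUB_spec h1 j1).2 _ rfl
  obtain ⟨p2, q2, -⟩ := (absUB_spec h2 j2).2 _ rfl
  have n0 := norm_nonneg c0
  have n1 := norm_nonneg c1
  have n2 := norm_nonneg c2
  have r1 := k3.le (add_nonneg p1 p2)
  have r1' := k3.nonneg (add_nonneg p1 p2)
  have r2 := k2.le (add_nonneg p0 r1')
  have r2' := k2.nonneg (add_nonneg p0 r1')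
  have he : 1 + 2 * eps = 1 + 4 * ur := by rw [eps_eq]; ring
  rw [he] at k1
  have r3 := k1.le (by positivity)
  have hu1 : ur ≤ 1.2e-16 := by norm_num [ur_eq]
  have b0 : a0 ≤ (1 + 9e-16) * ‖c0‖ := q0.trans (by gcongr; linarith)
  have b1 : a1 ≤ (1 + 9e-16) * ‖c1‖ := q1.trans (by gcongr; linarith)
  have b2 : a2 ≤ (1 + 9e-16) * ‖c2‖ := q2.trans (by gcongr; linarith)
  have b3 : t' ≤ (1 + 1.2e-16) * ((1 + 9e-16) * (‖c1‖ + ‖c2‖)) := r1.trans (by gcongr; linarith)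
  have b4 : t ≤ (1 + 1.2e-16) * ((1 + 1.1e-15) * (‖c0‖ + (‖c1‖ + ‖c2‖))) :=
    r2.trans (by gcongr; linarith)
  have b5 : (1 + ur) * ((1 + 4 * ur) * t) ≤
      (1 + 1.2e-16) * ((1 + 5e-16) * ((1 + 1.2e-16) * ((1 + 1.1e-15) * (‖c0‖ + (‖c1‖ + ‖c2‖))))) := by
    gcongr; linarith
  have b6 : 0 ≤ ‖c0‖ + (‖c1‖ + ‖c2‖) := by positivity
  linarith

/-- A jet without error with centre `f` and radius `t`, as they occur for boxes. -/
structure DiscJet (J : ACJ) (f : ℂ) (t : ℝ) : Prop where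
  isC : IsC J.f f
  e_eq : J.e = const 0
  coef : ∃ c0 c1 c2, IsC J.f0 c0 ∧ IsC J.f1 c1 ∧ IsC J.f2 c2 ∧ ‖c0‖ + (‖c1‖ + ‖c2‖) = t
  norm_le : ‖f‖ ≤ 15.9
  ratio : t ≤ 0.5225 * ‖f‖ ∨ 0.999 * ‖f‖ ≤ t

namespace DiscJet

variable {J K : ACJ} {f v : ℂ} {t : ℝ}

theorem centreLE (h : DiscJet J f t) : CentreLE J (4 ^ 2) := fun _ g _ hg => by
  rw [hg.unique h.isC]; exact h.norm_le.trans (by norm_num)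

theorem neg (h : DiscJet J f t) (hK : J.neg M = some K) : DiscJet K (-f) t := by
  obtain ⟨_, -, rfl⟩ := build_eq_some hK
  obtain ⟨c0, c1, c2, h0, h1, h2, hc⟩ := h.coef
  exact ⟨h.isC.neg, h.e_eq, ⟨_, _, _, h0.neg, h1.neg, h2.neg, by simpa using hc⟩,
    by simpa using h.norm_le, by simpa using h.ratio⟩

theorem hasSqrt (h : DiscJet J f t) (hJ : Rep M z J v) (hv : 1 ≤ ‖v‖) : HasSqrt M z J v := by
  intro r hr
  rcases hJ.sqrt hr with hr | ⟨f', σ, e, hf', hσ, he', hf0, hk, hk1, hb⟩ | ⟨⟨f', hf', hf9⟩, -⟩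
  · exact hr
  · exfalso
    obtain rfl := h.isC.unique hf'
    rw [h.e_eq] at he'
    cases he'
    obtain ⟨c0, c1, c2, h0, h1, h2, rfl⟩ := h.coef
    have s1 := size_ub hJ.built h0 h1 h2
    rw [hσ, ub_fin] at s1
    have s2 := size_le hJ.built h0 h1 h2 hσ
    have hf16 := h.norm_le
    have hfp : 0 < ‖f‖ := norm_pos_iff.2 hf0
    rw [add_zero] at *
    rcases h.ratio with hr | hr
    · nlinarith
    · obtain ⟨k, rfl⟩ : ∃ k, σ = k * ‖f‖ := ⟨σ / ‖f‖, by field_simp⟩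
      rw [mul_div_cancel_right₀ _ hfp.ne'] at hb
      have hk0 : 0.999 ≤ k := le_of_mul_le_mul_right (hr.trans s1) hfp
      have hk2 := le_of_mul_le_mul_right hk1 hfp
      have h1 := norm_add_le (v - f + k * f) ((1 - k : ℝ) * f)
      rw [show v - f + k * f + (1 - k : ℝ) * f = v by push_cast; ring, norm_mul, Complex.norm_real,
        Real.norm_eq_abs] at h1
      have h2 : |1 - k| ≤ 0.001 := by rw [abs_le]; constructor <;> linarith
      have h3 : |1 - k| * ‖f‖ ≤ 0.001 * 15.9 := by gcongr
      linarith
  · exfalso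
    obtain rfl := h.isC.unique hf'
    have : (16 : ℝ) ≤ 2 ^ 900 := by
      rw [show (16 : ℝ) = 2 ^ 4 by norm_num]; exact pow_le_pow_right₀ (by norm_num) (by norm_num)
    exact absurd hf9 (not_lt.2 ((h.norm_le.trans (by norm_num)).trans this))

end DiscJet

theorem scale_ratio (M : Machine) {i j : Fin 6} (hij : j.val = i.val + 3) :
    1.4139 * M.scale j ≤ M.scale i ∧ M.scale i ≤ 1.4145 * M.scale j := by
  have h1 := scale_bounds M i
  have h2 := scale_bounds M j
  rcases (by omega : i.val = 0 ∧ j.val = 3 ∨ i.val = 1 ∧ j.val = 4 ∨ i.val = 2 ∧ j.val = 5) with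
    ⟨h3, h4⟩ | ⟨h3, h4⟩ | ⟨h3, h4⟩
  · obtain rfl : i = 0 := Fin.ext h3
    obtain rfl : j = 3 := Fin.ext h4
    simp at h1 h2; constructor <;> linarith
  · obtain rfl : i = 1 := Fin.ext h3
    obtain rfl : j = 4 := Fin.ext h4
    simp at h1 h2; constructor <;> linarith
  · obtain rfl : i = 2 := Fin.ext h3
    obtain rfl : j = 5 := Fin.ext h4
    simp at h1 h2; constructor <;> linarith

theorem sq_ratio_bound {a b x y p q : ℝ} (ha : 0 < a) (hb : 0 < b) (hab : 0.4997 * b ^ 2 ≤ a ^ 2)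
    (hp : (1 - 1e-9) * (3 * a) ≤ |p|) (hq : (1 - 1e-9) * b ≤ |q|) (hx0 : 0 ≤ x) (hy0 : 0 ≤ y)
    (hx : x ≤ (1 + 3e-6) * a) (hy : y ≤ (1 + 3e-6) * b) :
    x ^ 2 + y ^ 2 ≤ 0.5225 ^ 2 * (p ^ 2 + q ^ 2) := by
  have h1 := pow_le_pow_left₀ (by positivity) hp 2
  have h2 := pow_le_pow_left₀ (by positivity) hq 2
  have h3 := pow_le_pow_left₀ hx0 hx 2
  have h4 := pow_le_pow_left₀ hy0 hy 2
  rw [sq_abs] at h1 h2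
  nlinarith

theorem abs_ge_of_approx {P c m a : ℝ} (ha : 0 < a) (hc : c = m * a) (h : |P - c| ≤ ur * |c|) {k : ℝ}
    (hk : k ≤ |m|) : (1 - 1e-9) * (k * a) ≤ |P| := by
  have h1 := abs_sub_abs_le_abs_sub c P
  rw [abs_sub_comm] at h1
  have hu : ur ≤ 1e-9 := by norm_num [ur_eq]
  have h2 : |c| = |m| * a := by rw [hc, abs_mul, abs_of_pos ha]
  rw [h2] at h h1
  have h3 : k * a ≤ |m| * a := by gcongr
  have h4 : 0 ≤ |m| * a := by positivity
  have h5 : ur * (|m| * a) ≤ 1e-9 * (|m| * a) := by gcongr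
  nlinarith

theorem abs_le_of_approx {n : ℤ} {x X C : ℝ} (hx : 0 < x) (hn : ¬ 1 < |n|) (hC : C = n * x)
    (h : |X - C| ≤ ur * |C|) : 0.999 * |X| ≤ x := by
  have hn1 : |(n : ℝ)| ≤ 1 := by exact_mod_cast not_lt.1 hn
  have hC1 : |C| ≤ x := by
    rw [hC, abs_mul, abs_of_pos hx]; nlinarith
  have hu : ur ≤ 1e-9 := by norm_num [ur_eq]
  have := abs_sub_abs_le_abs_sub X C
  nlinarith [abs_nonneg C]

theorem abs_ge_one_of_odd {n : ℤ} (hn : Odd n) : 1 ≤ |(n : ℝ)| := by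
  have : n ≠ 0 := by rintro rfl; simp at hn
  exact_mod_cast Int.one_le_abs this

theorem abs_ge_three_of_odd {n : ℤ} (hn : Odd n) (h : 1 < |n|) : 3 ≤ |(n : ℝ)| := by
  have h3 : 3 ≤ |n| := by
    obtain ⟨k, rfl⟩ := hn
    rcases abs_cases (2 * k + 1) with ⟨h4, _⟩ | ⟨h4, _⟩ <;> omega
  exact_mod_cast h3

theorem box_ratio {p : List Bool} {i j : Fin 6} (hij : j.val = i.val + 3) {P S P' S' : ℝ}
    (h1 : |P - (realAxis (axisBits p i)).1 * M.scale i| ≤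
      ur * |(realAxis (axisBits p i)).1 * M.scale i|)
    (h2 : (realAxis (axisBits p i)).2 * M.scale i ≤ S)
    (h3 : S ≤ (1 + 3e-6) * ((realAxis (axisBits p i)).2 * M.scale i))
    (h1' : |P' - (realAxis (axisBits p j)).1 * M.scale j| ≤
      ur * |(realAxis (axisBits p j)).1 * M.scale j|)
    (h2' : (realAxis (axisBits p j)).2 * M.scale j ≤ S')
    (h3' : S' ≤ (1 + 3e-6) * ((realAxis (axisBits p j)).2 * M.scale j)) :
    ‖(⟨S, S'⟩ : ℂ)‖ ≤ 0.5225 * ‖(⟨P, P'⟩ : ℂ)‖ ∨ 0.999 * ‖(⟨P, P'⟩ : ℂ)‖ ≤ ‖(⟨S, S'⟩ : ℂ)‖ := by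
  have hs := scale_pos M i
  have hs' := scale_pos M j
  have li := length_axisBits p i
  have lj := length_axisBits p j
  have hi := i.2
  have hj := j.2
  obtain ⟨ρ1, ρ2⟩ := scale_ratio M hij
  obtain ⟨m, e1, e2, e3⟩ := realAxis_fst (axisBits p i)
  obtain ⟨m', e1', e2', e3'⟩ := realAxis_fst (axisBits p j)
  have hη := realAxis_pos (axisBits p i)
  have hη' := realAxis_pos (axisBits p j)
  have hηη : (realAxis (axisBits p j)).2 = (realAxis (axisBits p i)).2 ∨
      (realAxis (axisBits p j)).2 = 2 * (realAxis (axisBits p i)).2 := by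
    rw [realAxis_snd, realAxis_snd]
    rcases (by omega : (axisBits p j).length = (axisBits p i).length ∨
      (axisBits p i).length = (axisBits p j).length + 1) with h | h
    · left; rw [h]
    · right; rw [h, ← zpow_one_add₀ (by norm_num)]; congr 1; push_cast; ring
  have hlen : (axisBits p i).length ≤ (axisBits p j).length + 1 := by omega
  have hnil : axisBits p i = [] → axisBits p j = [] := fun h => by
    rw [← List.length_eq_zero_iff] at h ⊢; omega
  have em' : axisBits p j = [] → m' = 0 := fun h => by rw [h] at e2'; simpa using e2'
  generalize (realAxis (axisBits p i)).1 = c at *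
  generalize (realAxis (axisBits p i)).2 = η at *
  generalize (realAxis (axisBits p j)).1 = c' at *
  generalize (realAxis (axisBits p j)).2 = η' at *
  generalize M.scale i = σ at *
  generalize M.scale j = σ' at *
  obtain ⟨a, ha⟩ : ∃ a, a = η * σ := ⟨_, rfl⟩
  obtain ⟨b, hb⟩ : ∃ b, b = η' * σ' := ⟨_, rfl⟩
  have ha0 : 0 < a := by rw [ha]; positivity
  have hb0 : 0 < b := by rw [hb]; positivity
  have eca : c * σ = m * a := by rw [e1, ha]; ring
  have ecb : c' * σ' = m' * b := by rw [e1', hb]; ring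
  rw [← ha] at h2 h3
  rw [← hb] at h2' h3'
  have q1 : 1.4139 * (η * σ') ≤ a := by rw [ha]; nlinarith
  have q2 : a ≤ 1.4145 * (η * σ') := by rw [ha]; nlinarith
  have hab : 0.70695 * b ≤ a ∧ a ≤ 1.4145 * b := by
    rcases hηη with h | h <;> rw [hb, h]
    · constructor
      · nlinarith [mul_pos hη hs']
      · exact q2
    · constructor
      · linarith
      · nlinarith [mul_pos hη hs']
  have hab1 : 0.4997 * b ^ 2 ≤ a ^ 2 := by
    have := pow_le_pow_left₀ (by positivity) hab.1 2; nlinarith [sq_nonneg b]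
  have hab2 : 0.4997 * a ^ 2 ≤ b ^ 2 := by
    have := pow_le_pow_left₀ ha0.le hab.2 2; nlinarith [sq_nonneg b]
  have hS0 : 0 ≤ S := ha0.le.trans h2
  have hS0' : 0 ≤ S' := hb0.le.trans h2'
  have nf : ‖(⟨P, P'⟩ : ℂ)‖ ^ 2 = P ^ 2 + P' ^ 2 := by
    rw [Complex.sq_norm, Complex.normSq_mk]; ring
  have ns : ‖(⟨S, S'⟩ : ℂ)‖ ^ 2 = S ^ 2 + S' ^ 2 := by
    rw [Complex.sq_norm, Complex.normSq_mk]; ring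
  have finish : S ^ 2 + S' ^ 2 ≤ 0.5225 ^ 2 * (P ^ 2 + P' ^ 2) →
      ‖(⟨S, S'⟩ : ℂ)‖ ≤ 0.5225 * ‖(⟨P, P'⟩ : ℂ)‖ := fun h => by
    rw [← sq_le_sq₀ (norm_nonneg _) (by positivity), mul_pow, nf, ns]; exact h
  by_cases hm : 1 < |m|
  · left
    have o1 : Odd m := e3.resolve_left fun h => by rw [h] at e2; simp at e2; simp [e2] at hm
    have o2 : Odd m' := e3'.resolve_left fun h => by
      rw [h] at hlen
      have : (2 : ℤ) ^ (axisBits p i).length ≤ 2 ^ 1 := pow_le_pow_right₀ (by norm_num) (by simpa using hlen)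
      omega
    exact finish (sq_ratio_bound ha0 hb0 hab1 (abs_ge_of_approx ha0 eca h1 (abs_ge_three_of_odd o1 hm))
      (by simpa using abs_ge_of_approx hb0 ecb h1' (abs_ge_one_of_odd o2)) hS0 hS0' h3 h3')
  by_cases hm' : 1 < |m'|
  · left
    have o2 : Odd m' := e3'.resolve_left fun h => by rw [em' h] at hm'; simp at hm'
    have o1 : Odd m := e3.resolve_left fun h => by rw [em' (hnil h)] at hm'; simp at hm'
    refine finish ?_
    rw [add_comm (S ^ 2), add_comm (P ^ 2)]
    exact sq_ratio_bound hb0 ha0 hab2 (abs_ge_of_approx hb0 ecb h1' (abs_ge_three_of_odd o2 hm'))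
      (by simpa using abs_ge_of_approx ha0 eca h1 (abs_ge_one_of_odd o1)) hS0' hS0 h3' h3
  · right
    have k1 := pow_le_pow_left₀ (by positivity) ((abs_le_of_approx ha0 hm eca h1).trans h2) 2
    have k2 := pow_le_pow_left₀ (by positivity) ((abs_le_of_approx hb0 hm' ecb h1').trans h2') 2
    rw [mul_pow, sq_abs] at k1 k2
    rw [← sq_le_sq₀ (by positivity) (norm_nonneg _), mul_pow, nf, ns]
    linarith

/-! ### The jets of a box -/

/-- The jet `J`, with centre `f` and linear coefficient `s` in the variable `k`, covers the
projection of the box of `p` to the coordinates `i` and `j`. -/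
structure BoxJet (M : Machine) (p : List Bool) (i j : Fin 6) (k : Fin 3) (J : ACJ) (f s : ℂ) :
    Prop where
  disc : DiscJet J f ‖s‖
  re_pos : 0 < s.re
  mem : ∀ v : ℂ, InAxis (axisBits p i) (v.re / M.scale i) → InAxis (axisBits p j) (v.im / M.scale j) →
    ‖v - f‖ ≤ ‖s‖
  rep : ∀ z : Fin 3 → ℂ, (∀ l, ‖z l‖ ≤ 1) → Rep M z J (f + s * z k)
  f_re : |f.re - (realAxis (axisBits p i)).1 * M.scale i| ≤ 1e-9
  f_im : |f.im - (realAxis (axisBits p j)).1 * M.scale j| ≤ 1e-9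
  s_re : (realAxis (axisBits p i)).2 * M.scale i ≤ s.re
  s_im : (realAxis (axisBits p j)).2 * M.scale j ≤ s.im

variable {p : List Bool} {i j : Fin 6} {k : Fin 3} {J : ACJ} {f s v : ℂ}

theorem abs_realAxis_fst_le (l : List Bool) : |(realAxis l).1| ≤ 4 := by
  obtain ⟨m, h1, h2, -⟩ := realAxis_fst l
  have h3 : |(m : ℝ)| ≤ 2 ^ l.length := by exact_mod_cast h2.le
  have h4 : (2 : ℝ) ^ l.length * (realAxis l).2 = 4 := by
    rw [realAxis_snd, ← zpow_natCast, ← zpow_add₀ (by norm_num)]; norm_num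
  have h5 := realAxis_pos l
  rw [h1, abs_mul, abs_of_pos h5, ← h4]
  gcongr

theorem boxJet_of_build (hp : p.length ≤ 200) (hij : j.val = i.val + 3) {d d' : Dbl × Dbl}
    (h1 : posSize M p i = some d) (h2 : posSize M p j = some d') {F0 F1 F2 : XComplex}
    (h : ACJ.build M ⟨d.1, d'.1⟩ F0 F1 F2 (const 0) = some J)
    (hF : (k = 0 ∧ F0 = ⟨d.2, d'.2⟩ ∧ F1 = .zero ∧ F2 = .zero) ∨
      (k = 1 ∧ F0 = .zero ∧ F1 = ⟨d.2, d'.2⟩ ∧ F2 = .zero) ∨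
      (k = 2 ∧ F0 = .zero ∧ F1 = .zero ∧ F2 = ⟨d.2, d'.2⟩)) :
    ∃ f s, BoxJet M p i j k J f s := by
  obtain ⟨P, S, c, η, rfl, nP, nS, rfl, rfl, a1, a2, a3⟩ := posSize_spec hp h1
  obtain ⟨P', S', c', η', rfl, nP', nS', rfl, rfl, b1, b2, b3⟩ := posSize_spec hp h2
  have hs : 0 < (realAxis (axisBits p i)).2 * M.scale i := mul_pos (realAxis_pos _) (scale_pos M i)
  have hs' : 0 < (realAxis (axisBits p j)).2 * M.scale j := mul_pos (realAxis_pos _) (scale_pos M j)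
  have m1 := abs_nonneg (P - (realAxis (axisBits p i)).1 * M.scale i)
  have m2 := abs_nonneg (P' - (realAxis (axisBits p j)).1 * M.scale j)
  have hf : IsC ⟨.fin P, .fin P'⟩ ⟨P, P'⟩ := ⟨rfl, rfl, nP, nP'⟩
  have hS : IsC ⟨.fin S, .fin S'⟩ ⟨S, S'⟩ := ⟨rfl, rfl, nS, nS'⟩
  have hd : ∃ c0 c1 c2 : ℂ, IsC F0 c0 ∧ IsC F1 c1 ∧ IsC F2 c2 ∧
      ‖c0‖ + (‖c1‖ + ‖c2‖) = ‖(⟨S, S'⟩ : ℂ)‖ ∧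
      ∀ z : Fin 3 → ℂ, c0 * z 0 + c1 * z 1 + c2 * z 2 = ⟨S, S'⟩ * z k := by
    rcases hF with ⟨rfl, rfl, rfl, rfl⟩ | ⟨rfl, rfl, rfl, rfl⟩ | ⟨rfl, rfl, rfl, rfl⟩
    · exact ⟨_, 0, 0, hS, isC_zero, isC_zero, by simp, by simp⟩
    · exact ⟨0, _, 0, isC_zero, hS, isC_zero, by simp, by simp⟩
    · exact ⟨0, 0, _, isC_zero, isC_zero, hS, by simp, by simp⟩
  obtain ⟨c0, c1, c2, i0, i1, i2, hsum, hlin⟩ := hd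
  obtain ⟨_, -, hJ⟩ := build_eq_some h
  have big : ∀ (l : Fin 6) {Q : ℝ}, |Q - (realAxis (axisBits p l)).1 * M.scale l| ≤
      ur * |(realAxis (axisBits p l)).1 * M.scale l| →
      |Q - (realAxis (axisBits p l)).1 * M.scale l| ≤ 1e-9 ∧ |Q| ≤ 7.9 := fun l Q hQ => by
    have e1 : |(realAxis (axisBits p l)).1 * M.scale l| ≤ 4 * 1.79 := by
      rw [abs_mul, abs_of_pos (scale_pos M l)]
      exact mul_le_mul (abs_realAxis_fst_le _) (scale_lt M l).le (scale_pos M l).le (by norm_num)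
    have hu : ur ≤ 1.2e-16 := by norm_num [ur_eq]
    have e2 : |Q - (realAxis (axisBits p l)).1 * M.scale l| ≤ 1.2e-16 * (4 * 1.79) :=
      hQ.trans (by gcongr)
    have := abs_sub_abs_le_abs_sub Q ((realAxis (axisBits p l)).1 * M.scale l)
    constructor <;> linarith
  obtain ⟨g1, g2⟩ := big i a1
  obtain ⟨g1', g2'⟩ := big j b1
  refine ⟨⟨P, P'⟩, ⟨S, S'⟩, ⟨by rwa [← hJ], by rw [← hJ], ⟨c0, c1, c2, by rwa [← hJ],
    by rwa [← hJ], by rwa [← hJ], hsum⟩, (Complex.norm_le_abs_re_add_abs_im _).trans (by linarith),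
    box_ratio hij a1 (by linarith) a3 b1 (by linarith) b3⟩, ?_, fun v hv hv' => ?_, fun z hz => ?_,
    g1, g1', ?_, ?_⟩
  · change 0 < S; linarith
  · have key : ∀ (l : Fin 6) {t Q T : ℝ}, InAxis (axisBits p l) (t / M.scale l) →
        (realAxis (axisBits p l)).2 * M.scale l + |Q - (realAxis (axisBits p l)).1 * M.scale l| ≤ T →
        |t - Q| ≤ T := fun l t Q T ht hQ => by
      have hσ := scale_pos M l
      obtain ⟨t1, t2⟩ := ht
      rw [le_div_iff₀ hσ] at t1
      rw [div_lt_iff₀ hσ] at t2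
      have := abs_le.1 (le_refl |Q - (realAxis (axisBits p l)).1 * M.scale l|)
      rw [abs_le]
      constructor <;> linarith
    have k1 := key i hv a2
    have k2 := key j hv' b2
    rw [← sq_le_sq₀ (norm_nonneg _) (norm_nonneg _), Complex.sq_norm, Complex.sq_norm,
      Complex.normSq_apply, Complex.normSq_mk]
    have k1' := abs_le.1 k1
    have k2' := abs_le.1 k2
    simp only [Complex.sub_re, Complex.sub_im]
    nlinarith
  · refine rep_of_build h hz (le_refl (0 : ℝ)) ?_
    rintro _ ⟨⟩ - - -
    refine ⟨_, _, _, _, hf, i0, i1, i2, ?_⟩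
    rw [add_assoc, add_assoc, ← add_assoc (c0 * z 0), hlin, sub_self, norm_zero]
  · change _ ≤ S; linarith
  · change _ ≤ S'; linarith

theorem alongJet_spec (hp : p.length ≤ 200) (h : alongJet M p = some J) :
    ∃ f s, BoxJet M p 0 3 0 J f s := by
  simp only [alongJet, bind_iff] at h
  obtain ⟨d, h1, d', h2, h⟩ := h
  exact boxJet_of_build hp rfl h1 h2 h (Or.inl ⟨rfl, rfl, rfl, rfl⟩)

theorem orthoJet_spec (hp : p.length ≤ 200) (h : orthoJet M p = some J) :
    ∃ f s, BoxJet M p 1 4 1 J f s := by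
  simp only [orthoJet, bind_iff] at h
  obtain ⟨d, h1, d', h2, h⟩ := h
  exact boxJet_of_build hp rfl h1 h2 h (Or.inr (Or.inl ⟨rfl, rfl, rfl, rfl⟩))

theorem whirleJet_spec (hp : p.length ≤ 200) (h : whirleJet M p = some J) :
    ∃ f s, BoxJet M p 2 5 2 J f s := by
  simp only [whirleJet, bind_iff] at h
  obtain ⟨d, h1, d', h2, h⟩ := h
  exact boxJet_of_build hp rfl h1 h2 h (Or.inr (Or.inr ⟨rfl, rfl, rfl, rfl⟩))

namespace BoxJet

theorem ne_zero (h : BoxJet M p i j k J f s) : s ≠ 0 := fun h0 => by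
  have := h.re_pos
  rw [h0] at this
  simp at this

theorem norm_coeff_le_one (_h : BoxJet M p i j k J f s) (hv : ‖v - f‖ ≤ ‖s‖) : ‖(v - f) / s‖ ≤ 1 := by
  rw [norm_div]; exact div_le_one_of_le₀ hv (norm_nonneg _)

theorem rep_of_eq (h : BoxJet M p i j k J f s) (hz : ∀ l, ‖z l‖ ≤ 1) (hk : z k = (v - f) / s) :
    Rep M z J v := by
  have := h.rep z hz
  rwa [hk, mul_div_cancel₀ _ h.ne_zero, add_sub_cancel] at this

theorem exists_rep (h : BoxJet M p i j k J f s) (hv : ‖v - f‖ ≤ ‖s‖) : ∃ z, Rep M z J v :=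
  ⟨fun _ => (v - f) / s, h.rep_of_eq (fun _ => h.norm_coeff_le_one hv) rfl⟩

end BoxJet

theorem exists_rep_of_mem {along ortho whirle : ACJ} {x : Fin 3 → ℂ} {f0 f1 f2 s0 s1 s2 : ℂ}
    (h0 : BoxJet M p 0 3 0 along f0 s0) (h1 : BoxJet M p 1 4 1 ortho f1 s1)
    (h2 : BoxJet M p 2 5 2 whirle f2 s2) (hx : x ∈ Z M p) : ∃ z, Rep M z along (x 0) ∧
    Rep M z ortho (x 1) ∧ Rep M z whirle (x 2) := by
  rw [mem_Z_iff (scale_pos M)] at hx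
  have k0 := h0.norm_coeff_le_one (h0.mem (x 0) (hx 0) (hx 3))
  have k1 := h1.norm_coeff_le_one (h1.mem (x 1) (hx 1) (hx 4))
  have k2 := h2.norm_coeff_le_one (h2.mem (x 2) (hx 2) (hx 5))
  have hz : ∀ l, ‖(![(x 0 - f0) / s0, (x 1 - f1) / s1, (x 2 - f2) / s2] : Fin 3 → ℂ) l‖ ≤ 1 := by
    intro l; fin_cases l
    exacts [k0, k1, k2]
  exact ⟨_, h0.rep_of_eq hz rfl, h1.rep_of_eq hz rfl, h2.rep_of_eq hz rfl⟩

/-! ### The visual angle -/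

theorem horizon_eq {s y : ℂ} (hs : s ^ 2 = -y) (hy : 0 ≤ y.re) : 1 - s ≠ 0 ∧ 1 + s ≠ 0 ∧
    (y * (y - 6) + 1 + (-4 * y + 4) * s) / ((y + 1) * (y + 1)) = ((1 + s) / (1 - s)) ^ 2 := by
  have h0 : (1 - s) * (1 + s) ≠ 0 := fun h => by
    have : y = -1 := by linear_combination h + hs
    rw [this] at hy; norm_num at hy
  obtain ⟨h1, h2⟩ := mul_ne_zero_iff.1 h0
  obtain rfl : y = -s ^ 2 := by rw [hs, neg_neg]
  refine ⟨h1, h2, ?_⟩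
  have h3 : -s ^ 2 + 1 ≠ 0 := by convert h0 using 1; ring
  rw [div_pow, div_eq_div_iff (mul_ne_zero h3 h3) (pow_ne_zero 2 h1)]
  ring

theorem cos_abs_arg_horizon {s y : ℂ} (hs : s ^ 2 = -y) (hy : 0 ≤ y.re) :
    Real.cos |Complex.arg (((1 + s) / (1 - s)) ^ 2)| * (1 + 2 * y.re + ‖y‖ ^ 2) =
      (‖y‖ - 1) ^ 2 - 2 * (‖y‖ + y.re) := by
  obtain ⟨h1, h2, -⟩ := horizon_eq hs hy
  obtain ⟨N, hN⟩ : ∃ N, N = (1 - s.re) ^ 2 + s.im ^ 2 := ⟨_, rfl⟩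
  have hN0 : 0 < N := by
    have := Complex.normSq_pos.2 h1
    rw [Complex.normSq_apply] at this
    simp at this
    rw [hN]; linarith
  have hr : ‖y‖ = s.re ^ 2 + s.im ^ 2 := by
    rw [← norm_neg, ← hs, norm_pow, Complex.sq_norm, Complex.normSq_apply]; ring
  have hre : y.re = s.im ^ 2 - s.re ^ 2 := by
    rw [← neg_neg y, ← hs, pow_two]; simp; ring
  have hq : (1 + s) / (1 - s) = ⟨(1 - ‖y‖) / N, 2 * s.im / N⟩ := by
    rw [div_eq_iff h1]
    apply Complex.ext <;> simp <;> field_simp <;> rw [hN] <;> (try rw [hr]) <;> ring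
  have hq0 : (1 + s) / (1 - s) ≠ 0 := div_ne_zero h2 h1
  rw [Real.cos_abs, Complex.cos_arg (pow_ne_zero 2 hq0), norm_pow, Complex.sq_norm]
  have hn := Complex.normSq_pos.2 hq0
  rw [hq] at hn ⊢
  rw [Complex.normSq_mk] at hn ⊢
  rw [div_mul_eq_mul_div, div_eq_iff hn.ne', pow_two (Complex.mk _ _)]
  simp only [Complex.mul_re]
  field_simp
  rw [hre, hr]
  ring

theorem cos_visualAngle (x : ℂ) : Real.cos (visualAngle x) * (1 + 2 * |x.re| + ‖x‖ ^ 2) =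
    (‖x‖ - 1) ^ 2 - 2 * (‖x‖ + |x.re|) := by
  have key : ∀ y : ℂ, 0 ≤ y.re → ‖y‖ = ‖x‖ → y.re = |x.re| →
      Real.cos |Complex.arg ((y * (y - 6) + 1 + (-4 * y + 4) * Complex.sqrt (-y)) / ((y + 1) * (y + 1)))| *
        (1 + 2 * |x.re| + ‖x‖ ^ 2) = (‖x‖ - 1) ^ 2 - 2 * (‖x‖ + |x.re|) := fun y hy h1 h2 => by
    have hs := Complex.sqrt_sq (-y)
    rw [(horizon_eq hs hy).2.2, ← h1, ← h2]
    exact cos_abs_arg_horizon hs hy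
  rw [visualAngle]
  split_ifs with h
  · exact key (-x) (by simpa using h.le) (norm_neg x) (by rw [abs_of_neg h]; rfl)
  · exact key x (not_lt.1 h) rfl (abs_of_nonneg (not_lt.1 h)).symm

theorem visualAngle_nonneg (x : ℂ) : 0 ≤ visualAngle x := abs_nonneg _

theorem visualAngle_le_pi (x : ℂ) : visualAngle x ≤ Real.pi := Complex.abs_arg_le_pi _

theorem abs_arg_eq_visualAngle {s y x : ℂ} (hs : s ^ 2 = -y) (hy : 0 ≤ y.re) (h1 : ‖y‖ = ‖x‖)
    (h2 : y.re = |x.re|) : |Complex.arg (((1 + s) / (1 - s)) ^ 2)| = visualAngle x := by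
  have h3 := cos_abs_arg_horizon hs hy
  rw [h1, h2] at h3
  have h4 : 0 < 1 + 2 * |x.re| + ‖x‖ ^ 2 := by positivity
  exact Real.injOn_cos ⟨abs_nonneg _, Complex.abs_arg_le_pi _⟩
    ⟨visualAngle_nonneg x, visualAngle_le_pi x⟩ (mul_right_cancel₀ h4.ne' (h3.trans (cos_visualAngle x).symm))

theorem abs_arg_lt {α η : ℂ} (hα : 0 < α.im) (h : α.re * |η.im| < α.im * η.re) :
    |Complex.arg η| < Complex.arg α := by
  by_contra hc
  push Not at hc
  have a1 := Complex.arg_nonneg_iff.2 hα.le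
  have a2 := Complex.abs_arg_le_pi η
  have e1 : α.re = ‖α‖ * Real.cos (Complex.arg α) := (Complex.norm_mul_cos_arg α).symm
  have e2 : α.im = ‖α‖ * Real.sin (Complex.arg α) := (Complex.norm_mul_sin_arg α).symm
  have e3 : η.re = ‖η‖ * Real.cos |Complex.arg η| := by rw [Real.cos_abs, Complex.norm_mul_cos_arg]
  have e4 : |η.im| = ‖η‖ * Real.sin |Complex.arg η| := by
    rw [← Real.abs_sin_eq_sin_abs_of_abs_le_pi a2, ← Complex.norm_mul_sin_arg, abs_mul, abs_norm]
  have h1 := Real.sin_nonpos_of_nonpos_of_neg_pi_le (x := Complex.arg α - |Complex.arg η|) (by linarith)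
    (by linarith)
  rw [Real.sin_sub] at h1
  rw [e1, e2, e3, e4] at h
  have := mul_nonneg (norm_nonneg α) (norm_nonneg η)
  nlinarith

theorem largerAngle_sound {x y : ACJ} {α η : ℂ} (hx : Rep M z x α) (hy : Rep M z y η) (hα : 0 < α.im)
    (hc : CentreLE y (2 ^ 20)) (h : largerAngle M x y = some true) : |Complex.arg η| < Complex.arg α := by
  refine abs_arg_lt hα ?_
  unfold largerAngle at h
  obtain ⟨o, h0, h⟩ := bind_iff.1 h
  have hz : Rep M z o (0 : ℝ) := rep_ofDbl isNormal_zero hx.hz h0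
  have tail : ∀ (xy : ACJ) (K : Option Bool), (x.imNeg >>= fun b => if b = true then K else
      (pure xy >>= fun xy => xy.imPos)) = some true → xy.imPos = some true := fun xy K h => by
    obtain ⟨b, h1, h⟩ := bind_iff.1 h
    cases b
    · exact h
    · exact absurd (hx.imNeg h1) (by linarith)
  have zero : o.imPos = some true → False := fun h => by simpa using hz.imPos h
  obtain ⟨p1, h1, h⟩ := bind_iff.1 h
  cases p1
  · exact (zero (tail o _ h)).elim
  obtain ⟨q1, i1, h⟩ := bind_iff.1 h
  have mid : ∀ xy : ACJ, (q1 = true → Rep M z xy (α / η)) → (q1 = false → xy = o) →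
      (∃ K : ACJ → Option Bool, (y.imNeg >>= fun b => if b = true then x.mul M y >>= (fun xy => x.imNeg >>= fun b =>
        if b = true then K xy else (pure xy >>= fun xy => xy.imPos)) else (pure xy >>= fun xy => x.imNeg >>=
        fun b => if b = true then K xy else (pure xy >>= fun xy => xy.imPos))) = some true) →
      α.re * |η.im| < α.im * η.re := by
    rintro xy hxy hxy' ⟨K, h⟩
    obtain ⟨q2, i2, h⟩ := bind_iff.1 h
    cases q2
    · have hp := tail xy _ h
      cases q1
      · rw [hxy' rfl] at hp; exact (zero hp).elim
      · have hp := (hxy rfl).imPos hp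
        have hi := hy.imPos i1
        have h0 : η ≠ 0 := by rintro rfl; simp at hi
        have hn := Complex.normSq_pos.2 h0
        rw [Complex.div_im, div_sub_div_same, div_pos_iff_of_pos_right hn] at hp
        rw [abs_of_pos hi]; linarith
    · obtain ⟨xy, i3, h⟩ := bind_iff.1 h
      have hp := (hx.mul hy i3).imPos (tail xy _ h)
      rw [Complex.mul_im] at hp
      rw [abs_of_neg (hy.imNeg i2)]; linarith
  cases q1
  · exact mid o (by simp) (fun _ => rfl) ⟨_, h⟩
  · obtain ⟨xy, i2, h⟩ := bind_iff.1 h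
    exact mid xy (fun _ => hx.div hy hc i2) (by simp) ⟨_, h⟩

/-! ### The jet of visual angles -/

/-- If the error of `x` is finite, then the modulus of its centre lies between `A` and `B`. -/
def CentreIn (x : ACJ) (A B : ℝ) : Prop :=
  ∀ e, x.e = .fin e → ∃ f, IsC x.f f ∧ A ≤ ‖f‖ ∧ ‖f‖ ≤ B

theorem CentreIn.le {A B : ℝ} (h : CentreIn x A B) : CentreLE x B := fun e g he hg => by
  obtain ⟨f, hf, -, h⟩ := h e he
  rwa [hg.unique hf]

theorem norm_bounds_of_sub_le {a c : ℂ} {A B : ℝ} (h : ‖a - c‖ ≤ 5 * ur * ‖a‖) (hA : A ≤ ‖a‖)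
    (hB : ‖a‖ ≤ B) : 0.99 * A ≤ ‖c‖ ∧ ‖c‖ ≤ 1.01 * B := by
  have h1 := norm_sub_norm_le c a
  have h2 := norm_sub_norm_le a c
  rw [norm_sub_rev] at h1
  have hu : 5 * ur ≤ 0.01 := by norm_num [ur_eq]
  have h3 := mul_le_mul_of_nonneg_right hu (norm_nonneg a)
  constructor <;> linarith

theorem CentreIn.mul {A B C D : ℝ} (hx : Rep M z x v) (hy : Rep M z y w) (h : x.mul M y = some r)
    (hB : CentreIn x A B) (hC : CentreIn y C D) (hC0 : 0 ≤ C) :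
    CentreIn r (0.99 * (A * C)) (1.01 * (B * D)) := by
  intro e he
  obtain ⟨a, b, σ, τ, f, f0, f1, f2, g, g0, g1, g2, c, c0, c1, c2, ha, hb, -, -, -, -, -, -,
    hf, -, -, -, hg, -, -, -, hc, -, -, -, -, -, -, -, h5, -⟩ := hx.mul_data hy h he
  obtain ⟨f', hf', p1, p2⟩ := hB a ha
  obtain ⟨g', hg', q1, q2⟩ := hC b hb
  obtain rfl := hf.unique hf'
  obtain rfl := hg.unique hg'
  rw [← norm_mul] at h5
  refine ⟨c, hc, norm_bounds_of_sub_le h5 ?_ ?_⟩ <;> rw [norm_mul] <;> gcongr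
  exact (norm_nonneg _).trans p2

theorem CentreIn.addD {A B C t : ℝ} (h : x.addD M (const t) = some r) (hB : CentreIn x A B)
    (hC : ∀ f, IsC x.f f → C ≤ ‖f + t‖) : CentreIn r (0.99 * C) (1.01 * (B + |t|)) := by
  intro e he
  simp only [ACJ.addD, bind_iff] at h
  obtain ⟨s, h1, e', h2, h3⟩ := h
  obtain ⟨_, -, rfl⟩ := build_eq_some h3
  cases he
  obtain ⟨_, _, ⟨⟩, h4, -⟩ := fmul_fin h2
  obtain ⟨a, b, ha, hb, -⟩ := fadd_fin h4
  obtain ⟨f, hf, -, hfB⟩ := hB a (Option.some.inj ha)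
  obtain ⟨c, hc, -, q⟩ := XComplex.addD_sound h1 hf (Option.some.inj hb)
  have hu := ur_pos
  refine ⟨c, hc, norm_bounds_of_sub_le (q.trans (by gcongr; linarith)) (hC f hf) ?_⟩
  refine (norm_add_le _ _).trans (add_le_add hfB ?_)
  rw [Complex.norm_real, Real.norm_eq_abs]

theorem CentreIn.subD {A B t : ℝ} (h : x.subD M (const t) = some r) (hB : CentreIn x A B) :
    CentreIn r (0.99 * 0) (1.01 * (B + |t|)) := by
  rw [← abs_neg]; exact CentreIn.addD h hB fun _ _ => norm_nonneg _

theorem CentreIn.mulD {A B t : ℝ} (h : x.mulD M (const t) = some r) (hB : CentreIn x A B) :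
    CentreIn r 0 (1.01 * (B * |t|)) := by
  intro e he
  simp only [ACJ.mulD, bind_iff] at h
  obtain ⟨s, h1, s0, h2, s1, h3, s2, h4, e', h5, h6⟩ := h
  obtain ⟨_, -, rfl⟩ := build_eq_some h6
  cases he
  obtain ⟨_, _, ⟨⟩, h7, -⟩ := fmul_fin h5
  obtain ⟨_, _, h8, h9, -⟩ := fadd_fin h7
  obtain ⟨a, _, ha, -, -⟩ := fmul_fin h8
  obtain ⟨b, -, -, -, hb, -⟩ := fin_of_sum4 h9
  obtain ⟨f, hf, -, hfB⟩ := hB a (Option.some.inj ha)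
  obtain ⟨c, hc, -, q⟩ := XComplex.mulD_sound h1 hf (Option.some.inj hb)
  refine ⟨c, hc, norm_nonneg _, CentreLE.of_norm_sub_le q ?_⟩
  rw [norm_mul, Complex.norm_real, Real.norm_eq_abs]
  gcongr

theorem DiscJet.centreIn {J : ACJ} {f : ℂ} {t : ℝ} (h : DiscJet J f t) : CentreIn J 0 16 :=
  fun _ _ => ⟨f, h.isC, norm_nonneg f, h.norm_le.trans (by norm_num)⟩

/-- The quotient in `horizon`, for a jet whose centre has nonnegative real part. -/
theorem horizon_quotient {o q1 den n h : ACJ} {f η δ : ℂ} {t : ℝ} (ho : DiscJet o f t)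
    (hf : 0 ≤ f.re) (hv : Rep M z o v) (hn : Rep M z n η) (hnB : CentreLE n 2000)
    (h1 : o.addD M (const 1) = some q1) (h2 : q1.mul M q1 = some den) (h3 : n.div M den = some h)
    (hδ : η / ((v + 1) * (v + 1)) = δ) : Rep M z h δ ∧ CentreLE h (2 ^ 20) := by
  have r1 : Rep M z q1 (v + 1) := by simpa using hv.addD h1
  have r2 := r1.mul r1 h2
  have c1 := ho.centreIn.addD h1 (C := 1) fun g hg => by
    rw [hg.unique ho.isC]
    refine le_trans ?_ (Complex.re_le_norm _)
    simpa using hf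
  have c2 := CentreIn.mul r1 r1 h2 c1 c1 (by norm_num)
  have c3 : CentreLE den (2 ^ 20) := c2.le.mono (by norm_num)
  refine ⟨hδ ▸ hn.div r2 c3 h3, fun e g he hg => ?_⟩
  obtain ⟨a, b, n', d, c, ha, hb, hn', hd, hc, -, hle⟩ := hn.div_centre r2 c3 h3 he
  obtain rfl := hg.unique hc
  obtain ⟨d', hd', l1, -⟩ := c2 b hb
  obtain rfl := hd.unique hd'
  have l2 := hnB a n' ha hn'
  rw [← norm_div] at hle
  have l3 := norm_le_of_norm_sub_le hle le_rfl le_rfl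
  have l4 : ‖n' / d‖ ≤ 2000 / (0.99 * (0.99 * 1 * (0.99 * 1))) := by
    rw [norm_div]; gcongr
  refine l3.trans ((mul_le_mul_of_nonneg_left l4 (by norm_num)).trans (by norm_num))

/-- The part of `horizon` after the choice of the sign. -/
def horizonOfRight (M : Machine) (ortho : ACJ) : Option ACJ := do
  let r ← (← ortho.mul M (← ortho.subD M (const 6))).addD M (const 1)
  let d ← (← (← ortho.mulD M (const (-4))).addD M (const 4)).mul M (← (← ortho.neg M).sqrt M)
  let x ← r.f.div d.f
  let h ← if ← some (const 0) <ᶠ some x.z.re then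
      (← r.add M d).div M (← (← ortho.addD M (const 1)).mul M (← ortho.addD M (const 1)))
    else
      (← r.sub M d).div M (← (← ortho.addD M (const 1)).mul M (← ortho.addD M (const 1)))
  if ← some ortho.f.re <ᶠ some (const (1 + eps)) *ᶠ (some ortho.size +ᶠ some ortho.e) then
    let err ← some (const (1 + eps)) *ᶠ (some h.size +ᶠ some h.e)
    ACJ.build M h.f .zero .zero .zero err
  else
    return h

theorem horizonOfRight_sound {o H : ACJ} {f : ℂ} {t : ℝ} (ho : DiscJet o f t) (hf : 0 ≤ f.re)
    (hv : Rep M z o v) (hv1 : 1 ≤ ‖v‖) (hre : 0 ≤ v.re) (h : horizonOfRight M o = some H) :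
    ∃ s : ℂ, s ^ 2 = -v ∧ Rep M z H (((1 + s) / (1 - s)) ^ 2) ∧ CentreLE H (2 ^ 20) := by
  unfold horizonOfRight at h
  obtain ⟨a1, h1, h⟩ := bind_iff.1 h
  obtain ⟨a2, h2, h⟩ := bind_iff.1 h
  obtain ⟨r, h3, h⟩ := bind_iff.1 h
  obtain ⟨b1, i1, h⟩ := bind_iff.1 h
  obtain ⟨b2, i2, h⟩ := bind_iff.1 h
  obtain ⟨b3, i3, h⟩ := bind_iff.1 h
  obtain ⟨b4, i4, h⟩ := bind_iff.1 h
  obtain ⟨d, i5, h⟩ := bind_iff.1 h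
  obtain ⟨x, -, h⟩ := bind_iff.1 h
  obtain ⟨b, -, h⟩ := bind_iff.1 h
  have c := ho.centreIn
  have r1 := hv.subD h1
  have c1 := c.subD h1
  have r2 := hv.mul r1 h2
  have c2 := CentreIn.mul hv r1 h2 c c1 (by norm_num)
  have r3 := r2.addD h3
  have c3 := (c2.addD h3 (C := 0) fun _ _ => norm_nonneg _).le
  have r4 := hv.mulD i1
  have r5 := r4.addD i2
  have c5 := ((c.mulD i1).addD i2 (C := 0) fun _ _ => norm_nonneg _).le
  have r6 := hv.neg i3
  obtain ⟨s, hs, r7⟩ := (ho.neg i3).hasSqrt r6 (by rwa [norm_neg]) b4 i4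
  have c7 := CentreLE.sqrt r6 i4 (ho.neg i3).centreLE (by norm_num)
  have r8 := r5.mul r7 i5
  have c8 := CentreLE.mul r5 r7 i5 c5 c7
  have hB : (1.01 : ℝ) * (1.01 * (1.01 * (16 * (1.01 * (16 + |6|))) + |1|) +
      1.01 * (1.01 * (1.01 * (16 * |-4|) + |4|) * (2 * 4))) ≤ 2000 := by norm_num [abs_of_nonneg]
  have key : ∀ j : ACJ, (∃ s : ℂ, s ^ 2 = -v ∧ Rep M z j (((1 + s) / (1 - s)) ^ 2) ∧
      CentreLE j (2 ^ 20)) → ((some o.f.re <ᶠ some (const (1 + eps)) *ᶠ (some o.size +ᶠ some o.e)) >>=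
      fun b => if b = true then (some (const (1 + eps)) *ᶠ (some j.size +ᶠ some j.e)) >>= fun err =>
        ACJ.build M j.f .zero .zero .zero err else pure j) = some H →
      ∃ s : ℂ, s ^ 2 = -v ∧ Rep M z H (((1 + s) / (1 - s)) ^ 2) ∧ CentreLE H (2 ^ 20) := by
    rintro j ⟨s, hs, hj, hjc⟩ h
    obtain ⟨b, -, h⟩ := bind_iff.1 h
    cases b
    · cases h; exact ⟨s, hs, hj, hjc⟩
    obtain ⟨err, k1, k2⟩ := bind_iff.1 h
    refine ⟨s, hs, rep_of_build k2 hj.hz (ubo_guard hj.size_nonneg hj.nonneg err k1) ?_, ?_⟩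
    · rintro e rfl - - -
      obtain ⟨σ, a, hσ, ha, -, -, hle, -⟩ := guard_fin hj.size_nonneg hj.nonneg k1
      obtain ⟨c, hc, hcv⟩ := hj.norm_sub_le ha hσ
      exact ⟨c, 0, 0, 0, hc, isC_zero, isC_zero, isC_zero, by simpa using hcv.trans hle⟩
    · obtain ⟨_, -, rfl⟩ := build_eq_some k2
      rintro e g rfl hg
      obtain ⟨σ, a, hσ, ha, -, -, hle, -⟩ := guard_fin hj.size_nonneg hj.nonneg k1
      exact hjc a g ha hg
  cases b
  · obtain ⟨n, j1, h⟩ := bind_iff.1 h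
    obtain ⟨q1, j2, h⟩ := bind_iff.1 h
    obtain ⟨q2, j3, h⟩ := bind_iff.1 h
    obtain rfl := Option.some.inj (j2.symm.trans j3)
    obtain ⟨den, j4, h⟩ := bind_iff.1 h
    obtain ⟨j, j5, h⟩ := bind_iff.1 h
    refine key j ⟨-s, by rw [neg_sq, hs], horizon_quotient ho hf hv (r3.sub r8 j1)
      ((CentreLE.sub r3 r8 j1 c3 c8).mono hB) j2 j4 j5 ?_⟩ h
    rw [← (horizon_eq (by rw [neg_sq, hs]) hre).2.2]
    push_cast; congr 1; ring
  · obtain ⟨n, j1, h⟩ := bind_iff.1 h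
    obtain ⟨q1, j2, h⟩ := bind_iff.1 h
    obtain ⟨q2, j3, h⟩ := bind_iff.1 h
    obtain rfl := Option.some.inj (j2.symm.trans j3)
    obtain ⟨den, j4, h⟩ := bind_iff.1 h
    obtain ⟨j, j5, h⟩ := bind_iff.1 h
    refine key j ⟨s, hs, horizon_quotient ho hf hv (r3.add r8 j1)
      ((CentreLE.add r3 r8 j1 c3 c8).mono hB) j2 j4 j5 ?_⟩ h
    rw [← (horizon_eq hs hre).2.2]
    push_cast; congr 1; ring

/-- What `largerAngle` certifies about the visual angles of a box. -/
theorem visualAngle_lt {p : List Bool} {J H A : ACJ} {f s α : ℂ} (hJ : BoxJet M p 1 4 1 J f s)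
    (hH : horizon M J = some H) (hA : ∀ z : Fin 3 → ℂ, (∀ l, ‖z l‖ ≤ 1) → Rep M z A α)
    (hα : 0 < α.im) (h : largerAngle M A H = some true) (hv : ‖v - f‖ ≤ ‖s‖) (hv1 : 1 ≤ ‖v‖) :
    visualAngle v < Complex.arg α := by
  have refl : ∀ g u : ℂ, 0 ≤ g.re → ∃ y : ℂ, y.re = |u.re| ∧ ‖y‖ = ‖u‖ ∧ ‖y - g‖ ≤ ‖u - g‖ := by
    intro g u hg
    have n : ‖(⟨|u.re|, u.im⟩ : ℂ)‖ = ‖u‖ := by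
      rw [← sq_eq_sq₀ (norm_nonneg _) (norm_nonneg _), Complex.sq_norm, Complex.sq_norm,
        Complex.normSq_mk, Complex.normSq_apply, abs_mul_abs_self]
    refine ⟨⟨|u.re|, u.im⟩, rfl, n, ?_⟩
    rw [← sq_le_sq₀ (norm_nonneg _) (norm_nonneg _), Complex.sq_norm, Complex.sq_norm,
      Complex.normSq_apply, Complex.normSq_apply]
    simp only [Complex.sub_re, Complex.sub_im]
    nlinarith [abs_mul_abs_self u.re, mul_le_mul_of_nonneg_right (le_abs_self u.re) hg]
  have fin : ∀ (o : ACJ) (y g : ℂ) (z : Fin 3 → ℂ), DiscJet o g ‖s‖ → 0 ≤ g.re → y.re = |v.re| →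
      ‖y‖ = ‖v‖ → Rep M z o y → horizonOfRight M o = some H → visualAngle v < Complex.arg α := by
    intro o y g z hd hg hre hn hr h'
    have hy0 : 0 ≤ y.re := hre ▸ abs_nonneg _
    obtain ⟨t, ht, k1, k2⟩ := horizonOfRight_sound hd hg hr (hn ▸ hv1) hy0 h'
    rw [← abs_arg_eq_visualAngle ht hy0 hn hre]
    exact largerAngle_sound (hA z hr.hz) k1 hα k2 h
  unfold horizon at hH
  obtain ⟨b, hb, hH⟩ := bind_iff.1 hH
  rw [hJ.disc.isC.re] at hb
  cases b
  · have hf : 0 ≤ f.re := by simpa [flt, Dbl.lt] using hb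
    obtain ⟨y, h1, h2, h3⟩ := refl f v hf
    obtain ⟨z, hz⟩ := hJ.exists_rep (h3.trans hv)
    exact fin J y f z hJ.disc hf h1 h2 hz hH
  · have hf : f.re < 0 := by simpa [flt, Dbl.lt] using hb
    obtain ⟨o, ho, hH⟩ := bind_iff.1 hH
    obtain ⟨y, h1, h2, h3⟩ := refl (-f) (-v) (by simpa using hf.le)
    obtain ⟨z, hz⟩ := hJ.exists_rep (v := -y) (by
      rw [← norm_neg, show -(-y - f) = y - -f by ring]
      exact h3.trans (by rwa [← norm_neg, show -(-v - -f) = v - f by ring]))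
    have := hz.neg ho
    rw [neg_neg] at this
    exact fin o y (-f) z (hJ.disc.neg ho) (by simpa using hf.le) (by simpa using h1) (by simpa using h2)
      this hH

/-! ### The angle bounds -/

/-- The jet `A` stands for the constant `α`. -/
def IsConst (M : Machine) (A : ACJ) (α : ℂ) : Prop :=
  ∀ z : Fin 3 → ℂ, (∀ l, ‖z l‖ ≤ 1) → Rep M z A α

theorem isConst_of_build {f : XComplex} {A : ACJ} {α c : ℂ} {e : ℝ} (hf : IsC f c) (he : ‖α - c‖ ≤ e)
    (h : ACJ.build M f .zero .zero .zero (.fin e) = some A) : IsConst M A α := fun z hz => by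
  refine rep_of_build h hz ((norm_nonneg _).trans he) ?_
  rintro _ ⟨⟩ - - -
  exact ⟨c, 0, 0, 0, hf, isC_zero, isC_zero, isC_zero, by simpa using he⟩

/-- The direction of the angle `vol3`. -/
abbrev vol3Val : ℂ := -0.3933 + 0.91942 * Complex.I

/-- The direction of the angle `third`. -/
abbrev thirdVal : ℂ := ⟨-1 / 2, √(3 / 4)⟩

theorem vol3Val_re : vol3Val.re = -0.3933 := by norm_num [vol3Val, Complex.div_re]

theorem vol3Val_im : vol3Val.im = 0.91942 := by norm_num [vol3Val, Complex.div_im, Complex.div_re]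

theorem arg_thirdVal : Complex.arg thirdVal = 2 * Real.pi / 3 := by
  have hc : Real.cos (2 * Real.pi / 3) = -1 / 2 := by
    rw [show 2 * Real.pi / 3 = Real.pi - Real.pi / 3 by ring, Real.cos_pi_sub, Real.cos_pi_div_three]
    norm_num
  have hs : Real.sin (2 * Real.pi / 3) = √(3 / 4) := by
    rw [show 2 * Real.pi / 3 = Real.pi - Real.pi / 3 by ring, Real.sin_pi_sub, Real.sin_pi_div_three,
      Real.sqrt_div (by norm_num), show (4 : ℝ) = 2 ^ 2 by norm_num, Real.sqrt_sq (by norm_num)]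
  have := Real.pi_pos
  have h := Complex.arg_cos_add_sin_mul_I (θ := 2 * Real.pi / 3) ⟨by linarith, by linarith⟩
  rw [← Complex.ofReal_cos, ← Complex.ofReal_sin, hc, hs] at h
  rw [← h]
  congr 1
  apply Complex.ext <;> simp

theorem arg_vol3Val_lt : Complex.arg vol3Val < 2 * Real.pi / 3 := by
  rw [← arg_thirdVal]
  refine (le_abs_self _).trans_lt (abs_arg_lt (by simp) ?_)
  have : √(3 / 4) ≤ 1 := Real.sqrt_le_one.2 (by norm_num)
  rw [vol3Val_re, vol3Val_im, abs_of_pos (by norm_num)]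
  linarith

theorem arg_I_lt : Complex.arg Complex.I < Complex.arg vol3Val := by
  refine (le_abs_self _).trans_lt (abs_arg_lt (by rw [vol3Val_im]; norm_num) ?_)
  rw [vol3Val_re, vol3Val_im]
  norm_num

theorem isConst_quarter {A : ACJ} (h : quarter M = some A) : IsConst M A Complex.I :=
  isConst_of_build (c := Complex.I) ⟨rfl, rfl, isNormal_zero, isNormal_one⟩ (by simp) h

theorem isNormal_of_le {x : ℝ} (h : 0.001 ≤ |x|) : IsNormal x :=
  Or.inr ((zpow_le_zpow_right₀ (n := -10) (by norm_num) (by norm_num)).trans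
    (le_trans (by norm_num) h))

theorem isConst_third {A : ACJ} (h : third M = some A) : IsConst M A thirdVal := by
  simp only [third, bind_iff] at h
  obtain ⟨im, h1, h⟩ := h
  obtain ⟨_, ⟨⟩, h2⟩ := fsqrt_eq_some h1
  rw [Dbl.sqrt, if_neg (by norm_num)] at h2
  have h3 : √(3 / 4) ≤ 1 := Real.sqrt_le_one.2 (by norm_num)
  have h0 := Real.sqrt_nonneg (3 / 4)
  obtain ⟨b, rfl, hb⟩ := flEq_of_abs_le (by rw [abs_of_nonneg h0]; linarith) h2
  refine isConst_of_build (c := ⟨-1 / 2, b⟩) ⟨rfl, rfl, isNormal_of_le (by norm_num [abs_of_neg]),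
    hb.isNormal⟩ ?_ h
  have h4 := hb.abs_sub_le
  rw [abs_of_nonneg h0] at h4
  have hu := ur_pos
  refine (norm_le_re_im _).trans ?_
  rw [Complex.sub_re, Complex.sub_im, sub_self, abs_zero, zero_add, abs_sub_comm, eps_eq]
  nlinarith

theorem isConst_vol3 {A : ACJ} (h : vol3 M = some A) : IsConst M A vol3Val := by
  simp only [vol3, bind_iff] at h
  obtain ⟨e, h1, h⟩ := h
  obtain ⟨_, _, ⟨⟩, ⟨⟩, h2⟩ := fmul_eq_some h1
  have hu := ur_pos
  have hu1 : ur ≤ 1e-9 := by norm_num [ur_eq]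
  have a1 := abs_le.1 (abs_round53_sub_le 1.415)
  rw [abs_of_pos (by norm_num)] at a1
  have a2 : 0 ≤ round53 1.415 * eps := mul_nonneg (round53_nonneg (by norm_num)) eps_nonneg
  obtain ⟨b, rfl, hb⟩ := flEq_of_abs_le (by
    rw [abs_of_nonneg a2, eps_eq]; nlinarith) h2
  have a3 := abs_round53_sub_le 0.3933
  have a4 := abs_round53_sub_le 0.91942
  rw [abs_of_pos (a := (0.3933 : ℝ)) (by norm_num)] at a3
  rw [abs_of_pos (a := (0.91942 : ℝ)) (by norm_num)] at a4
  refine isConst_of_build (c := ⟨-round53 0.3933, round53 0.91942⟩) ⟨rfl, rfl,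
    (isNormal_of_le (by norm_num [abs_of_pos])).round53.neg,
    (isNormal_of_le (by norm_num [abs_of_pos])).round53⟩ ?_ h
  refine (norm_le_re_im _).trans ?_
  have a5 := hb.ge a2
  rw [Complex.sub_re, Complex.sub_im, vol3Val_re, vol3Val_im, abs_sub_comm (0.91942 : ℝ),
    show (-0.3933 : ℝ) - -round53 0.3933 = round53 0.3933 - 0.3933 by ring]
  refine (add_le_add a3 a4).trans ?_
  rw [eps_eq] at a5
  have a6 : 1.414 * (2 * ur) ≤ round53 1.415 * (2 * ur) := by gcongr; linarith
  nlinarith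

/-- What a position says about the bound for the visual angle: the jet `A` stands for an angle that
is at most `vol3`, or it stands for `third` and a hole with this angle agrees with `p`. -/
def IsBound (M : Machine) (p : List Bool) (A : ACJ) : Prop :=
  ∃ α : ℂ, IsConst M A α ∧ 0 < α.im ∧ Complex.arg α ≤ 2 * Real.pi / 3 ∧
    (Complex.arg α ≤ Complex.arg vol3Val ∨ ∃ h ∈ holes, h.isVol3 = false ∧ h.matches p = true)

theorem isBound_quarter {p : List Bool} {A : ACJ} (h : quarter M = some A) : IsBound M p A :=
  ⟨_, isConst_quarter h, by simp, arg_I_lt.le.trans arg_vol3Val_lt.le, Or.inl arg_I_lt.le⟩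

theorem isBound_maxAngle {p : List Bool} {A : ACJ} {h : Hole} (hh : h ∈ holes)
    (hm : h.matches p = true) (hA : h.maxAngle M = some A) : IsBound M p A := by
  rw [Hole.maxAngle] at hA
  split_ifs at hA with h3
  · exact ⟨_, isConst_vol3 hA, by rw [vol3Val_im]; norm_num, arg_vol3Val_lt.le, Or.inl le_rfl⟩
  · exact ⟨_, isConst_third hA, by simp, arg_thirdVal.le, Or.inr ⟨h, hh, by simpa using h3, hm⟩⟩

/-! ### The exceptional boxes -/

/-- The centre of an interval, as a multiple of its half-length. -/
def axisNum (l : List Bool) : ℤ := l.foldl (fun a b => 2 * a + if b then 1 else -1) 0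

theorem realAxis_fst_eq (l : List Bool) : (realAxis l).1 = axisNum l * (realAxis l).2 := by
  induction l using List.reverseRecOn with
  | nil => simp [realAxis, axisNum]
  | append_singleton l b ih =>
    rw [realAxis_append, axisNum, List.foldl_append, ← axisNum]
    cases b <;> simp [ih] <;> ring

theorem holes_bounds : ∀ h ∈ holes, 12 ≤ (axisBits h.position 1).length ∧
    12 ≤ (axisBits h.position 4).length ∧ h.position.length ≤ 200 ∧
    1200 ≤ |axisNum ((axisBits h.position 4).take 12)| ∧
    25202 * (|axisNum ((axisBits h.position 1).take 12)| + 1) ^ 2 +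
      12603 * (|axisNum ((axisBits h.position 4).take 12)| + 1) ^ 2 < 9 * 1024 ^ 2 * 10000 := by
  decide +kernel

theorem InAxis.abs_bounds {l : List Bool} {t : ℝ} (h : InAxis l t) (hl : 12 ≤ l.length) :
    |(axisNum (l.take 12) : ℝ)| - 1 ≤ 1024 * |t| ∧ 1024 * |t| ≤ |(axisNum (l.take 12) : ℝ)| + 1 := by
  rw [← List.take_append_drop 12 l] at h
  have := h.of_append
  rw [InAxis, realAxis_fst_eq, realAxis_snd, List.length_take_of_le hl] at this
  norm_num at this
  obtain ⟨h1, h2⟩ := this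
  have h3 : |1024 * t - (axisNum (l.take 12) : ℝ)| ≤ 1 := by rw [abs_le]; constructor <;> linarith
  have h4 := abs_sub_abs_le_abs_sub (1024 * t) (axisNum (l.take 12))
  have h5 := abs_sub_abs_le_abs_sub (axisNum (l.take 12) : ℝ) (1024 * t)
  rw [abs_sub_comm] at h5
  rw [abs_mul, abs_of_pos (show (0 : ℝ) < 1024 by norm_num)] at h4 h5
  constructor <;> linarith

theorem norm_bounds_of_mem_hole {h : Hole} (hh : h ∈ holes) {y : Fin 3 → ℂ}
    (hy : y ∈ Z M h.position) : 1 < ‖y 1‖ ∧ ‖y 1‖ < 3 := by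
  obtain ⟨l1, l4, -, b1, b2⟩ := holes_bounds h hh
  rw [mem_Z_iff (scale_pos M)] at hy
  have a1 := ((hy 1).abs_bounds l1).2
  obtain ⟨a3, a4⟩ := (hy 4).abs_bounds l4
  obtain ⟨-, s1⟩ := scale_bounds M 1
  obtain ⟨s2, s3⟩ := scale_bounds M 4
  have p1 := scale_pos M 1
  have p4 := scale_pos M 4
  simp only [coord, Matrix.cons_val, abs_div, abs_of_pos p1, abs_of_pos p4] at a1 a3 a4 s1 s2 s3
  have b1' : (1200 : ℝ) ≤ |(axisNum ((axisBits h.position 4).take 12) : ℝ)| := by exact_mod_cast b1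
  have b2' : 25202 * (|(axisNum ((axisBits h.position 1).take 12) : ℝ)| + 1) ^ 2 +
      12603 * (|(axisNum ((axisBits h.position 4).take 12) : ℝ)| + 1) ^ 2 <
      9 * 1024 ^ 2 * 10000 := by exact_mod_cast b2
  generalize |(axisNum ((axisBits h.position 1).take 12) : ℝ)| = m at *
  generalize |(axisNum ((axisBits h.position 4).take 12) : ℝ)| = n at *
  rw [← mul_div_assoc, div_le_iff₀ p1] at a1
  rw [← mul_div_assoc, le_div_iff₀ p4] at a3
  rw [← mul_div_assoc, div_le_iff₀ p4] at a4
  have m0 : 0 ≤ m + 1 := by nlinarith [abs_nonneg (y 1).re]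
  constructor
  · refine lt_of_lt_of_le ?_ (Complex.abs_im_le_norm _)
    nlinarith
  · have a1' : 1024 * |(y 1).re| ≤ (m + 1) * 1.5875 := a1.trans (by gcongr)
    have a4' : 1024 * |(y 1).im| ≤ (n + 1) * 1.1226 := a4.trans (by gcongr)
    have q1 := pow_le_pow_left₀ (by positivity) a1' 2
    have q2 := pow_le_pow_left₀ (by positivity) a4' 2
    rw [mul_pow, sq_abs] at q1 q2
    rw [← sq_lt_sq₀ (norm_nonneg _) (by norm_num), Complex.sq_norm, Complex.normSq_apply]
    nlinarith [sq_nonneg (m + 1), sq_nonneg (n + 1)]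

/-- The digits of the exceptional boxes of the two kinds differ early. -/
theorem length_le_of_matches {h h' : Hole} {p : List Bool} (hh : h ∈ holes) (hh' : h' ∈ holes)
    (h3 : h.isVol3 = true) (h3' : h'.isVol3 = false) (hm : h.matches p = true)
    (hm' : h'.matches p = true) : p.length ≤ 12 := by
  have key : ∀ h ∈ holes, ∀ h' ∈ holes, h.isVol3 = true → h'.isVol3 = false →
      ∃ j ∈ List.range 13, j % 3 = 0 ∧ j < h.position.length ∧ j < h'.position.length ∧
        h.position.getD j false ≠ h'.position.getD j false := by decide +kernel
  obtain ⟨j, hj, j3, l, l', hne⟩ := key h hh h' hh' h3 h3'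
  rw [List.mem_range] at hj
  by_contra hc
  have get : ∀ g : Hole, g.matches p = true → j < g.position.length →
      p.getD j false = g.position.getD j false := fun g hg hl => by
    have := List.all_eq_true.1 hg j (List.mem_range.2 (lt_min hl (by omega)))
    simpa [j3] using this
  exact hne ((get h hm l).symm.trans (get h' hm' l'))

theorem minD_spec {h : Hole} (hh : h ∈ holes) {d : Dbl} (hd : h.minD M = some d) :
    ∃ a, d = .fin a ∧ ∀ y ∈ Z M h.position, a ≤ ‖y 1‖ := by
  obtain ⟨J, h1, h2⟩ := bind_iff.1 hd
  obtain ⟨f, s, hJ⟩ := orthoJet_spec (holes_bounds h hh).2.2.1 h1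
  have hc : CentreLE J (2 ^ 43) := hJ.disc.centreLE.mono (by norm_num)
  obtain ⟨a, rfl, -⟩ := (hJ.rep 0 (by simp)).absLB_fin hc h2
  refine ⟨a, rfl, fun y hy => ?_⟩
  rw [mem_Z_iff (scale_pos M)] at hy
  obtain ⟨z, hz⟩ := hJ.exists_rep (hJ.mem (y 1) (hy 1) (hy 4))
  obtain ⟨_, ⟨⟩, -, h⟩ := hz.absLB_fin hc h2
  exact h

theorem coversHoleLoop_spec {p : List Bool} {g : Hole} {y : Fin 3 → ℂ} (hg : g ∈ holes)
    (hy : y ∈ Z M g.position) (hgp : g.matches p = true)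
    (hp : ∀ h ∈ holes, h.isVol3 = true → p ≠ h.position) (hs : List Hole) :
    hs ⊆ holes → ∀ (m : ℝ) (A : ACJ) (res : Option (Dbl × ACJ)), IsBound M p A →
      (g ∈ hs ∨ m ≤ ‖y 1‖) → coversHoleLoop M p hs (.fin m) A = some res →
      ∃ m' A', res = some (.fin m', A') ∧ m' ≤ ‖y 1‖ ∧ IsBound M p A' := by
  induction hs with
  | nil =>
    intro _ m A res hA hm h
    have hm : m ≤ ‖y 1‖ := by simpa using hm
    have h3 := (norm_bounds_of_mem_hole hg hy).2
    rw [coversHoleLoop] at h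
    obtain ⟨b, hb, h⟩ := bind_iff.1 h
    obtain rfl : b = true := by
      simpa [fle, Dbl.le, (hm.trans_lt h3).le] using hb.symm
    cases h
    exact ⟨m, A, rfl, hm, hA⟩
  | cons h hs ih =>
    intro hsub m A res hA hm hl
    have hh := hsub List.mem_cons_self
    have hsub' := (List.cons_subset.1 hsub).2
    rw [coversHoleLoop] at hl
    obtain ⟨hd, h1, hl⟩ := bind_iff.1 hl
    obtain ⟨ha, h2, hl⟩ := bind_iff.1 hl
    rw [if_neg (by
      simp only [Bool.and_eq_true, beq_iff_eq, not_and]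
      exact hp h hh)] at hl
    obtain ⟨a, rfl, hay⟩ := minD_spec hh h1
    split_ifs at hl with hmt
    · obtain ⟨b, hb, hl⟩ := bind_iff.1 hl
      have rest : ∀ m', (m' ≤ a ∧ m' ≤ m) → ((largerAngle M ha A) >>= fun b => if b = true then
          (pure ha >>= fun A' => coversHoleLoop M p hs (.fin m') A') else
          (pure A >>= fun A' => coversHoleLoop M p hs (.fin m') A')) = some res →
          ∃ m' A', res = some (.fin m', A') ∧ m' ≤ ‖y 1‖ ∧ IsBound M p A' := by
        rintro m' ⟨k1, k2⟩ hl
        obtain ⟨b, -, hl⟩ := bind_iff.1 hl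
        have hm' : g ∈ hs ∨ m' ≤ ‖y 1‖ := by
          rcases hm with hm | hm
          · rcases List.mem_cons.1 hm with rfl | hm
            · exact Or.inr (k1.trans (hay y hy))
            · exact Or.inl hm
          · exact Or.inr (k2.trans hm)
        cases b
        · exact ih hsub' m' A res hA hm' hl
        · exact ih hsub' m' ha res (isBound_maxAngle hh hmt h2) hm' hl
      have hb' : decide (a < m) = b := by simpa [flt, Dbl.lt] using hb
      cases b
      · exact rest m ⟨not_lt.1 (by simpa using hb'), le_rfl⟩ hl
      · exact rest a ⟨le_rfl, (by simpa using hb' : a < m).le⟩ hl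
    · refine ih hsub' m A res hA (hm.imp_left fun hm => ?_) hl
      rcases List.mem_cons.1 hm with rfl | hm
      · exact absurd hgp hmt
      · exact hm

variable {M : Machine} {p : List Bool} {J : ACJ} {f s v : ℂ}

/-! ### Visual angles in large boxes -/

theorem two_thirds_le_visualAngle (h : 3 * ‖v‖ ^ 2 - 8 * ‖v‖ + 3 ≤ 2 * |v.re|) :
    2 * Real.pi / 3 ≤ visualAngle v := by
  by_contra hc
  push Not at hc
  have h1 := Real.cos_lt_cos_of_nonneg_of_le_pi (visualAngle_nonneg v)
    (by linarith [Real.pi_pos]) hc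
  rw [show 2 * Real.pi / 3 = Real.pi - Real.pi / 3 by ring, Real.cos_pi_sub,
    Real.cos_pi_div_three] at h1
  have h2 := cos_visualAngle v
  have h3 : 0 < 1 + 2 * |v.re| + ‖v‖ ^ 2 := by positivity
  nlinarith

theorem visualAngle_lt_vol3 (h : 3.88 ≤ ‖v‖) : visualAngle v < Complex.arg vol3Val := by
  by_contra hc
  push Not at hc
  have h1 := Real.cos_le_cos_of_nonneg_of_le_pi
    (Complex.arg_nonneg_iff.2 (by rw [vol3Val_im]; norm_num)) (visualAngle_le_pi v) hc
  have hV : 0 < Complex.normSq vol3Val ∧ Complex.normSq vol3Val < 1.0001 := by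
    rw [Complex.normSq_apply, vol3Val_re, vol3Val_im]; norm_num
  have hn : ‖vol3Val‖ < 1.0001 := by
    rw [← sq_lt_sq₀ (norm_nonneg _) (by norm_num), Complex.sq_norm]; exact hV.2.trans (by norm_num)
  have hn1 : (1 : ℝ) ≤ ‖vol3Val‖ := by
    rw [← sq_le_sq₀ (by norm_num) (norm_nonneg _), Complex.sq_norm, Complex.normSq_apply, vol3Val_re,
      vol3Val_im]; norm_num
  have h2 : Real.cos (Complex.arg vol3Val) ≤ -0.39 := by
    rw [Complex.cos_arg (Complex.normSq_pos.1 hV.1), vol3Val_re, div_le_iff₀ (by linarith)]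
    linarith
  have h3 := cos_visualAngle v
  have h4 := Complex.abs_re_le_norm v
  have h5 : 0 ≤ 1 + 2 * |v.re| + ‖v‖ ^ 2 := by positivity
  nlinarith [mul_le_mul_of_nonneg_right (h1.trans h2) h5]

theorem exists_visualAngle_ge (hJ : BoxJet M p 1 4 1 J f s) {a b P Q S T R : ℝ}
    (hP : |a - |(realAxis (axisBits p 1)).1| * M.scale 1| ≤ P)
    (hQ : |b - |(realAxis (axisBits p 4)).1| * M.scale 4| ≤ Q)
    (hS : S ≤ (realAxis (axisBits p 1)).2 * M.scale 1)
    (hT : T ≤ (realAxis (axisBits p 4)).2 * M.scale 4) (hS0 : 0 ≤ S) (hT0 : 0 ≤ T)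
    (hd : (P + 1e-9) ^ 2 + (Q + 1e-9) ^ 2 ≤ S ^ 2 + T ^ 2) (ha : 0 ≤ a) (h1 : 1 ≤ a ^ 2 + b ^ 2)
    (hR0 : 0 ≤ R) (hR : a ^ 2 + b ^ 2 ≤ R ^ 2) (hR' : 3 * R ^ 2 - 8 * R + 3 ≤ 2 * a) :
    ∃ v, ‖v - f‖ ≤ ‖s‖ ∧ 1 ≤ ‖v‖ ∧ 2 * Real.pi / 3 ≤ visualAngle v := by
  have sgn : ∀ c a σ g P : ℝ, |a - |c| * σ| ≤ P → |g - c * σ| ≤ 1e-9 →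
      ∃ a', |a'| = |a| ∧ |a' - g| ≤ P + 1e-9 := by
    intro c a σ g P h1 h2
    rw [abs_le] at h1 h2
    rcases le_total 0 c with hc | hc
    · rw [abs_of_nonneg hc] at h1
      exact ⟨a, rfl, abs_le.2 ⟨by linarith, by linarith⟩⟩
    · rw [abs_of_nonpos hc] at h1
      exact ⟨-a, abs_neg a, abs_le.2 ⟨by linarith, by linarith⟩⟩
  obtain ⟨a', e1, l1⟩ := sgn _ _ _ _ _ hP hJ.f_re
  obtain ⟨b', e2, l2⟩ := sgn _ _ _ _ _ hQ hJ.f_im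
  have n : ‖(⟨a', b'⟩ : ℂ)‖ ^ 2 = a ^ 2 + b ^ 2 := by
    rw [Complex.sq_norm, Complex.normSq_mk, ← sq_abs a, ← sq_abs b, ← e1, ← e2, sq_abs, sq_abs]; ring
  have n0 := norm_nonneg (⟨a', b'⟩ : ℂ)
  have n1 : 1 ≤ ‖(⟨a', b'⟩ : ℂ)‖ := by
    rw [← sq_le_sq₀ (by norm_num) n0, n]; simpa using h1
  have nR : ‖(⟨a', b'⟩ : ℂ)‖ ≤ R := by rwa [← sq_le_sq₀ n0 hR0, n]
  refine ⟨⟨a', b'⟩, ?_, n1, two_thirds_le_visualAngle ?_⟩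
  · rw [← sq_le_sq₀ (norm_nonneg _) (norm_nonneg _), Complex.sq_norm, Complex.sq_norm,
      Complex.normSq_apply, Complex.normSq_apply]
    have k1 := pow_le_pow_left₀ (abs_nonneg _) l1 2
    have k2 := pow_le_pow_left₀ (abs_nonneg _) l2 2
    have k3 := pow_le_pow_left₀ hS0 (hS.trans hJ.s_re) 2
    have k4 := pow_le_pow_left₀ hT0 (hT.trans hJ.s_im) 2
    rw [sq_abs] at k1 k2
    simp only [Complex.sub_re, Complex.sub_im]
    linarith
  · change _ ≤ 2 * |a'|
    rw [e1, abs_of_nonneg ha]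
    generalize ‖(⟨a', b'⟩ : ℂ)‖ = r at *
    nlinarith [mul_nonneg (sub_nonneg.2 n1) (sub_nonneg.2 nR)]

theorem abs_realAxis_fst {l : List Bool} :
    (l.length = 0 → |(realAxis l).1| = 0 ∧ (realAxis l).2 = 4) ∧
    (l.length = 1 → |(realAxis l).1| = 2 ∧ (realAxis l).2 = 2) ∧
    (l.length = 2 → (|(realAxis l).1| = 1 ∨ |(realAxis l).1| = 3) ∧ (realAxis l).2 = 1) := by
  refine ⟨fun h => ?_, fun h => ?_, fun h => ?_⟩
  · rw [List.length_eq_zero_iff.1 h]; simp [realAxis]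
  · obtain ⟨b, rfl⟩ := List.length_eq_one_iff.1 h
    cases b <;> norm_num [realAxis]
  · obtain ⟨b, c, rfl⟩ := List.length_eq_two.1 h
    cases b <;> cases c <;> norm_num [realAxis]

set_option maxHeartbeats 1000000 in
/-- In a large box the visual angle is not everywhere below `third`, or everywhere below `vol3`. -/
theorem large_box (hJ : BoxJet M p 1 4 1 J f s) (hp : p.length ≤ 12) :
    (∃ v, ‖v - f‖ ≤ ‖s‖ ∧ 1 ≤ ‖v‖ ∧ 2 * Real.pi / 3 ≤ visualAngle v) ∨
      ∀ x ∈ Z M p, visualAngle (x 1) < Complex.arg vol3Val := by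
  have l1 : (axisBits p 1).length = (p.length + 5 - 1) / 6 := length_axisBits p 1
  have l4 : (axisBits p 4).length = (p.length + 5 - 4) / 6 := length_axisBits p 4
  obtain ⟨a1, a2⟩ := scale_bounds M 1
  obtain ⟨b1, b2⟩ := scale_bounds M 4
  simp only [Matrix.cons_val] at a1 a2 b1 b2
  obtain ⟨p0, p1, p2⟩ := abs_realAxis_fst (l := axisBits p 1)
  obtain ⟨q0, q1, q2⟩ := abs_realAxis_fst (l := axisBits p 4)
  have key := @exists_visualAngle_ge M p J f s hJ
  have hbox : ∀ x ∈ Z M p, |(realAxis (axisBits p 1)).1| - (realAxis (axisBits p 1)).2 ≤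
      |(x 1).re| / M.scale 1 ∧ |(realAxis (axisBits p 4)).1| - (realAxis (axisBits p 4)).2 ≤
      |(x 1).im| / M.scale 4 := fun x hx => by
    rw [mem_Z_iff (scale_pos M)] at hx
    have ax : ∀ (l : List Bool) (t : ℝ), InAxis l t → |(realAxis l).1| - (realAxis l).2 ≤ |t| :=
      fun l t ⟨h1, h2⟩ => by
        rw [sub_le_iff_le_add, abs_le]
        constructor <;> cases abs_cases t <;> linarith
    have k1 := ax _ _ (hx 1)
    have k4 := ax _ _ (hx 4)
    rw [abs_div, abs_of_pos (scale_pos M _)] at k1 k4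
    exact ⟨k1, k4⟩
  rcases (by omega : (axisBits p 1).length = 0 ∧ (axisBits p 4).length = 0 ∨
    (axisBits p 1).length = 1 ∧ (axisBits p 4).length = 0 ∨
    (axisBits p 1).length = 1 ∧ (axisBits p 4).length = 1 ∨
    (axisBits p 1).length = 2 ∧ (axisBits p 4).length = 1 ∨
    (axisBits p 1).length = 2 ∧ (axisBits p 4).length = 2) with
    ⟨k1, k4⟩ | ⟨k1, k4⟩ | ⟨k1, k4⟩ | ⟨k1, k4⟩ | ⟨k1, k4⟩
  · rw [(p0 k1).1, (p0 k1).2, (q0 k4).1, (q0 k4).2] at key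
    left
    apply key (a := 1) (b := 0) (P := 1) (Q := 0) (S := 6) (T := 4) (R := 1) <;>
      first | norm_num; done | linarith
  · rw [(p1 k1).1, (p1 k1).2, (q0 k4).1, (q0 k4).2] at key
    left
    apply key (a := 1) (b := 0) (P := 2.18) (Q := 0) (S := 3.17) (T := 4) (R := 1) <;>
      first | norm_num; done | linarith | exact abs_le.2 ⟨by linarith, by linarith⟩
  · rw [(p1 k1).1, (p1 k1).2, (q1 k4).1, (q1 k4).2] at key
    left
    apply key (a := 1) (b := 0) (P := 2.18) (Q := 2.25) (S := 3.17) (T := 2.24) (R := 1) <;>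
      first | norm_num; done | linarith | exact abs_le.2 ⟨by linarith, by linarith⟩
  · rcases (p2 k1).1 with h | h <;> rw [h, (p2 k1).2, (q1 k4).1, (q1 k4).2] at key <;> left
    · apply key (a := 1) (b := 0) (P := 0.6) (Q := 2.25) (S := 1.58) (T := 2.24) (R := 1) <;>
        first | norm_num; done | linarith | exact abs_le.2 ⟨by linarith, by linarith⟩
    · apply key (a := 2.3) (b := 1.1) (P := 2.463) (Q := 1.146) (S := 1.587) (T := 2.244)
        (R := 2.55) <;> first | norm_num; done | linarith | exact abs_le.2 ⟨by linarith, by linarith⟩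
  · rcases (p2 k1).1 with h | h <;> rcases (q2 k4).1 with h' | h' <;>
      rw [h, h', (p2 k1).2, (q2 k4).2] at key
    · left
      apply key (a := 1) (b := 0) (P := 0.6) (Q := 1.13) (S := 1.58) (T := 1.12) (R := 1) <;>
        first | norm_num; done | linarith | exact abs_le.2 ⟨by linarith, by linarith⟩
    · left
      apply key (a := 0.8) (b := 1.65) (P := 0.788) (Q := 1.718) (S := 1.587) (T := 1.122)
        (R := 1.84) <;> first | norm_num; done | linarith | exact abs_le.2 ⟨by linarith, by linarith⟩
    · left
      apply key (a := 2.875) (b := 0.675) (P := 1.8875) (Q := 0.4476) (S := 1.5873) (T := 1.1224)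
        (R := 2.9532) <;>
        first | norm_num; done | linarith | exact abs_le.2 ⟨by linarith, by linarith⟩
    · right
      intro x hx
      obtain ⟨u1, u4⟩ := hbox x hx
      rw [h, (p2 k1).2, le_div_iff₀ (scale_pos M _)] at u1
      rw [h', (q2 k4).2, le_div_iff₀ (scale_pos M _)] at u4
      refine visualAngle_lt_vol3 ?_
      have w1 : 3.17 ≤ |(x 1).re| := by linarith
      have w4 : 2.244 ≤ |(x 1).im| := by linarith
      rw [← sq_le_sq₀ (by norm_num) (norm_nonneg _), Complex.sq_norm, Complex.normSq_apply]
      nlinarith [abs_mul_abs_self (x 1).re, abs_mul_abs_self (x 1).im]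

variable {M : Machine} {p : List Bool} {z : Fin 3 → ℂ} {J : ACJ} {v : ℂ}

/-! ### The program -/

theorem norm_lt_of_absUB_lt_lit {B : ℝ} (hJ : Rep M z J v) (h : (J.absUB M <ᶠ some (lit B)) = some true) :
    ‖v‖ < B := by
  obtain ⟨t, h1, h2, h3⟩ := hJ.absUB.lt h
  obtain ⟨_, _, -, -, ht⟩ := fmul_fin h1
  refine h2.trans_lt (lt_of_not_ge fun hc => ?_)
  have := round53_mono hc
  rw [ht.fixed] at this
  linarith

theorem lt_norm_of_lit_lt_absLB {B : ℝ} (hJ : Rep M z J v) (hc : CentreLE J (2 ^ 43))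
    (h : (some (lit B) <ᶠ J.absLB M) = some true) : B < ‖v‖ := by
  obtain ⟨_, d, ⟨⟩, hd, hlt⟩ := flt_eq_some h
  obtain ⟨a, rfl, -, ha⟩ := hJ.absLB_fin hc hd
  have hlt : round53 B < a := by simpa [Dbl.lt, lit] using hlt
  refine lt_of_lt_of_le (lt_of_not_ge fun hc' => ?_) ha
  have hr : round53 a = a := by
    simp only [ACJ.absLB, bind_iff] at hd
    obtain ⟨w, h1, b, -, h2⟩ := hd
    cases b <;> cases h2
    · exact round53_zero
    · obtain ⟨_, _, -, -, hw⟩ := fmul_fin h1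
      exact hw.fixed
  have := round53_mono hc'
  rw [hr] at this
  linarith

theorem norm_lt_sq_of_lt {d : Dbl} {along whirle : ACJ} {x0 x2 : ℂ} (h0 : Rep M z along x0)
    (h2 : Rep M z whirle x2) (hc : CentreLE whirle (2 ^ 43)) (hx2 : ‖x2‖ ≤ 4)
    (hd : whirle.absLB M = some d)
    (h : (along.absUB M <ᶠ some (const (1 - eps)) *ᶠ some d *ᶠ some d) = some true) :
    ‖x0‖ < ‖x2‖ ^ 2 := by
  obtain ⟨a, rfl, ha0, ha⟩ := h2.absLB_fin hc hd
  obtain ⟨_, q, -, hq, -⟩ := flt_eq_some h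
  obtain ⟨b', _, hb, ⟨⟩, hq'⟩ := fmul_eq_some hq
  obtain ⟨_, _, ⟨⟩, ⟨⟩, hb'⟩ := fmul_eq_some hb
  have hu := ur_pos
  have hu1 : ur ≤ 1e-9 := by norm_num [ur_eq]
  have he : 1 - eps = 1 - 2 * ur := by rw [eps_eq]
  have a4 : a ≤ 4 := ha.trans hx2
  have e0 : 0 ≤ (1 - eps) * a := mul_nonneg (by rw [he]; linarith) ha0
  have e1 : (1 - eps) * a ≤ 4 := by rw [he]; nlinarith
  obtain ⟨b, rfl, fb⟩ := flEq_of_abs_le (by rw [abs_of_nonneg e0]; linarith) hb'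
  have b0 := fb.nonneg e0
  have b1 := fb.le e0
  have b2 : b ≤ 8 := by nlinarith
  have e2 : 0 ≤ b * a := mul_nonneg b0 ha0
  obtain ⟨q, rfl, fq⟩ := flEq_of_abs_le (by rw [abs_of_nonneg e2]; nlinarith) hq'
  have q1 := fq.le e2
  rw [hq] at h
  obtain ⟨t, -, t1, t2⟩ := h0.absUB.lt h
  have q2 : q ≤ a ^ 2 := by
    rw [he] at b1
    have w1 : b * a ≤ (1 + ur) * ((1 - 2 * ur) * a) * a := by gcongr
    have w2 : q ≤ (1 + ur) * ((1 + ur) * ((1 - 2 * ur) * a) * a) := q1.trans (by gcongr)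
    have w3 : (1 + ur) * ((1 + ur) * (1 - 2 * ur)) ≤ 1 := by nlinarith [sq_nonneg ur]
    nlinarith [mul_le_mul_of_nonneg_right w3 (sq_nonneg a)]
  exact (t1.trans_lt t2).trans_le (q2.trans (pow_le_pow_left₀ ha0 ha 2))

/-- The test of the visual angle. -/
theorem false_of_visualAngle {x : Fin 3 → ℂ} {h : Hole} {A J H : ACJ} {f s : ℂ} (hx : x ∈ Z M p)
    (hh : h ∈ holes) (hm : h.matches p = true) (hA : IsBound M p A) (hJ : BoxJet M p 1 4 1 J f s)
    (hH : horizon M J = some H) (hl : largerAngle M A H = some true) (hx1 : 1 ≤ ‖x 1‖)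
    (hv : h.angle ≤ visualAngle (x 1)) : False := by
  obtain ⟨α, hα, him, hle, hor⟩ := hA
  have hZ := (mem_Z_iff (scale_pos M)).1 hx
  have h1 := visualAngle_lt hJ hH hα him hl (hJ.mem (x 1) (hZ 1) (hZ 4)) hx1
  rw [Hole.angle] at hv
  split_ifs at hv with h3
  · rcases hor with h4 | ⟨g, hg, hg3, hgm⟩
    · exact absurd (hv.trans_lt h1) (not_lt.2 h4)
    · rcases large_box hJ (length_le_of_matches hh hg h3 hg3 hm hgm) with ⟨v, k1, k2, k3⟩ | k
      · exact absurd (visualAngle_lt hJ hH hα him hl k1 k2) (not_lt.2 (hle.trans k3))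
      · exact absurd (k x hx) (not_lt.2 hv)
  · linarith

theorem mngFree_of_inequalityHolds {code : List ℕ} (hp : p.length ≤ 200)
    (hcode : code.getD 0 0 = 50 → code.getD 2 0 ≠ 41) (h : inequalityHolds M code p = some true) :
    MNGFree M (Z M p) := by
  rintro x ⟨hx, d1, d2, d3, d4, ⟨g, hg, ⟨y, hy, hy0, hy1⟩, hv⟩, hvol⟩
  have hgm := matches_of_mem (scale_pos M) hx hy hy0
  have hx1 := (norm_bounds_of_mem_hole hg hy).1.trans_le hy1
  obtain ⟨res, hc, h⟩ := bind_iff.1 h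
  obtain ⟨A0, hq, hc⟩ := bind_iff.1 hc
  obtain ⟨m, A, rfl, hm, hA⟩ := coversHoleLoop_spec hg hy hgm
    (fun h hh h3 hph => hvol h hh h3 (hph ▸ hx)) holes (fun _ => id) 4 A0 res (isBound_quarter hq)
    (Or.inl hg) hc
  obtain ⟨along, j0, h⟩ := bind_iff.1 h
  obtain ⟨ortho, j1, h⟩ := bind_iff.1 h
  obtain ⟨whirle, j2, h⟩ := bind_iff.1 h
  obtain ⟨f0, s0, b0⟩ := alongJet_spec hp j0
  obtain ⟨f1, s1, b1⟩ := orthoJet_spec hp j1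
  obtain ⟨f2, s2, b2⟩ := whirleJet_spec hp j2
  obtain ⟨z, r0, r1, r2⟩ := exists_rep_of_mem b0 b1 b2 hx
  have h43 : (4 : ℝ) ^ 2 ≤ 2 ^ 43 := by norm_num
  have x2 : ‖x 2‖ ≤ 4 := by nlinarith
  have word : ∀ X l, evaluateWord M (code.drop 2) along ortho whirle = some X → X.length M = some l →
      lengthTest M l along = some true → (X.notIdentity M = some true ∨
        wordImpliesCommuting (code.drop 2) = true ∧ (code.drop 2).getD 0 0 ≠ 41) →
      ¬ IsMinimal (shortGen (x 0)) (closeGen (x 1) (x 2)) := fun X l k1 k2 k3 k4 =>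
    not_isMinimal_of_word r0 r1 r2 (b0.disc.hasSqrt r0 (by linarith)) (b1.disc.hasSqrt r1 hx1.le)
      (b2.disc.hasSqrt r2 d3) b0.disc.centreLE b1.disc.centreLE b2.disc.centreLE d1 (by linarith) hx1
      (norm_pos_iff.1 (by linarith)) k1 k2 k3 k4
  generalize hc0 : code.getD 0 0 = c at h
  split at h
  · exact absurd (norm_lt_of_absUB_lt_lit r0 h) (not_lt.2 d1)
  · exact absurd (lt_norm_of_lit_lt_absLB r0 (b0.disc.centreLE.mono h43) h) (not_lt.2 d2)
  · obtain ⟨t, -, k1, k2⟩ := r1.absUB.lt h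
    linarith
  · obtain ⟨H, k1, k2⟩ := bind_iff.1 h
    exact (false_of_visualAngle hx hg hgm hA b1 k1 k2 hx1.le hv).elim
  · obtain ⟨t, -, k1, k2⟩ := r2.absUB.lt h
    linarith
  · obtain ⟨d, k1, k2⟩ := bind_iff.1 h
    exact absurd (norm_lt_sq_of_lt r0 r2 (b2.disc.centreLE.mono h43) x2 k1 k2) (not_lt.2 d4)
  · obtain ⟨X, k1, h⟩ := bind_iff.1 h
    obtain ⟨l, k2, h⟩ := bind_iff.1 h
    split at h
    · obtain ⟨b, k3, h⟩ := bind_iff.1 h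
      cases b
      · cases h
      · exact word X l k1 k2 h (Or.inl k3)
    · split_ifs at h with hw
      · refine word X l k1 k2 h (Or.inr ⟨hw, ?_⟩)
        simpa using hcode hc0
      · cases h
    · cases h

theorem MNGFree.mono {R S : Set (Fin 3 → ℂ)} (h : MNGFree M S) (hRS : R ⊆ S) : MNGFree M R :=
  fun x hx => h x ⟨hRS hx.1, hx.2⟩

theorem MNGFree.union {R S : Set (Fin 3 → ℂ)} (hR : MNGFree M R) (hS : MNGFree M S) :
    MNGFree M (R ∪ S) := by
  rintro x ⟨hx | hx, hd⟩
  exacts [hR x ⟨hx, hd⟩, hS x ⟨hx, hd⟩]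

theorem mngFree_of_verify {file : List ℕ} (hfile : WordsNonempty file) (n : ℕ) :
    ∀ (p : List Bool) (a : ℤ) (input rest : List ℤ) (ms : List (List Bool)), n + p.length ≤ 200 →
      verify M file n p a input = some (ms, rest) → MNGFree M (Z M p \ ⋃ m ∈ ms, Z M m) := by
  induction n with
  | zero => intro p a input rest ms _ h; cases h
  | succ n ih =>
    intro p a input rest ms hp h
    have tail : ∀ code input, (verify M file n (p ++ [false]) code input >>= fun r =>
        verify M file n (p ++ [true]) code r.2 >>= fun r' => pure (r.1 ++ r'.1, r'.2)) =
        some (ms, rest) → MNGFree M (Z M p \ ⋃ m ∈ ms, Z M m) := fun code input h => by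
      obtain ⟨⟨ms0, i0⟩, h0, h⟩ := bind_iff.1 h
      obtain ⟨⟨ms1, i1⟩, h1, h⟩ := bind_iff.1 h
      cases h
      have hl : ∀ b, n + (p ++ [b]).length ≤ 200 := fun b => by simp; omega
      refine ((ih _ _ _ _ _ (hl _) h0).union (ih _ _ _ _ _ (hl _) h1)).mono fun x hx => ?_
      obtain ⟨hx, hn⟩ := hx
      simp only [List.mem_append, Set.mem_iUnion, not_exists] at hn
      refine (Z_subset_union (scale_pos M) p hx).imp (fun k => ⟨k, ?_⟩) fun k => ⟨k, ?_⟩ <;>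
        simp only [Set.mem_iUnion, not_exists] <;> intro m hm
      exacts [hn m (Or.inl hm), hn m (Or.inr hm)]
    have body : ∀ (code : ℤ) input, (if code < 0 then pure ([p], input) else if code ≠ 0 then
        inequalityFor file code >>= fun c => inequalityHolds M c p >>= fun holds =>
          if holds = true then pure ([], input) else
          (verify M file n (p ++ [false]) code input >>= fun r =>
        verify M file n (p ++ [true]) code r.2 >>= fun r' => pure (r.1 ++ r'.1, r'.2)) else
        (verify M file n (p ++ [false]) code input >>= fun r =>
        verify M file n (p ++ [true]) code r.2 >>= fun r' => pure (r.1 ++ r'.1, r'.2))) =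
        some (ms, rest) → MNGFree M (Z M p \ ⋃ m ∈ ms, Z M m) := fun code input h => by
      split_ifs at h with c1 c2
      · cases h
        rintro x ⟨⟨hx, hn⟩, -⟩
        simp [hx] at hn
      · obtain ⟨c, k1, h⟩ := bind_iff.1 h
        obtain ⟨b, k2, h⟩ := bind_iff.1 h
        cases b
        · exact tail code input h
        · refine (mngFree_of_inequalityHolds (by omega) ?_ k2).mono Set.sdiff_subset
          rw [inequalityFor, if_neg (by omega)] at k1
          exact hfile c (List.mem_of_getElem? k1)
      · exact tail code input h
    unfold verify at h
    dsimp only at h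
    by_cases ha : a = 0
    · rw [if_pos ha] at h
      cases input with
      | nil => cases h
      | cons c input => exact body c input h
    · rw [if_neg ha] at h
      exact body a input h

end Verify

end

theorem mainTheorem1 (M : Verify.Machine) (conditionlist : List ℕ)
    (hwords : Verify.WordsNonempty conditionlist)
    (input : List ℤ) (p : List Bool) (ms : List (List Bool))
    (hrun : Verify.program M conditionlist input p = some ms) :
    Verify.MNGFree M (Verify.Z M p \ ⋃ m ∈ ms, Verify.Z M m) := by
  simp only [Verify.program, Option.bind_eq_bind, Option.bind_eq_some_iff] at hrun
  obtain ⟨⟨out, rest⟩, h, h'⟩ := hrun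
  cases h'
  rcases le_or_gt p.length 200 with hp | hp
  · exact Verify.mngFree_of_verify hwords _ p 0 input rest out (by omega) h
  · rw [Nat.sub_eq_zero_of_le hp.le] at h
    cases h
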